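/- Let $A$ be a left coherent ring and $B$ a right coherent ring (every finitely generated left ideal of $A$, respectively right ideal of $B$, is finitely presented). A left module $J$ over a left coherent ring $R$ is called fp-injective if $\mathrm{Ext}^1_R(M,J)=0$ for every finitely presented left $R$-module $M$; similarly for right modules over right coherent rings. A finite complex $D^\bullet$ of $A$-$B$-bimodules is a dualizing complex for $A$ and $B$ if (i) its terms are fp-injective left $A$-modules and fp-injective right $B$-modules; (ii) its cohomology bimodules are finitely presented as left $A$-modules and as right $B$-modules; (iii) the homothety maps $A\to\mathrm{Hom}_{D(\mathrm{mod}\text{-}B)}(D^\bullet,D^\bullet[*])$ and $B^{\mathrm{op}}\to\mathrm{Hom}_{D(A\text{-}\mathrm{mod})}(D^\bullet,D^\bullet[*])$ are isomorphisms of graded rings ($A$ and $B^{\mathrm{op}}$ being placed in degree $0$). For a ring $R$, let $\mathrm{Hot}(R\text{-}\mathrm{mod})$ be the homotopy category of unbounded complexes of left $R$-modules. The coderived category $D^{\mathrm{co}}(R\text{-}\mathrm{mod})$ (respectively, the contraderived category $D^{\mathrm{ctr}}(R\text{-}\mathrm{mod})$) is the Verdier quotient of $\mathrm{Hot}(R\text{-}\mathrm{mod})$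 by its smallest full triangulated subcategory that contains the total complexes of all short exact sequences of complexes of left $R$-modules and is closed under infinite direct sums (respectively, infinite products); the complexes in this subcategory are called coacyclic (respectively, contraacyclic). Let $D^\bullet$ be a dualizing complex for $A$ and $B$, and assume that every fp-injective left $A$-module has finite injective dimension. Then the functor $\mathrm{Hom}_A(D^\bullet,-)\colon\mathrm{Hot}(A\text{-}\mathrm{mod})\to\mathrm{Hot}(B\text{-}\mathrm{mod})$ has a right derived functor $\mathbb R\mathrm{Hom}_A(D^\bullet,-)\colon D^{\mathrm{co}}(A\text{-}\mathrm{mod})\to D^{\mathrm{ctr}}(B\text{-}\mathrm{mod})$, computed by applying $\mathrm{Hom}_A(D^\bullet,-)$ to complexes of injective left $A$-modules; the functor $D^\bullet\otimes_B-\colon\mathrm{Hot}(B\text{-}\mathrm{mod})\to\mathrm{Hot}(A\text{-}\mathrm{mod})$ has a left derived functor $D^\bullet\otimes^{\mathbb L}_B-\colon D^{\mathrm{ctr}}(B\text{-}\mathrm{mod})\to D^{\mathrm{co}}(A\text{-}\mathrm{mod})$, computed by applying $D^\bullet\otimes_B-$ to complexes of flat left $B$-modules; and these two derived functors are mutually inverse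 equivalences of triangulated categories $D^{\mathrm{co}}(A\text{-}\mathrm{mod})\simeq D^{\mathrm{ctr}}(B\text{-}\mathrm{mod})$. -/

import Mathlib

open CategoryTheory CategoryTheory.Limits CategoryTheory.Pretriangulated
open CochainComplex CochainComplex.HomComplex
open scoped TensorProduct

universe u

attribute [-instance] CategoryTheory.catToReflQuiver

noncomputable section

namespace CoContra

/-! ### Coherent rings and fp-injective modules -/

/-- A ring is left coherent if every finitely generated left ideal is finitely presented. -/
def IsLeftCoherent (R : Type u) [Ring R] : Prop :=
  ∀ I : Ideal R, I.FG → Module.FinitePresentation R I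

/-- A ring is right coherent if its opposite ring is left coherent. -/
def IsRightCoherent (R : Type u) [Ring R] : Prop := IsLeftCoherent Rᵐᵒᵖ

/-- A left module `J` is fp-injective if `Ext¹(M, J) = 0` for every finitely presented `M`. -/
def IsFPInjective {R : Type u} [Ring R] (J : ModuleCat.{u} R) : Prop :=
  ∀ M : ModuleCat.{u} R, Module.FinitePresentation R M → Subsingleton (Abelian.Ext M J 1)

/-! ### Coderived and contraderived categories -/

section Exotic

variable (R : Type u) [Ring R]

/-- The homotopy category of unbounded complexes of left `R`-modules. -/
abbrev Hot : Type (u + 1) := HomotopyCategory (ModuleCat.{u} R) (ComplexShape.up ℤ)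

/-- The passage from complexes to the homotopy category. -/
abbrev toHot : CochainComplex (ModuleCat.{u} R) ℤ ⥤ Hot R :=
  HomotopyCategory.quotient (ModuleCat.{u} R) (ComplexShape.up ℤ)

variable {R}

/-- The total complex of a three-term sequence `K ⟶ L ⟶ M` of complexes (with zero composition),
the complex `M` being placed in degree zero of the additional grading: it is
the iterated cone, with terms `K^{n+2} ⊕ L^{n+1} ⊕ M^n`. -/
def totalComplex (S : ShortComplex (CochainComplex (ModuleCat.{u} R) ℤ)) :
    CochainComplex (ModuleCat.{u} R) ℤ :=
  mappingCone (mappingCone.desc S.f 0 S.g (by simp) : mappingCone S.f ⟶ S.X₃)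

variable (R)

/-- The coacyclic complexes: the smallest (strictly full) triangulated subcategory of
the homotopy category which contains the total complexes of all short exact sequences of complexes
and is closed under infinite direct sums. -/
inductive coacyclic : ObjectProperty (Hot R)
  | total (S : ShortComplex (CochainComplex (ModuleCat.{u} R) ℤ)) (hS : S.ShortExact) :
      coacyclic ((toHot R).obj (totalComplex S))
  | zero (X : Hot R) (hX : IsZero X) : coacyclic X
  | shift (X : Hot R) (n : ℤ) (hX : coacyclic X) : coacyclic (X⟦n⟧)
  | ext (T : Triangle (Hot R)) (hT : T ∈ distTriang (Hot R))
      (h₁ : coacyclic T.obj₁) (h₃ : coacyclic T.obj₃) : coacyclic T.obj₂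
  | directSum (ι : Type u) (K : ι → CochainComplex (ModuleCat.{u} R) ℤ)
      (hK : ∀ i, coacyclic ((toHot R).obj (K i))) : coacyclic ((toHot R).obj (∐ K))

/-- The contraacyclic complexes: the smallest (strictly full) triangulated subcategory of
the homotopy category which contains the total complexes of all short exact sequences of complexes
and is closed under infinite products. -/
inductive contraacyclic : ObjectProperty (Hot R)
  | total (S : ShortComplex (CochainComplex (ModuleCat.{u} R) ℤ)) (hS : S.ShortExact) :
      contraacyclic ((toHot R).obj (totalComplex S))
  | zero (X : Hot R) (hX : IsZero X) : contraacyclic X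
  | shift (X : Hot R) (n : ℤ) (hX : contraacyclic X) : contraacyclic (X⟦n⟧)
  | ext (T : Triangle (Hot R)) (hT : T ∈ distTriang (Hot R))
      (h₁ : contraacyclic T.obj₁) (h₃ : contraacyclic T.obj₃) : contraacyclic T.obj₂
  | product (ι : Type u) (K : ι → CochainComplex (ModuleCat.{u} R) ℤ)
      (hK : ∀ i, contraacyclic ((toHot R).obj (K i))) : contraacyclic ((toHot R).obj (∏ᶜ K))

instance : (coacyclic R).IsTriangulated where
  exists_zero := ⟨_, isZero_zero _, .zero _ (isZero_zero _)⟩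
  isStableUnderShiftBy n := ⟨fun X hX => .shift X n hX⟩
  ext₂' T hT h₁ h₃ := ObjectProperty.le_isoClosure _ _ (.ext T hT h₁ h₃)

instance : (contraacyclic R).IsTriangulated where
  exists_zero := ⟨_, isZero_zero _, .zero _ (isZero_zero _)⟩
  isStableUnderShiftBy n := ⟨fun X hX => .shift X n hX⟩
  ext₂' T hT h₁ h₃ := ObjectProperty.le_isoClosure _ _ (.ext T hT h₁ h₃)

/-- The coderived category of left `R`-modules: the Verdier quotient of the homotopy category
by the coacyclic complexes. -/
abbrev Coderived : Type (u + 1) := (coacyclic R).trW.Localization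

/-- The contraderived category of left `R`-modules: the Verdier quotient of the homotopy category
by the contraacyclic complexes. -/
abbrev Contraderived : Type (u + 1) := (contraacyclic R).trW.Localization

/-- The Verdier quotient functor. -/
abbrev toCoderived : Hot R ⥤ Coderived R := (coacyclic R).trW.Q

/-- The Verdier quotient functor. -/
abbrev toContraderived : Hot R ⥤ Contraderived R := (contraacyclic R).trW.Q

end Exotic

/-! ### The tensor product over a noncommutative ring -/

section Tensor

section

variable (A : Type*) (B : Type u) [Ring A] [Ring B]

section

variable (E : Type u) [AddCommGroup E] [Module A E] [Module Bᵐᵒᵖ E]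
  (N : Type u) [AddCommGroup N] [Module B N]

/-- The relations `(e b) ⊗ n = e ⊗ (b n)`. (When the actions of `A` and `B` on `E` commute,
the `A`-span is the additive span.) -/
def balancedRel : Submodule A (E ⊗[ℤ] N) :=
  Submodule.span A {x | ∃ (e : E) (b : B) (n : N),
    x = (MulOpposite.op b • e) ⊗ₜ[ℤ] n - e ⊗ₜ[ℤ] (b • n)}

/-- The tensor product `E ⊗_B N` of an `A`-`B`-bimodule `E` and a left `B`-module `N`; it is
a left `A`-module. -/
abbrev BalancedTensor : Type u := (E ⊗[ℤ] N) ⧸ balancedRel A B E N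

end

section

variable {E E' : Type u} [AddCommGroup E] [Module A E] [Module Bᵐᵒᵖ E]
  [AddCommGroup E'] [Module A E'] [Module Bᵐᵒᵖ E']
  {N N' : Type u} [AddCommGroup N] [Module B N] [AddCommGroup N'] [Module B N']

/-- The map `f ⊗ g` on tensor products over `B`, for a bimodule map `f` (an `A`-linear map
which is also `B`-linear on the right) and a `B`-linear map `g`. -/
def BalancedTensor.map (f : E →ₗ[A] E') (hf : ∀ (b : B) (e : E),
    f (MulOpposite.op b • e) = MulOpposite.op b • f e) (g : N →ₗ[B] N') :
    BalancedTensor A B E N →ₗ[A] BalancedTensor A B E' N' :=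
  Submodule.mapQ _ _ (TensorProduct.AlgebraTensorModule.map f (g.restrictScalars ℤ)) (by
    rw [balancedRel, Submodule.span_le]
    rintro _ ⟨e, b, n, rfl⟩
    refine Submodule.subset_span ⟨f e, b, g n, ?_⟩
    simp [hf])

/-- The image of `e ⊗ n` in `E ⊗_B N`. -/
def BalancedTensor.tmul (e : E) (n : N) : BalancedTensor A B E N :=
  Submodule.Quotient.mk (e ⊗ₜ[ℤ] n)

variable {A B} in
lemma BalancedTensor.hom_ext {P : Type*} [AddCommGroup P] [Module A P]
    {f g : BalancedTensor A B E N →ₗ[A] P}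
    (h : ∀ (e : E) (n : N), f (tmul A B e n) = g (tmul A B e n)) : f = g := by
  refine LinearMap.ext fun x => ?_
  obtain ⟨x, rfl⟩ := Submodule.Quotient.mk_surjective _ x
  induction x using TensorProduct.induction_on with
  | zero => simp
  | tmul e n => exact h e n
  | add x y hx hy => rw [Submodule.Quotient.mk_add, map_add, map_add, hx, hy]

@[simp]
lemma BalancedTensor.map_tmul (f : E →ₗ[A] E') (hf : ∀ (b : B) (e : E),
    f (MulOpposite.op b • e) = MulOpposite.op b • f e) (g : N →ₗ[B] N') (e : E) (n : N) :
    BalancedTensor.map A B f hf g (tmul A B e n) = tmul A B (f e) (g n) := rfl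

lemma BalancedTensor.tmul_add (e : E) (n n' : N) :
    tmul A B e (n + n') = tmul A B e n + tmul A B e n' := by
  simp [tmul, TensorProduct.tmul_add]

lemma BalancedTensor.add_tmul (e e' : E) (n : N) :
    tmul A B (e + e') n = tmul A B e n + tmul A B e' n := by
  simp [tmul, TensorProduct.add_tmul]

end

end

variable (A B : Type u) [Ring A] [Ring B]

/-- A left `B`-module `F` is flat if `- ⊗_B F` preserves injectivity of maps of right
`B`-modules. -/
def IsFlat {B : Type u} [Ring B] (F : ModuleCat.{u} B) : Prop :=
  ∀ (M M' : ModuleCat.{u} Bᵐᵒᵖ) (f : M →ₗ[Bᵐᵒᵖ] M'), Function.Injective f →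
    Function.Injective (BalancedTensor.map ℤ B (N := F) (N' := F)
      (f.restrictScalars ℤ) (fun b e => f.map_smul (MulOpposite.op b) e) LinearMap.id)

/-- The abelian category of `A`-`B`-bimodules. -/
abbrev BimodCat : Type (u + 1) := ModuleCat.{u} (A ⊗[ℤ] Bᵐᵒᵖ)

/-- The underlying left `A`-module of an `A`-`B`-bimodule. -/
abbrev leftModule : BimodCat A B ⥤ ModuleCat.{u} A :=
  ModuleCat.restrictScalars
    (Algebra.TensorProduct.includeLeftRingHom : A →+* A ⊗[ℤ] Bᵐᵒᵖ)

/-- The underlying right `B`-module of an `A`-`B`-bimodule. -/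
abbrev rightModule : BimodCat A B ⥤ ModuleCat.{u} Bᵐᵒᵖ :=
  ModuleCat.restrictScalars
    (Algebra.TensorProduct.includeRight : Bᵐᵒᵖ →ₐ[ℤ] A ⊗[ℤ] Bᵐᵒᵖ).toRingHom

variable {A B}

instance (E : BimodCat A B) : Module A E :=
  Module.compHom E (Algebra.TensorProduct.includeLeftRingHom : A →+* A ⊗[ℤ] Bᵐᵒᵖ)

instance (E : BimodCat A B) : Module Bᵐᵒᵖ E :=
  Module.compHom E (Algebra.TensorProduct.includeRight : Bᵐᵒᵖ →ₐ[ℤ] A ⊗[ℤ] Bᵐᵒᵖ).toRingHom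

lemma left_smul_def (E : BimodCat A B) (a : A) (e : E) :
    a • e = (a ⊗ₜ[ℤ] (1 : Bᵐᵒᵖ)) • e := rfl

lemma right_smul_def (E : BimodCat A B) (b : Bᵐᵒᵖ) (e : E) :
    b • e = ((1 : A) ⊗ₜ[ℤ] b) • e := rfl

instance (E : BimodCat A B) : SMulCommClass A Bᵐᵒᵖ E where
  smul_comm a b e := by
    simp only [left_smul_def, right_smul_def, smul_smul, Algebra.TensorProduct.tmul_mul_tmul,
      one_mul, mul_one]

/-- A bimodule map, as a map of left `A`-modules. -/
def leftLinear {E E' : BimodCat A B} (f : E ⟶ E') : E →ₗ[A] E' where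
  toFun := f
  map_add' := map_add f.hom
  map_smul' a e := f.hom.map_smul (a ⊗ₜ[ℤ] (1 : Bᵐᵒᵖ)) e

variable (A B)

/-- The bifunctor `(E, N) ↦ E ⊗_B N` from `A`-`B`-bimodules and left `B`-modules to
left `A`-modules. -/
def tensorBifunctor : BimodCat A B ⥤ ModuleCat.{u} B ⥤ ModuleCat.{u} A where
  obj E :=
    { obj := fun N => ModuleCat.of A (BalancedTensor A B E N)
      map := fun g => ModuleCat.ofHom
        (BalancedTensor.map A B LinearMap.id (fun _ _ => rfl) g.hom)
      map_id := fun N => ModuleCat.hom_ext (BalancedTensor.hom_ext fun _ _ => rfl)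
      map_comp := fun f g => ModuleCat.hom_ext (BalancedTensor.hom_ext fun _ _ => rfl) }
  map f :=
    { app := fun N => ModuleCat.ofHom (BalancedTensor.map A B (leftLinear f)
        (fun b e => f.hom.map_smul ((1 : A) ⊗ₜ[ℤ] MulOpposite.op b) e) LinearMap.id)
      naturality := fun _ _ _ => ModuleCat.hom_ext (BalancedTensor.hom_ext fun _ _ => rfl) }
  map_id E := by
    ext N : 2
    exact ModuleCat.hom_ext (BalancedTensor.hom_ext fun _ _ => rfl)
  map_comp f g := by
    ext N : 2
    exact ModuleCat.hom_ext (BalancedTensor.hom_ext fun _ _ => rfl)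

instance : (tensorBifunctor A B).Additive where
  map_add := by
    intros
    ext N : 2
    exact ModuleCat.hom_ext (BalancedTensor.hom_ext fun _ _ => BalancedTensor.add_tmul A B _ _ _)

instance (E : BimodCat A B) : ((tensorBifunctor A B).obj E).Additive where
  map_add :=
    ModuleCat.hom_ext (BalancedTensor.hom_ext fun _ _ => BalancedTensor.tmul_add A B _ _ _)

end Tensor

/-! ### The functors `Hom_A(D, -)` and `D ⊗_B -` on complexes -/

section Functors

variable {A B : Type u} [Ring A] [Ring B]

/-- A complex of bimodules, as a complex of left `A`-modules. -/
abbrev leftComplex (D : CochainComplex (BimodCat A B) ℤ) : CochainComplex (ModuleCat.{u} A) ℤ :=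
  ((leftModule A B).mapHomologicalComplex (ComplexShape.up ℤ)).obj D

/-- A complex of bimodules, as a complex of right `B`-modules. -/
abbrev rightComplex (D : CochainComplex (BimodCat A B) ℤ) :
    CochainComplex (ModuleCat.{u} Bᵐᵒᵖ) ℤ :=
  ((rightModule A B).mapHomologicalComplex (ComplexShape.up ℤ)).obj D

/-- The right action of `b : B`, as an endomorphism of the complex of left `A`-modules. -/
def rightMul (D : CochainComplex (BimodCat A B) ℤ) (b : B) : leftComplex D ⟶ leftComplex D where
  f i := ModuleCat.ofHom (X := D.X i) (Y := D.X i)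
    { toFun := fun e => MulOpposite.op b • e
      map_add' := smul_add _
      map_smul' := fun a e => (smul_comm a (MulOpposite.op b) e).symm }
  comm' i j _ := by
    ext e
    exact (D.d i j).hom.map_smul ((1 : A) ⊗ₜ[ℤ] MulOpposite.op b) e

/-- The left action of `a : A`, as an endomorphism of the complex of right `B`-modules. -/
def leftMul (D : CochainComplex (BimodCat A B) ℤ) (a : A) : rightComplex D ⟶ rightComplex D where
  f i := ModuleCat.ofHom (X := D.X i) (Y := D.X i)
    { toFun := fun e => a • e
      map_add' := smul_add _
      map_smul' := fun b e => smul_comm a b e }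
  comm' i j _ := by
    ext e
    exact (D.d i j).hom.map_smul (a ⊗ₜ[ℤ] (1 : Bᵐᵒᵖ)) e

variable (D : CochainComplex (BimodCat A B) ℤ)

lemma rightMul_apply (b : B) (i : ℤ) (e : D.X i) :
    ((rightMul D b).f i).hom e = MulOpposite.op b • e := rfl

lemma rightMul_one : rightMul D 1 = 𝟙 _ := by
  ext i e
  exact one_smul Bᵐᵒᵖ (show D.X i from e)

lemma rightMul_mul (b b' : B) : rightMul D (b * b') = rightMul D b ≫ rightMul D b' := by
  ext i e
  exact mul_smul (β := D.X i) (MulOpposite.op b') (MulOpposite.op b) e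

lemma rightMul_add (b b' : B) : rightMul D (b + b') = rightMul D b + rightMul D b' := by
  ext i e
  exact add_smul (M := D.X i) (MulOpposite.op b) (MulOpposite.op b') e

lemma rightMul_zero : rightMul D 0 = 0 := by
  ext i e
  exact zero_smul Bᵐᵒᵖ (A := D.X i) e

variable (M M' : CochainComplex (ModuleCat.{u} A) ℤ)

/-- The left `B`-module structure on the group of cochains of degree `n` from `D` to `M`, i.e.
on the product of the groups `Hom_A(D^p, M^{p+n})`: it is induced by the right action of `B`
on `D`, so that `(b z)(e) = z(e b)`. -/
instance homModule (n : ℤ) : Module B (Cochain (leftComplex D) M n) where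
  smul b z := (Cochain.ofHom (rightMul D b)).comp z (zero_add n)
  one_smul z := by
    change (Cochain.ofHom (rightMul D 1)).comp z (zero_add n) = z
    rw [rightMul_one, Cochain.id_comp]
  mul_smul b b' z := by
    change (Cochain.ofHom (rightMul D (b * b'))).comp z (zero_add n) =
      (Cochain.ofHom (rightMul D b)).comp
        ((Cochain.ofHom (rightMul D b')).comp z (zero_add n)) (zero_add n)
    rw [rightMul_mul, Cochain.ofHom_comp, Cochain.comp_assoc_of_first_is_zero_cochain]
  smul_zero b := Cochain.comp_zero _ _
  smul_add b z z' := Cochain.comp_add _ _ _ _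
  add_smul b b' z := by
    change (Cochain.ofHom (rightMul D (b + b'))).comp z (zero_add n) =
      (Cochain.ofHom (rightMul D b)).comp z (zero_add n) +
      (Cochain.ofHom (rightMul D b')).comp z (zero_add n)
    rw [rightMul_add, Cochain.ofHom_add, Cochain.add_comp]
  zero_smul z := by
    change (Cochain.ofHom (rightMul D 0)).comp z (zero_add n) = 0
    rw [rightMul_zero, Cochain.ofHom_zero, Cochain.zero_comp]

lemma hom_smul_def (n : ℤ) (b : B) (z : Cochain (leftComplex D) M n) :
    b • z = (Cochain.ofHom (rightMul D b)).comp z (zero_add n) := rfl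

/-- The complex `Hom_A(D, M)` of left `B`-modules. -/
def homComplex : CochainComplex (ModuleCat.{u} B) ℤ where
  X n := ModuleCat.of B (Cochain (leftComplex D) M n)
  d i j := ModuleCat.ofHom
    { toFun := δ i j
      map_add' := δ_add i j
      map_smul' := fun b z => δ_ofHom_comp (rightMul D b) z j }
  shape i j hij := by
    ext z : 2
    exact δ_shape i j hij z
  d_comp_d' i j k _ _ := by
    ext z : 2
    exact δ_δ i j k z

variable {M M'}

/-- Composition with a cochain `h` of degree `m`, as a map `Hom_A(D, M)^i → Hom_A(D, M')^j`. -/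
def homPostcomp {m : ℤ} (h : Cochain M M' m) (i j : ℤ) (hij : i + m = j) :
    Cochain (leftComplex D) M i →ₗ[B] Cochain (leftComplex D) M' j where
  toFun z := z.comp h hij
  map_add' _ _ := Cochain.add_comp _ _ _ _
  map_smul' b z :=
    Cochain.comp_assoc_of_first_is_zero_cochain (Cochain.ofHom (rightMul D b)) z h hij

/-- The functor `Hom_A(D, -)` from complexes of left `A`-modules to complexes of left
`B`-modules. -/
def homFunctor : CochainComplex (ModuleCat.{u} A) ℤ ⥤ CochainComplex (ModuleCat.{u} B) ℤ where
  obj M := homComplex D M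
  map {M M'} f :=
    { f := fun i => ModuleCat.ofHom (homPostcomp D (Cochain.ofHom f) i i (add_zero i))
      comm' := fun i j _ => by
        ext z : 2
        exact δ_comp_ofHom z f j }
  map_id M := by
    ext i z : 3
    exact Cochain.comp_id z
  map_comp f g := by
    ext i z : 3
    have H (z : Cochain (leftComplex D) _ i) : z.comp (Cochain.ofHom (f ≫ g)) (add_zero i) =
        (z.comp (Cochain.ofHom f) (add_zero i)).comp (Cochain.ofHom g) (add_zero i) := by
      rw [Cochain.ofHom_comp, Cochain.comp_assoc_of_third_is_zero_cochain]
    exact H z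

lemma comp_ofHom_of_homotopy {f g : M ⟶ M'} (h : Homotopy f g) (i j k : ℤ)
    (hij : i + 1 = j) (hki : k + 1 = i) (z : Cochain (leftComplex D) M i) :
    z.comp (Cochain.ofHom f) (add_zero i) =
      δ k i (z.comp (Cochain.ofHomotopy h) (by lia)) +
      (δ i j z).comp (Cochain.ofHomotopy h) (by lia) +
      z.comp (Cochain.ofHom g) (add_zero i) := by
  rw [δ_comp z (Cochain.ofHomotopy h) (by lia) j 0 i (by lia) (by lia) (by lia)]
  simp [δ_ofHomotopy, Cochain.comp_sub]

/-- The functor `Hom_A(D, -)` respects homotopies. -/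
def homFunctorMapHomotopy {f g : M ⟶ M'} (h : Homotopy f g) :
    Homotopy ((homFunctor D).map f) ((homFunctor D).map g) :=
  (Cochain.equivHomotopy _ _).symm
    ⟨Cochain.mk (fun i j hij => ModuleCat.ofHom (homPostcomp D (Cochain.ofHomotopy h) i j hij)), by
      ext i z : 3
      rw [Cochain.add_v, δ_v (-1) 0 (by lia) _ i i (by lia) (i - 1) (i + 1) (by lia) (by lia)]
      simp only [Cochain.ofHom_v, Int.negOnePow_zero, one_smul]
      exact comp_ofHom_of_homotopy D h i (i + 1) (i - 1) (by lia) (by lia) z⟩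

/-- The functor `Hom_A(D, -)` on homotopy categories. -/
def homHot : Hot A ⥤ Hot B :=
  CategoryTheory.Quotient.lift _ (homFunctor D ⋙ toHot B) (fun _ _ _ _ ⟨h⟩ =>
    HomotopyCategory.eq_of_homotopy _ _ (homFunctorMapHomotopy D h))

/-- The functor `D ⊗_B -` from complexes of left `B`-modules to complexes of left `A`-modules:
the (direct sum) total complex of the bicomplex of the modules `D^p ⊗_B N^q`. -/
abbrev tensorFunctor : CochainComplex (ModuleCat.{u} B) ℤ ⥤ CochainComplex (ModuleCat.{u} A) ℤ :=
  (tensorBifunctor A B).map₂CochainComplex.obj D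

/-- The functor `D ⊗_B -` on homotopy categories. -/
def tensorHot : Hot B ⥤ Hot A :=
  CategoryTheory.Quotient.lift _ (tensorFunctor D ⋙ toHot A) (fun _ _ _ _ ⟨h⟩ =>
    HomotopyCategory.eq_of_homotopy _ _
      (HomologicalComplex.mapBifunctorMapHomotopy₂ (𝟙 D) h (tensorBifunctor A B) _))

end Functors

/-! ### Dualizing complexes -/

section Dualizing

variable {A B : Type u} [Ring A] [Ring B]

attribute [local instance] HasDerivedCategory.standard

/-- A dualizing complex for the rings `A` and `B`. The homothety condition says that the graded
ring `Hom(D, D[*])`, computed in the derived category of right `B`-modules (respectively of left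
`A`-modules), is `A` (respectively `Bᵒᵖ`) placed in degree zero, via the action on `D`. -/
structure IsDualizingComplex (D : CochainComplex (BimodCat A B) ℤ) : Prop where
  /-- `D` is a finite complex -/
  finite : ∃ m n : ℤ, ∀ i : ℤ, i < m ∨ n < i → IsZero (D.X i)
  /-- the terms are fp-injective left `A`-modules -/
  fpInjective_left (i : ℤ) : IsFPInjective ((leftModule A B).obj (D.X i))
  /-- the terms are fp-injective right `B`-modules -/
  fpInjective_right (i : ℤ) : IsFPInjective ((rightModule A B).obj (D.X i))
  /-- the cohomology bimodules are finitely presented left `A`-modules -/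
  fp_left (i : ℤ) : Module.FinitePresentation A ((leftModule A B).obj (D.homology i))
  /-- the cohomology bimodules are finitely presented right `B`-modules -/
  fp_right (i : ℤ) : Module.FinitePresentation Bᵐᵒᵖ ((rightModule A B).obj (D.homology i))
  /-- the homothety map `A → Hom_{D(mod-B)}(D, D)` is bijective -/
  homothety_left : Function.Bijective (fun a : A =>
    (DerivedCategory.Q (C := ModuleCat.{u} Bᵐᵒᵖ)).map (leftMul D a))
  /-- `Hom_{D(mod-B)}(D, D[n]) = 0` for `n ≠ 0` -/
  hom_right_eq_zero (n : ℤ) (hn : n ≠ 0)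
    (f : (DerivedCategory.Q (C := ModuleCat.{u} Bᵐᵒᵖ)).obj (rightComplex D) ⟶
      ((DerivedCategory.Q (C := ModuleCat.{u} Bᵐᵒᵖ)).obj (rightComplex D))⟦n⟧) : f = 0
  /-- the homothety map `Bᵒᵖ → Hom_{D(A-mod)}(D, D)` is bijective -/
  homothety_right : Function.Bijective (fun b : B =>
    (DerivedCategory.Q (C := ModuleCat.{u} A)).map (rightMul D b))
  /-- `Hom_{D(A-mod)}(D, D[n]) = 0` for `n ≠ 0` -/
  hom_left_eq_zero (n : ℤ) (hn : n ≠ 0)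
    (f : (DerivedCategory.Q (C := ModuleCat.{u} A)).obj (leftComplex D) ⟶
      ((DerivedCategory.Q (C := ModuleCat.{u} A)).obj (leftComplex D))⟦n⟧) : f = 0

end Dualizing

/-! ### The derived functors -/

section Derived

variable {A B : Type u} [Ring A] [Ring B] (D : CochainComplex (BimodCat A B) ℤ)

/-- `Φ`, together with `α`, is the right derived functor `RHom_A(D, -)` from the coderived category
of left `A`-modules to the contraderived category of left `B`-modules: it is a right derived
functor of `Hom_A(D, -)` with respect to the class of morphisms with coacyclic cone (universal
property), and it is computed by applying `Hom_A(D, -)` to complexes of injective modules. -/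
structure IsRHom (Φ : Coderived A ⥤ Contraderived B)
    (α : homHot D ⋙ toContraderived B ⟶ toCoderived A ⋙ Φ) : Prop where
  isRightDerived : Φ.IsRightDerivedFunctor α (coacyclic A).trW
  isIso_of_injective (J : CochainComplex (ModuleCat.{u} A) ℤ) (hJ : ∀ i, Injective (J.X i)) :
    IsIso (α.app ((toHot A).obj J))

/-- `Ψ`, together with `β`, is the left derived functor `D ⊗ᴸ_B -` from the contraderived category
of left `B`-modules to the coderived category of left `A`-modules: it is a left derived functor of
`D ⊗_B -` with respect to the class of morphisms with contraacyclic cone (universal property),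
and it is computed by applying `D ⊗_B -` to complexes of flat modules. -/
structure IsLTensor (Ψ : Contraderived B ⥤ Coderived A)
    (β : toContraderived B ⋙ Ψ ⟶ tensorHot D ⋙ toCoderived A) : Prop where
  isLeftDerived : Ψ.IsLeftDerivedFunctor β (contraacyclic B).trW
  isIso_of_flat (F : CochainComplex (ModuleCat.{u} B) ℤ) (hF : ∀ i, IsFlat (F.X i)) :
    IsIso (β.app ((toHot B).obj F))

end Derived

end CoContra

end

/-! On homotopy categories the functor D ⊗_B - is left adjoint to Hom_A(D, -). Once the coderived
category is realised by complexes of injective A-modules and the contraderived category by complexes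
of projective B-modules, this adjunction passes to the quotients. What remains is that the unit and
the counit are isomorphisms.

Realisation. Complexes of injectives are right orthogonal to coacyclic complexes
(`rightOrthogonal_coacyclic`), so only resolutions are needed. Every complex embeds, with coacyclic
cokernel, into a complex of fp-injectives: the colimit of a sequence of embeddings whose terms
factor through injectives (`exists_trW_fpExt`). The injective dimensions of fp-injectives are
uniformly bounded, because products of fp-injectives are fp-injective
(`exists_injectiveDimension_bound`), so a resolution of finite length finishes the job. Dually, over
B one takes the limit of a tower; its terms are flat because coherence makes products of flat
modules flat (`exists_trW_flat`). The bound on projective dimensions of flat B-modules is not a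
hypothesis but a consequence of the existence of D (`exists_hasProjectiveDimensionLT_of_flat`): a
flat module M is quasi-isomorphic to the finite complex Hom_A(D, J), with J a finite injective
resolution of D ⊗_B M, and the terms of Hom_A(D, J) have no positive Ext from flat modules.

One module at a time. Write V^* for the group of characters of V. For objects X, Y of a derived
category, a ring S acting on X, and a map t : V → Hom(X, Y), one compares Hom(M, Y)^* with
Hom_S(Hom(M, X), V^*). If V^* is injective over S, both sides are exact on triangles in M, so a
five-lemma argument spreads the isomorphism from the shifts of the ring to all bounded objects with
finitely presented cohomology (`PairGood.of_bounded`). For M = X = D the homothety condition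
identifies End(D) with S, and the conclusion is that V = Hom(X, Y), with vanishing in the other
degrees. With V a flat module F and Y = D ⊗_B F this handles the unit (`acyclic_mappingCone_curry`);
with V = J^* for an injective J and Y = Hom_A(D, J)^* it handles the counit
(`acyclic_mappingCone_uncurry`).

Unbounded complexes. By finiteness of D and the two dimension bounds, the functors involved have
finite amplitude. A natural transformation between such functors which is invertible on one-term
complexes is invertible everywhere (`isIso_app_of_single`): by brutal truncation its cone is, for
each n, homotopy equivalent to a complex with zero n-th term, and a complex with this property is
contractible. Finally, complexes of flat modules compute D ⊗^L_B - because the projective resolution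
of a complex of flat modules can be chosen so that its cone stays coacyclic after tensoring
(`tensorContraacyclic_total`). -/

noncomputable section

namespace CoContra

/-! ### Adjoints of Verdier quotient functors obtained from orthogonal resolutions -/

section Bousfield

variable {C E : Type*} [Category* C] [Category* E] [HasZeroObject C] [HasShift C ℤ]
  [Preadditive C] [∀ n : ℤ, (CategoryTheory.shiftFunctor C n).Additive] [Pretriangulated C]
  [IsTriangulated C] (P : ObjectProperty C) [P.IsTriangulated] (L : C ⥤ E)
  [L.IsLocalization P.trW]

/-- If every object admits a morphism to an object right orthogonal to `P` with cone in `P`, then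
the Verdier quotient functor has a fully faithful right adjoint. -/
lemma exists_rightAdjoint
    (h : ∀ X : C, ∃ (J : C) (s : X ⟶ J), P.rightOrthogonal J ∧ P.trW s) :
    ∃ (r : E ⥤ C) (adj : L ⊣ r), (∀ Y, IsIso (adj.counit.app Y)) ∧
      ∀ J, P.rightOrthogonal J → IsIso (adj.unit.app J) := by
  have := Localization.essSurj L P.trW
  choose J s hJ hs using h
  have hinv (X : C) : IsIso (L.map (s X)) := Localization.inverts L P.trW _ (hs X)
  let Jo (Y : E) : C := J (L.objPreimage Y)
  let i (Y : E) : L.obj (Jo Y) ≅ Y :=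
    (asIso (L.map (s (L.objPreimage Y)))).symm ≪≫ L.objObjPreimageIso Y
  -- Morphisms into an object right orthogonal to `P` do not change under the Verdier quotient, so
  -- `Jo Y` represents the functor Hom(L -, Y).
  let e₀ (X : C) (Y : E) : (X ⟶ Jo Y) ≃ (L.obj X ⟶ L.obj (Jo Y)) :=
    Equiv.ofBijective _
      ((hJ (L.objPreimage Y)).map_bijective_of_isTriangulated L X)
  let e (X : C) (Y : E) : (L.obj X ⟶ Y) ≃ (X ⟶ Jo Y) :=
    ((i Y).symm.homToEquiv.trans (e₀ X Y).symm)
  have he (X' X : C) (Y : E) (f : X' ⟶ X) (g : L.obj X ⟶ Y) :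
      e X' Y (L.map f ≫ g) = f ≫ e X Y g := by
    apply (e₀ X' Y).injective
    have h₁ (X : C) (g : L.obj X ⟶ Y) : L.map (e X Y g) = g ≫ (i Y).inv :=
      (e₀ X Y).apply_symm_apply _
    change L.map _ = L.map _
    rw [L.map_comp, h₁, h₁, Category.assoc]
  let adj := Adjunction.adjunctionOfEquivRight e he
  have hc (Y : E) : IsIso (adj.counit.app Y) := by
    have : adj.counit.app Y = (i Y).hom := by
      have h₂ : adj.counit.app Y = (e (Jo Y) Y).symm (𝟙 _) := rfl
      rw [h₂]
      change L.map (𝟙 (Jo Y)) ≫ (i Y).hom = _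
      rw [L.map_id, Category.id_comp]
    rw [this]
    infer_instance
  -- The triangle identity makes L of the unit at `K` invertible. Both `K` and its image under the
  -- right adjoint of L are right orthogonal, so the inverse lifts along L and remains an inverse.
  refine ⟨_, adj, hc, fun K hK => ?_⟩
  have hc' := hc (L.obj K)
  have h₁ : IsIso (L.map (adj.unit.app K)) := by
    have := adj.left_triangle_components K
    have h : IsIso (L.map (adj.unit.app K) ≫ adj.counit.app (L.obj K)) := by
      rw [this]
      exact IsIso.id _
    exact IsIso.of_isIso_comp_right _ (adj.counit.app (L.obj K))
  obtain ⟨g, hg⟩ := (hK.map_bijective_of_isTriangulated L _).2 (inv (L.map (adj.unit.app K)))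
  have hJ' : P.rightOrthogonal ((L ⋙ Adjunction.rightAdjointOfEquiv e he).obj K) := hJ _
  refine ⟨g, ?_, ?_⟩
  · apply (hK.map_bijective_of_isTriangulated L _).1
    simp [hg]
  · apply (hJ'.map_bijective_of_isTriangulated L _).1
    simp only [Functor.map_comp, hg, IsIso.inv_hom_id]
    simp

/-- The dual of `exists_rightAdjoint`. -/
lemma exists_leftAdjoint
    (h : ∀ X : C, ∃ (J : C) (s : J ⟶ X), P.leftOrthogonal J ∧ P.trW s) :
    ∃ (l : E ⥤ C) (adj : l ⊣ L), (∀ Y, IsIso (adj.unit.app Y)) ∧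
      ∀ J, P.leftOrthogonal J → IsIso (adj.counit.app J) := by
  have := Localization.essSurj L P.trW
  choose J s hJ hs using h
  have hinv (X : C) : IsIso (L.map (s X)) := Localization.inverts L P.trW _ (hs X)
  let Jo (Y : E) : C := J (L.objPreimage Y)
  let i (Y : E) : L.obj (Jo Y) ≅ Y :=
    (asIso (L.map (s (L.objPreimage Y)))) ≪≫ L.objObjPreimageIso Y
  let e₀ (X : C) (Y : E) : (Jo Y ⟶ X) ≃ (L.obj (Jo Y) ⟶ L.obj X) :=
    Equiv.ofBijective _
      ((hJ (L.objPreimage Y)).map_bijective_of_isTriangulated L X)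
  let e (Y : E) (X : C) : (Jo Y ⟶ X) ≃ (Y ⟶ L.obj X) :=
    (e₀ X Y).trans (i Y).homFromEquiv
  have h₁ (X : C) (Y : E) (g : Jo Y ⟶ X) : e Y X g = (i Y).inv ≫ L.map g := rfl
  have he (Y : E) (X X' : C) (f : X ⟶ X') (g : Jo Y ⟶ X) :
      e Y X' (g ≫ f) = e Y X g ≫ L.map f := by
    simp [h₁]
  let adj := Adjunction.adjunctionOfEquivLeft e he
  have hc (Y : E) : IsIso (adj.unit.app Y) := by
    have : adj.unit.app Y = (i Y).inv := by
      have h₂ : adj.unit.app Y = e Y (Jo Y) (𝟙 _) := rfl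
      rw [h₂, h₁, L.map_id, Category.comp_id]
    rw [this]
    infer_instance
  refine ⟨_, adj, hc, fun K hK => ?_⟩
  have hc' := hc (L.obj K)
  have h₁ : IsIso (L.map (adj.counit.app K)) := by
    have := adj.right_triangle_components K
    have h : IsIso (adj.unit.app (L.obj K) ≫ L.map (adj.counit.app K)) := by
      rw [this]
      exact IsIso.id _
    exact IsIso.of_isIso_comp_left (adj.unit.app (L.obj K)) _
  obtain ⟨g, hg⟩ := (hK.map_bijective_of_isTriangulated L _).2 (inv (L.map (adj.counit.app K)))
  have hJ' : P.leftOrthogonal ((L ⋙ Adjunction.leftAdjointOfEquiv e he).obj K) := hJ _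
  refine ⟨g, ?_, ?_⟩
  · apply (hJ'.map_bijective_of_isTriangulated L _).1
    simp only [Functor.map_comp, hg, IsIso.hom_inv_id]
    simp
  · apply (hK.map_bijective_of_isTriangulated L _).1
    simp [hg]

end Bousfield

/-! ### Derived functors as Kan extensions along a functor with an adjoint -/

section Kan

variable {C E H : Type*} [Category* C] [Category* E] [Category* H]

/-- If `L` has a right adjoint `r`, then `r ⋙ F` is a left Kan extension of `F` along `L`. -/
lemma isLeftKanExtension_of_adjunction {L : C ⥤ E} {r : E ⥤ C} (adj : L ⊣ r) (F : C ⥤ H) :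
    (r ⋙ F).IsLeftKanExtension (F := F) (L := L)
      (F.leftUnitor.inv ≫ Functor.whiskerRight adj.unit F ≫ (Functor.associator _ _ _).hom) where
  nonempty_isUniversal := ⟨IsInitial.ofUniqueHom (fun Y =>
      -- The comparison with another extension is forced: its structure map evaluated on the image
      -- of r, followed by its value on the counit.
      StructuredArrow.homMk (Functor.whiskerLeft r Y.hom ≫
        (Functor.associator _ _ _).inv ≫ Functor.whiskerRight adj.counit Y.right ≫
        Y.right.leftUnitor.hom) (by
      ext X
      have h : F.map (adj.unit.app X) ≫ Y.hom.app (r.obj (L.obj X)) =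
        Y.hom.app X ≫ Y.right.map (L.map (adj.unit.app X)) := Y.hom.naturality (adj.unit.app X)
      have h' : Y.right.map (L.map (adj.unit.app X)) ≫ Y.right.map (adj.counit.app (L.obj X)) =
          𝟙 _ := by
        rw [← Functor.map_comp]
        exact (congr_arg _ (adj.left_triangle_components X)).trans (Y.right.map_id _)
      refine Eq.trans (b := F.map (adj.unit.app X) ≫ Y.hom.app (r.obj (L.obj X)) ≫
        Y.right.map (adj.counit.app (L.obj X))) (by simp [Functor.LeftExtension.mk]) ?_
      rw [reassoc_of% h]
      erw [h']
      exact Category.comp_id _)) (fun Y f => by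
      ext X
      have h : F.map (adj.unit.app (r.obj X)) ≫ f.right.app (L.obj (r.obj X)) =
          Y.hom.app (r.obj X) := by
        have h := congr_app (StructuredArrow.w f) (r.obj X)
        simpa [Functor.LeftExtension.mk] using h
      have h' : F.map (r.map (adj.counit.app X)) ≫ f.right.app X =
        f.right.app (L.obj (r.obj X)) ≫ Y.right.map (adj.counit.app X) :=
        f.right.naturality (adj.counit.app X)
      have h₃ : F.map (adj.unit.app (r.obj X)) ≫ F.map (r.map (adj.counit.app X)) = 𝟙 _ := by
        rw [← Functor.map_comp]
        exact (congr_arg _ (adj.right_triangle_components X)).trans (F.map_id _)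
      refine Eq.trans (b := Y.hom.app (r.obj X) ≫ Y.right.map (adj.counit.app X)) ?_ ?_
      · refine Eq.trans ?_ (congr_arg (· ≫ Y.right.map (adj.counit.app X)) h)
        have (φ : F.obj (r.obj X) ⟶ Y.right.obj X)
            (ψ : F.obj (r.obj (L.obj (r.obj X))) ⟶ Y.right.obj (L.obj (r.obj X)))
            (hφ : F.map (r.map (adj.counit.app X)) ≫ φ = ψ ≫ Y.right.map (adj.counit.app X)) :
            φ = (F.map (adj.unit.app (r.obj X)) ≫ ψ) ≫ Y.right.map (adj.counit.app X) := by
          rw [Category.assoc, ← hφ, reassoc_of% h₃]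
        exact this (f.right.app X) (f.right.app (L.obj (r.obj X))) h'
      · change _ = Y.hom.app (r.obj X) ≫ 𝟙 _ ≫ Y.right.map (adj.counit.app X) ≫ 𝟙 _
        rw [Category.id_comp]
        exact (congr_arg _ (Category.comp_id _)).symm)⟩

/-- If `L` has a left adjoint `l`, then `l ⋙ F` is a right Kan extension of `F` along `L`. -/
lemma isRightKanExtension_of_adjunction {L : C ⥤ E} {l : E ⥤ C} (adj : l ⊣ L) (F : C ⥤ H) :
    (l ⋙ F).IsRightKanExtension (F := F) (L := L)
      ((Functor.associator _ _ _).inv ≫ Functor.whiskerRight adj.counit F ≫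
        F.leftUnitor.hom) where
  nonempty_isUniversal := ⟨IsTerminal.ofUniqueHom (fun Y =>
      CostructuredArrow.homMk (Y.left.leftUnitor.inv ≫ Functor.whiskerRight adj.unit Y.left ≫
        (Functor.associator _ _ _).hom ≫ Functor.whiskerLeft l Y.hom) (by
      ext X
      have h : Y.left.map (L.map (adj.counit.app X)) ≫ Y.hom.app X =
        Y.hom.app (l.obj (L.obj X)) ≫ F.map (adj.counit.app X) :=
        Y.hom.naturality (adj.counit.app X)
      have h' : Y.left.map (adj.unit.app (L.obj X)) ≫ Y.left.map (L.map (adj.counit.app X)) =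
          𝟙 _ := by
        rw [← Functor.map_comp]
        exact (congr_arg _ (adj.right_triangle_components X)).trans (Y.left.map_id _)
      refine Eq.trans (b := Y.left.map (adj.unit.app (L.obj X)) ≫ Y.hom.app (l.obj (L.obj X)) ≫
        F.map (adj.counit.app X)) (by simp [Functor.RightExtension.mk]) ?_
      rw [← h, reassoc_of% h'])) (fun Y f => by
      ext X
      have h : f.left.app (L.obj (l.obj X)) ≫ F.map (adj.counit.app (l.obj X)) =
          Y.hom.app (l.obj X) := by
        have h := congr_app (CostructuredArrow.w f) (l.obj X)
        simpa [Functor.RightExtension.mk] using h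
      have h' : Y.left.map (adj.unit.app X) ≫ f.left.app (L.obj (l.obj X)) =
        f.left.app X ≫ F.map (l.map (adj.unit.app X)) :=
        f.left.naturality (adj.unit.app X)
      have h₃ : F.map (l.map (adj.unit.app X)) ≫ F.map (adj.counit.app (l.obj X)) = 𝟙 _ := by
        rw [← Functor.map_comp]
        exact (congr_arg _ (adj.left_triangle_components X)).trans (F.map_id _)
      refine Eq.trans (b := Y.left.map (adj.unit.app X) ≫ Y.hom.app (l.obj X)) ?_ ?_
      · refine Eq.trans ?_ (congr_arg (Y.left.map (adj.unit.app X) ≫ ·) h)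
        have (φ : Y.left.obj X ⟶ F.obj (l.obj X))
            (ψ : Y.left.obj (L.obj (l.obj X)) ⟶ F.obj (l.obj (L.obj (l.obj X))))
            (hφ : Y.left.map (adj.unit.app X) ≫ ψ = φ ≫ F.map (l.map (adj.unit.app X))) :
            φ = Y.left.map (adj.unit.app X) ≫ ψ ≫ F.map (adj.counit.app (l.obj X)) := by
          rw [reassoc_of% hφ, h₃]
          exact (Category.comp_id _).symm
        exact this (f.left.app X) (f.left.app (L.obj (l.obj X))) h'
      · change _ = 𝟙 _ ≫ Y.left.map (adj.unit.app X) ≫ 𝟙 _ ≫ Y.hom.app (l.obj X)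
        rw [Category.id_comp]
        exact (congr_arg _ (Category.id_comp _)).symm)⟩

end Kan

/-! ### Cones of a natural transformation between triangulated functors -/

section Cones

lemma isIso_app_shift {C E : Type*} [Category* C] [Category* E] [HasShift C ℤ] [HasShift E ℤ]
    {F G : C ⥤ E} [F.CommShift ℤ] [G.CommShift ℤ] (θ : F ⟶ G) [NatTrans.CommShift θ ℤ]
    (X : C) (h : IsIso (θ.app X)) (n : ℤ) : IsIso (θ.app (X⟦n⟧)) := by
  have := NatTrans.shift_app_comm θ n X
  have h' : θ.app (X⟦n⟧) = (F.commShiftIso n).hom.app X ≫ (θ.app X)⟦n⟧' ≫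
      (G.commShiftIso n).inv.app X := by
    rw [← Category.assoc, this]
    simp
  rw [h']
  infer_instance

variable {C E : Type*} [Category* C] [Category* E] [HasZeroObject C] [HasShift C ℤ]
  [Preadditive C] [∀ n : ℤ, (CategoryTheory.shiftFunctor C n).Additive] [Pretriangulated C]
  [HasZeroObject E] [HasShift E ℤ] [Preadditive E]
  [∀ n : ℤ, (CategoryTheory.shiftFunctor E n).Additive]
  [Pretriangulated E] (F G : C ⥤ E) [F.CommShift ℤ] [G.CommShift ℤ] [F.IsTriangulated]
  [G.IsTriangulated] (θ : F ⟶ G)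

/-- If a natural transformation of triangulated functors is an isomorphism at the first vertex of
a triangle, then its cone at the second vertex is also the cone of some morphism between
the values of the functors at the third vertex. -/
lemma exists_triangle_of_isIso₁ [IsTriangulated E] {X₁ X₂ X₃ : C} {a : X₁ ⟶ X₂} {b : X₂ ⟶ X₃}
    {c : X₃ ⟶ X₁⟦(1 : ℤ)⟧} (hT : Triangle.mk a b c ∈ distTriang C)
    [IsIso (θ.app X₁)] {Z : E} {g : G.obj X₂ ⟶ Z} {h : Z ⟶ (F.obj X₂)⟦(1 : ℤ)⟧}
    (hZ : Triangle.mk (θ.app X₂) g h ∈ distTriang E) :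
    ∃ (c : F.obj X₃ ⟶ G.obj X₃) (g' : G.obj X₃ ⟶ Z)
      (h' : Z ⟶ (F.obj X₃)⟦(1 : ℤ)⟧), Triangle.mk c g' h' ∈ distTriang E := by
  have hF : Triangle.mk (F.map a) (F.map b) (F.map c ≫ (F.commShiftIso (1 : ℤ)).hom.app X₁) ∈
    distTriang E := F.map_distinguished _ hT
  have hG : Triangle.mk (G.map a) (G.map b) (G.map c ≫ (G.commShiftIso (1 : ℤ)).hom.app X₁) ∈
    distTriang E := G.map_distinguished _ hT
  -- The composite equals θ at X₁ followed by G a. Since θ at X₁ is invertible, its cone is still G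
  -- X₃, and the octahedron of this composite contains the triangle F X₃ → G X₃ → Z.
  have h₁₃ : Triangle.mk (F.map a ≫ θ.app X₂) (G.map b)
      ((G.map c ≫ (G.commShiftIso (1 : ℤ)).hom.app X₁) ≫
        (inv (θ.app X₁))⟦(1 : ℤ)⟧') ∈ distTriang E := by
    refine isomorphic_distinguished _ hG _ (Triangle.isoMk (Triangle.mk _ _ _) (Triangle.mk _ _ _)
      (asIso (X := F.obj X₁) (Y := G.obj X₁) (θ.app X₁)) (Iso.refl _) (Iso.refl _) ?_ ?_ ?_)
    · change (F.map a ≫ θ.app X₂) ≫ 𝟙 (G.obj X₂) = θ.app X₁ ≫ G.map a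
      simp
    · change G.map b ≫ 𝟙 (G.obj X₃) = 𝟙 (G.obj X₂) ≫ G.map b
      simp
    · change ((G.map c ≫ (G.commShiftIso (1 : ℤ)).hom.app X₁) ≫
        (inv (θ.app X₁))⟦(1 : ℤ)⟧') ≫ (θ.app X₁)⟦(1 : ℤ)⟧' = 𝟙 (G.obj X₃) ≫ _
      have h₅ : (inv (θ.app X₁))⟦(1 : ℤ)⟧' ≫ (θ.app X₁)⟦(1 : ℤ)⟧' = 𝟙 _ := by
        rw [← Functor.map_comp, IsIso.inv_hom_id, CategoryTheory.Functor.map_id]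
      exact (Category.assoc _ _ _).trans ((congr_arg _ h₅).trans
        ((Category.comp_id _).trans (Category.id_comp _).symm))
  let O := Triangulated.someOctahedron rfl hF hZ h₁₃
  exact ⟨_, _, _, O.mem⟩

/-- If a natural transformation of triangulated functors is an isomorphism at the third vertex of
a triangle, then its cone at the second vertex is also the (shifted) cone of some morphism between
the shifted values of the functors at the first vertex. -/
lemma exists_triangle_of_isIso₃ [IsTriangulated E] {X₁ X₂ X₃ : C} {a : X₁ ⟶ X₂} {b : X₂ ⟶ X₃}
    {c : X₃ ⟶ X₁⟦(1 : ℤ)⟧} (hT : Triangle.mk a b c ∈ distTriang C)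
    [IsIso (θ.app X₃)] {Z : E} {g : G.obj X₂ ⟶ Z} {h : Z ⟶ (F.obj X₂)⟦(1 : ℤ)⟧}
    (hZ : Triangle.mk (θ.app X₂) g h ∈ distTriang E) :
    ∃ (g' : Z ⟶ (F.obj X₁)⟦(1 : ℤ)⟧) (c : (F.obj X₁)⟦(1 : ℤ)⟧ ⟶ (G.obj X₁)⟦(1 : ℤ)⟧)
      (h' : (G.obj X₁)⟦(1 : ℤ)⟧ ⟶ Z⟦(1 : ℤ)⟧), Triangle.mk g' c h' ∈ distTriang E := by
  have hF : Triangle.mk (F.map b) (F.map c ≫ (F.commShiftIso (1 : ℤ)).hom.app X₁)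
    (-(F.map a)⟦(1 : ℤ)⟧') ∈ distTriang E := rot_of_distTriang _ (F.map_distinguished _ hT)
  have hG : Triangle.mk (G.map b) (G.map c ≫ (G.commShiftIso (1 : ℤ)).hom.app X₁)
    (-(G.map a)⟦(1 : ℤ)⟧') ∈ distTriang E := rot_of_distTriang _ (G.map_distinguished _ hT)
  -- After rotation the same trick applies to θ at X₂ followed by G b, which is F b followed by an
  -- isomorphism and so has cone (F X₁)[1].
  have h₁₃ : Triangle.mk (θ.app X₂ ≫ G.map b)
      (inv (θ.app X₃) ≫ (F.map c ≫ (F.commShiftIso (1 : ℤ)).hom.app X₁))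
      (-((F.map a)⟦(1 : ℤ)⟧')) ∈ distTriang E := by
    refine isomorphic_distinguished _ hF _ (Triangle.isoMk (Triangle.mk _ _ _) (Triangle.mk _ _ _)
      (Iso.refl _) (asIso (X := F.obj X₃) (Y := G.obj X₃) (θ.app X₃)).symm (Iso.refl _) ?_ ?_ ?_)
    · change (θ.app X₂ ≫ G.map b) ≫ inv (θ.app X₃) = 𝟙 (F.obj X₂) ≫ F.map b
      simp
    · change (inv (θ.app X₃) ≫ (F.map c ≫ (F.commShiftIso (1 : ℤ)).hom.app X₁)) ≫
        𝟙 ((F.obj X₁)⟦(1 : ℤ)⟧) = inv (θ.app X₃) ≫ _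
      exact Category.comp_id _
    · change (-((F.map a)⟦(1 : ℤ)⟧')) ≫ (𝟙 (F.obj X₂))⟦(1 : ℤ)⟧' =
        𝟙 ((F.obj X₁)⟦(1 : ℤ)⟧) ≫ (-((F.map a)⟦(1 : ℤ)⟧'))
      simp
  let O := Triangulated.someOctahedron rfl hZ hG h₁₃
  exact ⟨_, _, _, O.mem⟩

variable [NatTrans.CommShift θ ℤ]

/-- A natural transformation of triangulated functors which is an isomorphism at two vertices of
a triangle is an isomorphism at the third one. -/
lemma isIso_app_obj₂ (T : Triangle C) (hT : T ∈ distTriang C)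
    (h₁ : IsIso (θ.app T.obj₁)) (h₃ : IsIso (θ.app T.obj₃)) : IsIso (θ.app T.obj₂) := by
  let φ : F.mapTriangle.obj T ⟶ G.mapTriangle.obj T :=
    { hom₁ := θ.app _
      hom₂ := θ.app _
      hom₃ := θ.app _
      comm₁ := θ.naturality _
      comm₂ := θ.naturality _
      comm₃ := by
        have := NatTrans.shift_app_comm θ (1 : ℤ) T.obj₁
        change (F.map T.mor₃ ≫ (F.commShiftIso (1 : ℤ)).hom.app T.obj₁) ≫ (θ.app _)⟦(1 : ℤ)⟧' =
          θ.app T.obj₃ ≫ G.map T.mor₃ ≫ (G.commShiftIso (1 : ℤ)).hom.app T.obj₁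
        rw [Category.assoc, this, θ.naturality_assoc] }
  exact isIso₂_of_isIso₁₃ φ (F.map_distinguished T hT) (G.map_distinguished T hT) h₁ h₃

end Cones

end CoContra
end

noncomputable section

namespace CoContra

/-! ### Contractibility tested one degree at a time -/

section Contractible

variable {C : Type*} [Category* C] [Preadditive C]

/-- A complex whose identity is, in each degree separately, of the form `d s + s' d`
is contractible. -/
lemma nonempty_homotopy_id_zero_of_pointwise (P : CochainComplex C ℤ)
    (h : ∀ i j k : ℤ, i + 1 = j → j + 1 = k → ∃ (a : P.X j ⟶ P.X i) (b : P.X k ⟶ P.X j),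
      𝟙 (P.X j) = a ≫ P.d i j + P.d j k ≫ b) :
    Nonempty (Homotopy (𝟙 P) 0) := by
  choose a s has using fun j : ℤ => h (j - 1) j (j + 1) (by lia) (by lia)
  have hs (j : ℤ) : P.d j (j + 1) ≫ s j ≫ P.d j (j + 1) = P.d j (j + 1) := by
    have := has j =≫ P.d j (j + 1)
    simpa using this.symm
  -- The local formula composed with d gives d s d = d. If z d = 0, the formula reads z = z a d, and
  -- then z s d = z a d s d = z. Thus s splits the differential onto the cocycles, and the unrelated
  -- maps a can be discarded.
  have key (i j : ℤ) (hij : i + 1 = j) :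
      ∃ t : P.X j ⟶ P.X i, P.d i j ≫ t ≫ P.d i j = P.d i j ∧
        ∀ {Z : C} (z : Z ⟶ P.X j), z ≫ P.d j (j + 1) = 0 → z ≫ t ≫ P.d i j = z := by
    subst hij
    refine ⟨s i, hs i, fun z hz => ?_⟩
    have h1 := z ≫= has (i + 1)
    simp only [Category.comp_id, Preadditive.comp_add] at h1
    rw [reassoc_of% hz, zero_comp, add_zero] at h1
    have h2 : P.d (i + 1 - 1) (i + 1) ≫ s i ≫ P.d i (i + 1) = P.d (i + 1 - 1) (i + 1) := by
      have : i + 1 - 1 = i := by lia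
      have H : ∀ l, l = i → P.d l (i + 1) ≫ s i ≫ P.d i (i + 1) = P.d l (i + 1) := by
        rintro _ rfl
        exact hs _
      exact H _ this
    calc z ≫ s i ≫ P.d i (i + 1)
        = (z ≫ a (i + 1) ≫ P.d (i + 1 - 1) (i + 1)) ≫ s i ≫ P.d i (i + 1) := by rw [← h1]
      _ = z := by rw [Category.assoc, Category.assoc, h2, ← h1]
  choose t ht ht' using key
  -- First project to the cocycles by 1 - d t, then apply the splitting t. Then k d = 1 - d t and d
  -- k = d t, with sum 1.
  let k (j i : ℤ) (hij : i + 1 = j) : P.X j ⟶ P.X i :=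
    (𝟙 _ - P.d j (j + 1) ≫ t j (j + 1) rfl) ≫ t i j hij
  refine ⟨(Cochain.equivHomotopy _ _).symm
    ⟨Cochain.mk (fun p q hpq => k p q (by lia)), ?_⟩⟩
  ext p
  rw [Cochain.add_v, δ_v (-1) 0 (by lia) _ p p (by lia) (p - 1) (p + 1) (by lia) (by lia)]
  simp only [Cochain.ofHom_v, Cochain.mk_v, Int.negOnePow_zero, one_smul,
    HomologicalComplex.id_f, HomologicalComplex.zero_f, add_zero, k]
  have h1 : (𝟙 _ - P.d p (p + 1) ≫ t p (p + 1) rfl) ≫ t (p - 1) p (by lia) ≫ P.d (p - 1) p =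
      𝟙 _ - P.d p (p + 1) ≫ t p (p + 1) rfl := by
    apply ht'
    simp [ht]
  rw [Category.assoc, h1]
  simp

/-- In degree n, a homotopy from the identity to a map vanishing there is exactly a pointwise
formula 1 = a d + d b. The map f may vary with n, which is what makes truncation arguments work for
unbounded complexes. -/
lemma nonempty_homotopy_id_zero_of_forall_exists (P : CochainComplex C ℤ)
    (h : ∀ n : ℤ, ∃ f : P ⟶ P, Nonempty (Homotopy (𝟙 P) f) ∧ f.f n = 0) :
    Nonempty (Homotopy (𝟙 P) 0) := by
  refine nonempty_homotopy_id_zero_of_pointwise P fun i j k hij hjk => ?_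
  obtain ⟨f, ⟨H⟩, hf⟩ := h j
  refine ⟨H.hom j i, H.hom k j, ?_⟩
  have := H.comm j
  rw [hf, add_zero, dNext_eq _ (show (ComplexShape.up ℤ).Rel j k from hjk),
    prevD_eq _ (show (ComplexShape.up ℤ).Rel i j from hij)] at this
  rw [← HomologicalComplex.id_f, this, add_comm]

end Contractible

/-! ### Morphisms to and from the total complex of a short exact sequence -/

section Total

variable {R : Type u} [Ring R] {S : ShortComplex (CochainComplex (ModuleCat.{u} R) ℤ)}

lemma shortExact_X (hS : S.ShortExact) (p : ℤ) :
    (S.map (HomologicalComplex.eval _ _ p)).ShortExact :=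
  hS.map_of_exact _

/-- A map from the total complex of a three-term sequence is null-homotopic if the cochains on
the sequence with values in the target form a short exact sequence. -/
lemma homotopy_zero_of_cochains_from {X₁ X₂ X₃ G : CochainComplex (ModuleCat.{u} R) ℤ}
    (f : X₁ ⟶ X₂) (g : X₂ ⟶ X₃) (π : mappingCone f ⟶ X₃)
    (inlπ : (mappingCone.inl f).comp (Cochain.ofHom π) (add_zero (-1)) = 0)
    (inrπ : mappingCone.inr f ≫ π = g)
    (L1 : ∀ (n : ℤ) (c : Cochain X₁ G n),
      ∃ v : Cochain X₂ G n, (Cochain.ofHom f).comp v (zero_add n) = c)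
    (L2 : ∀ (n : ℤ) (c : Cochain X₂ G n), (Cochain.ofHom f).comp c (zero_add n) = 0 →
      ∃ w : Cochain X₃ G n, (Cochain.ofHom g).comp w (zero_add n) = c)
    (L3 : ∀ (n : ℤ) (c c' : Cochain X₃ G n), (Cochain.ofHom g).comp c (zero_add n) =
      (Cochain.ofHom g).comp c' (zero_add n) → c = c')
    (ψ : mappingCone π ⟶ G) : Nonempty (Homotopy ψ 0) := by
  replace inrπ : (Cochain.ofHom (mappingCone.inr f)).comp (Cochain.ofHom π) (zero_add 0) =
      Cochain.ofHom g := by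
    rw [← Cochain.ofHom_comp, inrπ]
  obtain ⟨za, hza'⟩ : ∃ za, (mappingCone.inl π).comp (Cochain.ofHom ψ) (add_zero (-1)) = za :=
    ⟨_, rfl⟩
  obtain ⟨zb, hzb'⟩ : ∃ zb,
    (Cochain.ofHom (mappingCone.inr π)).comp (Cochain.ofHom ψ) (zero_add 0) = zb := ⟨_, rfl⟩
  obtain ⟨zaa, hzaa'⟩ : ∃ zaa,
    (mappingCone.inl f).comp za (show -1 + -1 = -2 by norm_num) = zaa := ⟨_, rfl⟩
  obtain ⟨zab, hzab'⟩ : ∃ zab,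
    (Cochain.ofHom (mappingCone.inr f)).comp za (zero_add (-1)) = zab := ⟨_, rfl⟩
  have dza : δ (-1) 0 za = (Cochain.ofHom π).comp zb (zero_add 0) := by
    rw [← hza', ← hzb', δ_comp_ofHom, mappingCone.δ_inl, Cochain.ofHom_comp,
      Cochain.comp_assoc_of_third_is_zero_cochain]
  have dzab : δ (-1) 0 zab = (Cochain.ofHom g).comp zb (zero_add 0) := by
    rw [← hzab', δ_ofHom_comp, dza, ← Cochain.comp_assoc_of_third_is_zero_cochain, inrπ]
  have dzaa : δ (-2) (-1) zaa = - (Cochain.ofHom f).comp zab (zero_add (-1)) := by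
    rw [← hzaa', δ_comp _ _ (show -1 + -1 = -2 by norm_num) 0 0 (-1) (by norm_num) (by norm_num)
      (by norm_num), dza, ← Cochain.comp_assoc_of_third_is_zero_cochain, inlπ,
      mappingCone.δ_inl, Cochain.ofHom_comp, Cochain.comp_assoc_of_first_is_zero_cochain, hzab',
      Cochain.zero_comp, zero_add, show (-1 : ℤ).negOnePow = -1 from rfl, Units.neg_smul, one_smul]
  -- The component of the homotopy on X₁ is taken to be zero. Its component on X₂ is an extension of
  -- `-zaa`; what it fails to account for vanishes on X₁ and descends to the component `β` on X₃.
  -- The remaining equation on X₃ can be checked after pulling back to X₂.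
  obtain ⟨wab, hwab⟩ := L1 (-2) (-zaa)
  obtain ⟨β, hβ⟩ := L2 (-1) (zab - δ (-2) (-1) wab) (by
    rw [Cochain.comp_sub, ← δ_ofHom_comp, hwab, δ_neg, dzaa, neg_neg, sub_self])
  have hzb : δ (-1) 0 β = zb := L3 _ _ _ (by
    rw [← δ_ofHom_comp, hβ, δ_sub, dzab, δ_δ, sub_zero])
  obtain ⟨α, inlα, inrα⟩ : ∃ α : Cochain (mappingCone f) G (-2),
      (mappingCone.inl f).comp α (show -1 + -2 = -3 by norm_num) = 0 ∧
      (Cochain.ofHom (mappingCone.inr f)).comp α (zero_add (-2)) = wab :=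
    ⟨mappingCone.descCochain f 0 wab (by norm_num), mappingCone.inl_descCochain _ _ _ _,
      mappingCone.inr_descCochain _ _ _ _⟩
  obtain ⟨w, inlw, inrw⟩ : ∃ w : Cochain (mappingCone π) G (-1),
      (mappingCone.inl π).comp w (show -1 + -1 = -2 by norm_num) = α ∧
      (Cochain.ofHom (mappingCone.inr π)).comp w (zero_add (-1)) = β :=
    ⟨mappingCone.descCochain π α β (by norm_num), mappingCone.inl_descCochain _ _ _ _,
      mappingCone.inr_descCochain _ _ _ _⟩
  have hza : za = δ (-2) (-1) α + (Cochain.ofHom π).comp β (zero_add (-1)) := by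
    rw [mappingCone.ext_cochain_from_iff f (-2) (-1) (by norm_num)]
    constructor
    · rw [Cochain.comp_add, ← Cochain.comp_assoc (mappingCone.inl f) (Cochain.ofHom π) β
        (add_zero (-1)) (zero_add (-1)) (by norm_num), inlπ, Cochain.zero_comp, add_zero]
      have h1 := δ_comp (mappingCone.inl f) α (show -1 + -2 = -3 by norm_num) 0 (-1) (-2)
        (by norm_num) (by norm_num) (by norm_num)
      rw [inlα, δ_zero, mappingCone.δ_inl, Cochain.ofHom_comp,
        Cochain.comp_assoc_of_first_is_zero_cochain, inrα, hwab,
        show (-2 : ℤ).negOnePow = 1 from rfl, one_smul, ← sub_eq_add_neg] at h1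
      rw [hzaa']
      exact (sub_eq_zero.1 h1.symm).symm
    · rw [Cochain.comp_add, ← δ_ofHom_comp, inrα,
        ← Cochain.comp_assoc_of_second_is_zero_cochain, inrπ, hβ, hzab']
      abel
  refine ⟨(Cochain.equivHomotopy _ _).symm ⟨w, ?_⟩⟩
  rw [Cochain.ofHom_zero, add_zero, mappingCone.ext_cochain_from_iff π (-1) 0 (by norm_num)]
  constructor
  · rw [hza']
    have h1 := δ_comp (mappingCone.inl π) w (show -1 + -1 = -2 by norm_num) 0 0 (-1)
        (by norm_num) (by norm_num) (by norm_num)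
    rw [inlw, mappingCone.δ_inl, Cochain.ofHom_comp,
        Cochain.comp_assoc_of_first_is_zero_cochain, inrw, show (-1 : ℤ).negOnePow = -1 from rfl,
        Units.neg_smul, one_smul] at h1
    rw [hza, h1]
    abel
  · rw [← δ_ofHom_comp, inrw, hzb, hzb']

/-- A map to the total complex of a three-term sequence is null-homotopic if the cochains from
the source to the sequence form a short exact sequence. -/
lemma homotopy_zero_of_cochains_to {X₁ X₂ X₃ G : CochainComplex (ModuleCat.{u} R) ℤ}
    (f : X₁ ⟶ X₂) (g : X₂ ⟶ X₃) (π : mappingCone f ⟶ X₃)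
    (hπ : Cochain.ofHom π = (mappingCone.snd f).comp (Cochain.ofHom g) (add_zero 0))
    (L1 : ∀ (n : ℤ) (c : Cochain G X₃ n),
      ∃ v : Cochain G X₂ n, v.comp (Cochain.ofHom g) (add_zero n) = c)
    (L2 : ∀ (n : ℤ) (c : Cochain G X₂ n), c.comp (Cochain.ofHom g) (add_zero n) = 0 →
      ∃ w : Cochain G X₁ n, w.comp (Cochain.ofHom f) (add_zero n) = c)
    (L3 : ∀ (n : ℤ) (c c' : Cochain G X₁ n), c.comp (Cochain.ofHom f) (add_zero n) =
      c'.comp (Cochain.ofHom f) (add_zero n) → c = c')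
    (ψ : G ⟶ mappingCone π) : Nonempty (Homotopy ψ 0) := by
  obtain ⟨z₁, hz₁⟩ : ∃ z₁, (Cochain.ofHom ψ).comp (mappingCone.fst π).1 (zero_add 1) = z₁ :=
    ⟨_, rfl⟩
  obtain ⟨zb, hzb⟩ : ∃ zb, (Cochain.ofHom ψ).comp (mappingCone.snd π) (zero_add 0) = zb :=
    ⟨_, rfl⟩
  obtain ⟨y₁, hy₁⟩ : ∃ y₁, z₁.comp (mappingCone.fst f).1 (show 1 + 1 = 2 by norm_num) = y₁ :=
    ⟨_, rfl⟩
  obtain ⟨y₂, hy₂⟩ : ∃ y₂, z₁.comp (mappingCone.snd f) (add_zero 1) = y₂ := ⟨_, rfl⟩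
  have dz₁ : δ 1 2 z₁ = 0 := by
    rw [← hz₁, δ_ofHom_comp, Cocycle.δ_eq_zero, Cochain.comp_zero]
  have dy₂ : δ 1 2 y₂ = - y₁.comp (Cochain.ofHom f) (add_zero 2) := by
    rw [← hy₂, ← hy₁, δ_comp_zero_cochain _ _ _ (by norm_num), dz₁, Cochain.zero_comp, add_zero,
      mappingCone.δ_snd, Cochain.comp_neg, Cochain.comp_assoc_of_third_is_zero_cochain]
  have z₁π : z₁.comp (Cochain.ofHom π) (add_zero 1) = y₂.comp (Cochain.ofHom g) (add_zero 1) := by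
    rw [hπ, ← hy₂, Cochain.comp_assoc_of_third_is_zero_cochain]
  have dzb : δ 0 1 zb = - y₂.comp (Cochain.ofHom g) (add_zero 1) := by
    rw [← hzb, δ_ofHom_comp, mappingCone.δ_snd, Cochain.comp_neg,
      ← Cochain.comp_assoc_of_third_is_zero_cochain, hz₁, z₁π]
  -- Dually, the X₃-component of the homotopy is zero: `zb` is lifted to X₂, the resulting error
  -- lifts to X₁, and the equation in X₁ is checked in X₂.
  obtain ⟨v₂, hv₂⟩ := L1 0 zb
  obtain ⟨v₁, hv₁⟩ := L2 1 (- y₂ - δ 0 1 v₂) (by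
    rw [Cochain.sub_comp, ← δ_comp_ofHom, hv₂, dzb, Cochain.neg_comp, sub_self])
  have dv₁ : δ 1 2 v₁ = y₁ := L3 _ _ _ (by
    rw [← δ_comp_ofHom, hv₁, δ_sub, δ_neg, dy₂, δ_δ, sub_zero, neg_neg])
  obtain ⟨w₁, w₁fst, w₁snd⟩ : ∃ w₁ : Cochain G (mappingCone f) 0,
      w₁.comp (mappingCone.fst f).1 (zero_add 1) = v₁ ∧
      w₁.comp (mappingCone.snd f) (add_zero 0) = v₂ :=
    ⟨mappingCone.liftCochain f v₁ v₂ (zero_add 1), mappingCone.liftCochain_fst _ _ _ _,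
      mappingCone.liftCochain_snd _ _ _ _⟩
  obtain ⟨w, wfst, wsnd⟩ : ∃ w : Cochain G (mappingCone π) (-1),
      w.comp (mappingCone.fst π).1 (show -1 + 1 = 0 by norm_num) = w₁ ∧
      w.comp (mappingCone.snd π) (add_zero (-1)) = 0 :=
    ⟨mappingCone.liftCochain π w₁ 0 (by norm_num), mappingCone.liftCochain_fst _ _ _ _,
      mappingCone.liftCochain_snd _ _ _ _⟩
  have hw₁ : - δ 0 1 w₁ = z₁ := by
    rw [mappingCone.ext_cochain_to_iff f 1 2 (by norm_num)]
    constructor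
    · have h1 := δ_comp w₁ (mappingCone.fst f).1 (zero_add 1) 1 2 2
        (by norm_num) (by norm_num) (by norm_num)
      rw [w₁fst, dv₁, Cocycle.δ_eq_zero, Cochain.comp_zero, zero_add,
        show (1 : ℤ).negOnePow = -1 from rfl, Units.neg_smul, one_smul] at h1
      rw [Cochain.neg_comp, ← h1, hy₁]
    · have h1 := δ_comp_zero_cochain w₁ (mappingCone.snd f) 1 (by norm_num)
      rw [w₁snd, mappingCone.δ_snd, Cochain.comp_neg,
        ← Cochain.comp_assoc_of_third_is_zero_cochain, w₁fst, hv₁] at h1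
      rw [Cochain.neg_comp, hy₂]
      rw [eq_sub_of_add_eq' h1.symm]
      abel
  refine ⟨(Cochain.equivHomotopy _ _).symm ⟨w, ?_⟩⟩
  rw [Cochain.ofHom_zero, add_zero, mappingCone.ext_cochain_to_iff π 0 1 (by norm_num)]
  constructor
  · have h1 := δ_comp w (mappingCone.fst π).1 (show -1 + 1 = 0 by norm_num) 0 2 1
      (by norm_num) (by norm_num) (by norm_num)
    rw [wfst, Cocycle.δ_eq_zero, Cochain.comp_zero, zero_add,
        show (1 : ℤ).negOnePow = -1 from rfl, Units.neg_smul, one_smul] at h1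
    rw [hz₁, ← hw₁, h1, neg_neg]
  · have h1 := δ_comp_zero_cochain w (mappingCone.snd π) 0 (by norm_num)
    rw [wsnd, δ_zero, mappingCone.δ_snd, Cochain.comp_neg,
        ← Cochain.comp_assoc w (mappingCone.fst π).1 (Cochain.ofHom π) (show -1 + 1 = 0 by norm_num)
          (add_zero 1) (by norm_num), wfst, hπ,
        ← Cochain.comp_assoc_of_third_is_zero_cochain, w₁snd, hv₂] at h1
    rw [hzb]
    exact (neg_add_eq_zero.1 h1.symm)

/-- Left exactness of the cochains is automatic from degreewise exactness, so only the extension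
property `hG` has to be supplied. It holds for injective targets, and also for targets Hom_A(D, J)
when the last term of the sequence is flat. -/
lemma homotopy_zero_of_totalComplex_to (hS : S.ShortExact)
    (G : CochainComplex (ModuleCat.{u} R) ℤ)
    (hG : ∀ (p q : ℤ) (u : S.X₁.X p ⟶ G.X q), ∃ v : S.X₂.X p ⟶ G.X q, S.f.f p ≫ v = u)
    (ψ : totalComplex S ⟶ G) : Nonempty (Homotopy ψ 0) := by
  refine homotopy_zero_of_cochains_from S.f S.g (mappingCone.desc S.f 0 S.g (by simp))
    (by simp) (by simp) (fun n c => ?_) (fun n c hc => ?_) (fun n c c' hc => ?_) ψ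
  · choose v hv using fun (p q : ℤ) (hpq : p + n = q) => hG p q (c.v p q hpq)
    exact ⟨Cochain.mk v, by ext p q hpq; simp [hv]⟩
  · have hc' (p q : ℤ) (hpq : p + n = q) : S.f.f p ≫ c.v p q hpq = 0 := by
      have := Cochain.congr_v hc p q hpq
      simpa using this
    have (p q : ℤ) (hpq : p + n = q) : ∃ w : S.X₃.X p ⟶ G.X q, S.g.f p ≫ w = c.v p q hpq :=
      have := (shortExact_X hS p).epi_g
      ⟨(shortExact_X hS p).exact.desc _ (hc' p q hpq),
        (shortExact_X hS p).exact.g_desc _ (hc' p q hpq)⟩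
    choose w hw using this
    exact ⟨Cochain.mk w, by ext p q hpq; simp [hw]⟩
  · ext p q hpq : 1
    have : Epi (S.g.f p) := (shortExact_X hS p).epi_g
    have h := Cochain.congr_v hc p q hpq
    simp only [Cochain.zero_cochain_comp_v, Cochain.ofHom_v] at h
    exact (cancel_epi (S.g.f p)).1 h

/-- The dual, with a lifting property; it is used for complexes of projective modules. -/
lemma homotopy_zero_of_to_totalComplex (hS : S.ShortExact)
    (G : CochainComplex (ModuleCat.{u} R) ℤ)
    (hG : ∀ (p q : ℤ) (u : G.X p ⟶ S.X₃.X q), ∃ v : G.X p ⟶ S.X₂.X q, v ≫ S.g.f q = u)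
    (ψ : G ⟶ totalComplex S) : Nonempty (Homotopy ψ 0) := by
  refine homotopy_zero_of_cochains_to S.f S.g (mappingCone.desc S.f 0 S.g (by simp))
    (by simp [mappingCone.descCochain]) (fun n c => ?_) (fun n c hc => ?_)
    (fun n c c' hc => ?_) ψ
  · choose v hv using fun (p q : ℤ) (hpq : p + n = q) => hG p q (c.v p q hpq)
    exact ⟨Cochain.mk v, by ext p q hpq; simp [hv]⟩
  · have hc' (p q : ℤ) (hpq : p + n = q) : c.v p q hpq ≫ S.g.f q = 0 := by
      have := Cochain.congr_v hc p q hpq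
      simpa using this
    have (p q : ℤ) (hpq : p + n = q) : ∃ w : G.X p ⟶ S.X₁.X q, w ≫ S.f.f q = c.v p q hpq :=
      have := (shortExact_X hS q).mono_f
      ⟨(shortExact_X hS q).exact.lift _ (hc' p q hpq),
        (shortExact_X hS q).exact.lift_f _ (hc' p q hpq)⟩
    choose w hw using this
    exact ⟨Cochain.mk w, by ext p q hpq; simp [hw]⟩
  · ext p q hpq : 1
    have : Mono (S.f.f q) := (shortExact_X hS q).mono_f
    have h := Cochain.congr_v hc p q hpq
    simp only [Cochain.comp_zero_cochain_v, Cochain.ofHom_v] at h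
    exact (cancel_mono (S.f.f q)).1 h

end Total

end CoContra

end

noncomputable section

namespace CoContra

/-! ### Triangulated subcategories of the homotopy category -/

section Subcategories

variable {R : Type u} [Ring R]

/-- There is no constructor for isomorphisms, but the target of an isomorphism is an extension of
its cone, a zero object, by its source. -/
instance : (coacyclic R).IsClosedUnderIsomorphisms where
  of_iso {X Y} e hX := by
    obtain ⟨Z, g, h, hT⟩ := distinguished_cocone_triangle e.hom
    exact coacyclic.ext _ hT hX
      (coacyclic.zero _ ((Triangle.isZero₃_iff_isIso₁ _ hT).2 (inferInstanceAs (IsIso e.hom))))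

instance : (contraacyclic R).IsClosedUnderIsomorphisms where
  of_iso {X Y} e hX := by
    obtain ⟨Z, g, h, hT⟩ := distinguished_cocone_triangle e.hom
    exact contraacyclic.ext _ hT hX
      (contraacyclic.zero _ ((Triangle.isZero₃_iff_isIso₁ _ hT).2 (inferInstanceAs (IsIso e.hom))))

variable (P : ObjectProperty (Hot R)) [P.IsTriangulated] [P.IsClosedUnderIsomorphisms]

lemma trW_map_iff {X Y : CochainComplex (ModuleCat.{u} R) ℤ} (f : X ⟶ Y) :
    P.trW ((toHot R).map f) ↔ P ((toHot R).obj (mappingCone f)) :=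
  P.trW_iff_of_distinguished _ (HomotopyCategory.mappingCone_triangleh_distinguished f)

lemma prop_iff_of_trW {X Y : Hot R} {s : X ⟶ Y} (hs : P.trW s) : P X ↔ P Y := by
  obtain ⟨Z, g, h, hT, hZ⟩ := hs
  exact ⟨fun hX => P.ext_of_isTriangulatedClosed₂ _ hT hX hZ,
    fun hY => P.ext_of_isTriangulatedClosed₁ _ hT hY hZ⟩

/-- A short exact sequence whose total complex belongs to a triangulated subcategory. -/
lemma trW_desc_of_total (S : ShortComplex (CochainComplex (ModuleCat.{u} R) ℤ))
    (hS : P ((toHot R).obj (totalComplex S))) :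
    P.trW ((toHot R).map (mappingCone.desc S.f 0 S.g (by simp) : mappingCone S.f ⟶ S.X₃)) :=
  (trW_map_iff P _).2 hS

/-- When the total complex lies in `P`, the comparison map from the cone of f to X₃ is invertible
modulo `P`, so the short exact sequence behaves like a distinguished triangle. This and the next
lemmas are the resulting two-out-of-three statements. -/
lemma trW_f_of_total (S : ShortComplex (CochainComplex (ModuleCat.{u} R) ℤ))
    (hS : P ((toHot R).obj (totalComplex S))) (h : P ((toHot R).obj S.X₃)) :
    P.trW ((toHot R).map S.f) :=
  (trW_map_iff P _).2 ((prop_iff_of_trW P (trW_desc_of_total P S hS)).2 h)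

lemma prop_X₃_iff_of_total (S : ShortComplex (CochainComplex (ModuleCat.{u} R) ℤ))
    (hS : P ((toHot R).obj (totalComplex S))) :
    P ((toHot R).obj S.X₃) ↔ P.trW ((toHot R).map S.f) := by
  rw [trW_map_iff, prop_iff_of_trW P (trW_desc_of_total P S hS)]

/-- The map g is the inclusion of X₂ in the cone of f, whose own cone is X₁[1], followed by the
comparison map. -/
lemma trW_g_of_total (S : ShortComplex (CochainComplex (ModuleCat.{u} R) ℤ))
    (hS : P ((toHot R).obj (totalComplex S))) (h : P ((toHot R).obj S.X₁)) :
    P.trW ((toHot R).map S.g) := by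
  have h1 : P.trW ((toHot R).map (mappingCone.inr S.f)) :=
    (P.trW_iff_of_distinguished _ (rot_of_distTriang _
      (HomotopyCategory.mappingCone_triangleh_distinguished S.f))).2
      (ObjectProperty.IsStableUnderShift.isStableUnderShiftBy 1 |>.le_shift _ h)
  have h2 := P.trW.comp_mem _ _ h1 (trW_desc_of_total P S hS)
  rwa [← Functor.map_comp, mappingCone.inr_desc] at h2

lemma prop_of_homotopy_id_zero {K : CochainComplex (ModuleCat.{u} R) ℤ}
    (h : Nonempty (Homotopy (𝟙 K) 0)) : P ((toHot R).obj K) :=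
  P.prop_of_isZero ((HomotopyCategory.isZero_quotient_obj_iff _).2 h)

lemma prop_X₂_of_total (S : ShortComplex (CochainComplex (ModuleCat.{u} R) ℤ))
    (hS : P ((toHot R).obj (totalComplex S))) (h₁ : P ((toHot R).obj S.X₁))
    (h₃ : P ((toHot R).obj S.X₃)) : P ((toHot R).obj S.X₂) :=
  (prop_iff_of_trW P (trW_f_of_total P S hS h₃)).1 h₁

lemma prop_X₃_of_total (S : ShortComplex (CochainComplex (ModuleCat.{u} R) ℤ))
    (hS : P ((toHot R).obj (totalComplex S))) (h₁ : P ((toHot R).obj S.X₁))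
    (h₂ : P ((toHot R).obj S.X₂)) : P ((toHot R).obj S.X₃) :=
  (prop_iff_of_trW P (trW_g_of_total P S hS h₁)).1 h₂

end Subcategories

/-! ### Subcomplexes and quotient complexes of complexes of modules -/

section Subcomplex

variable {R : Type u} [Ring R]

lemma shortExact_of_elements {X Y Z : CochainComplex (ModuleCat.{u} R) ℤ} (f : X ⟶ Y) (g : Y ⟶ Z)
    (hf : ∀ i, Function.Injective (f.f i)) (hg : ∀ i, Function.Surjective (g.f i))
    (hfg : ∀ i (x : X.X i), g.f i (f.f i x) = 0)
    (hex : ∀ i (y : Y.X i), g.f i y = 0 → ∃ x : X.X i, f.f i x = y) :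
    ∃ w : f ≫ g = 0, (ShortComplex.mk f g w).ShortExact := by
  have w : f ≫ g = 0 := by
    ext i x
    exact hfg i x
  refine ⟨w, HomologicalComplex.shortExact_of_degreewise_shortExact _ fun i => ?_⟩
  exact {
    exact := (ShortComplex.moduleCat_exact_iff _).2 fun y hy => hex i y hy
    mono_f := (ModuleCat.mono_iff_injective _).2 (hf i)
    epi_g := (ModuleCat.epi_iff_surjective _).2 (hg i) }

variable (K : CochainComplex (ModuleCat.{u} R) ℤ) (S : ∀ i, Submodule R (K.X i))
  (hS : ∀ i j, ∀ x ∈ S i, K.d i j x ∈ S j)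

/-- The subcomplex given by a family of submodules stable under the differential. -/
def subcomplex : CochainComplex (ModuleCat.{u} R) ℤ where
  X i := ModuleCat.of R (S i)
  d i j := ModuleCat.ofHom ((K.d i j).hom.restrict (hS i j))
  shape i j hij := by
    ext x
    change K.d i j x.1 = 0
    rw [K.shape i j hij]
    rfl
  d_comp_d' i j k _ _ := by
    ext x
    change (K.d i j ≫ K.d j k) x.1 = 0
    rw [K.d_comp_d]
    rfl

/-- The inclusion of a subcomplex. -/
def subcomplexι : subcomplex K S hS ⟶ K where
  f i := ModuleCat.ofHom (S i).subtype
  comm' i j _ := rfl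

/-- The quotient by a subcomplex. -/
def quotientComplex : CochainComplex (ModuleCat.{u} R) ℤ where
  X i := ModuleCat.of R (K.X i ⧸ S i)
  d i j := ModuleCat.ofHom ((S i).mapQ (S j) (K.d i j).hom (hS i j))
  shape i j hij := by
    ext x
    change (S j).mkQ (K.d i j x) = 0
    rw [K.shape i j hij]
    exact map_zero (S j).mkQ
  d_comp_d' i j k _ _ := by
    ext x
    change (S k).mkQ ((K.d i j ≫ K.d j k) x) = 0
    rw [K.d_comp_d]
    exact map_zero (S k).mkQ

/-- The projection to a quotient complex. -/
def quotientComplexπ : K ⟶ quotientComplex K S hS where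
  f i := ModuleCat.ofHom (S i).mkQ
  comm' i j _ := rfl

lemma subcomplexι_comp_quotientComplexπ :
    subcomplexι K S hS ≫ quotientComplexπ K S hS = 0 := by
  ext i x
  exact (Submodule.Quotient.mk_eq_zero (S i)).2 x.2

/-- The short exact sequence of a subcomplex. -/
abbrev subcomplexSequence : ShortComplex (CochainComplex (ModuleCat.{u} R) ℤ) :=
  ShortComplex.mk _ _ (subcomplexι_comp_quotientComplexπ K S hS)

lemma subcomplexSequence_shortExact : (subcomplexSequence K S hS).ShortExact := by
  obtain ⟨w, h⟩ := shortExact_of_elements (subcomplexι K S hS) (quotientComplexπ K S hS)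
    (fun i => (S i).injective_subtype) (fun i => (S i).mkQ_surjective)
    (fun i x => (Submodule.Quotient.mk_eq_zero (S i)).2 x.2)
    (fun i y hy => ⟨⟨y, (Submodule.Quotient.mk_eq_zero (S i)).1 hy⟩, rfl⟩)
  exact h

lemma exists_distinguished_of_splits (T : ShortComplex (CochainComplex (ModuleCat.{u} R) ℤ))
    (hT : ∀ i, Nonempty (T.map (HomologicalComplex.eval _ _ i)).Splitting) :
    ∃ h, Triangle.mk ((toHot R).map T.f) ((toHot R).map T.g) h ∈ distTriang (Hot R) :=
  ⟨_, (HomotopyCategory.distinguished_iff_iso_trianglehOfDegreewiseSplit _).2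
    ⟨T, fun i => (hT i).some, ⟨Iso.refl _⟩⟩⟩

/-- The terms of degree `≥ n`, as a family of submodules. -/
def brutalSubmodule (n i : ℤ) : Submodule R (K.X i) := if n ≤ i then ⊤ else ⊥

lemma brutalSubmodule_d (n i j : ℤ) (x : K.X i) (hx : x ∈ brutalSubmodule K n i) :
    K.d i j x ∈ brutalSubmodule K n j := by
  by_cases hj : n ≤ j
  · simp [brutalSubmodule, hj]
  · by_cases hi : n ≤ i
    · rw [K.shape i j (by simp; lia)]
      exact zero_mem _
    · have : x = 0 := by simpa [brutalSubmodule, hi] using hx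
      rw [this, map_zero]
      exact zero_mem _

/-- The brutal truncation of a complex in degrees `≥ n`. -/
abbrev brutalGE (n : ℤ) : CochainComplex (ModuleCat.{u} R) ℤ :=
  subcomplex K (brutalSubmodule K n) (brutalSubmodule_d K n)

/-- The brutal truncation of a complex in degrees `< n`. -/
abbrev brutalLT (n : ℤ) : CochainComplex (ModuleCat.{u} R) ℤ :=
  quotientComplex K (brutalSubmodule K n) (brutalSubmodule_d K n)

lemma brutalGE_isZero (n i : ℤ) (h : i < n) : IsZero ((brutalGE K n).X i) := by
  have : brutalSubmodule K n i = ⊥ := by simp [brutalSubmodule, h]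
  have : Subsingleton (brutalSubmodule K n i) := by rw [this]; infer_instance
  exact @ModuleCat.isZero_of_subsingleton _ _ _ this

lemma brutalLT_isZero (n i : ℤ) (h : n ≤ i) : IsZero ((brutalLT K n).X i) := by
  have : brutalSubmodule K n i = ⊤ := by simp [brutalSubmodule, h]
  have : Subsingleton (K.X i ⧸ brutalSubmodule K n i) := by
    rw [this]; infer_instance
  exact @ModuleCat.isZero_of_subsingleton _ _ _ this

lemma nonempty_brutalGE_iso (n i : ℤ) (h : n ≤ i) : Nonempty ((brutalGE K n).X i ≅ K.X i) := by
  have : brutalSubmodule K n i = ⊤ := by simp [brutalSubmodule, h]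
  exact ⟨((LinearEquiv.ofEq _ _ this).trans Submodule.topEquiv).toModuleIso⟩

lemma nonempty_brutalLT_iso (n i : ℤ) (h : i < n) : Nonempty ((brutalLT K n).X i ≅ K.X i) := by
  have : brutalSubmodule K n i = ⊥ := by simp [brutalSubmodule, h]
  exact ⟨(Submodule.quotEquivOfEqBot _ this).toModuleIso⟩

/-- In every degree one of the two outer terms of the truncation sequence vanishes, so the sequence
splits degreewise and gives a genuine triangle in the homotopy category. -/
lemma brutal_distinguished (n : ℤ) :
    ∃ h, Triangle.mk ((toHot R).map (subcomplexι K _ (brutalSubmodule_d K n)))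
      ((toHot R).map (quotientComplexπ K _ (brutalSubmodule_d K n))) h ∈ distTriang (Hot R) := by
  refine exists_distinguished_of_splits (subcomplexSequence K _ (brutalSubmodule_d K n))
    fun i => ?_
  have hex := shortExact_X (subcomplexSequence_shortExact K _ (brutalSubmodule_d K n)) i
  by_cases h : n ≤ i
  · have hz : IsZero ((subcomplexSequence K _ (brutalSubmodule_d K n)).map
      (HomologicalComplex.eval _ _ i)).X₃ := brutalLT_isZero K n i h
    have := hex.isIso_f_iff.2 hz
    exact ⟨ShortComplex.Splitting.ofIsIsoOfIsZero _ this hz⟩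
  · have hz : IsZero ((subcomplexSequence K _ (brutalSubmodule_d K n)).map
      (HomologicalComplex.eval _ _ i)).X₁ := brutalGE_isZero K n i (by lia)
    have := hex.isIso_g_iff.2 hz
    exact ⟨ShortComplex.Splitting.ofIsZeroOfIsIso _ hz this⟩

end Subcomplex

end CoContra

end

noncomputable section

namespace CoContra

/-! ### Bounded complexes in triangulated subcategories -/

section Acyclic

variable {R : Type u} [Ring R]

lemma acyclic_iff_elements (K : CochainComplex (ModuleCat.{u} R) ℤ) :
    K.Acyclic ↔ ∀ i j k : ℤ, i + 1 = j → j + 1 = k → ∀ x : K.X j, K.d j k x = 0 →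
      ∃ y : K.X i, K.d i j y = x := by
  have key (i j k : ℤ) (hij : i + 1 = j) (hjk : j + 1 = k) : K.ExactAt j ↔
      ∀ x : K.X j, K.d j k x = 0 → ∃ y : K.X i, K.d i j y = x := by
    rw [K.exactAt_iff' i j k (by simp; lia) (by simp; lia), ShortComplex.moduleCat_exact_iff]
    rfl
  refine ⟨fun h i j k hij hjk => (key i j k hij hjk).1 (h j), fun h j => ?_⟩
  exact (key (j - 1) j (j + 1) (by lia) rfl).2 (h (j - 1) j (j + 1) (by lia) rfl)

lemma homotopy_id_zero_of_isIso_d (Q : CochainComplex (ModuleCat.{u} R) ℤ) (b c : ℤ)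
    (hbc : b + 1 = c) (hd : IsIso (Q.d b c)) (hQ : ∀ i, i ≠ b → i ≠ c → IsZero (Q.X i)) :
    Nonempty (Homotopy (𝟙 Q) 0) := by
  refine nonempty_homotopy_id_zero_of_pointwise Q fun i j k hij hjk => ?_
  by_cases hj : j = b
  · subst hj
    obtain rfl : c = k := by lia
    exact ⟨0, inv (Q.d j c), by simp⟩
  · by_cases hj' : j = c
    · subst hj'
      obtain rfl : i = b := by lia
      exact ⟨inv (Q.d i j), 0, by simp⟩
    · exact ⟨0, 0, (hQ j hj hj').eq_of_src _ _⟩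

/-- The kernel of the differential in degree `b`, together with the terms of lower degrees. -/
def canonicalSubmodule (K : CochainComplex (ModuleCat.{u} R) ℤ) (b i : ℤ) :
    Submodule R (K.X i) where
  carrier := {x | (b ≤ i → K.d i (i + 1) x = 0) ∧ (b < i → x = 0)}
  zero_mem' := ⟨fun _ => map_zero _, fun _ => rfl⟩
  add_mem' hx hy := ⟨fun h => by rw [map_add, hx.1 h, hy.1 h, add_zero],
    fun h => by rw [hx.2 h, hy.2 h, add_zero]⟩
  smul_mem' r x hx := ⟨fun h => by rw [map_smul, hx.1 h, smul_zero],
    fun h => by rw [hx.2 h, smul_zero]⟩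

lemma canonicalSubmodule_d (K : CochainComplex (ModuleCat.{u} R) ℤ) (b i j : ℤ) (x : K.X i)
    (hx : x ∈ canonicalSubmodule K b i) : K.d i j x ∈ canonicalSubmodule K b j := by
  by_cases hij : i + 1 = j
  · subst hij
    refine ⟨fun _ => ?_, fun h => ?_⟩
    · change (K.d i (i + 1) ≫ K.d (i + 1) (i + 1 + 1)) x = 0
      rw [K.d_comp_d]
      rfl
    · exact hx.1 (by lia)
  · rw [K.shape i j (by simpa using hij)]
    exact zero_mem _

/-- A bounded acyclic complex belongs to any triangulated subcategory which contains
the total complexes of short exact sequences. -/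
lemma prop_of_bounded_acyclic (P : ObjectProperty (Hot R)) [P.IsTriangulated]
    [P.IsClosedUnderIsomorphisms]
    (hP : ∀ S : ShortComplex (CochainComplex (ModuleCat.{u} R) ℤ), S.ShortExact →
      P ((toHot R).obj (totalComplex S)))
    (K : CochainComplex (ModuleCat.{u} R) ℤ) (hK : K.Acyclic) (a b : ℤ)
    (hb : ∀ i, i < a ∨ b < i → IsZero (K.X i)) : P ((toHot R).obj K) := by
  obtain ⟨n, hn⟩ : ∃ n : ℕ, b < a + n := ⟨(b + 1 - a).toNat, by lia⟩
  replace hb : ∀ i, i < a ∨ a + n ≤ i → IsZero (K.X i) := fun i hi => hb i (by lia)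
  clear hn
  induction n generalizing K with
  | zero =>
    exact prop_of_homotopy_id_zero P (nonempty_homotopy_id_zero_of_pointwise K
      fun i j k hij hjk => ⟨0, 0, (hb j (by lia)).eq_of_src _ _⟩)
  | succ n ih =>
    rw [acyclic_iff_elements] at hK
    -- Here n counts the degrees that may be occupied. The canonical truncation is acyclic and
    -- occupies one degree less. The quotient lives in degrees a + n - 1 and a + n, where its
    -- differential is invertible because `K` is exact and zero in degree a + n + 1; hence it is
    -- contractible.
    let S := canonicalSubmodule K (a + n - 1)
    have hS := canonicalSubmodule_d K (a + n - 1)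
    have hz {i : ℤ} (h : IsZero (K.X i)) (x : K.X i) : x = 0 :=
      @Subsingleton.elim _ (ModuleCat.subsingleton_of_isZero h) _ _
    refine prop_X₂_of_total P (subcomplexSequence K S hS)
      (hP _ (subcomplexSequence_shortExact K S hS)) (ih _ ?_ ?_) ?_
    · rw [acyclic_iff_elements]
      rintro i j k hij hjk ⟨x, hx⟩ hx'
      by_cases h : a + n - 1 < j
      · exact ⟨0, Subtype.ext ((map_zero _).trans (hx.2 h).symm)⟩
      · obtain ⟨y, hy⟩ := hK i j k hij hjk x (congr_arg Subtype.val hx')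
        exact ⟨⟨y, fun h' => by lia, fun h' => by lia⟩, Subtype.ext hy⟩
    · intro i hi
      have : Subsingleton (S i) := ⟨fun x y => Subtype.ext (by
        rcases hi with hi | hi
        · rw [hz (hb i (by lia)) x.1, hz (hb i (by lia)) y.1]
        · rw [x.2.2 (by lia), y.2.2 (by lia)])⟩
      exact @ModuleCat.isZero_of_subsingleton _ _ _ this
    · refine prop_of_homotopy_id_zero P
        (homotopy_id_zero_of_isIso_d _ (a + n - 1) (a + n) (by lia) ?_ ?_)
      · rw [ConcreteCategory.isIso_iff_bijective]
        constructor
        · refine (injective_iff_map_eq_zero ((quotientComplex K S hS).d _ _).hom).2 fun x hx => ?_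
          obtain ⟨x, rfl⟩ := (S _).mkQ_surjective x
          have h1 : K.d (a + n - 1) (a + n) x ∈ S (a + n) :=
            (Submodule.Quotient.mk_eq_zero _).1 hx
          have h2 := h1.2 (by lia)
          refine (Submodule.Quotient.mk_eq_zero _).2 ⟨fun _ => ?_, fun h => by lia⟩
          rw [show a + n - 1 + 1 = a + n by lia]
          exact h2
        · intro x
          obtain ⟨x, rfl⟩ := (S _).mkQ_surjective x
          obtain ⟨y, hy⟩ := hK (a + n - 1) (a + n) (a + n + 1) (by lia) rfl x
            (hz (hb _ (by right; push_cast; lia)) _)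
          exact ⟨(S _).mkQ y, congr_arg (S _).mkQ hy⟩
      · intro i h1 h2
        have : Subsingleton (K.X i ⧸ S i) := by
          by_cases h : i < a + n - 1
          · have : S i = ⊤ := by
              rw [eq_top_iff]
              exact fun x _ => ⟨fun h' => by lia, fun h' => by lia⟩
            rw [this]
            infer_instance
          · have := ModuleCat.subsingleton_of_isZero (hb i (by right; push_cast; lia))
            infer_instance
        exact @ModuleCat.isZero_of_subsingleton _ _ _ this

/-- A triangulated subcategory which contains the complexes with a single term in a class of
modules contains the bounded complexes with terms in this class. -/
lemma prop_of_bounded (P : ObjectProperty (Hot R)) [P.IsTriangulated]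
    [P.IsClosedUnderIsomorphisms] (𝒳 : ObjectProperty (ModuleCat.{u} R))
    [𝒳.IsClosedUnderIsomorphisms] (h0 : ∀ M, IsZero M → 𝒳 M)
    (h : ∀ (n : ℤ) (K : CochainComplex (ModuleCat.{u} R) ℤ), (∀ i, i ≠ n → IsZero (K.X i)) →
      (∀ i, 𝒳 (K.X i)) → P ((toHot R).obj K))
    (K : CochainComplex (ModuleCat.{u} R) ℤ) (hK : ∀ i, 𝒳 (K.X i)) (a b : ℤ)
    (hb : ∀ i, i < a ∨ b < i → IsZero (K.X i)) : P ((toHot R).obj K) := by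
  obtain ⟨n, hn⟩ : ∃ n : ℕ, b < a + n := ⟨(b + 1 - a).toNat, by lia⟩
  replace hb : ∀ i, i < a ∨ a + n ≤ i → IsZero (K.X i) := fun i hi => hb i (by lia)
  clear hn
  induction n generalizing K with
  | zero =>
    exact prop_of_homotopy_id_zero P (nonempty_homotopy_id_zero_of_pointwise K
      fun i j k hij hjk => ⟨0, 0, (hb j (by lia)).eq_of_src _ _⟩)
  | succ n ih =>
    -- The top term is split off as a one-term subcomplex.
    obtain ⟨w, hT⟩ := brutal_distinguished K (a + n)
    refine P.ext_of_isTriangulatedClosed₂ _ hT (h (a + n) _ ?_ ?_) (ih _ ?_ ?_)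
    · intro i hi
      rcases lt_or_gt_of_ne hi with hi | hi
      · exact brutalGE_isZero _ _ _ hi
      · exact (hb i (by right; push_cast; lia)).of_iso
          (nonempty_brutalGE_iso K (a + n) i hi.le).some
    · intro i
      by_cases hi : a + n ≤ i
      · exact 𝒳.prop_of_iso (nonempty_brutalGE_iso K (a + n) i hi).some.symm (hK i)
      · exact h0 _ (brutalGE_isZero _ _ _ (by lia))
    · intro i
      by_cases hi : i < a + n
      · exact 𝒳.prop_of_iso (nonempty_brutalLT_iso K (a + n) i hi).some.symm (hK i)
      · exact h0 _ (brutalLT_isZero _ _ _ (by lia))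
    · intro i hi
      rcases hi with hi | hi
      · exact (hb i (by lia)).of_iso (nonempty_brutalLT_iso K (a + n) i (by lia)).some
      · exact brutalLT_isZero _ _ _ hi

end Acyclic

/-! ### Orthogonality of injectives to coacyclic and of projectives to contraacyclic complexes -/

section Orthogonality

variable {R : Type u} [Ring R]

/-- Evaluation in a degree preserves coproducts, so the null-homotopies of the restrictions to the
summands assemble into a single cochain. -/
lemma homotopy_zero_sigma {ι : Type u} (K : ι → CochainComplex (ModuleCat.{u} R) ℤ)
    (L : CochainComplex (ModuleCat.{u} R) ℤ) (f : ∐ K ⟶ L)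
    (h : ∀ i, Nonempty (Homotopy (Sigma.ι K i ≫ f) 0)) : Nonempty (Homotopy f 0) := by
  have (i : ι) : ∃ z : Cochain (K i) L (-1),
      Cochain.ofHom (Sigma.ι K i ≫ f) = δ (-1) 0 z + Cochain.ofHom 0 :=
    ⟨_, (Cochain.equivHomotopy _ _ (h i).some).2⟩
  choose z hz using this
  have hc (p : ℤ) := isColimitOfPreserves
    (HomologicalComplex.eval (ModuleCat.{u} R) (ComplexShape.up ℤ) p) (coproductIsCoproduct K)
  have (p q : ℤ) (hpq : p + -1 = q) : ∃ y : (∐ K).X p ⟶ L.X q,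
      ∀ i, (Sigma.ι K i).f p ≫ y = (z i).v p q hpq :=
    ⟨(hc p).desc (Cocone.mk (L.X q) (Discrete.natTrans fun i => (z i.as).v p q hpq)),
      fun i => (hc p).fac _ ⟨i⟩⟩
  choose y hy using this
  refine ⟨(Cochain.equivHomotopy _ _).symm ⟨Cochain.mk y, ?_⟩⟩
  ext p : 1
  refine (hc p).hom_ext fun ⟨i⟩ => ?_
  have h1 := Cochain.congr_v (hz i) p p (add_zero p)
  rw [Cochain.add_v, δ_v (-1) 0 (neg_add_cancel 1) _ p p (add_zero p) (p - 1) (p + 1) rfl rfl] at h1 ⊢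
  change (Sigma.ι K i).f p ≫ _ = (Sigma.ι K i).f p ≫ _
  simp only [Cochain.ofHom_v, HomologicalComplex.comp_f, HomologicalComplex.zero_f, add_zero,
    Preadditive.comp_add, Cochain.mk_v, Linear.comp_units_smul] at h1 ⊢
  rw [h1, reassoc_of% hy, HomologicalComplex.Hom.comm_assoc, hy]

lemma homotopy_zero_pi {ι : Type u} (K : ι → CochainComplex (ModuleCat.{u} R) ℤ)
    (L : CochainComplex (ModuleCat.{u} R) ℤ) (f : L ⟶ ∏ᶜ K)
    (h : ∀ i, Nonempty (Homotopy (f ≫ Pi.π K i) 0)) : Nonempty (Homotopy f 0) := by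
  have (i : ι) : ∃ z : Cochain L (K i) (-1),
      Cochain.ofHom (f ≫ Pi.π K i) = δ (-1) 0 z + Cochain.ofHom 0 :=
    ⟨_, (Cochain.equivHomotopy _ _ (h i).some).2⟩
  choose z hz using this
  have hc (p : ℤ) := isLimitOfPreserves
    (HomologicalComplex.eval (ModuleCat.{u} R) (ComplexShape.up ℤ) p) (productIsProduct K)
  have (p q : ℤ) (hpq : p + -1 = q) : ∃ y : L.X p ⟶ (∏ᶜ K).X q,
      ∀ i, y ≫ (Pi.π K i).f q = (z i).v p q hpq :=
    ⟨(hc q).lift (Cone.mk (L.X p) (Discrete.natTrans fun i => (z i.as).v p q hpq)),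
      fun i => (hc q).fac _ ⟨i⟩⟩
  choose y hy using this
  refine ⟨(Cochain.equivHomotopy _ _).symm ⟨Cochain.mk y, ?_⟩⟩
  ext p : 1
  refine (hc p).hom_ext fun ⟨i⟩ => ?_
  have h1 := Cochain.congr_v (hz i) p p (add_zero p)
  rw [Cochain.add_v, δ_v (-1) 0 (neg_add_cancel 1) _ p p (add_zero p) (p - 1) (p + 1) rfl rfl] at h1 ⊢
  change _ ≫ (Pi.π K i).f p = _ ≫ (Pi.π K i).f p
  simp only [Cochain.ofHom_v, HomologicalComplex.comp_f, HomologicalComplex.zero_f, add_zero,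
    Preadditive.add_comp, Cochain.mk_v, Linear.units_smul_comp, Category.assoc] at h1 ⊢
  rw [h1, hy, ← HomologicalComplex.Hom.comm, reassoc_of% hy]

/-- Induction on the construction of coacyclic complexes. Degreewise injectivity of `J` makes
cochains on a short exact sequence exact, so maps from total complexes are null-homotopic, with no
boundedness condition on `J`; the other closure operations preserve the vanishing. -/
lemma rightOrthogonal_coacyclic (J : CochainComplex (ModuleCat.{u} R) ℤ)
    (hJ : ∀ i, Injective (J.X i)) : (coacyclic R).rightOrthogonal ((toHot R).obj J) := by
  intro K f hK
  induction hK generalizing J with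
  | total S hS =>
    obtain ⟨f, rfl⟩ := (toHot R).map_surjective f
    rw [HomotopyCategory.quotient_map_eq_zero_iff]
    refine homotopy_zero_of_totalComplex_to hS J (fun p q w => ?_) f
    have := hJ q
    have : Mono (S.f.f p) := (shortExact_X hS p).mono_f
    exact ⟨Injective.factorThru w (S.f.f p), Injective.comp_factorThru _ _⟩
  | zero X hX => exact hX.eq_of_src _ _
  | shift X n hX ih =>
    -- Maps X[n] → J are maps X → J[-n], and J[-n] again has injective terms; this is why the
    -- induction keeps `J` arbitrary.
    have h := ih (J⟦-n⟧) (fun i => hJ _)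
      ((shiftShiftNeg X n).inv ≫ f⟦-n⟧' ≫ ((toHot R).commShiftIso (-n)).inv.app J)
    rw [Preadditive.IsIso.comp_left_eq_zero, Preadditive.IsIso.comp_right_eq_zero] at h
    exact (CategoryTheory.shiftFunctor (Hot R) (-n)).map_injective (h.trans (Functor.map_zero _ _ _).symm)
  | ext T hT h₁ h₃ ih₁ ih₃ =>
    obtain ⟨g, rfl⟩ := Triangle.yoneda_exact₂ T hT f (ih₁ J hJ _)
    rw [ih₃ J hJ g, comp_zero]
  | directSum ι K hK ih =>
    obtain ⟨f, rfl⟩ := (toHot R).map_surjective f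
    rw [HomotopyCategory.quotient_map_eq_zero_iff]
    refine homotopy_zero_sigma K J f fun i => ?_
    rw [← HomotopyCategory.quotient_map_eq_zero_iff]
    exact ih i J hJ _

/-- The dual induction, in which lifting against epimorphisms replaces extension along
monomorphisms. -/
lemma leftOrthogonal_contraacyclic (J : CochainComplex (ModuleCat.{u} R) ℤ)
    (hJ : ∀ i, Projective (J.X i)) : (contraacyclic R).leftOrthogonal ((toHot R).obj J) := by
  intro K f hK
  induction hK generalizing J with
  | total S hS =>
    obtain ⟨f, rfl⟩ := (toHot R).map_surjective f
    rw [HomotopyCategory.quotient_map_eq_zero_iff]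
    refine homotopy_zero_of_to_totalComplex hS J (fun p q w => ?_) f
    have := hJ p
    have : Epi (S.g.f q) := (shortExact_X hS q).epi_g
    exact ⟨Projective.factorThru w (S.g.f q), Projective.factorThru_comp _ _⟩
  | zero X hX => exact hX.eq_of_tgt _ _
  | shift X n hX ih =>
    have h := ih (J⟦-n⟧) (fun i => hJ _)
      (((toHot R).commShiftIso (-n)).hom.app J ≫ f⟦-n⟧' ≫ (shiftShiftNeg X n).hom)
    rw [Preadditive.IsIso.comp_left_eq_zero, Preadditive.IsIso.comp_right_eq_zero] at h
    exact (CategoryTheory.shiftFunctor (Hot R) (-n)).map_injective (h.trans (Functor.map_zero _ _ _).symm)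
  | ext T hT h₁ h₃ ih₁ ih₃ =>
    obtain ⟨g, rfl⟩ := Triangle.coyoneda_exact₂ T hT f (ih₃ J hJ _)
    rw [ih₁ J hJ g, zero_comp]
  | product ι K hK ih =>
    obtain ⟨f, rfl⟩ := (toHot R).map_surjective f
    rw [HomotopyCategory.quotient_map_eq_zero_iff]
    refine homotopy_zero_pi K J f fun i => ?_
    rw [← HomotopyCategory.quotient_map_eq_zero_iff]
    exact ih i J hJ _

end Orthogonality

/-! ### From bounded to unbounded complexes -/

section Unbounded

variable {R S : Type u} [Ring R] [Ring S]

/-- The objects isomorphic to a complex with zero terms outside of a set of degrees. -/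
def hotSupported (R : Type u) [Ring R] (U : Set ℤ) : ObjectProperty (Hot R) := fun X =>
  ∃ K : CochainComplex (ModuleCat.{u} R) ℤ, (∀ i ∉ U, IsZero (K.X i)) ∧
    Nonempty (X ≅ (toHot R).obj K)

instance (U : Set ℤ) : (hotSupported R U).IsClosedUnderIsomorphisms where
  of_iso e := fun ⟨K, hK, ⟨e'⟩⟩ => ⟨K, hK, ⟨e.symm ≪≫ e'⟩⟩

lemma hotSupported_shift {U V : Set ℤ} {X : Hot R} (hX : hotSupported R U X) (n : ℤ)
    (h : ∀ i, i + n ∈ U → i ∈ V) : hotSupported R V (X⟦n⟧) := by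
  obtain ⟨K, hK, ⟨e⟩⟩ := hX
  exact ⟨K⟦n⟧, fun i hi => hK (i + n) fun h' => hi (h i h'),
    ⟨(CategoryTheory.shiftFunctor (Hot R) n).mapIso e ≪≫
      ((toHot R).commShiftIso n).symm.app K⟩⟩

/-- The third vertex is isomorphic to the cone of a representing map of complexes, which occupies
the degrees of Y together with those of X moved down by one. -/
lemma hotSupported_of_distinguished {U V : Set ℤ} {X Y Z : Hot R} {f : X ⟶ Y} {g : Y ⟶ Z}
    {h : Z ⟶ X⟦(1 : ℤ)⟧} (hT : Triangle.mk f g h ∈ distTriang (Hot R))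
    (hX : hotSupported R U X) (hY : hotSupported R U Y) (hV : ∀ i, i ∈ U ∨ i + 1 ∈ U → i ∈ V) :
    hotSupported R V Z := by
  obtain ⟨K, hK, ⟨e⟩⟩ := hX
  obtain ⟨L, hL, ⟨e'⟩⟩ := hY
  obtain ⟨f', hf'⟩ := (toHot R).map_surjective (e.inv ≫ f ≫ e'.hom)
  refine ⟨mappingCone f', fun i hi => ?_, ⟨?_⟩⟩
  · rw [mappingCone.isZero_X_iff]
    exact ⟨hK _ fun h => hi (hV i (Or.inr h)), hL _ fun h => hi (hV i (Or.inl h))⟩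
  · exact Triangle.π₃.mapIso (isoTriangleOfIso₁₂ _ _ hT
      (HomotopyCategory.mappingCone_triangleh_distinguished f') e e' (by
        change f ≫ e'.hom = e.hom ≫ (toHot R).map f'
        rw [hf', e.hom_inv_id_assoc]))

/-- If `X` is homotopy equivalent to a complex with zero n-th term, its identity is homotopic to a
map vanishing in degree n. Having this for every n suffices for contractibility, even though the
complexes depend on n. -/
lemma isZero_of_hotSupported (X : Hot R) (h : ∀ n, ∃ U, n ∉ U ∧ hotSupported R U X) :
    IsZero X := by
  obtain ⟨K, rfl⟩ := (HomotopyCategory.quotient_obj_surjective X)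
  refine (HomotopyCategory.isZero_quotient_obj_iff _).2
    (nonempty_homotopy_id_zero_of_forall_exists K fun n => ?_)
  obtain ⟨U, hn, L, hL, ⟨e⟩⟩ := h n
  obtain ⟨f, hf⟩ := (toHot R).map_surjective e.hom
  obtain ⟨g, hg⟩ := (toHot R).map_surjective e.inv
  refine ⟨f ≫ g, ⟨HomotopyCategory.homotopyOfEq _ _ ?_⟩, ?_⟩
  · rw [Functor.map_comp, hf, hg, e.hom_inv_id]
    exact (toHot R).map_id K
  · rw [HomologicalComplex.comp_f, (hL n hn).eq_of_tgt (f.f n) 0, zero_comp]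

variable (F G : Hot R ⥤ Hot S) [F.CommShift ℤ] [F.IsTriangulated] [G.CommShift ℤ]
  [G.IsTriangulated] (θ : F ⟶ G) [NatTrans.CommShift θ ℤ]

/-- The objects at which a natural transformation is an isomorphism. -/
def isoLocus : ObjectProperty (Hot R) := fun X => IsIso (θ.app X)

instance : (isoLocus F G θ).IsClosedUnderIsomorphisms where
  of_iso e h := by
    have : IsIso (θ.app _) := h
    exact (NatTrans.isIso_app_iff_of_iso θ e).1 h

instance : (isoLocus F G θ).IsTriangulated where
  exists_zero := ⟨_, isZero_zero _,
    ⟨0, (F.map_isZero (isZero_zero _)).eq_of_src _ _, (G.map_isZero (isZero_zero _)).eq_of_src _ _⟩⟩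
  isStableUnderShiftBy n := ⟨fun X hX => isIso_app_shift θ X hX n⟩
  ext₂' T hT h₁ h₃ := ObjectProperty.le_isoClosure _ _ (isIso_app_obj₂ F G θ T hT h₁ h₃)

/-- A natural transformation of triangulated functors of finite amplitude is an isomorphism on
the complexes with terms in a class of modules if it is an isomorphism on the complexes with
a single term in this class. -/
lemma isIso_app_of_single (𝒳 : ObjectProperty (ModuleCat.{u} R))
    [𝒳.IsClosedUnderIsomorphisms] (h0 : ∀ M, IsZero M → 𝒳 M)
    (h : ∀ (n : ℤ) (K : CochainComplex (ModuleCat.{u} R) ℤ), (∀ i, i ≠ n → IsZero (K.X i)) →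
      (∀ i, 𝒳 (K.X i)) → IsIso (θ.app ((toHot R).obj K))) (c : ℤ)
    (hGE : ∀ (n : ℤ) (K : CochainComplex (ModuleCat.{u} R) ℤ), (∀ i, i < n → IsZero (K.X i)) →
      (∀ i, 𝒳 (K.X i)) → hotSupported S (Set.Ici (n - c)) (F.obj ((toHot R).obj K)) ∧
        hotSupported S (Set.Ici (n - c)) (G.obj ((toHot R).obj K)))
    (hLE : ∀ (n : ℤ) (K : CochainComplex (ModuleCat.{u} R) ℤ), (∀ i, n < i → IsZero (K.X i)) →
      (∀ i, 𝒳 (K.X i)) → hotSupported S (Set.Iic (n + c)) (F.obj ((toHot R).obj K)) ∧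
        hotSupported S (Set.Iic (n + c)) (G.obj ((toHot R).obj K)))
    (K : CochainComplex (ModuleCat.{u} R) ℤ) (hK : ∀ i, 𝒳 (K.X i)) :
    IsIso (θ.app ((toHot R).obj K)) := by
  have hge (n : ℤ) (K : CochainComplex (ModuleCat.{u} R) ℤ) (hK : ∀ i, 𝒳 (K.X i)) (i : ℤ) :
      𝒳 ((brutalGE K n).X i) := by
    by_cases hi : n ≤ i
    · exact 𝒳.prop_of_iso (nonempty_brutalGE_iso K n i hi).some.symm (hK i)
    · exact h0 _ (brutalGE_isZero _ _ _ (by lia))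
  have hlt (n : ℤ) (K : CochainComplex (ModuleCat.{u} R) ℤ) (hK : ∀ i, 𝒳 (K.X i)) (i : ℤ) :
      𝒳 ((brutalLT K n).X i) := by
    by_cases hi : i < n
    · exact 𝒳.prop_of_iso (nonempty_brutalLT_iso K n i hi).some.symm (hK i)
    · exact h0 _ (brutalLT_isZero _ _ _ (by lia))
  have bounded := prop_of_bounded (isoLocus F G θ) 𝒳 h0 h
  have below (a : ℤ) (K : CochainComplex (ModuleCat.{u} R) ℤ) (hK : ∀ i, 𝒳 (K.X i))
      (ha : ∀ i, i < a → IsZero (K.X i)) : IsIso (θ.app ((toHot R).obj K)) := by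
    obtain ⟨Z, g, w, hZ⟩ := distinguished_cocone_triangle (θ.app ((toHot R).obj K))
    refine (Triangle.isZero₃_iff_isIso₁ _ hZ).1 (isZero_of_hotSupported Z fun n => ?_)
    -- The truncation K^{<n+c+2} is bounded, so the cone Z is controlled by K^{≥n+c+2}, whose images
    -- live in degrees at least n + 2. The shift by 1 and the cone lose one degree each, and
    -- shifting back recovers one; so Z lives in degrees at least n + 1.
    obtain ⟨v, hT⟩ := brutal_distinguished K (n + c + 2)
    have : IsIso (θ.app ((toHot R).obj (brutalLT K (n + c + 2)))) := by
      refine bounded _ (hlt _ K hK) a (n + c + 2) fun i hi => ?_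
      by_cases h' : n + c + 2 ≤ i
      · exact brutalLT_isZero _ _ _ h'
      · exact (ha i (by lia)).of_iso (nonempty_brutalLT_iso K _ i (by lia)).some
    obtain ⟨g', c', h', hT'⟩ := exists_triangle_of_isIso₃ F G θ hT hZ
    obtain ⟨h1, h2⟩ := hGE (n + c + 2) _ (brutalGE_isZero K (n + c + 2)) (hge _ K hK)
    refine ⟨Set.Ici (n + 1), by simp, ?_⟩
    have h3 := hotSupported_of_distinguished (V := Set.Ici n) (rot_of_distTriang _ hT')
      (hotSupported_shift (V := Set.Ici (n + 1)) h1 1 (by simp; lia))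
      (hotSupported_shift (V := Set.Ici (n + 1)) h2 1 (by simp; lia)) (by simp; lia)
    exact (hotSupported S _).prop_of_iso (shiftShiftNeg Z (1 : ℤ))
      (hotSupported_shift (V := Set.Ici (n + 1)) h3 (-1) (by simp))
  obtain ⟨Z, g, w, hZ⟩ := distinguished_cocone_triangle (θ.app ((toHot R).obj K))
  refine (Triangle.isZero₃_iff_isIso₁ _ hZ).1 (isZero_of_hotSupported Z fun n => ?_)
  -- Now the upper truncation is bounded below and already treated. The other one lives in degrees
  -- at most n - c - 1, so its images and the cone live in degrees at most n - 1.
  obtain ⟨v, hT⟩ := brutal_distinguished K (n - c)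
  have := below (n - c) _ (hge _ K hK) (brutalGE_isZero K (n - c))
  obtain ⟨c', g', h', hT'⟩ := exists_triangle_of_isIso₁ F G θ hT hZ
  obtain ⟨h1, h2⟩ := hLE (n - c - 1) _ (fun i hi => brutalLT_isZero K (n - c) i (by lia))
    (hlt _ K hK)
  exact ⟨Set.Iic (n - 1), by simp, hotSupported_of_distinguished hT' h1 h2 (by simp; lia)⟩

end Unbounded

end CoContra

end

noncomputable section

namespace CoContra

open MulOpposite

/-! ### Character modules over noncommutative rings -/

section Characters

/-- The group of characters of an abelian group with values in `ℚ/ℤ`. -/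
def CharMod (F : Type*) [AddCommGroup F] : Type _ := F →+ AddCircle (1 : ℚ)

instance (F : Type*) [AddCommGroup F] : AddCommGroup (CharMod F) :=
  inferInstanceAs (AddCommGroup (F →+ AddCircle (1 : ℚ)))

instance (F : Type*) [AddCommGroup F] : FunLike (CharMod F) F (AddCircle (1 : ℚ)) :=
  inferInstanceAs (FunLike (F →+ AddCircle (1 : ℚ)) F (AddCircle (1 : ℚ)))

instance (F : Type*) [AddCommGroup F] :
    AddMonoidHomClass (CharMod F) F (AddCircle (1 : ℚ)) :=
  inferInstanceAs (AddMonoidHomClass (F →+ AddCircle (1 : ℚ)) F (AddCircle (1 : ℚ)))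

lemma CharMod.ext {F : Type*} [AddCommGroup F] {c c' : CharMod F} (h : ∀ x, c x = c' x) :
    c = c' := DFunLike.ext _ _ h

@[simp]
lemma CharMod.add_apply {F : Type*} [AddCommGroup F] (c c' : CharMod F) (x : F) :
    (c + c') x = c x + c' x := rfl

@[simp]
lemma CharMod.zero_apply {F : Type*} [AddCommGroup F] (x : F) : (0 : CharMod F) x = 0 := rfl

/-- Evaluation of characters. -/
def CharMod.eval {F : Type*} [AddCommGroup F] (x : F) : CharMod F →+ AddCircle (1 : ℚ) where
  toFun c := c x
  map_zero' := rfl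
  map_add' _ _ := rfl

lemma CharMod.sum_apply {F ι : Type*} [AddCommGroup F] (s : Finset ι) (c : ι → CharMod F)
    (x : F) : (∑ i ∈ s, c i) x = ∑ i ∈ s, c i x :=
  map_sum (CharMod.eval x) c s

instance (B : Type*) [Ring B] (F : Type*) [AddCommGroup F] [Module B F] :
    Module Bᵐᵒᵖ (CharMod F) where
  smul b c := AddMonoidHom.comp (show F →+ _ from c) (DistribSMul.toAddMonoidHom F b.unop)
  one_smul c := CharMod.ext fun x => congr_arg c (one_smul B x)
  mul_smul b b' c := CharMod.ext fun x => congr_arg c (mul_smul b'.unop b.unop x)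
  smul_zero _ := rfl
  smul_add _ _ _ := rfl
  add_smul b b' c := CharMod.ext fun x =>
    (congr_arg c (add_smul b.unop b'.unop x)).trans (map_add c _ _)
  zero_smul c := CharMod.ext fun x => (congr_arg c (zero_smul B x)).trans (map_zero c)

instance (B : Type*) [Ring B] (F : Type*) [AddCommGroup F] [Module Bᵐᵒᵖ F] :
    Module B (CharMod F) where
  smul b c := AddMonoidHom.comp (show F →+ _ from c) (DistribSMul.toAddMonoidHom F (op b))
  one_smul c := CharMod.ext fun x => congr_arg c (one_smul Bᵐᵒᵖ x)
  mul_smul b b' c := CharMod.ext fun x => congr_arg c (mul_smul (op b') (op b) x)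
  smul_zero _ := rfl
  smul_add _ _ _ := rfl
  add_smul b b' c := CharMod.ext fun x =>
    (congr_arg c (add_smul (op b) (op b') x)).trans (map_add c _ _)
  zero_smul c := CharMod.ext fun x => (congr_arg c (zero_smul Bᵐᵒᵖ x)).trans (map_zero c)

lemma CharMod.op_smul_apply {B F : Type*} [Ring B] [AddCommGroup F] [Module B F] (b : Bᵐᵒᵖ)
    (c : CharMod F) (x : F) : (b • c) x = c (b.unop • x) := rfl

/-- The restriction of characters along an additive map. -/
def CharMod.comp {F G : Type*} [AddCommGroup F] [AddCommGroup G] (c : CharMod G) (f : F →+ G) :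
    CharMod F := AddMonoidHom.comp (show G →+ _ from c) f

@[simp]
lemma CharMod.comp_apply {F G : Type*} [AddCommGroup F] [AddCommGroup G] (c : CharMod G)
    (f : F →+ G) (x : F) : c.comp f x = c (f x) := rfl

lemma CharMod.exists_extension {F G : Type*} [AddCommGroup F] [AddCommGroup G] (f : F →+ G)
    (hf : Function.Injective f) (c : CharMod F) : ∃ c' : CharMod G, ∀ x, c' (f x) = c x := by
  obtain ⟨c', hc'⟩ := CharacterModule.dual_surjective_of_injective f.toIntLinearMap hf c
  exact ⟨c', fun x => DFunLike.congr_fun hc' x⟩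

lemma CharMod.eq_zero {F : Type*} [AddCommGroup F] {x : F} (h : ∀ c : CharMod F, c x = 0) :
    x = 0 :=
  CharacterModule.eq_zero_of_character_apply h

/-- Characters separate a subgroup from its complement. -/
lemma CharMod.mem_of_forall {F : Type*} [AddCommGroup F] (Y : AddSubgroup F) (x : F)
    (h : ∀ c : CharMod F, (∀ y ∈ Y, c y = 0) → c x = 0) : x ∈ Y := by
  rw [← QuotientAddGroup.eq_zero_iff]
  refine CharMod.eq_zero fun c => ?_
  exact h (c.comp (QuotientAddGroup.mk' Y)) fun y hy => by
    rw [CharMod.comp_apply, show QuotientAddGroup.mk' Y y = 0 from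
      (QuotientAddGroup.eq_zero_iff y).2 hy, map_zero]

/-- A character which vanishes on the kernel of an additive map factors through this map. -/
lemma CharMod.exists_factor {F G : Type*} [AddCommGroup F] [AddCommGroup G] (f : F →+ G)
    (c : CharMod F) (h : ∀ x, f x = 0 → c x = 0) : ∃ c' : CharMod G, ∀ x, c' (f x) = c x := by
  obtain ⟨c', hc'⟩ := CharMod.exists_extension (QuotientAddGroup.kerLift f)
    (QuotientAddGroup.kerLift_injective f)
    (QuotientAddGroup.lift f.ker (show F →+ _ from c) (fun x hx => h x hx))
  exact ⟨c', fun x => hc' (QuotientAddGroup.mk x)⟩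

/-- The dual of a linear map. -/
def CharMod.dual {B F G : Type*} [Ring B] [AddCommGroup F] [Module B F] [AddCommGroup G]
    [Module B G] (f : F →ₗ[B] G) : CharMod G →ₗ[Bᵐᵒᵖ] CharMod F where
  toFun c := c.comp f.toAddMonoidHom
  map_add' _ _ := rfl
  map_smul' b c := CharMod.ext fun x => congr_arg c (f.map_smul b.unop x).symm

@[simp]
lemma CharMod.dual_apply {B F G : Type*} [Ring B] [AddCommGroup F] [Module B F] [AddCommGroup G]
    [Module B G] (f : F →ₗ[B] G) (c : CharMod G) (x : F) : CharMod.dual f c x = c (f x) := rfl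

end Characters

/-! ### Balanced maps and flatness -/

section Flat

variable {A : Type*} {B : Type u} [Ring A] [Ring B]

section

variable {E F : Type u} [AddCommGroup E] [Module A E] [Module Bᵐᵒᵖ E] [SMulCommClass A Bᵐᵒᵖ E]
  [AddCommGroup F] [Module B F]

variable (A) in
/-- The character of a balanced tensor product given by a balanced pairing. -/
lemma BalancedTensor.exists_char (β : E →ₗ[Bᵐᵒᵖ] CharMod F) :
    ∃ χ : CharMod (BalancedTensor A B E F), ∀ e f, χ (tmul A B e f) = β e f := by
  let β' : E ⊗[ℤ] F →+ AddCircle (1 : ℚ) := TensorProduct.liftAddHom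
    (AddMonoidHom.mk' (fun e => (show F →+ AddCircle (1 : ℚ) from β e))
      (fun e e' => map_add β e e'))
    (fun n e f => by
      change β (n • e) f = β e (n • f)
      rw [map_zsmul, map_zsmul]
      exact map_zsmul (CharMod.eval f) n (β e))
  have h : ∀ x ∈ balancedRel A B E F, β' x = 0 := by
    intro x hx
    -- The relations form an A-span while `β'` is merely additive, so vanishing is proved for all
    -- A-multiples at once; on generators this uses that the two actions commute.
    suffices ∀ (a : A), β' (a • x) = 0 by simpa using this 1
    refine Submodule.span_induction (p := fun x _ => ∀ a : A, β' (a • x) = 0)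
      ?_ ?_ ?_ ?_ hx
    · rintro _ ⟨e, b, f, rfl⟩ a
      rw [smul_sub, map_sub, sub_eq_zero, TensorProduct.smul_tmul', TensorProduct.smul_tmul',
        smul_comm]
      change β (op b • a • e) f = β (a • e) (b • f)
      rw [map_smul]
      rfl
    · intro a
      simp
    · intro x y _ _ hx hy a
      rw [smul_add, map_add, hx, hy, add_zero]
    · intro r x _ hx a
      rw [smul_smul]
      exact hx _
  exact ⟨QuotientAddGroup.lift (balancedRel A B E F).toAddSubgroup β' h, fun e f => rfl⟩

variable (A) in
/-- The balanced pairing given by a character. -/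
def BalancedTensor.pairing (χ : CharMod (BalancedTensor A B E F)) : E →ₗ[Bᵐᵒᵖ] CharMod F where
  toFun e := χ.comp (AddMonoidHom.mk' (tmul A B e) (tmul_add A B e))
  map_add' e e' := CharMod.ext fun f =>
    (congr_arg χ (add_tmul A B e e' f)).trans (map_add χ _ _)
  map_smul' b e := CharMod.ext fun f => by
    refine congr_arg χ ((Submodule.Quotient.eq _).2 (Submodule.subset_span ⟨e, b.unop, f, rfl⟩))

variable (A B) in
lemma BalancedTensor.smul_tmul (a : A) (e : E) (f : F) :
    a • tmul A B e f = tmul A B (a • e) f := rfl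

variable (A B) in
lemma BalancedTensor.op_smul_tmul (b : B) (e : E) (f : F) :
    tmul A B (op b • e) f = tmul A B e (b • f) :=
  (Submodule.Quotient.eq _).2 (Submodule.subset_span ⟨e, b, f, rfl⟩)

lemma BalancedTensor.induction {p : BalancedTensor A B E F → Prop} (x : BalancedTensor A B E F)
    (h0 : p 0) (ht : ∀ e f, p (tmul A B e f)) (ha : ∀ x y, p x → p y → p (x + y)) : p x := by
  obtain ⟨x, rfl⟩ := Submodule.Quotient.mk_surjective _ x
  induction x using TensorProduct.induction_on with
  | zero => exact h0
  | tmul e f => exact ht e f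
  | add x y hx hy => exact ha _ _ hx hy

lemma BalancedTensor.addHom_ext {P : Type*} [AddCommGroup P]
    {f g : BalancedTensor A B E F →+ P} (h : ∀ (e : E) (x : F), f (tmul A B e x) = g (tmul A B e x)) :
    f = g := by
  ext x
  induction x using BalancedTensor.induction with
  | h0 => simp
  | ht e x => exact h e x
  | ha x y hx hy => rw [map_add, map_add, hx, hy]

end

/-- If the pairings with values in the characters of `N` extend to `N'`, then
`E ⊗ N → E' ⊗ N'` is injective. -/
lemma BalancedTensor.map_injective_of_forall {E E' N N' : Type u} [AddCommGroup E] [Module A E]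
    [Module Bᵐᵒᵖ E] [SMulCommClass A Bᵐᵒᵖ E] [AddCommGroup E'] [Module A E'] [Module Bᵐᵒᵖ E']
    [SMulCommClass A Bᵐᵒᵖ E'] [AddCommGroup N] [Module B N] [AddCommGroup N'] [Module B N']
    (f : E →ₗ[A] E') (hf : ∀ (b : B) (e : E), f (op b • e) = op b • f e) (g : N →ₗ[B] N')
    (h : ∀ β : E →ₗ[Bᵐᵒᵖ] CharMod N, ∃ β' : E' →ₗ[Bᵐᵒᵖ] CharMod N',
      ∀ e n, β' (f e) (g n) = β e n) :
    Function.Injective (BalancedTensor.map A B f hf g) := by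
  rw [injective_iff_map_eq_zero]
  intro x hx
  refine CharMod.eq_zero fun χ => ?_
  obtain ⟨β', hβ'⟩ := h (pairing A χ)
  obtain ⟨χ', hχ'⟩ := exists_char A β'
  have : χ'.comp (BalancedTensor.map A B f hf g).toAddMonoidHom = χ :=
    addHom_ext fun e n => (hχ' _ _).trans (hβ' e n)
  rw [← this, CharMod.comp_apply]
  exact (congr_arg χ' hx).trans (map_zero _)

/-- Lambek's criterion. Characters of E ⊗ F are the B-linear maps from E to the characters of F, so
injectivity of E ⊗ F → E' ⊗ F means that such maps extend from E to E'. By Baer's criterion ideals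
suffice. -/
lemma isFlat_iff_baer (F : ModuleCat.{u} B) : IsFlat F ↔ Module.Baer Bᵐᵒᵖ (CharMod F) := by
  constructor
  · intro h I g
    obtain ⟨χ, hχ⟩ := BalancedTensor.exists_char ℤ g
    obtain ⟨χ', hχ'⟩ := CharMod.exists_extension _
      (h (ModuleCat.of Bᵐᵒᵖ I) (ModuleCat.of Bᵐᵒᵖ Bᵐᵒᵖ) I.subtype Subtype.val_injective) χ
    refine ⟨BalancedTensor.pairing ℤ χ', fun x hx => CharMod.ext fun f => ?_⟩
    rw [← hχ ⟨x, hx⟩ f]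
    exact (hχ' (BalancedTensor.tmul ℤ B (E := ModuleCat.of Bᵐᵒᵖ I) (⟨x, hx⟩ : I) f))
  · intro h M M' f hf
    refine BalancedTensor.map_injective_of_forall _ _ _ fun β => ?_
    obtain ⟨β', hβ'⟩ := Module.Baer.extension_property h f hf β
    exact ⟨β', fun e n => DFunLike.congr_fun (DFunLike.congr_fun hβ' e) n⟩

end Flat

end CoContra

end

noncomputable section

namespace CoContra

open MulOpposite

/-! ### Relations over coherent rings -/

section Coherent

variable {R : Type u} [Ring R]

/-- Every finitely generated submodule is finitely presented. -/
def IsCoherentModule (R M : Type*) [Ring R] [AddCommGroup M] [Module R M] : Prop :=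
  ∀ K : Submodule R M, K.FG → Module.FinitePresentation R K

lemma IsCoherentModule.of_equiv {M N : Type*} [AddCommGroup M] [Module R M] [AddCommGroup N]
    [Module R N] (h : IsCoherentModule R M) (e : N ≃ₗ[R] M) : IsCoherentModule R N := by
  intro K hK
  have := h (K.map e.toLinearMap) (hK.map _)
  exact Module.FinitePresentation.of_equiv (e.submoduleMap K).symm

/-- The image of a finitely generated K in N is finitely presented, so the kernel of K → N is
finitely generated. It embeds in M, hence is finitely presented, and K is an extension of finitely
presented modules. -/
lemma IsCoherentModule.prod {M N : Type*} [AddCommGroup M] [Module R M] [AddCommGroup N]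
    [Module R N] (hM : IsCoherentModule R M) (hN : IsCoherentModule R N) :
    IsCoherentModule R (M × N) := by
  intro K hK
  let p : K →ₗ[R] N := (LinearMap.snd R M N).comp K.subtype
  let p' : K →ₗ[R] p.range := p.rangeRestrict
  have hp' : Function.Surjective p' := LinearMap.surjective_rangeRestrict p
  have : Module.Finite R K := Module.Finite.iff_fg.2 hK
  have : Module.FinitePresentation R p.range := hN _ (Module.Finite.iff_fg.1 inferInstance)
  have hk : p'.ker.FG := Module.FinitePresentation.fg_ker p' hp'
  let q : p'.ker →ₗ[R] M := ((LinearMap.fst R M N).comp K.subtype).comp p'.ker.subtype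
  have hq : Function.Injective q := by
    rw [injective_iff_map_eq_zero]
    rintro ⟨⟨⟨m, n⟩, hx⟩, hx'⟩ h
    have h2 : n = 0 := congr_arg Subtype.val hx'
    have h1 : m = 0 := h
    subst h1 h2
    rfl
  have : Module.Finite R p'.ker := Module.Finite.iff_fg.2 hk
  have : Module.FinitePresentation R q.range := hM _ (Module.Finite.iff_fg.1 inferInstance)
  let e : q.range ≃ₗ[R] p'.ker := (LinearEquiv.ofInjective q hq).symm
  have : Module.FinitePresentation R p'.ker := 
    Module.FinitePresentation.of_equiv (M := q.range) (N := p'.ker) e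
  exact Module.finitePresentation_of_ker p' hp'

lemma IsLeftCoherent.isCoherentModule (hR : IsLeftCoherent R) (n : ℕ) :
    IsCoherentModule R (Fin n → R) := by
  induction n with
  | zero =>
    intro K hK
    have : Subsingleton K := ⟨fun x y => Subtype.ext (Subsingleton.elim _ _)⟩
    infer_instance
  | succ n ih =>
    exact (IsCoherentModule.prod hR ih).of_equiv (Fin.consLinearEquiv R (fun _ => R)).symm

/-- The relations between finitely many elements of a coherent module are
generated by finitely many relations. -/
lemma IsCoherentModule.exists_relations {M : Type*} [AddCommGroup M] [Module R M]
    (h : IsCoherentModule R M) {n : ℕ} (k : Fin n → M) :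
    ∃ (m : ℕ) (s : Fin m → Fin n → R), (∀ j, ∑ i, s j i • k i = 0) ∧
      ∀ c : Fin n → R, ∑ i, c i • k i = 0 → ∃ t : Fin m → R, ∀ i, c i = ∑ j, t j * s j i := by
  let l : (Fin n → R) →ₗ[R] M := Fintype.linearCombination R k
  have : Module.FinitePresentation R l.range := h _ (Module.Finite.iff_fg.1 inferInstance)
  have hk := Module.FinitePresentation.fg_ker l.rangeRestrict l.surjective_rangeRestrict
  rw [LinearMap.ker_rangeRestrict] at hk
  obtain ⟨m, s, hs⟩ := Submodule.fg_iff_exists_fin_generating_family.1 hk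
  refine ⟨m, s, fun j => ?_, fun c hc => ?_⟩
  · have : s j ∈ l.ker := by
      rw [← hs]
      exact Submodule.subset_span ⟨j, rfl⟩
    simpa [l, Fintype.linearCombination_apply] using this
  · have : c ∈ l.ker := by simpa [l, Fintype.linearCombination_apply] using hc
    rw [← hs, Submodule.mem_span_range_iff_exists_fun] at this
    obtain ⟨t, ht⟩ := this
    exact ⟨t, fun i => by rw [← ht]; simp⟩

end Coherent

/-! ### Flat modules over coherent rings -/

section Flat

variable {B : Type u} [Ring B]

/-- The columns of `r` generate the right relations between the elements `i k`. -/
def RelGen {n m : ℕ} (i : Fin n → B) (r : Fin n → Fin m → B) : Prop :=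
  (∀ l, ∑ k, i k * r k l = 0) ∧
    ∀ c : Fin n → B, ∑ k, i k * c k = 0 → ∃ s : Fin m → B, ∀ k, c k = ∑ l, r k l * s l

lemma exists_relGen (hB : IsRightCoherent B) {n : ℕ} (i : Fin n → B) :
    ∃ (m : ℕ) (r : Fin n → Fin m → B), RelGen i r := by
  obtain ⟨m, s, hs, hs'⟩ := IsCoherentModule.exists_relations (M := Bᵐᵒᵖ) hB (fun k => op (i k))
  refine ⟨m, fun k l => (s l k).unop, fun l => ?_, fun c hc => ?_⟩
  · have := congr_arg unop (hs l)
    simpa using this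
  · obtain ⟨t, ht⟩ := hs' (fun k => op (c k)) (by
      apply unop_injective
      simpa using hc)
    refine ⟨fun l => (t l).unop, fun k => ?_⟩
    have := congr_arg unop (ht k)
    simpa using this

/-- Linear equations in `F` are solved by generating relations. -/
def RelSolvable (B : Type u) [Ring B] (F : Type*) [AddCommGroup F] [Module B F] : Prop :=
  ∀ (n m : ℕ) (i : Fin n → B) (r : Fin n → Fin m → B), RelGen i r → ∀ f : Fin n → F,
    ∑ k, i k • f k = 0 → ∃ y : Fin m → F, ∀ k, f k = ∑ l, r k l • y l

lemma tensor_exists_sum {E F : Type*} [AddCommGroup E] [AddCommGroup F] (x : E ⊗[ℤ] F) :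
    ∃ (n : ℕ) (e : Fin n → E) (f : Fin n → F), x = ∑ k, e k ⊗ₜ f k := by
  induction x using TensorProduct.induction_on with
  | zero => exact ⟨0, Fin.elim0, Fin.elim0, by simp⟩
  | tmul e f => exact ⟨1, fun _ => e, fun _ => f, by simp⟩
  | add x y hx hy =>
    obtain ⟨n, e, f, rfl⟩ := hx
    obtain ⟨m, e', f', rfl⟩ := hy
    exact ⟨n + m, Fin.append e e', Fin.append f f', by simp [Fin.sum_univ_add]⟩

/-- Half of the equational criterion of flatness. A map from a right ideal I to the characters of F
is a balanced pairing of I with F. If Σ e_k f_k = 0, solvability rewrites the f_k through relations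
that kill the e_k, so the pairing vanishes on Σ e_k ⊗ f_k and factors through multiplication I ⊗ F →
F. The character of F so obtained is the value at 1 of the extension. Only generation of relations
is assumed, so that the lemma also applies over the ring opposite to `A`. -/
lemma RelSolvable.baer_of_relGen
    (hB : ∀ (n : ℕ) (i : Fin n → B), ∃ (m : ℕ) (r : Fin n → Fin m → B), RelGen i r)
    {F : Type*} [AddCommGroup F] [Module B F] (h : RelSolvable B F) :
    Module.Baer Bᵐᵒᵖ (CharMod F) := by
  intro I g
  let β : I ⊗[ℤ] F →+ AddCircle (1 : ℚ) := TensorProduct.liftAddHom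
    (AddMonoidHom.mk' (fun e => (show F →+ AddCircle (1 : ℚ) from g e))
      (fun e e' => map_add g e e'))
    (fun n e f => by
      change g (n • e) f = g e (n • f)
      rw [map_zsmul, map_zsmul]
      exact map_zsmul (CharMod.eval f) n (g e))
  let μ : I ⊗[ℤ] F →+ F := TensorProduct.liftAddHom
    (AddMonoidHom.mk' (fun e => DistribSMul.toAddMonoidHom F e.1.unop)
      (fun e e' => AddMonoidHom.ext fun f => add_smul _ _ _))
    (fun n e f => by
      change (n • e.1).unop • f = e.1.unop • n • f
      rw [unop_smul, smul_comm e.1.unop n f, smul_assoc])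
  obtain ⟨w, hw⟩ := CharMod.exists_factor μ β (fun x hx => by
    obtain ⟨n, e, f, rfl⟩ := tensor_exists_sum x
    obtain ⟨m, r, hr⟩ := hB n (fun k => (e k).1.unop)
    obtain ⟨y, hy⟩ := h n m _ r hr f (by simpa [μ] using hx)
    change β _ = 0
    rw [map_sum]
    change ∑ k, g (e k) (f k) = 0
    calc ∑ k, g (e k) (f k) = ∑ k, ∑ l, g (op (r k l) • e k) (y l) := by
          refine Finset.sum_congr rfl fun k _ => ?_
          rw [hy k, map_sum]
          refine Finset.sum_congr rfl fun l _ => ?_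
          exact (DFunLike.congr_fun (map_smul g (op (r k l)) (e k)) (y l)).symm
      _ = ∑ l, g (∑ k, op (r k l) • e k) (y l) := by
          rw [Finset.sum_comm]
          refine Finset.sum_congr rfl fun l _ => ?_
          rw [map_sum, CharMod.sum_apply]
      _ = 0 := by
          refine Finset.sum_eq_zero fun l _ => ?_
          have : ∑ k, op (r k l) • e k = 0 := by
            apply Subtype.ext
            apply unop_injective
            simpa using hr.1 l
          rw [this, map_zero, CharMod.zero_apply])
  refine ⟨LinearMap.toSpanSingleton Bᵐᵒᵖ _ w, fun x hx => CharMod.ext fun f => ?_⟩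
  rw [LinearMap.toSpanSingleton_apply, CharMod.op_smul_apply]
  exact hw (⟨x, hx⟩ ⊗ₜ f)

lemma RelSolvable.baer (hB : IsRightCoherent B) {F : Type*} [AddCommGroup F] [Module B F]
    (h : RelSolvable B F) : Module.Baer Bᵐᵒᵖ (CharMod F) :=
  h.baer_of_relGen fun _ i => exists_relGen hB i

/-- The generating relations do not depend on the coordinate, so equations in a product are solved
coordinatewise. Over a coherent ring this is Chase's theorem that products of flat modules are flat.
-/
lemma RelSolvable.pi {ι : Type*} {F : ι → Type*} [∀ i, AddCommGroup (F i)]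
    [∀ i, Module B (F i)] (h : ∀ i, RelSolvable B (F i)) : RelSolvable B (∀ i, F i) := by
  intro n m i r hr f hf
  choose y hy using fun j => h j n m i r hr (fun k => f k j) (by
    simpa using congr_fun hf j)
  exact ⟨fun l j => y j l, fun k => by ext j; simpa using hy j k⟩

lemma RelSolvable.of_retract {F F' : Type*} [AddCommGroup F] [Module B F] [AddCommGroup F']
    [Module B F'] (h : RelSolvable B F) (s : F' →ₗ[B] F) (p : F →ₗ[B] F')
    (hps : ∀ x, p (s x) = x) : RelSolvable B F' := by
  intro n m i r hr f hf
  obtain ⟨y, hy⟩ := h n m i r hr (fun k => s (f k)) (by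
    have := congr_arg s hf
    simpa using this)
  refine ⟨fun l => p (y l), fun k => ?_⟩
  have := congr_arg p (hy k)
  simpa [hps] using this

lemma RelSolvable.finsupp (ι : Type*) : RelSolvable B (ι →₀ B) := by
  classical
  intro n m i r hr f hf
  -- The zero solution is imposed wherever all right-hand sides vanish, so that the solution is
  -- finitely supported.
  have (x : ι) : ∃ s : Fin m → B, (∀ k, f k x = ∑ l, r k l * s l) ∧
      ((∀ k, f k x = 0) → s = 0) := by
    by_cases h : ∀ k, f k x = 0
    · exact ⟨0, fun k => by simp [h k], fun _ => rfl⟩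
    · obtain ⟨s, hs⟩ := hr.2 (fun k => f k x) (by simpa using DFunLike.congr_fun hf x)
      exact ⟨s, hs, fun h' => absurd h' h⟩
  choose s hs hs' using this
  refine ⟨fun l => Finsupp.onFinset (Finset.univ.biUnion fun k => (f k).support)
    (fun x => s x l) (fun x hx => ?_), fun k => ?_⟩
  · by_contra h
    refine hx (congr_fun (hs' x fun k => ?_) l)
    by_contra h'
    exact h (Finset.mem_biUnion.2 ⟨k, Finset.mem_univ _, Finsupp.mem_support_iff.2 h'⟩)
  · ext x
    simpa using hs x k

lemma RelSolvable.of_projective (P : Type*) [AddCommGroup P] [Module B P]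
    [Module.Projective B P] : RelSolvable B P := by
  obtain ⟨s, hs⟩ := Module.projective_def'.1 ‹Module.Projective B P›
  exact (RelSolvable.finsupp P).of_retract s (Finsupp.linearCombination B id)
    (fun x => LinearMap.congr_fun hs x)

/-- If the quotient is flat, then the restriction of characters to a submodule has a linear
section. -/
lemma exists_section_charMod {Z P V : Type*} [AddCommGroup Z] [Module B Z] [AddCommGroup P]
    [Module B P] [AddCommGroup V] [Module B V] (i : Z →ₗ[B] P) (p : P →ₗ[B] V)
    (hi : Function.Injective i) (hp : Function.Surjective p)
    (hip : Function.Exact i p) (hV : Module.Baer Bᵐᵒᵖ (CharMod V)) :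
    ∃ σ : CharMod Z →ₗ[Bᵐᵒᵖ] CharMod P, ∀ c z, σ c (i z) = c z := by
  have hpd : Function.Injective (CharMod.dual p) := by
    rw [injective_iff_map_eq_zero]
    intro c hc
    refine CharMod.ext fun v => ?_
    obtain ⟨x, rfl⟩ := hp v
    exact DFunLike.congr_fun hc x
  obtain ⟨ρ, hρ⟩ := Module.Baer.extension_property hV (CharMod.dual p) hpd LinearMap.id
  have hid : Function.Surjective (CharMod.dual i) := fun c => by
    obtain ⟨c', hc'⟩ := CharMod.exists_extension i.toAddMonoidHom hi c
    exact ⟨c', CharMod.ext hc'⟩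
  -- Since ρ retracts the dual of p, this map kills the characters coming from V, which are the
  -- kernel of restriction to Z. It therefore descends to the characters of Z and gives the section.
  let φ : CharMod P →ₗ[Bᵐᵒᵖ] CharMod P := LinearMap.id - (CharMod.dual p).comp ρ
  have hφ : (CharMod.dual i).ker ≤ φ.ker := by
    intro c hc
    obtain ⟨v, hv⟩ := CharMod.exists_factor p.toAddMonoidHom c (fun x hx => by
      obtain ⟨z, rfl⟩ := (hip x).1 hx
      exact DFunLike.congr_fun (show CharMod.dual i c = 0 from hc) z)
    obtain rfl : CharMod.dual p v = c := CharMod.ext hv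
    change CharMod.dual p v - CharMod.dual p (ρ (CharMod.dual p v)) = 0
    rw [show ρ (CharMod.dual p v) = v from LinearMap.congr_fun hρ v, sub_self]
  refine ⟨((CharMod.dual i).ker.liftQ φ hφ).comp
    (LinearMap.quotKerEquivOfSurjective _ hid).symm.toLinearMap, fun c z => ?_⟩
  obtain ⟨c, rfl⟩ := hid c
  have : (LinearMap.quotKerEquivOfSurjective _ hid).symm (CharMod.dual i c) =
      (CharMod.dual i).ker.mkQ c := by
    rw [LinearEquiv.symm_apply_eq]
    rfl
  rw [LinearMap.comp_apply, LinearEquiv.coe_coe, this, Submodule.mkQ_apply, Submodule.liftQ_apply]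
  change c (i z) - ρ c (p (i z)) = c (i z)
  rw [(hip _).2 ⟨z, rfl⟩, map_zero, sub_zero]

/-- The dual sequence splits because the characters of V are injective, so the characters of Z are a
retract of those of P: the kernel of a surjection of flat modules is flat. -/
lemma baer_charMod_of_exact {Z P V : Type*} [AddCommGroup Z] [Module B Z] [AddCommGroup P]
    [Module B P] [AddCommGroup V] [Module B V] (i : Z →ₗ[B] P) (p : P →ₗ[B] V)
    (hi : Function.Injective i) (hp : Function.Surjective p)
    (hip : Function.Exact i p) (hP : Module.Baer Bᵐᵒᵖ (CharMod P))
    (hV : Module.Baer Bᵐᵒᵖ (CharMod V)) : Module.Baer Bᵐᵒᵖ (CharMod Z) := by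
  obtain ⟨σ, hσ⟩ := exists_section_charMod i p hi hp hip hV
  intro I g
  obtain ⟨g', hg'⟩ := hP I (σ.comp g)
  refine ⟨(CharMod.dual i).comp g', fun x hx => CharMod.ext fun z => ?_⟩
  rw [LinearMap.comp_apply, hg' x hx, CharMod.dual_apply, LinearMap.comp_apply, hσ]

end Flat

end CoContra

end

noncomputable section

namespace CoContra

open MulOpposite

/-! ### fp-injectivity as an extension property -/

section FPInjective

/-- Maps from finitely generated submodules of finite free modules extend. -/
def FPExt (R J : Type*) [Ring R] [AddCommGroup J] [Module R J] : Prop :=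
  ∀ (n : ℕ) (K : Submodule R (Fin n → R)), K.FG → ∀ g : K →ₗ[R] J,
    ∃ h : (Fin n → R) →ₗ[R] J, ∀ x : K, h x = g x

variable {R : Type u} [Ring R]

/-- The short exact sequence of a submodule and a surjective map with this kernel. -/
lemma shortExact_of_ker {K M N : Type u} [AddCommGroup K] [Module R K] [AddCommGroup M]
    [Module R M] [AddCommGroup N] [Module R N] (i : K →ₗ[R] M) (p : M →ₗ[R] N)
    (hi : Function.Injective i) (hp : Function.Surjective p) (hip : Function.Exact i p) :
    (ShortComplex.mk (ModuleCat.ofHom i) (ModuleCat.ofHom p)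
      (by ext x; exact (hip _).2 ⟨x, rfl⟩)).ShortExact where
  exact := (ShortComplex.moduleCat_exact_iff _).2 fun y hy => (hip y).1 hy
  mono_f := (ModuleCat.mono_iff_injective _).2 hi
  epi_g := (ModuleCat.epi_iff_surjective _).2 hp

/-- Finitely presented modules are the quotients of R^n by finitely generated K, and R^n is
projective; Ext¹ of the quotient vanishes exactly when every map K → J extends to R^n. -/
lemma isFPInjective_iff (J : ModuleCat.{u} R) : IsFPInjective J ↔ FPExt R J := by
  constructor
  · intro hJ n K hK g
    have hS := shortExact_of_ker K.subtype K.mkQ K.injective_subtype K.mkQ_surjective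
      (LinearMap.exact_subtype_mkQ K)
    have : Subsingleton (Abelian.Ext (ModuleCat.of R ((Fin n → R) ⧸ K)) J 1) :=
      hJ (ModuleCat.of R ((Fin n → R) ⧸ K))
        (Module.finitePresentation_of_surjective K.mkQ K.mkQ_surjective (by simpa using hK))
    obtain ⟨x, hx⟩ := Abelian.Ext.contravariant_sequence_exact₁ hS J
      (Abelian.Ext.mk₀ (ModuleCat.ofHom g)) (add_zero 1) (Subsingleton.elim _ _)
    obtain ⟨h, rfl⟩ := Abelian.Ext.homEquiv₀.symm.surjective x
    refine ⟨h.hom, fun x => ?_⟩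
    have h1 : ModuleCat.ofHom K.subtype ≫ h = ModuleCat.ofHom g := by
      apply Abelian.Ext.homEquiv₀.symm.injective
      simpa [Abelian.Ext.homEquiv₀] using hx
    exact ConcreteCategory.congr_hom h1 x
  · intro hJ M hM
    obtain ⟨n, K, e, hK⟩ := Module.FinitePresentation.exists_fin R M
    have hS := shortExact_of_ker K.subtype (e.symm.toLinearMap.comp K.mkQ) K.injective_subtype
      (e.symm.surjective.comp K.mkQ_surjective)
      (fun y => by
        rw [LinearMap.comp_apply, LinearEquiv.coe_coe, e.symm.map_eq_zero_iff]
        exact LinearMap.exact_subtype_mkQ K y)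
    have : Projective (ModuleCat.of R (Fin n → R)) :=
      (IsProjective.iff_projective _).1 inferInstance
    refine ⟨fun x y => ?_⟩
    suffices ∀ x : Abelian.Ext M J 1, x = 0 by rw [this x, this y]
    clear x y
    intro x
    obtain ⟨y, rfl⟩ := Abelian.Ext.contravariant_sequence_exact₃ hS J x
      (Abelian.Ext.eq_zero_of_projective _) (add_zero 1)
    obtain ⟨g, rfl⟩ := Abelian.Ext.homEquiv₀.symm.surjective y
    obtain ⟨h, hh⟩ := hJ n K hK g.hom
    have h1 : Abelian.Ext.homEquiv₀.symm g =
        (Abelian.Ext.mk₀ (ModuleCat.ofHom K.subtype)).comp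
          (Abelian.Ext.mk₀ (ModuleCat.ofHom h)) (add_zero 0) := by
      rw [Abelian.Ext.mk₀_comp_mk₀]
      refine congr_arg Abelian.Ext.homEquiv₀.symm ?_
      ext x
      exact (hh x).symm
    rw [h1]
    exact hS.extClass_comp_assoc _

lemma FPExt.pi {ι : Type*} {J : ι → Type*} [∀ i, AddCommGroup (J i)] [∀ i, Module R (J i)]
    (h : ∀ i, FPExt R (J i)) : FPExt R (∀ i, J i) := by
  intro n K hK g
  choose y hy using fun i => h i n K hK ((LinearMap.proj i).comp g)
  exact ⟨LinearMap.pi y, fun x => funext fun i => hy i x⟩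

lemma exists_factor_of_surjective {M N Q : Type*} [AddCommGroup M] [Module R M] [AddCommGroup N]
    [Module R N] [AddCommGroup Q] [Module R Q] (l : M →ₗ[R] N) (hl : Function.Surjective l)
    (q : M →ₗ[R] Q) (h : ∀ x, l x = 0 → q x = 0) : ∃ g : N →ₗ[R] Q, ∀ x, g (l x) = q x := by
  refine ⟨(l.ker.liftQ q (fun x hx => h x hx)).comp
    (LinearMap.quotKerEquivOfSurjective l hl).symm.toLinearMap, fun x => ?_⟩
  have : (LinearMap.quotKerEquivOfSurjective l hl).symm (l x) = l.ker.mkQ x := by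
    rw [LinearEquiv.symm_apply_eq]
    rfl
  rw [LinearMap.comp_apply, LinearEquiv.coe_coe, this]
  rfl

/-- The form in which injectivity is mostly used: `l` becomes injective modulo its kernel, and `q`
descends to that quotient. -/
lemma baer_exists_factor {R M N Q : Type*} [Ring R] [AddCommGroup M] [Module R M] [AddCommGroup N]
    [Module R N] [AddCommGroup Q] [Module R Q] (hQ : Module.Baer R Q) (l : M →ₗ[R] N)
    (q : M →ₗ[R] Q) (h : ∀ x, l x = 0 → q x = 0) : ∃ g : N →ₗ[R] Q, ∀ x, g (l x) = q x := by
  obtain ⟨g, hg⟩ := Module.Baer.extension_property hQ (l.ker.liftQ l le_rfl)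
    (LinearMap.ker_eq_bot.1 (Submodule.ker_liftQ_eq_bot _ _ _ le_rfl))
    (l.ker.liftQ q (fun x hx => h x hx))
  exact ⟨g, fun x => LinearMap.congr_fun hg (l.ker.mkQ x)⟩

end FPInjective

/-! ### Tensor products and Hom with an fp-injective bimodule -/

section Bimodules

variable {A B : Type u} [Ring A] [Ring B] {E : Type u} [AddCommGroup E] [Module A E]
  [Module Bᵐᵒᵖ E] [SMulCommClass A Bᵐᵒᵖ E]

variable (B) in
/-- The left multiplication by a matrix over `A`, as a map of right `B`-modules. -/
def matrixMul {p m : ℕ} (s : Fin p → Fin m → A) : (Fin m → E) →ₗ[Bᵐᵒᵖ] (Fin p → E) where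
  toFun e j := ∑ i, s j i • e i
  map_add' e e' := by
    ext j
    simp [Finset.sum_add_distrib]
  map_smul' b e := by
    ext j
    simp only [Pi.smul_apply, RingHom.id_apply, Finset.smul_sum]
    exact Finset.sum_congr rfl fun i _ => smul_comm _ _ _

/-- The map `e ↦ e ⊗ f`. -/
def BalancedTensor.tmulRight {F : Type u} [AddCommGroup F] [Module B F] (f : F) :
    E →ₗ[A] BalancedTensor A B E F where
  toFun e := tmul A B e f
  map_add' e e' := add_tmul A B e e' f
  map_smul' _ _ := rfl

/-- A map from the span of k_1, ..., k_m to E ⊗ F is a tuple x satisfying the finitely many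
generating relations s; it extends if x is a sum of tuples H(k_i) ⊗ f with H : A^n → E. This is
tested by characters. One that kills such tuples is a map E^m → F^*; by fp-injectivity of E every
solution of the relations in E has the form H(k_i), so this map vanishes on ker s. By injectivity of
F^* it factors through s, and hence it kills x. -/
lemma FPExt.balancedTensor (hA : IsLeftCoherent A) (hE : FPExt A E) {F : Type u} [AddCommGroup F]
    [Module B F] (hF : Module.Baer Bᵐᵒᵖ (CharMod F)) : FPExt A (BalancedTensor A B E F) := by
  intro n K hK g
  obtain ⟨m, k, rfl⟩ := Submodule.fg_iff_exists_fin_generating_family.1 hK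
  obtain ⟨p, s, hs, hs'⟩ := (hA.isCoherentModule n).exists_relations k
  have hk (i : Fin m) : k i ∈ Submodule.span A (Set.range k) := Submodule.subset_span ⟨i, rfl⟩
  let x (i : Fin m) : BalancedTensor A B E F := g ⟨k i, hk i⟩
  -- The tuples of the form G(k_i) for the obvious maps G : A^n → E ⊗ F.
  let Y : AddSubgroup (Fin m → BalancedTensor A B E F) := AddSubgroup.closure
    {y | ∃ (H : (Fin n → A) →ₗ[A] E) (f : F), y = fun i => BalancedTensor.tmul A B (H (k i)) f}
  have hx : x ∈ Y := by
    refine CharMod.mem_of_forall Y x fun χ hχ => ?_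
    let β : (Fin m → E) →ₗ[Bᵐᵒᵖ] CharMod F := ∑ i, (BalancedTensor.pairing A
      (χ.comp (AddMonoidHom.single (fun _ => BalancedTensor A B E F) i))).comp (LinearMap.proj i)
    have hβ (e : Fin m → E) (f : F) : β e f = χ (fun i => BalancedTensor.tmul A B (e i) f) := by
      rw [LinearMap.sum_apply, CharMod.sum_apply,
        ← Finset.univ_sum_single (fun i => BalancedTensor.tmul A B (e i) f), map_sum]
      rfl
    obtain ⟨β', hβ'⟩ := baer_exists_factor hF (matrixMul B s) β (fun e he => by
      obtain ⟨h, hh⟩ := exists_factor_of_surjective (R := A)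
        (M := Fin m → A) (N := Submodule.span A (Set.range k))
        ((Fintype.linearCombination A k).codRestrict _ (fun c =>
          Submodule.mem_span_range_iff_exists_fun A |>.2 ⟨c, rfl⟩))
        (fun y => by
          obtain ⟨c, hc⟩ := (Submodule.mem_span_range_iff_exists_fun A).1 y.2
          exact ⟨c, Subtype.ext hc⟩)
        (Fintype.linearCombination A e) (fun c hc => by
          obtain ⟨t, ht⟩ := hs' c (congr_arg Subtype.val hc)
          rw [Fintype.linearCombination_apply]
          have : ∀ i, c i • e i = ∑ j, t j • s j i • e i := fun i => by
            rw [ht i, Finset.sum_smul]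
            simp only [mul_smul]
          rw [Finset.sum_congr rfl fun i _ => this i, Finset.sum_comm]
          refine Finset.sum_eq_zero fun j _ => ?_
          rw [← Finset.smul_sum, show ∑ i, s j i • e i = 0 from congr_fun he j, smul_zero])
      obtain ⟨H, hH⟩ := hE n _ hK h
      have hHe (i : Fin m) : H (k i) = e i := by
        classical
        rw [hH ⟨k i, hk i⟩]
        have := hh (Pi.single i 1)
        rw [Fintype.linearCombination_apply_single, one_smul] at this
        rw [← this]
        congr 1
        apply Subtype.ext
        simp
      refine CharMod.ext fun f => ?_
      rw [hβ]
      exact hχ _ (AddSubgroup.subset_closure ⟨H, f, by simp only [hHe]⟩))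
    choose χ' hχ' using fun j : Fin p => BalancedTensor.exists_char A
      (β'.comp (LinearMap.single Bᵐᵒᵖ (fun _ => E) j))
    -- The factorization of `β` through s, rewritten on the tensor product: χ is a sum of characters
    -- of the combinations Σ_i s_ji y_i, and those vanish for y = x.
    have key (i : Fin m) (y : BalancedTensor A B E F) :
        χ (Pi.single i y) = ∑ j, χ' j (s j i • y) := by
      induction y using BalancedTensor.induction with
      | h0 => simp
      | ha y y' hy hy' =>
        rw [Pi.single_add, map_add, hy, hy', ← Finset.sum_add_distrib]
        exact Finset.sum_congr rfl fun j _ => by rw [smul_add, map_add]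
      | ht e f =>
        have h1 : χ (Pi.single i (BalancedTensor.tmul A B e f)) = β (Pi.single i e) f := by
          rw [hβ]
          congr 1
          ext i'
          rcases eq_or_ne i' i with rfl | h
          · simp
          · simp only [Pi.single_eq_of_ne h]
            exact (map_zero (BalancedTensor.tmulRight f)).symm
        have h2 : matrixMul B s (Pi.single i e) = ∑ j, Pi.single j (s j i • e) := by
          ext j
          rw [Finset.sum_apply, Finset.sum_eq_single j (fun j' _ h => Pi.single_eq_of_ne h.symm _)
            (fun h => absurd (Finset.mem_univ _) h), Pi.single_eq_same]
          change ∑ i', s j i' • (Pi.single i e : Fin m → E) i' = _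
          rw [Finset.sum_eq_single i (fun i' _ h => by rw [Pi.single_eq_of_ne h, smul_zero])
            (fun h => absurd (Finset.mem_univ _) h), Pi.single_eq_same]
        rw [h1, ← hβ', h2, map_sum, CharMod.sum_apply]
        refine Finset.sum_congr rfl fun j _ => ?_
        rw [BalancedTensor.smul_tmul, hχ']
        rfl
    rw [← Finset.univ_sum_single x, map_sum, Finset.sum_congr rfl fun i _ => key i (x i),
      Finset.sum_comm]
    refine Finset.sum_eq_zero fun j _ => ?_
    rw [← map_sum, show ∑ i, s j i • x i = 0 from ?_, map_zero]
    simp only [x, ← map_smul, ← map_sum]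
    rw [show ∑ i, s j i • (⟨k i, hk i⟩ : Submodule.span A (Set.range k)) = 0 from
      Subtype.ext (by simpa using hs j), map_zero]
  obtain ⟨G, hG⟩ : ∃ G : (Fin n → A) →ₗ[A] BalancedTensor A B E F, ∀ i, G (k i) = x i := by
    refine AddSubgroup.closure_induction (p := fun x _ =>
      ∃ G : (Fin n → A) →ₗ[A] BalancedTensor A B E F, ∀ i, G (k i) = x i) ?_ ?_ ?_ ?_ hx
    · rintro _ ⟨H, f, rfl⟩
      exact ⟨(BalancedTensor.tmulRight f).comp H, fun i => rfl⟩
    · exact ⟨0, fun i => rfl⟩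
    · rintro y y' _ _ ⟨G, hG⟩ ⟨G', hG'⟩
      exact ⟨G + G', fun i => by simp [hG, hG']⟩
    · rintro y _ ⟨G, hG⟩
      exact ⟨-G, fun i => by simp [hG]⟩
  refine ⟨G, fun y => ?_⟩
  obtain ⟨c, hc⟩ := (Submodule.mem_span_range_iff_exists_fun A).1 y.2
  have hy : y = ∑ i, c i • (⟨k i, hk i⟩ : Submodule.span A (Set.range k)) :=
    Subtype.ext (by simpa using hc.symm)
  rw [hy, map_sum, AddSubmonoidClass.coe_finset_sum, map_sum]
  refine Finset.sum_congr rfl fun i _ => ?_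
  rw [map_smul, SetLike.val_smul, map_smul, hG]

/-- Solutions of linear equations in `Hom_A(E, J)`. -/
lemma exists_solution_hom (hE : FPExt Bᵐᵒᵖ E) {J : Type*} [AddCommGroup J] [Module A J]
    (hJ : Module.Baer A J) {n m : ℕ} (i : Fin n → B) (r : Fin n → Fin m → B) (hr : RelGen i r)
    (f : Fin n → E →ₗ[A] J) (hf : ∀ e, ∑ k, f k (op (i k) • e) = 0) :
    ∃ y : Fin m → E →ₗ[A] J, ∀ k e, f k e = ∑ l, y l (op (r k l) • e) := by
  classical
  let v : (Fin n → E) →ₗ[A] (Fin m → E) :=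
    { toFun := fun e l => ∑ k, op (r k l) • e k
      map_add' := fun e e' => by
        ext l
        simp [Finset.sum_add_distrib]
      map_smul' := fun a e => by
        ext l
        simp only [Pi.smul_apply, RingHom.id_apply, Finset.smul_sum]
        exact Finset.sum_congr rfl fun k _ => (smul_comm _ _ _).symm }
  -- The desired y_l are the components of a map g with Σ f_k = g ∘ v, which exists once Σ f_k
  -- vanishes on ker v. A tuple e in ker v respects all relations between the i_k, so by
  -- fp-injectivity of E it has the form e_k = e' i_k for a single e', and then the hypothesis on f
  -- applies.
  obtain ⟨g, hg⟩ := baer_exists_factor hJ v (∑ k, (f k).comp (LinearMap.proj k)) (fun e he => by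
    -- The right ideal generated by the i_k, placed in the free module of rank one in order to match
    -- the form of `FPExt`.
    let w : Fin n → (Fin 1 → Bᵐᵒᵖ) := fun k _ => op (i k)
    have hw (k : Fin n) : w k ∈ Submodule.span Bᵐᵒᵖ (Set.range w) :=
      Submodule.subset_span ⟨k, rfl⟩
    obtain ⟨h, hh⟩ := exists_factor_of_surjective (R := Bᵐᵒᵖ)
      (M := Fin n → Bᵐᵒᵖ) (N := Submodule.span Bᵐᵒᵖ (Set.range w))
      ((Fintype.linearCombination Bᵐᵒᵖ w).codRestrict _ (fun c =>
        Submodule.mem_span_range_iff_exists_fun Bᵐᵒᵖ |>.2 ⟨c, rfl⟩))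
      (fun y => by
        obtain ⟨c, hc⟩ := (Submodule.mem_span_range_iff_exists_fun Bᵐᵒᵖ).1 y.2
        exact ⟨c, Subtype.ext hc⟩)
      (Fintype.linearCombination Bᵐᵒᵖ e) (fun c hc => by
        have h1 := congr_arg unop (congr_fun (congr_arg Subtype.val hc) 0)
        obtain ⟨t, ht⟩ := hr.2 (fun k => (c k).unop) (by
          simpa [w, Fintype.linearCombination_apply] using h1)
        rw [Fintype.linearCombination_apply]
        have : ∀ k, c k • e k = ∑ l, op (t l) • op (r k l) • e k := fun k => by
          rw [← op_unop (c k), ht k, Finset.op_sum, Finset.sum_smul]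
          simp only [op_mul, mul_smul]
        rw [Finset.sum_congr rfl fun k _ => this k, Finset.sum_comm]
        refine Finset.sum_eq_zero fun l _ => ?_
        rw [← Finset.smul_sum, show ∑ k, op (r k l) • e k = 0 from congr_fun he l, smul_zero])
    obtain ⟨H, hH⟩ := hE 1 _ (Submodule.fg_span (Set.finite_range w)) h
    have hHe (k : Fin n) : e k = op (i k) • H (fun _ => 1) := by
      rw [← map_smul]
      have h1 : (op (i k) • fun _ => 1 : Fin 1 → Bᵐᵒᵖ) = w k := by
        ext
        simp [w]
      rw [h1, hH ⟨w k, hw k⟩]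
      have := hh (Pi.single k 1)
      rw [Fintype.linearCombination_apply_single, one_smul] at this
      rw [← this]
      congr 1
      apply Subtype.ext
      simp
    simp only [LinearMap.sum_apply, LinearMap.comp_apply, LinearMap.proj_apply]
    rw [Finset.sum_congr rfl fun k _ => congr_arg (f k) (hHe k)]
    exact hf _)
  refine ⟨fun l => g.comp (LinearMap.single A (fun _ => E) l), fun k e => ?_⟩
  have h1 := hg (Pi.single k e)
  have h2 : (∑ k, (f k).comp (LinearMap.proj k)) (Pi.single k e) = f k e := by
    rw [LinearMap.sum_apply, Finset.sum_eq_single k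
      (fun k' _ h => by simp [Pi.single_eq_of_ne h])
      (fun h => absurd (Finset.mem_univ _) h)]
    simp
  have h3 : v (Pi.single k e) = ∑ l, Pi.single l (op (r k l) • e) := by
    ext l
    rw [Finset.sum_apply, Finset.sum_eq_single l (fun l' _ h => Pi.single_eq_of_ne h.symm _)
      (fun h => absurd (Finset.mem_univ _) h), Pi.single_eq_same]
    change ∑ k', op (r k' l) • (Pi.single k e : Fin n → E) k' = _
    rw [Finset.sum_eq_single k (fun k' _ h => by rw [Pi.single_eq_of_ne h, smul_zero])
      (fun h => absurd (Finset.mem_univ _) h), Pi.single_eq_same]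
  rw [← h2, ← h1, h3, map_sum]
  rfl

/-- The linear map out of a balanced tensor product given by a balanced map. -/
def BalancedTensor.lift {Z J : Type u} [AddCommGroup Z] [Module B Z] [AddCommGroup J] [Module A J]
    (φ : Z →+ (E →ₗ[A] J)) (hφ : ∀ (b : B) (z : Z) (e : E), φ (b • z) e = φ z (op b • e)) :
    BalancedTensor A B E Z →ₗ[A] J :=
  (balancedRel A B E Z).liftQ (TensorProduct.AlgebraTensorModule.lift
    { toFun := fun e =>
        (AddMonoidHom.mk' (fun z => φ z e) (fun z z' => by simp)).toIntLinearMap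
      map_add' := fun e e' => by
        ext z
        exact map_add (φ z) e e'
      map_smul' := fun a e => by
        ext z
        exact map_smul (φ z) a e }) (by
    rw [balancedRel, Submodule.span_le]
    rintro _ ⟨e, b, z, rfl⟩
    rw [SetLike.mem_coe, LinearMap.mem_ker, map_sub, sub_eq_zero]
    exact (hφ b z e).symm)

/-- Extension of balanced maps with values in an injective module along a submodule with
flat quotient. -/
lemma exists_extension_balanced {Z P V J : Type u} [AddCommGroup Z] [Module B Z] [AddCommGroup P]
    [Module B P] [AddCommGroup V] [Module B V] [AddCommGroup J] [Module A J]
    (i : Z →ₗ[B] P) (p : P →ₗ[B] V) (hi : Function.Injective i) (hp : Function.Surjective p)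
    (hip : Function.Exact i p) (hV : Module.Baer Bᵐᵒᵖ (CharMod V)) (hJ : Module.Baer A J)
    (φ : Z →+ (E →ₗ[A] J)) (hφ : ∀ (b : B) (z : Z) (e : E), φ (b • z) e = φ z (op b • e)) :
    ∃ ψ : P →+ (E →ₗ[A] J), (∀ (b : B) (z : P) (e : E), ψ (b • z) e = ψ z (op b • e)) ∧
      ∀ z, ψ (i z) = φ z := by
  obtain ⟨σ, hσ⟩ := exists_section_charMod i p hi hp hip hV
  -- Flatness of the quotient makes E ⊗ Z → E ⊗ P injective, through the section σ of the
  -- restriction of characters; it remains to extend along this map into the injective J.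
  have hinj := BalancedTensor.map_injective_of_forall (A := A) (LinearMap.id : E →ₗ[A] E)
    (fun _ _ => rfl) i (fun β => ⟨σ.comp β, fun e z => hσ (β e) z⟩)
  obtain ⟨Ψ, hΨ⟩ := Module.Baer.extension_property hJ _ hinj (BalancedTensor.lift φ hφ)
  refine ⟨AddMonoidHom.mk' (fun z => Ψ.comp (BalancedTensor.tmulRight z)) (fun z z' => ?_),
    fun b z e => ?_, fun z => ?_⟩
  · ext e
    exact (congr_arg Ψ (BalancedTensor.tmul_add A B e z z')).trans (map_add Ψ _ _)
  · exact congr_arg Ψ (BalancedTensor.op_smul_tmul A B b e z).symm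
  · ext e
    exact LinearMap.congr_fun hΨ (BalancedTensor.tmul A B e z)

end Bimodules

end CoContra

end

noncomputable section

namespace CoContra

/-! ### Hom_A(D, -) on cochains and shifts -/

section HomFunctor

variable {A B : Type u} [Ring A] [Ring B] (D : CochainComplex (BimodCat A B) ℤ)
  {M M' M'' : CochainComplex (ModuleCat.{u} A) ℤ}

/-- Composition with a cochain, as a cochain between the complexes `Hom_A(D, -)`. -/
def homCochain {m : ℤ} (h : Cochain M M' m) :
    Cochain ((homFunctor D).obj M) ((homFunctor D).obj M') m :=
  Cochain.mk (fun i j hij => ModuleCat.ofHom (homPostcomp D h i j hij))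

lemma homCochain_add {m : ℤ} (h h' : Cochain M M' m) :
    homCochain D (h + h') = homCochain D h + homCochain D h' := by
  ext i j hij z : 3
  exact Cochain.comp_add (show Cochain (leftComplex D) M i from z) h h' hij

lemma homCochain_zero {m : ℤ} : homCochain D (0 : Cochain M M' m) = 0 := by
  ext i j hij z : 3
  exact Cochain.comp_zero (show Cochain (leftComplex D) M i from z) hij

lemma homCochain_neg {m : ℤ} (h : Cochain M M' m) : homCochain D (-h) = -homCochain D h := by
  rw [← add_eq_zero_iff_eq_neg, ← homCochain_add, neg_add_cancel, homCochain_zero]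

lemma homCochain_comp {m m' n : ℤ} (h : Cochain M M' m) (h' : Cochain M' M'' m') (hn : m + m' = n) :
    homCochain D (h.comp h' hn) = (homCochain D h).comp (homCochain D h') hn := by
  ext i j hij z : 3
  rw [Cochain.comp_v _ _ hn i (i + m) j rfl (by lia)]
  exact (Cochain.comp_assoc (show Cochain (leftComplex D) M i from z) h h' rfl hn (by lia)).symm

lemma homCochain_ofHom (f : M ⟶ M') :
    homCochain D (Cochain.ofHom f) = Cochain.ofHom ((homFunctor D).map f) := by
  ext i : 1
  rfl

/-- Postcomposition acts on the right, so the Leibniz rule puts the sign (-1)^m on δ(z)·h, which is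
the one cancelled by the differential of the cochain z ↦ z·h. Thus Hom_A(D, -) commutes with all
differentials, from which preservation of cones follows formally. -/
lemma δ_homCochain {m n : ℤ} (h : Cochain M M' m) (hmn : m + 1 = n) :
    δ m n (homCochain D h) = homCochain D (δ m n h) := by
  ext i j hij z : 3
  rw [δ_v m n hmn _ i j hij (j - 1) (i + 1) rfl rfl]
  have key (z : Cochain (leftComplex D) M i) :
      δ (j - 1) j (z.comp h (show i + m = j - 1 by lia)) +
        n.negOnePow • (δ i (i + 1) z).comp h (show i + 1 + m = j by lia) =
      z.comp (δ m n h) hij := by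
    rw [δ_comp z h (show i + m = j - 1 by lia) (i + 1) n j (by lia) (by lia) (by lia),
      show n.negOnePow = -m.negOnePow by rw [← hmn, Int.negOnePow_succ]]
    simp
  exact key z

lemma rightMul_comp_rightUnshift (a : ℤ) {i j : ℤ} (z : Cochain (leftComplex D) (M⟦a⟧) i) (b : B)
    (hij : i + a = j) :
    ((b • z : Cochain (leftComplex D) (M⟦a⟧) i)).rightUnshift j hij = b • z.rightUnshift j hij := by
  ext p q hpq : 1
  rw [hom_smul_def, hom_smul_def, Cochain.rightUnshift_v _ _ _ p q hpq (p + i) rfl]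
  simp only [Cochain.zero_cochain_comp_v, Cochain.rightUnshift_v _ _ _ p q hpq (p + i) rfl,
    Category.assoc]

/-- The compatibility of `Hom_A(D, -)` with the shifts. -/
def homShiftIso (a : ℤ) (M : CochainComplex (ModuleCat.{u} A) ℤ) :
    (homFunctor D).obj (M⟦a⟧) ≅ ((homFunctor D).obj M)⟦a⟧ :=
  HomologicalComplex.Hom.isoOfComponents (fun i => LinearEquiv.toModuleIso
    (X₁ := Cochain (leftComplex D) (M⟦a⟧) i) (X₂ := Cochain (leftComplex D) M (i + a))
    { (Cochain.rightShiftAddEquiv (leftComplex D) M (i + a) a i rfl).symm with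
      map_smul' := fun b z => rightMul_comp_rightUnshift D a z b rfl }) (fun i j hij => by
    ext z : 2
    have key (z : Cochain (leftComplex D) (M⟦a⟧) i) :
        a.negOnePow • δ (i + a) (j + a) (z.rightUnshift (i + a) rfl) =
          (δ i j z).rightUnshift (j + a) rfl := by
      rw [Cochain.δ_rightUnshift z (i + a) rfl (j + a) j rfl, smul_smul, Int.units_mul_self,
        one_smul]
    exact key z)

lemma homFunctor_XIsoOfEq_hom_v {i j : ℤ} (h : i = j) (z : Cochain (leftComplex D) M i) (p q : ℤ)
    (hpq : p + j = q) :
    (show Cochain (leftComplex D) M j from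
      (((homFunctor D).obj M).XIsoOfEq h).hom.hom z).v p q hpq = z.v p q (by lia) := by
  subst h
  rfl

instance homFunctorCommShift : (homFunctor D).CommShift ℤ where
  commShiftIso a := NatIso.ofComponents (homShiftIso D a) (fun {M M'} f => by
    ext i z : 3
    have key (z : Cochain (leftComplex D) (M⟦a⟧) i) :
        (z.comp (Cochain.ofHom (f⟦a⟧')) (add_zero i)).rightUnshift (i + a) rfl =
          (z.rightUnshift (i + a) rfl).comp (Cochain.ofHom f) (add_zero _) := by
      ext p q hpq : 1
      rw [Cochain.rightUnshift_v _ _ _ p q hpq (p + i) rfl, Cochain.comp_zero_cochain_v,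
        Cochain.comp_zero_cochain_v, Cochain.rightUnshift_v _ _ _ p q hpq (p + i) rfl]
      obtain rfl : q = p + i + a := by lia
      simp only [shiftFunctorObjXIso, HomologicalComplex.XIsoOfEq_rfl, Iso.refl_hom,
        Category.assoc, Category.id_comp, Cochain.ofHom_v]
      exact Category.comp_id _
    exact key z)
  commShiftIso_zero := by
    ext M i z : 7
    rw [Functor.CommShift.isoZero_hom_app]
    have key (z : Cochain (leftComplex D) (M⟦(0 : ℤ)⟧) i) :
        z.rightUnshift (i + 0) rfl = (((homFunctor D).obj M).XIsoOfEq (add_zero i).symm).hom.hom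
          (z.comp (Cochain.ofHom ((shiftFunctorZero _ ℤ).hom.app M)) (add_zero i)) := by
      ext p q hpq : 1
      rw [homFunctor_XIsoOfEq_hom_v, Cochain.rightUnshift_v _ _ _ p q hpq (p + i) rfl,
        Cochain.comp_zero_cochain_v]
      obtain rfl : q = p + i := by lia
      simp [CochainComplex.shiftFunctorZero_hom_app_f]
    refine (key z).trans ?_
    rw [HomologicalComplex.comp_f, CochainComplex.shiftFunctorZero_inv_app_f]
    rfl
  commShiftIso_add a b := by
    ext M i z : 7
    rw [Functor.CommShift.isoAdd_hom_app]
    have key (z : Cochain (leftComplex D) (M⟦a + b⟧) i) :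
        z.rightUnshift (i + (a + b)) rfl =
          (((homFunctor D).obj M).XIsoOfEq (show i + b + a = i + (a + b) by lia)).hom.hom
          (((z.comp (Cochain.ofHom ((shiftFunctorAdd _ a b).hom.app M))
            (add_zero i)).rightUnshift (i + b) rfl).rightUnshift (i + b + a) rfl) := by
      ext p q hpq : 1
      rw [homFunctor_XIsoOfEq_hom_v, Cochain.rightUnshift_v _ _ _ p q hpq (p + i) rfl,
        Cochain.rightUnshift_v _ _ _ p q _ (p + i + b) (by lia),
        Cochain.rightUnshift_v _ _ _ p (p + i + b) _ (p + i) (by lia),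
        Cochain.comp_zero_cochain_v]
      obtain rfl : q = p + i + b + a := by lia
      simp [CochainComplex.shiftFunctorAdd_hom_app_f]
    refine (key z).trans ?_
    simp only [HomologicalComplex.comp_f, CochainComplex.shiftFunctorAdd_inv_app_f]
    rfl

end HomFunctor

end CoContra

end

noncomputable section

namespace CoContra

/-! ### Mapping cones under Hom_A(D, -) -/

section HomFunctor

variable {A B : Type u} [Ring A] [Ring B] (D : CochainComplex (BimodCat A B) ℤ)
  {M M' : CochainComplex (ModuleCat.{u} A) ℤ}

instance : (homFunctor D).Additive where
  map_add {M M' f g} := by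
    ext i z : 3
    exact (congr_arg (fun y => (show Cochain (leftComplex D) M i from z).comp y (add_zero i))
      (Cochain.ofHom_add f g)).trans (Cochain.comp_add _ _ _ _)

lemma homCochain_v_comp_v {M'' : CochainComplex (ModuleCat.{u} A) ℤ} {m m' n : ℤ}
    (h : Cochain M M' m) (h' : Cochain M' M'' m')
    (hn : m + m' = n) (i j k : ℤ) (hij : i + m = j) (hjk : j + m' = k) :
    (homCochain D h).v i j hij ≫ (homCochain D h').v j k hjk =
      (homCochain D (h.comp h' hn)).v i k (by lia) := by
  rw [homCochain_comp, Cochain.comp_v _ _ hn i j k hij hjk]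

/-- The functor `Hom_A(D, -)` preserves mapping cones. -/
def homMappingConeIso (f : M ⟶ M') :
    (homFunctor D).obj (mappingCone f) ≅ mappingCone ((homFunctor D).map f) where
  hom := mappingCone.lift _ (Cocycle.mk (homCochain D (mappingCone.fst f).1) 2 (by lia) (by
      rw [δ_homCochain D _ (by lia), Cocycle.δ_eq_zero, homCochain_zero]))
    (homCochain D (mappingCone.snd f)) (by
      rw [δ_homCochain D _ (by lia), mappingCone.δ_snd, homCochain_neg, homCochain_comp,
        homCochain_ofHom]
      exact neg_add_cancel _)
  inv := mappingCone.desc _ (homCochain D (mappingCone.inl f))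
    ((homFunctor D).map (mappingCone.inr f)) (by
      rw [δ_homCochain D _ (by lia), mappingCone.δ_inl, homCochain_ofHom, Functor.map_comp])
  hom_inv_id := by
    rw [← cancel_mono (𝟙 _)]
    ext1 i
    rw [Category.comp_id, Category.id_comp, HomologicalComplex.comp_f,
      mappingCone.lift_desc_f _ _ _ _ _ _ _ _ (i + 1) rfl]
    have := Cochain.congr_v (congr_arg (homCochain D) (mappingCone.id f)) i i (add_zero i)
    rw [homCochain_add, homCochain_comp, homCochain_comp, homCochain_ofHom, homCochain_ofHom] at this
    rw [Cochain.add_v, Cochain.comp_v _ _ _ i (i + 1) i rfl (by lia),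
      Cochain.comp_zero_cochain_v, Cochain.ofHom_v, Cochain.ofHom_v,
      (homFunctor D).map_id] at this
    exact this
  inv_hom_id := by
    have h₁ (i : ℤ) : ((homFunctor D).map (mappingCone.inr f)).f i =
      (homCochain D (Cochain.ofHom (mappingCone.inr f))).v i i (add_zero i) := rfl
    have h₂ : homCochain D (Cochain.ofHom (𝟙 M)) = Cochain.ofHom (𝟙 _) := by
      rw [homCochain_ofHom, (homFunctor D).map_id]
    have h₃ : homCochain D (Cochain.ofHom (𝟙 M')) = Cochain.ofHom (𝟙 _) := by
      rw [homCochain_ofHom, (homFunctor D).map_id]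
    ext1 i
    refine mappingCone.ext_from _ (i + 1) i rfl ?_ ?_
    · rw [HomologicalComplex.comp_f, mappingCone.inl_v_desc_f_assoc, HomologicalComplex.id_f,
        Category.comp_id]
      refine mappingCone.ext_to _ i (i + 1) rfl ?_ ?_
      · rw [Category.assoc, mappingCone.lift_f_fst_v, mappingCone.inl_v_fst_v]
        refine (homCochain_v_comp_v D (mappingCone.inl f) (mappingCone.fst f).1 (neg_add_cancel 1)
          (i + 1) i (i + 1) (by lia) rfl).trans ?_
        rw [mappingCone.inl_fst, h₂]
        rfl
      · rw [Category.assoc, mappingCone.lift_f_snd_v, mappingCone.inl_v_snd_v,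
          homCochain_v_comp_v D (mappingCone.inl f) (mappingCone.snd f) (add_zero (-1))
          (i + 1) i i (by lia) (by lia), mappingCone.inl_snd, homCochain_zero]
        rfl
    · rw [HomologicalComplex.comp_f, mappingCone.inr_f_desc_f_assoc, HomologicalComplex.id_f,
        Category.comp_id]
      refine mappingCone.ext_to _ i (i + 1) rfl ?_ ?_
      · rw [Category.assoc, mappingCone.lift_f_fst_v, mappingCone.inr_f_fst_v, h₁]
        refine (homCochain_v_comp_v D (Cochain.ofHom (mappingCone.inr f)) (mappingCone.fst f).1
          (zero_add 1) i i (i + 1) (by lia) rfl).trans ?_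
        rw [mappingCone.inr_fst, homCochain_zero]
        rfl
      · rw [Category.assoc, mappingCone.lift_f_snd_v, mappingCone.inr_f_snd_v, h₁,
          homCochain_v_comp_v D (Cochain.ofHom (mappingCone.inr f)) (mappingCone.snd f)
          (zero_add 0) i i i (by lia) (by lia), mappingCone.inr_snd, h₃]
        rfl

lemma map_inr_homMappingConeIso_hom (f : M ⟶ M') :
    (homFunctor D).map (mappingCone.inr f) ≫ (homMappingConeIso D f).hom = mappingCone.inr _ := by
  rw [← Iso.eq_comp_inv]
  dsimp only [homMappingConeIso]
  rw [mappingCone.inr_desc]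

/-- The connecting morphism of a mapping cone. -/
def coneConnecting {R : Type u} [Ring R] {K L : CochainComplex (ModuleCat.{u} R) ℤ} (f : K ⟶ L) :
    mappingCone f ⟶ K⟦(1 : ℤ)⟧ := (mappingCone.triangle f).mor₃

lemma inl_v_coneConnecting_f {R : Type u} [Ring R] {K L : CochainComplex (ModuleCat.{u} R) ℤ}
    (f : K ⟶ L) (p q : ℤ) (hpq : p + (-1) = q) :
    (mappingCone.inl f).v p q hpq ≫ (coneConnecting f).f q =
      -(K.shiftFunctorObjXIso 1 q p (by rw [← hpq, neg_add_cancel_right])).inv :=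
  mappingCone.inl_v_triangle_mor₃_f f p q hpq

lemma inr_f_coneConnecting_f {R : Type u} [Ring R] {K L : CochainComplex (ModuleCat.{u} R) ℤ}
    (f : K ⟶ L) (p : ℤ) : (mappingCone.inr f).f p ≫ (coneConnecting f).f p = 0 :=
  mappingCone.inr_f_triangle_mor₃_f f p

lemma inr_coneConnecting {R : Type u} [Ring R] {K L : CochainComplex (ModuleCat.{u} R) ℤ}
    (f : K ⟶ L) : mappingCone.inr f ≫ coneConnecting f = 0 :=
  mappingCone.inr_triangleδ f

lemma homMappingConeIso_hom_connecting (f : M ⟶ M') :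
    (homFunctor D).map (coneConnecting f) ≫ (homShiftIso D 1 M).hom =
      (homMappingConeIso D f).hom ≫ coneConnecting ((homFunctor D).map f) := by
  refine (Iso.inv_comp_eq _).1 ?_
  ext1 i
  refine mappingCone.ext_from _ (i + 1) i rfl ?_ ?_
  · rw [HomologicalComplex.comp_f, inl_v_coneConnecting_f]
    dsimp only [homMappingConeIso]
    rw [mappingCone.inl_v_desc_f_assoc]
    ext z : 2
    have key (z : Cochain (leftComplex D) M (i + 1)) :
        ((z.comp (mappingCone.inl f) (by lia : _ = i)).comp
          (Cochain.ofHom (coneConnecting f)) (add_zero i)).rightUnshift (i + 1) rfl = -z := by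
      ext p q hpq : 1
      rw [Cochain.rightUnshift_v _ _ _ p q hpq (p + i) rfl, Cochain.comp_zero_cochain_v,
        Cochain.comp_v _ _ _ p q (p + i) hpq (by lia), Cochain.ofHom_v, Category.assoc,
        Category.assoc, ← Category.assoc ((mappingCone.inl f).v _ _ _), inl_v_coneConnecting_f,
        Preadditive.neg_comp, Iso.inv_hom_id, Preadditive.comp_neg, Category.comp_id, Cochain.neg_v]
    refine (key z).trans ?_
    rfl
  · rw [HomologicalComplex.comp_f, inr_f_coneConnecting_f]
    dsimp only [homMappingConeIso]
    rw [mappingCone.inr_f_desc_f_assoc]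
    rw [HomologicalComplex.comp_f, ← HomologicalComplex.comp_f_assoc, ← Functor.map_comp,
      inr_coneConnecting, Functor.map_zero, HomologicalComplex.zero_f, zero_comp]

/-- The functor `Hom_A(D, -)` preserves the triangles given by mapping cones. -/
def homTriangleIso (f : M ⟶ M') :
    (homFunctor D).mapTriangle.obj (mappingCone.triangle f) ≅
      mappingCone.triangle ((homFunctor D).map f) :=
  Triangle.isoMk _ _ (Iso.refl _) (Iso.refl _) (homMappingConeIso D f)
    ((Category.comp_id _).trans (Category.id_comp _).symm)
    ((map_inr_homMappingConeIso_hom D f).trans (Category.id_comp _).symm)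
    ((congr_arg (((homFunctor D).mapTriangle.obj (mappingCone.triangle f)).mor₃ ≫ ·)
      ((CategoryTheory.shiftFunctor _ (1 : ℤ)).map_id _)).trans
        ((Category.comp_id _).trans (homMappingConeIso_hom_connecting D f)))

instance homHotCommShift : (homHot D).CommShift ℤ :=
  Quotient.liftCommShift _ _ _ _

/-- The functor `Hom_A(D, -)` on homotopy categories is induced by the functor on complexes. -/
def homHotFactors : toHot A ⋙ homHot D ≅ homFunctor D ⋙ toHot B := Iso.refl _

instance : NatTrans.CommShift (homHotFactors D).hom ℤ :=
  Quotient.liftCommShift_compatibility _ _ _ _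

/-- The functor `Hom_A(D, -)` preserves the triangles given by mapping cones. -/
def homTrianglehIso (f : M ⟶ M') :
    (homHot D).mapTriangle.obj (mappingCone.triangleh f) ≅
      mappingCone.triangleh ((homFunctor D).map f) :=
  (Functor.mapTriangleCompIso _ _).symm.app _ ≪≫
    (Functor.mapTriangleIso (homHotFactors D)).app _ ≪≫
    (Functor.mapTriangleCompIso _ _).app _ ≪≫
    (toHot B).mapTriangle.mapIso (homTriangleIso D f)

instance : (homHot D).IsTriangulated where
  map_distinguished := by
    rintro T ⟨K, L, f, ⟨e⟩⟩
    exact ⟨_, _, _, ⟨(homHot D).mapTriangle.mapIso e ≪≫ homTrianglehIso D f⟩⟩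

end HomFunctor
end CoContra
end

open MulOpposite

noncomputable section

namespace CoContra

/-! ### The adjunction between D ⊗_B - and Hom_A(D, -) -/

section Adjunction

variable {A B : Type u} [Ring A] [Ring B] (D : CochainComplex (BimodCat A B) ℤ)
  {X X' : CochainComplex (ModuleCat.{u} B) ℤ} {M M' : CochainComplex (ModuleCat.{u} A) ℤ}

variable (X) in
/-- The inclusion of `D^p ⊗_B X^q` into the total complex. -/
def tensorι (p q n : ℤ) (h : p + q = n) :
    ModuleCat.of A (BalancedTensor A B (D.X p) (X.X q)) ⟶ ((tensorFunctor D).obj X).X n :=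
  HomologicalComplex.ιMapBifunctor D X (tensorBifunctor A B) (ComplexShape.up ℤ) p q n h

/-- Morphisms from the terms of the total complex are determined by their components. -/
lemma tensor_hom_ext {n : ℤ} {Y : ModuleCat.{u} A} {f g : ((tensorFunctor D).obj X).X n ⟶ Y}
    (h : ∀ (p q : ℤ) (hpq : p + q = n) (e : D.X p) (x : X.X q),
      f.hom ((tensorι D X p q n hpq).hom (BalancedTensor.tmul A B e x)) =
        g.hom ((tensorι D X p q n hpq).hom (BalancedTensor.tmul A B e x))) : f = g := by
  refine HomologicalComplex.mapBifunctor.hom_ext (fun p q hpq => ?_)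
  exact ModuleCat.hom_ext (BalancedTensor.hom_ext fun e x => h p q hpq e x)

lemma tensorι_d (p q n n' : ℤ) (h : p + q = n) (h' : n + 1 = n') (e : D.X p) (x : X.X q) :
    (((tensorFunctor D).obj X).d n n').hom ((tensorι D X p q n h).hom (BalancedTensor.tmul A B e x)) =
      (tensorι D X (p + 1) q n' (by lia)).hom (BalancedTensor.tmul A B ((D.d p (p + 1)).hom e) x) +
      p.negOnePow • (tensorι D X p (q + 1) n' (by lia)).hom
        (BalancedTensor.tmul A B e ((X.d q (q + 1)).hom x)) := by
  have key : tensorι D X p q n h ≫ ((tensorFunctor D).obj X).d n n' =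
      ((tensorBifunctor A B).map (D.d p (p + 1))).app (X.X q) ≫
        tensorι D X (p + 1) q n' (by lia) +
      p.negOnePow • ((tensorBifunctor A B).obj (D.X p)).map (X.d q (q + 1)) ≫
        tensorι D X p (q + 1) n' (by lia) := by
    refine (congr_arg (tensorι D X p q n h ≫ ·) (HomologicalComplex.mapBifunctor.d_eq D X
      (tensorBifunctor A B) (ComplexShape.up ℤ) n n')).trans ?_
    refine (Preadditive.comp_add _ _ _ _ _ _).trans ?_
    congr 1
    · refine (HomologicalComplex.mapBifunctor.ι_D₁ D X (tensorBifunctor A B) (ComplexShape.up ℤ)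
        n n' p q h).trans ?_
      refine (HomologicalComplex.mapBifunctor.d₁_eq D X (tensorBifunctor A B) (ComplexShape.up ℤ)
        (show (ComplexShape.up ℤ).Rel p (p + 1) from rfl) q n' (by dsimp; lia)).trans ?_
      exact one_smul _ _
    · refine (HomologicalComplex.mapBifunctor.ι_D₂ D X (tensorBifunctor A B) (ComplexShape.up ℤ)
        n n' p q h).trans ?_
      exact HomologicalComplex.mapBifunctor.d₂_eq D X (tensorBifunctor A B) (ComplexShape.up ℤ)
        p (show (ComplexShape.up ℤ).Rel q (q + 1) from rfl) n' (by dsimp; lia)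
  exact congr_arg (fun f => f.hom (BalancedTensor.tmul A B e x)) key

lemma tensorFunctor_map_tensorι (f : X ⟶ X') (p q n : ℤ) (h : p + q = n) (e : D.X p) (x : X.X q) :
    (((tensorFunctor D).map f).f n).hom ((tensorι D X p q n h).hom (BalancedTensor.tmul A B e x)) =
      (tensorι D X' p q n h).hom (BalancedTensor.tmul A B e ((f.f q).hom x)) := by
  have := HomologicalComplex.ι_mapBifunctorMap (𝟙 D) f (tensorBifunctor A B) (ComplexShape.up ℤ)
    p q n h
  exact congr_arg (fun f => f.hom (BalancedTensor.tmul A B e x)) this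

variable {D} in
/-- The components of a cochain from `D` to `M`. -/
def cochainApply {q : ℤ} (z : Cochain (leftComplex D) M q) (p n : ℤ) (h : p + q = n) :
    D.X p →ₗ[A] M.X n := (z.v p n h).hom

variable {D} in
lemma cochain_ext {q : ℤ} {z z' : Cochain (leftComplex D) M q}
    (h : ∀ (p n : ℤ) (hpn : p + q = n) (e : D.X p),
      cochainApply z p n hpn e = cochainApply z' p n hpn e) : z = z' := by
  ext p n hpn : 1
  exact ModuleCat.hom_ext (LinearMap.ext (h p n hpn))

variable {D} in
/-- The cochain from `D` to `M` with given components. -/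
def cochainMk {q : ℤ} (g : ∀ (p n : ℤ), p + q = n → (D.X p →ₗ[A] M.X n)) :
    Cochain (leftComplex D) M q :=
  Cochain.mk (fun p n h => ModuleCat.ofHom (X := D.X p) (g p n h))

@[simp]
lemma cochainApply_mk {q : ℤ} (g : ∀ (p n : ℤ), p + q = n → (D.X p →ₗ[A] M.X n)) (p n : ℤ)
    (h : p + q = n) : cochainApply (cochainMk g) p n h = g p n h := rfl

@[simp]
lemma cochainApply_add {q : ℤ} (z z' : Cochain (leftComplex D) M q) (p n : ℤ) (h : p + q = n)
    (e : D.X p) :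
    cochainApply (z + z') p n h e = cochainApply z p n h e + cochainApply z' p n h e := rfl

@[simp]
lemma cochainApply_smul {q : ℤ} (b : B) (z : Cochain (leftComplex D) M q) (p n : ℤ)
    (h : p + q = n) (e : D.X p) :
    cochainApply (b • z) p n h e = cochainApply z p n h (op b • e) := by
  rw [hom_smul_def]
  exact congr_arg (fun f => f.hom e) (Cochain.zero_cochain_comp_v (Cochain.ofHom (rightMul D b)) z p n h)

lemma cochainApply_comp_ofHom {q : ℤ} (z : Cochain (leftComplex D) M q) (f : M ⟶ M') (p n : ℤ)
    (h : p + q = n) (e : D.X p) :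
    cochainApply (z.comp (Cochain.ofHom f) (add_zero q)) p n h e =
      (f.f n).hom (cochainApply z p n h e) :=
  congr_arg (fun f => f.hom e) (Cochain.comp_zero_cochain_v z (Cochain.ofHom f) p n h)

lemma cochainApply_δ {q : ℤ} (z : Cochain (leftComplex D) M q) (p n n' : ℤ)
    (h : p + q = n) (h' : n + 1 = n') (e : D.X p) :
    cochainApply (δ q (q + 1) z) p n' (by lia) e =
      (M.d n n').hom (cochainApply z p n h e) + (q + 1).negOnePow •
        cochainApply z (p + 1) n' (by lia) ((D.d p (p + 1)).hom e) :=
  congr_arg (fun f => f.hom e) (δ_v q (q + 1) rfl z p n' (by lia) n (p + 1) (by lia) rfl)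

variable (X) in
/-- The element `e ⊗ x` of the total complex. -/
def tensorElt {p q : ℤ} (n : ℤ) (h : p + q = n) (x : X.X q) :
    D.X p →ₗ[A] ((tensorFunctor D).obj X).X n :=
  (tensorι D X p q n h).hom.comp (BalancedTensor.tmulRight x)

lemma tensorElt_add {p q n : ℤ} (h : p + q = n) (x y : X.X q) (e : D.X p) :
    tensorElt D X n h (x + y) e = tensorElt D X n h x e + tensorElt D X n h y e :=
  (congr_arg (tensorι D X p q n h).hom (BalancedTensor.tmul_add A B e x y)).trans (map_add _ _ _)

lemma tensorElt_smul {p q n : ℤ} (h : p + q = n) (b : B) (x : X.X q) (e : D.X p) :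
    tensorElt D X n h (b • x) e = tensorElt D X n h x (op b • e) :=
  congr_arg (tensorι D X p q n h).hom (BalancedTensor.op_smul_tmul A B b e x).symm

lemma tensorElt_d {p q n n' : ℤ} (h : p + q = n) (h' : n + 1 = n') (e : D.X p) (x : X.X q) :
    (((tensorFunctor D).obj X).d n n').hom (tensorElt D X n h x e) =
      tensorElt D X n' (by lia) x ((D.d p (p + 1)).hom e) +
      p.negOnePow • tensorElt D X n' (by lia) ((X.d q (q + 1)).hom x) e :=
  tensorι_d D p q n n' h h' e x

lemma tensorElt_map (f : X ⟶ X') {p q n : ℤ} (h : p + q = n) (e : D.X p) (x : X.X q) :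
    (((tensorFunctor D).map f).f n).hom (tensorElt D X n h x e) =
      tensorElt D X' n h ((f.f q).hom x) e :=
  tensorFunctor_map_tensorι D f p q n h e x

lemma smul_map_negOnePow {R : Type u} [Ring R] {N N' : Type*} [AddCommGroup N] [Module R N]
    [AddCommGroup N'] [Module R N'] (f : N →ₗ[R] N') (n : ℤ) (x : N) :
    f (n.negOnePow • x) = n.negOnePow • f x := by
  rw [Units.smul_def, Units.smul_def, map_zsmul]

/-- The map `Hom(D ⊗_B X, M) → Hom(X, Hom_A(D, M))`. -/
def tensorHomCurry (φ : (tensorFunctor D).obj X ⟶ M) : X ⟶ (homFunctor D).obj M where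
  f q := ModuleCat.ofHom (X := X.X q) (Y := Cochain (leftComplex D) M q)
    -- The Koszul sign (-1)^{pq} for exchanging e in D^p and x in X^q reconciles the sign (-1)^p in
    -- the total complex with the sign in the differential of the Hom complex.
    { toFun := fun x => cochainMk (fun p n h =>
        (p * q).negOnePow • (φ.f n).hom.comp (tensorElt D X n h x))
      map_add' := fun x y => cochain_ext fun p n h e => by
        simp only [cochainApply_mk, cochainApply_add, LinearMap.smul_apply, LinearMap.comp_apply,
          tensorElt_add, map_add, smul_add]
      map_smul' := fun b x => cochain_ext fun p n h e => by
        simp only [RingHom.id_apply, cochainApply_mk, cochainApply_smul, LinearMap.smul_apply,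
          LinearMap.comp_apply, tensorElt_smul] }
  comm' q q' hq := by
    obtain rfl : q + 1 = q' := hq
    ext x : 2
    refine cochain_ext fun p n h e => ?_
    obtain ⟨m, rfl⟩ : ∃ m, n = m + 1 := ⟨n - 1, by lia⟩
    have h0 : p + q = m := by lia
    have h1 : (M.d m (m + 1)).hom ((φ.f m).hom (tensorElt D X m h0 x e)) =
      (φ.f (m + 1)).hom ((((tensorFunctor D).obj X).d m (m + 1)).hom (tensorElt D X m h0 x e)) :=
      congr_arg (fun f => f.hom (tensorElt D X m h0 x e)) (φ.comm m (m + 1))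
    rw [tensorElt_d D h0 rfl, map_add, smul_map_negOnePow] at h1
    refine (cochainApply_δ D _ p m (m + 1) h0 rfl e).trans ?_
    change (M.d m (m + 1)).hom ((p * q).negOnePow • (φ.f m).hom (tensorElt D X m h0 x e)) +
      (q + 1).negOnePow • ((p + 1) * q).negOnePow • (φ.f (m + 1)).hom
        (tensorElt D X (m + 1) _ x ((D.d p (p + 1)).hom e)) =
      (p * (q + 1)).negOnePow • (φ.f (m + 1)).hom
        (tensorElt D X (m + 1) h ((X.d q (q + 1)).hom x) e)
    rw [smul_map_negOnePow, h1, smul_add, smul_smul, smul_smul, ← Int.negOnePow_add,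
      ← Int.negOnePow_add, show p * q + p = p * (q + 1) by ring,
      show q + 1 + (p + 1) * q = p * q + 1 + (q + q) by ring,
      Int.negOnePow_add (p * q + 1), Int.negOnePow_even (q + q) ⟨q, rfl⟩, mul_one,
      Int.negOnePow_succ, Units.neg_smul]
    abel

lemma tensorHomCurry_apply (φ : (tensorFunctor D).obj X ⟶ M) (q : ℤ) (x : X.X q) (p n : ℤ)
    (h : p + q = n) (e : D.X p) :
    cochainApply (((tensorHomCurry D φ).f q).hom x) p n h e =
      (p * q).negOnePow • (φ.f n).hom (tensorElt D X n h x e) := rfl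

/-- The map `Hom(X, Hom_A(D, M)) → Hom(D ⊗_B X, M)`, on terms. -/
def tensorHomUncurryX (ψ : X ⟶ (homFunctor D).obj M) (n : ℤ) :
    ((tensorFunctor D).obj X).X n ⟶ M.X n :=
  HomologicalComplex.mapBifunctorDesc (fun p q h => (p * q).negOnePow •
    ModuleCat.ofHom (X := BalancedTensor A B (D.X p) (X.X q)) (BalancedTensor.lift
      (AddMonoidHom.mk' (fun x => cochainApply (((ψ.f q).hom x)) p n h) (fun x y => by
        rw [map_add]
        rfl)) (fun b x e => by
        change cochainApply (((ψ.f q).hom (b • x))) p n h e = _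
        rw [map_smul]
        exact cochainApply_smul D b _ p n h e)))

lemma tensorHomUncurryX_apply (ψ : X ⟶ (homFunctor D).obj M) {p q n : ℤ} (h : p + q = n)
    (x : X.X q) (e : D.X p) : (tensorHomUncurryX D ψ n).hom (tensorElt D X n h x e) =
      (p * q).negOnePow • cochainApply ((ψ.f q).hom x) p n h e :=
  congr_arg (fun f : ModuleCat.of A (BalancedTensor A B (D.X p) (X.X q)) ⟶ M.X n =>
      f.hom (BalancedTensor.tmul A B e x))
    (HomologicalComplex.ι_mapBifunctorDesc (K₁ := D) (K₂ := X) (F := tensorBifunctor A B)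
      (c := ComplexShape.up ℤ) _ p q h)

/-- The map `Hom(X, Hom_A(D, M)) → Hom(D ⊗_B X, M)`. -/
def tensorHomUncurry (ψ : X ⟶ (homFunctor D).obj M) : (tensorFunctor D).obj X ⟶ M where
  f := tensorHomUncurryX D ψ
  comm' n n' hn := by
    obtain rfl : n + 1 = n' := hn
    refine tensor_hom_ext D fun p q h e x => ?_
    change (M.d n (n + 1)).hom ((tensorHomUncurryX D ψ n).hom (tensorElt D X n h x e)) =
      (tensorHomUncurryX D ψ (n + 1)).hom
        ((((tensorFunctor D).obj X).d n (n + 1)).hom (tensorElt D X n h x e))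
    have h1 : ((ψ.f (q + 1)).hom ((X.d q (q + 1)).hom x) : Cochain (leftComplex D) M (q + 1)) =
      δ q (q + 1) ((ψ.f q).hom x) := (congr_arg (fun f => f.hom x) (ψ.comm q (q + 1))).symm
    have h2 := cochainApply_δ D ((ψ.f q).hom x) p n (n + 1) h rfl e
    rw [← h1] at h2
    have s₁ : (p + p * (q + 1)).negOnePow = (p * q).negOnePow := by
      rw [show p + p * (q + 1) = p * q + (p + p) by ring, Int.negOnePow_add,
        Int.negOnePow_even (p + p) ⟨p, rfl⟩, mul_one]
    have s₂ : (p + p * (q + 1) + (q + 1)).negOnePow = -((p + 1) * q).negOnePow := by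
      rw [show p + p * (q + 1) + (q + 1) = (p + 1) * q + 1 + (p + p) by ring, Int.negOnePow_add,
        Int.negOnePow_even (p + p) ⟨p, rfl⟩, mul_one, Int.negOnePow_succ]
    rw [tensorElt_d D h rfl, map_add, smul_map_negOnePow, tensorHomUncurryX_apply,
      tensorHomUncurryX_apply, tensorHomUncurryX_apply, smul_map_negOnePow, h2, smul_smul, smul_add,
      smul_smul, ← Int.negOnePow_add, ← Int.negOnePow_add, s₁, s₂, Units.neg_smul]
    abel

/-- The adjunction between `D ⊗_B -` and `Hom_A(D, -)` on complexes. -/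
def tensorHomAdjunction : tensorFunctor D ⊣ homFunctor D :=
  Adjunction.mkOfHomEquiv
    { homEquiv := fun X M =>
        { toFun := tensorHomCurry D
          invFun := tensorHomUncurry D
          left_inv := fun φ => by
            ext1 n
            refine tensor_hom_ext D fun p q h e x => ?_
            refine (tensorHomUncurryX_apply D (tensorHomCurry D φ) h x e).trans ?_
            rw [tensorHomCurry_apply, smul_smul, Int.units_mul_self, one_smul]
            rfl
          right_inv := fun ψ => by
            ext q x : 3
            refine cochain_ext fun p n h e => ?_
            refine (tensorHomCurry_apply D (tensorHomUncurry D ψ) q x p n h e).trans ?_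
            refine (congr_arg _ (tensorHomUncurryX_apply D ψ h x e)).trans ?_
            rw [smul_smul, Int.units_mul_self, one_smul] }
      homEquiv_naturality_left_symm := fun {X X' M} f ψ => by
        ext1 n
        refine tensor_hom_ext D fun p q h e x => ?_
        refine (tensorHomUncurryX_apply D (f ≫ ψ) h x e).trans ?_
        refine Eq.trans ?_ (congr_arg (tensorHomUncurryX D ψ n).hom (tensorElt_map D f h e x)).symm
        exact (tensorHomUncurryX_apply D ψ h _ e).symm
      homEquiv_naturality_right := fun {X M M'} φ f => by
        ext q x : 3
        refine cochain_ext fun p n h e => ?_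
        refine (tensorHomCurry_apply D (φ ≫ f) q x p n h e).trans ?_
        refine Eq.trans ?_ (cochainApply_comp_ofHom D (((tensorHomCurry D φ).f q).hom x) f p n h e).symm
        rw [tensorHomCurry_apply, smul_map_negOnePow]
        rfl }

/-- The adjunction between `D ⊗_B -` and `Hom_A(D, -)` on homotopy categories. -/
def tensorHomAdjunctionHot : tensorHot D ⊣ homHot D where
  unit := Quotient.natTransLift _ (Functor.whiskerRight (tensorHomAdjunction D).unit (toHot B))
  counit := Quotient.natTransLift _ (Functor.whiskerRight (tensorHomAdjunction D).counit (toHot A))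
  left_triangle_components := by
    rintro ⟨X⟩
    refine ((toHot A).map_comp _ _).symm.trans ?_
    exact (congr_arg (toHot A).map ((tensorHomAdjunction D).left_triangle_components X)).trans
      ((toHot A).map_id _)
  right_triangle_components := by
    rintro ⟨M⟩
    refine ((toHot B).map_comp _ _).symm.trans ?_
    exact (congr_arg (toHot B).map ((tensorHomAdjunction D).right_triangle_components M)).trans
      ((toHot B).map_id _)

/-- The compatibility of D ⊗_B - with shifts is transported from its right adjoint, which also
yields that it is triangulated without any computation with total complexes. -/
instance tensorHotCommShift : (tensorHot D).CommShift ℤ :=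
  (tensorHomAdjunctionHot D).leftAdjointCommShift ℤ

instance : (tensorHomAdjunctionHot D).CommShift ℤ :=
  (tensorHomAdjunctionHot D).commShift_of_rightAdjoint ℤ

instance : (tensorHot D).IsTriangulated :=
  (tensorHomAdjunctionHot D).isTriangulated_leftAdjoint

end Adjunction
end CoContra
end

open MulOpposite

noncomputable section

namespace CoContra

/-! ### The terms of Hom_A(D, J) and of D ⊗_B F -/

section Terms

variable {A B : Type u} [Ring A] [Ring B] (D : CochainComplex (BimodCat A B) ℤ)

lemma baer_of_injective {R : Type u} [Ring R] {M : ModuleCat.{u} R} (hM : Injective M) :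
    Module.Baer R M :=
  Module.Baer.iff_injective.2 ((Module.injective_iff_injective_object R M).2 hM)

lemma injective_of_baer {R : Type u} [Ring R] {M : ModuleCat.{u} R} (hM : Module.Baer R M) :
    Injective M :=
  (Module.injective_iff_injective_object R M).1 (Module.Baer.iff_injective.1 hM)

/-- The term is a product of groups Hom_A(D^p, J^{p+q}). Linear equations are solved in each factor
by `exists_solution_hom`, with generating relations common to all factors. -/
lemma isFlat_homFunctor_X (hB : IsRightCoherent B) (hD : ∀ i, FPExt Bᵐᵒᵖ (D.X i))
    (J : CochainComplex (ModuleCat.{u} A) ℤ) (hJ : ∀ i, Injective (J.X i)) (q : ℤ) :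
    IsFlat (((homFunctor D).obj J).X q) := by
  rw [isFlat_iff_baer]
  refine RelSolvable.baer hB ?_
  change RelSolvable B (Cochain (leftComplex D) J q)
  intro n m i r hr f hf
  have hf' (p k : ℤ) (h : p + q = k) (e : D.X p) :
      ∑ j, cochainApply (f j) p k h (op (i j) • e) = 0 := by
    let ev : Cochain (leftComplex D) J q →+ J.X k :=
      AddMonoidHom.mk' (fun z => cochainApply z p k h e) (fun _ _ => rfl)
    have := congr_arg ev hf
    rw [map_sum, map_zero] at this
    rw [← this]
    exact Finset.sum_congr rfl fun j _ => (cochainApply_smul D (i j) (f j) p k h e).symm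
  choose y hy using fun (p k : ℤ) (h : p + q = k) => exists_solution_hom (hD p)
    (baer_of_injective (hJ k)) i r hr (fun j => cochainApply (f j) p k h) (hf' p k h)
  refine ⟨fun l => cochainMk (fun p k h => y p k h l), fun j => cochain_ext fun p k h e => ?_⟩
  rw [hy p k h j e]
  let ev : Cochain (leftComplex D) J q →+ J.X k :=
    AddMonoidHom.mk' (fun z => cochainApply z p k h e) (fun _ _ => rfl)
  change _ = ev _
  rw [map_sum]
  exact Finset.sum_congr rfl fun l _ => (cochainApply_smul D (r j l)
    (cochainMk (M := J) (fun p k h => y p k h l)) p k h e).symm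

lemma isZero_homFunctor_X (M : CochainComplex (ModuleCat.{u} A) ℤ) (q : ℤ)
    (h : ∀ p n : ℤ, p + q = n → IsZero (D.X p) ∨ IsZero (M.X n)) :
    IsZero (((homFunctor D).obj M).X q) := by
  have : Subsingleton (((homFunctor D).obj M).X q) := ⟨fun z z' => cochain_ext fun p n hpn e => by
    rcases h p n hpn with h | h
    · have := ModuleCat.subsingleton_of_isZero h
      rw [Subsingleton.elim e 0, map_zero, map_zero]
    · have := ModuleCat.subsingleton_of_isZero h
      exact Subsingleton.elim _ _⟩
  exact @ModuleCat.isZero_of_subsingleton _ _ _ this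

lemma isZero_tensorFunctor_X (X : CochainComplex (ModuleCat.{u} B) ℤ) (n : ℤ)
    (h : ∀ p q : ℤ, p + q = n → IsZero (D.X p) ∨ IsZero (X.X q)) :
    IsZero (((tensorFunctor D).obj X).X n) := by
  rw [IsZero.iff_id_eq_zero]
  refine tensor_hom_ext D fun p q hpq e x => ?_
  suffices tensorElt D X n hpq x e = 0 by
    change tensorElt D X n hpq x e = 0
    exact this
  rcases h p q hpq with h | h
  · have := ModuleCat.subsingleton_of_isZero h
    rw [Subsingleton.elim e 0, map_zero]
  · have := ModuleCat.subsingleton_of_isZero h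
    -- The zero is written as a multiple by 0 so that it can be moved to the other factor.
    rw [Subsingleton.elim x 0, ← zero_smul B 0, tensorElt_smul]
    rw [MulOpposite.op_zero, zero_smul, map_zero]

variable (X : CochainComplex (ModuleCat.{u} B) ℤ)

/-- The projection of the total complex on `D^p ⊗_B X^q`. -/
def tensorπ (p q n : ℤ) :
    ((tensorFunctor D).obj X).X n ⟶ ModuleCat.of A (BalancedTensor A B (D.X p) (X.X q)) :=
  HomologicalComplex.mapBifunctorDesc (fun p' q' _ => if hp : p' = p then if hq : q' = q then
    eqToHom (by subst hp hq; rfl) else 0 else 0)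

lemma tensorπ_tensorι_self (p q n : ℤ) (h : p + q = n) (x : BalancedTensor A B (D.X p) (X.X q)) :
    (tensorπ D X p q n).hom ((tensorι D X p q n h).hom x) = x := by
  have := HomologicalComplex.ι_mapBifunctorDesc (K₁ := D) (K₂ := X) (F := tensorBifunctor A B)
    (c := ComplexShape.up ℤ) (j := n) (A := ModuleCat.of A (BalancedTensor A B (D.X p) (X.X q)))
    (fun p' q' _ => if hp : p' = p then if hq : q' = q then
    eqToHom (by subst hp hq; rfl) else 0 else 0) p q h
  rw [dif_pos rfl, dif_pos rfl] at this
  exact congr_arg (fun f : ModuleCat.of A (BalancedTensor A B (D.X p) (X.X q)) ⟶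
    ModuleCat.of A (BalancedTensor A B (D.X p) (X.X q)) => f.hom x) this

lemma tensorπ_tensorι_of_ne (p q p' q' n : ℤ) (h : p + q = n) (hp : p ≠ p')
    (x : BalancedTensor A B (D.X p) (X.X q)) :
    (tensorπ D X p' q' n).hom ((tensorι D X p q n h).hom x) = 0 := by
  have := HomologicalComplex.ι_mapBifunctorDesc (K₁ := D) (K₂ := X) (F := tensorBifunctor A B)
    (c := ComplexShape.up ℤ) (j := n) (A := ModuleCat.of A (BalancedTensor A B (D.X p') (X.X q')))
    (fun p'' q'' _ => if hp : p'' = p' then if hq : q'' = q' then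
    eqToHom (by subst hp hq; rfl) else 0 else 0) p q h
  rw [dif_neg hp] at this
  exact congr_arg (fun f : ModuleCat.of A (BalancedTensor A B (D.X p) (X.X q)) ⟶
    ModuleCat.of A (BalancedTensor A B (D.X p') (X.X q')) => f.hom x) this

lemma FPExt.of_retract {R : Type u} [Ring R] {J J' : Type*} [AddCommGroup J] [Module R J]
    [AddCommGroup J'] [Module R J'] (h : FPExt R J) (i : J' →ₗ[R] J) (p : J →ₗ[R] J')
    (hp : ∀ x, p (i x) = x) : FPExt R J' := by
  intro n K hK g
  obtain ⟨y, hy⟩ := h n K hK (i.comp g)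
  exact ⟨p.comp y, fun x => by simp [hy, hp]⟩

/-- Only finitely many D^p are nonzero, so the term is a retract of a finite product of modules D^p
⊗ F^q, each of them fp-injective. -/
lemma fpExt_tensorFunctor_X (hA : IsLeftCoherent A) (hD : ∀ i, FPExt A (D.X i))
    (hfin : ∃ m n : ℤ, ∀ i : ℤ, i < m ∨ n < i → IsZero (D.X i))
    (hX : ∀ i, IsFlat (X.X i)) (n : ℤ) : FPExt A (((tensorFunctor D).obj X).X n) := by
  obtain ⟨a, b, hab⟩ := hfin
  let i : ((tensorFunctor D).obj X).X n →ₗ[A]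
      (∀ p : Finset.Icc a b, BalancedTensor A B (D.X p) (X.X (n - p))) :=
    LinearMap.pi fun p => (tensorπ D X p (n - p) n).hom
  let s : (∀ p : Finset.Icc a b, BalancedTensor A B (D.X p) (X.X (n - p))) →ₗ[A]
      ((tensorFunctor D).obj X).X n :=
    ∑ p : Finset.Icc a b, (tensorι D X p (n - p) n (add_sub_cancel _ _)).hom.comp (LinearMap.proj p)
  refine FPExt.of_retract (FPExt.pi fun p : Finset.Icc a b =>
    FPExt.balancedTensor hA (hD p) ((isFlat_iff_baer _).1 (hX (n - p)))) i s ?_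
  have : ModuleCat.ofHom (s.comp i) = 𝟙 _ := by
    refine tensor_hom_ext D fun p q hpq e x => ?_
    obtain rfl : q = n - p := by lia
    change s (i _) = (tensorι D X p (n - p) n hpq).hom _
    by_cases hp : p ∈ Finset.Icc a b
    · simp only [s, LinearMap.sum_apply, LinearMap.comp_apply, LinearMap.proj_apply]
      rw [Finset.sum_eq_single ⟨p, hp⟩]
      · exact congr_arg (tensorι D X p (n - p) n hpq).hom (tensorπ_tensorι_self D X p (n - p) n hpq _)
      · intro p' _ hp'
        refine (congr_arg (tensorι D X p' (n - p') n _).hom (tensorπ_tensorι_of_ne D X p (n - p)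
          p' (n - p') n hpq (fun h => hp' (Subtype.ext h.symm)) _)).trans (map_zero _)
      · exact fun h => absurd (Finset.mem_univ _) h
    · have := ModuleCat.subsingleton_of_isZero (hab p (by
        rw [Finset.mem_Icc] at hp
        lia))
      have h0 : (tensorι D X p (n - p) n hpq).hom (BalancedTensor.tmul A B e x) = 0 := by
        change tensorElt D X n hpq x e = 0
        rw [Subsingleton.elim e 0, map_zero]
      rw [h0, map_zero, map_zero]
  exact fun x => congr_arg (fun f => f.hom x) this

end Terms

end CoContra

end

noncomputable section

namespace CoContra

/-! ### Embeddings into and coverings by contractible complexes -/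

section Disks

variable {R : Type u} [Ring R]

lemma mappingCone_X_iso_biprod {X Y : CochainComplex (ModuleCat.{u} R) ℤ} (f : X ⟶ Y) (i : ℤ) :
    Nonempty ((mappingCone f).X i ≅ X.X (i + 1) ⊞ Y.X i) :=
  ⟨HomologicalComplex.homotopyCofiber.XIsoBiprod f i (i + 1) rfl⟩

lemma injective_mappingCone_X {X Y : CochainComplex (ModuleCat.{u} R) ℤ} (f : X ⟶ Y)
    (hX : ∀ i, Injective (X.X i)) (hY : ∀ i, Injective (Y.X i)) (i : ℤ) :
    Injective ((mappingCone f).X i) := by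
  have := hX (i + 1)
  have := hY i
  exact Injective.of_iso (mappingCone_X_iso_biprod f i).some.symm inferInstance

lemma projective_mappingCone_X {X Y : CochainComplex (ModuleCat.{u} R) ℤ} (f : X ⟶ Y)
    (hX : ∀ i, Projective (X.X i)) (hY : ∀ i, Projective (Y.X i)) (i : ℤ) :
    Projective ((mappingCone f).X i) := by
  have := hX (i + 1)
  have := hY i
  exact Projective.of_iso (mappingCone_X_iso_biprod f i).some.symm inferInstance

/-- Zero modules are embedded into zero modules, so that resolutions of complexes enlarge their
supports only by a controlled amount. -/
lemma exists_mono_injective (M : ModuleCat.{u} R) : ∃ (E : ModuleCat.{u} R) (f : M ⟶ E),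
    Injective E ∧ Mono f ∧ (IsZero M → IsZero E) := by
  by_cases h : IsZero M
  · exact ⟨M, 𝟙 M, h.injective, inferInstance, fun h => h⟩
  · exact ⟨Injective.under M, Injective.ι M, inferInstance, inferInstance, fun h' => (h h').elim⟩

lemma exists_epi_projective (M : ModuleCat.{u} R) : ∃ (E : ModuleCat.{u} R) (f : E ⟶ M),
    Projective E ∧ Epi f ∧ (IsZero M → IsZero E) := by
  by_cases h : IsZero M
  · exact ⟨M, 𝟙 M, h.projective, inferInstance, fun h => h⟩
  · exact ⟨Projective.over M, Projective.π M, inferInstance, inferInstance, fun h' => (h h').elim⟩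

/-- The complex with given terms and zero differential. -/
def zeroComplex (E : ℤ → ModuleCat.{u} R) : CochainComplex (ModuleCat.{u} R) ℤ where
  X := E
  d _ _ := 0

/-- The neighborhood of radius `c` of a set of integers. -/
def thicken (U : Set ℤ) (c : ℕ) : Set ℤ := {i | ∃ j ∈ U, j - c ≤ i ∧ i ≤ j + c}

lemma mem_thicken_of_mem {U : Set ℤ} {i j : ℤ} {c : ℕ} (h : j ∈ U) (h₁ : j - c ≤ i)
    (h₂ : i ≤ j + c) : i ∈ thicken U c := ⟨j, h, h₁, h₂⟩

/-- Every complex embeds into a contractible complex of injective modules. -/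
lemma exists_mono_contractible (X : CochainComplex (ModuleCat.{u} R) ℤ) :
    ∃ (I : CochainComplex (ModuleCat.{u} R) ℤ) (f : X ⟶ I), (∀ i, Injective (I.X i)) ∧
      (∀ i, Mono (f.f i)) ∧ Nonempty (Homotopy (𝟙 I) 0) ∧
      ∀ i, IsZero (X.X i) → IsZero (X.X (i + 1)) → IsZero (I.X i) := by
  choose E f hE hf h0 using fun i => exists_mono_injective (X.X i)
  -- The cone of the identity of a complex with zero differential is cofree: any graded family f is
  -- one component of a chain map, the other component being -δβ.
  let β : Cochain X (zeroComplex E) 0 := Cochain.ofHoms f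
  let g : X ⟶ mappingCone (𝟙 (zeroComplex E)) := mappingCone.lift _
    (Cocycle.mk (-δ 0 1 β) 2 (by lia) (by rw [δ_neg, δ_δ, neg_zero])) β (by
      rw [Cocycle.mk_coe, Cochain.comp_id, add_neg_cancel])
  refine ⟨_, g, injective_mappingCone_X _ hE hE, fun i => ?_,
    ⟨mappingCone.homotopyToZeroOfId _⟩, fun i hi hi' =>
      (mappingCone.isZero_X_iff _ _).2 ⟨h0 _ hi', h0 _ hi⟩⟩
  have h : g.f i ≫ (mappingCone.snd (𝟙 (zeroComplex E))).v i i (add_zero i) = f i := by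
    rw [mappingCone.lift_f_snd_v]
    rfl
  have : Mono (g.f i ≫ (mappingCone.snd (𝟙 (zeroComplex E))).v i i (add_zero i)) := by
    rw [h]
    exact hf i
  exact mono_of_mono _ ((mappingCone.snd (𝟙 (zeroComplex E))).v i i (add_zero i))

/-- Every complex is a quotient of a contractible complex of projective modules. -/
lemma exists_epi_contractible (X : CochainComplex (ModuleCat.{u} R) ℤ) :
    ∃ (I : CochainComplex (ModuleCat.{u} R) ℤ) (f : I ⟶ X), (∀ i, Projective (I.X i)) ∧
      (∀ i, Epi (f.f i)) ∧ Nonempty (Homotopy (𝟙 I) 0) ∧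
      ∀ i, IsZero (X.X i) → IsZero (X.X (i - 1)) → IsZero (I.X i) := by
  choose E f hE hf h0 using fun i => exists_epi_projective (X.X i)
  -- The index is shifted because the i-th term of the cone contains Z^{i+1}, which has to be the
  -- cover of X^i.
  let Z := zeroComplex (fun i => E (i - 1))
  let α : Cochain Z X (-1) := Cochain.mk (fun p q hpq => f (p - 1) ≫
    (X.XIsoOfEq (show p - 1 = q by lia)).hom)
  let g : mappingCone (𝟙 Z) ⟶ X := mappingCone.desc (𝟙 Z) α
    (Cocycle.homOf (Cocycle.mk (δ (-1) 0 α) 1 (by lia) (δ_δ _ _ _ _))) (by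
      rw [Category.id_comp, Cocycle.cochain_ofHom_homOf_eq_coe, Cocycle.mk_coe])
  refine ⟨_, g, projective_mappingCone_X _ (fun i => hE _) (fun i => hE _), fun i => ?_,
    ⟨mappingCone.homotopyToZeroOfId _⟩, fun i hi hi' =>
      (mappingCone.isZero_X_iff _ _).2 ⟨h0 _ (by rwa [add_sub_cancel_right]), h0 _ hi'⟩⟩
  have h : (mappingCone.inl (𝟙 Z)).v (i + 1) i (by lia) ≫ g.f i = f (i + 1 - 1) ≫
      (X.XIsoOfEq (show i + 1 - 1 = i by lia)).hom := by
    rw [mappingCone.inl_v_desc_f]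
    rfl
  have : Epi ((mappingCone.inl (𝟙 Z)).v (i + 1) i (by lia) ≫ g.f i) := by
    rw [h]
    have := hf (i + 1 - 1)
    exact @epi_comp _ _ _ _ _ _ this _ inferInstance
  exact epi_of_epi ((mappingCone.inl (𝟙 Z)).v (i + 1) i _) _

end Disks

/-! ### Replacing one vertex of a triangle modulo a subcategory -/

section Octahedra

variable {C : Type*} [Category C] [Preadditive C] [HasZeroObject C] [HasShift C ℤ]
  [∀ n : ℤ, (CategoryTheory.shiftFunctor C n).Additive] [Pretriangulated C] [IsTriangulated C]
  (P : ObjectProperty C) [P.IsTriangulated]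

/-- Changing the target of I → Y by a `P`-equivalence changes its fibre by a `P`-equivalence: this
is the octahedron of g and t. -/
lemma exists_trW_fibre {X I Y J' J : C} {f : X ⟶ I} {g : I ⟶ Y} {h : Y ⟶ X⟦(1 : ℤ)⟧}
    (hT : Triangle.mk f g h ∈ distTriang C) {t : Y ⟶ J'} (ht : P.trW t)
    {a : J ⟶ I} {b : J' ⟶ J⟦(1 : ℤ)⟧} (hT' : Triangle.mk a (g ≫ t) b ∈ distTriang C) :
    ∃ s : X ⟶ J, P.trW s := by
  rw [P.trW_iff'] at ht
  obtain ⟨Z, c, d, hZ, hP⟩ := ht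
  exact ⟨_, _, _, _, (Triangulated.someOctahedron' rfl hT hZ hT').mem, hP⟩

/-- Likewise for the cone of K → Q when its source is changed. -/
lemma exists_trW_cone {K Q Y P' W : C} {f : K ⟶ Q} {g : Q ⟶ Y} {h : Y ⟶ K⟦(1 : ℤ)⟧}
    (hT : Triangle.mk f g h ∈ distTriang C) {t : P' ⟶ K} (ht : P.trW t)
    {a : Q ⟶ W} {b : W ⟶ P'⟦(1 : ℤ)⟧} (hT' : Triangle.mk (t ≫ f) a b ∈ distTriang C) :
    ∃ s : W ⟶ Y, P.trW s := by
  obtain ⟨Z, c, d, hZ, hP⟩ := ht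
  exact ⟨(Triangulated.someOctahedron rfl hZ hT hT').m₃,
    ObjectProperty.trW.mk' P (Triangulated.someOctahedron rfl hZ hT hT').mem hP⟩

end Octahedra

end CoContra

end

noncomputable section

namespace CoContra

/-! ### Resolutions of finite length -/

section FiniteResolutions

variable {R : Type u} [Ring R] (P : ObjectProperty (Hot R)) [P.IsTriangulated]
  [P.IsClosedUnderIsomorphisms]

lemma exists_fibre_triangle {X Y : CochainComplex (ModuleCat.{u} R) ℤ} (f : X ⟶ Y) :
    ∃ (a : (toHot R).obj ((mappingCone f)⟦(-1 : ℤ)⟧) ⟶ (toHot R).obj X)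
      (b : (toHot R).obj Y ⟶ ((toHot R).obj ((mappingCone f)⟦(-1 : ℤ)⟧))⟦(1 : ℤ)⟧),
      Triangle.mk a ((toHot R).map f) b ∈ distTriang (Hot R) := by
  have h := inv_rot_of_distTriang _ (HomotopyCategory.mappingCone_triangleh_distinguished f)
  let e := ((toHot R).commShiftIso (-1 : ℤ)).app (mappingCone f)
  refine ⟨e.hom ≫ (mappingCone.triangleh f).invRotate.mor₁,
    (mappingCone.triangleh f).invRotate.mor₃ ≫ e.inv⟦(1 : ℤ)⟧', isomorphic_distinguished _ h _ ?_⟩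
  refine Triangle.isoMk _ _ e (Iso.refl _) (Iso.refl _) (Category.comp_id _) ?_ ?_
  · exact (Category.comp_id _).trans (Category.id_comp _).symm
  · refine (Category.assoc _ _ _).trans ((congr_arg ((mappingCone.triangleh f).invRotate.mor₃ ≫ ·)
      (((CategoryTheory.shiftFunctor (Hot R) (1 : ℤ)).map_comp _ _).symm.trans
        ((congr_arg _ e.inv_hom_id).trans
          ((CategoryTheory.shiftFunctor (Hot R) (1 : ℤ)).map_id _)))).trans ?_)
    exact (Category.comp_id _).trans (Category.id_comp _).symm

lemma isZero_quotientComplex_X (K : CochainComplex (ModuleCat.{u} R) ℤ)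
    (S : ∀ i, Submodule R (K.X i)) (hS : ∀ i j, ∀ x ∈ S i, K.d i j x ∈ S j) (i : ℤ)
    (h : IsZero (K.X i)) : IsZero ((quotientComplex K S hS).X i) := by
  have := ModuleCat.subsingleton_of_isZero h
  have : Subsingleton (K.X i ⧸ S i) := (Submodule.mkQ_surjective _).subsingleton
  exact @ModuleCat.isZero_of_subsingleton _ _ _ this

lemma isZero_subcomplex_X (K : CochainComplex (ModuleCat.{u} R) ℤ)
    (S : ∀ i, Submodule R (K.X i)) (hS : ∀ i j, ∀ x ∈ S i, K.d i j x ∈ S j) (i : ℤ)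
    (h : IsZero (K.X i)) : IsZero ((subcomplex K S hS).X i) := by
  have := ModuleCat.subsingleton_of_isZero h
  have : Subsingleton (S i) := Subtype.val_injective.subsingleton
  exact @ModuleCat.isZero_of_subsingleton _ _ _ this

/-- The quotient of a complex by a monomorphism. -/
lemma exists_shortExact_of_mono {X I : CochainComplex (ModuleCat.{u} R) ℤ} (f : X ⟶ I)
    (hf : ∀ i, Mono (f.f i)) : ∃ (Y : CochainComplex (ModuleCat.{u} R) ℤ) (g : I ⟶ Y) (w : f ≫ g = 0),
      (ShortComplex.mk f g w).ShortExact ∧ ∀ i, IsZero (I.X i) → IsZero (Y.X i) := by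
  have hd (i j : ℤ) (x) (hx : x ∈ LinearMap.range (f.f i).hom) :
      I.d i j x ∈ LinearMap.range (f.f j).hom := by
    obtain ⟨x, rfl⟩ := hx
    exact ⟨X.d i j x, (congr_arg (fun g => g.hom x) (f.comm i j)).symm⟩
  obtain ⟨w, h⟩ := shortExact_of_elements f (quotientComplexπ I (fun i => LinearMap.range (f.f i).hom) hd)
    (fun i => (ModuleCat.mono_iff_injective _).1 (hf i)) (fun i => Submodule.mkQ_surjective _)
    (fun i x => (Submodule.Quotient.mk_eq_zero _).2 ⟨x, rfl⟩)
    (fun i y hy => (Submodule.Quotient.mk_eq_zero _).1 hy)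
  exact ⟨_, _, w, h, fun i => isZero_quotientComplex_X _ _ _ i⟩

/-- The kernel of an epimorphism of complexes. -/
lemma exists_shortExact_of_epi {X I : CochainComplex (ModuleCat.{u} R) ℤ} (g : I ⟶ X)
    (hg : ∀ i, Epi (g.f i)) : ∃ (Y : CochainComplex (ModuleCat.{u} R) ℤ) (f : Y ⟶ I) (w : f ≫ g = 0),
      (ShortComplex.mk f g w).ShortExact ∧ ∀ i, IsZero (I.X i) → IsZero (Y.X i) := by
  have hd (i j : ℤ) (x) (hx : x ∈ LinearMap.ker (g.f i).hom) :
      I.d i j x ∈ LinearMap.ker (g.f j).hom := by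
    have h := congr_arg (fun g => g.hom x) (g.comm i j)
    refine LinearMap.mem_ker.2 (h.symm.trans ?_)
    exact (congr_arg (X.d i j).hom (LinearMap.mem_ker.1 hx)).trans (map_zero _)
  obtain ⟨w, h⟩ := shortExact_of_elements (subcomplexι I (fun i => LinearMap.ker (g.f i).hom) hd) g
    (fun i => Submodule.injective_subtype _) (fun i => (ModuleCat.epi_iff_surjective _).1 (hg i))
    (fun i x => x.2)
    (fun i y hy => ⟨⟨y, hy⟩, rfl⟩)
  exact ⟨_, _, w, h, fun i => isZero_subcomplex_X _ _ _ i⟩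

/-- The injective resolution of a complex of modules of bounded injective dimension. -/
lemma exists_injective_resolution_of_dim
    (hP : ∀ S : ShortComplex (CochainComplex (ModuleCat.{u} R) ℤ), S.ShortExact →
      P ((toHot R).obj (totalComplex S))) (k : ℕ)
    (X : CochainComplex (ModuleCat.{u} R) ℤ) (hX : ∀ i, HasInjectiveDimensionLT (X.X i) (k + 1))
    (U : Set ℤ) (hU : ∀ i ∉ U, IsZero (X.X i)) :
    ∃ (J : CochainComplex (ModuleCat.{u} R) ℤ) (s : X ⟶ J), (∀ i, Injective (J.X i)) ∧
      P.trW ((toHot R).map s) ∧ ∀ i ∉ thicken U (2 * k), IsZero (J.X i) := by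
  induction k generalizing X U with
  | zero =>
    refine ⟨X, 𝟙 X, fun i => injective_iff_hasInjectiveDimensionLT_one.2 (hX i), ?_,
      fun i hi => hU i fun h => hi (mem_thicken_of_mem h (by lia) (by lia))⟩
    rw [(toHot R).map_id]
    exact P.trW.id_mem _
  | succ k ih =>
    -- Modulo `P`, the complex X is the fibre of I → Y with Y = I/X of smaller injective dimension.
    -- The resolution of X is the fibre of I → J', where J' resolves Y. Every step enlarges the
    -- support by at most 2 on each side.
    obtain ⟨I, f, hI, hf, -, hI0⟩ := exists_mono_contractible X
    obtain ⟨Y, g, w, hS, hY⟩ := exists_shortExact_of_mono f hf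
    let U' : Set ℤ := {i | i ∈ U ∨ i + 1 ∈ U}
    have hIU (i : ℤ) (hi : i ∉ U') : IsZero (I.X i) :=
      hI0 i (hU i fun h => hi (Or.inl h)) (hU _ fun h => hi (Or.inr h))
    obtain ⟨J', t, hJ', ht, hJU⟩ := ih Y (fun i => by
      have := hI i
      exact (shortExact_X hS i).hasInjectiveDimensionLT_X₃ _
        (hasInjectiveDimensionLT_of_ge (I.X i) 1 (k + 1) (by lia)) (hX i)) U'
      (fun i hi => hY i (hIU i hi))
    obtain ⟨a, b, hT⟩ := exists_fibre_triangle (g ≫ t)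
    -- The honest triangle has the cone of f as its third vertex rather than Y, so g ≫ t is factored
    -- through this cone, and the comparison map becomes part of the `P`-equivalence.
    have hg : (toHot R).map (g ≫ t) = (toHot R).map (mappingCone.inr f) ≫
        (toHot R).map ((mappingCone.desc f 0 g (by simp [w]) : mappingCone f ⟶ Y) ≫ t) := by
      rw [← Functor.map_comp, mappingCone.inr_desc_assoc]
    rw [hg] at hT
    have hd : P.trW ((toHot R).map (mappingCone.desc f 0 g (by simp [w]) : mappingCone f ⟶ Y)) :=
      trW_desc_of_total P (ShortComplex.mk f g w) (hP _ hS)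
    have ht' : P.trW ((toHot R).map
        ((mappingCone.desc f 0 g (by simp [w]) : mappingCone f ⟶ Y) ≫ t)) := by
      rw [Functor.map_comp]
      exact P.trW.comp_mem _ _ hd ht
    obtain ⟨s, hs⟩ := exists_trW_fibre P
      (HomotopyCategory.mappingCone_triangleh_distinguished f)
      ht' hT
    obtain ⟨s, rfl⟩ := (toHot R).map_surjective s
    refine ⟨_, s, fun i => injective_mappingCone_X (g ≫ t) hI hJ' (i + -1), hs, fun i hi => ?_⟩
    refine (mappingCone.isZero_X_iff (g ≫ t) (i + -1)).2 ⟨hIU _ fun h => hi ?_, hJU _ fun h => hi ?_⟩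
    · rcases h with h | h
      · exact mem_thicken_of_mem h (by lia) (by lia)
      · exact mem_thicken_of_mem h (by lia) (by lia)
    · obtain ⟨j, hj | hj, h₁, h₂⟩ := h
      · exact mem_thicken_of_mem hj (by lia) (by lia)
      · exact mem_thicken_of_mem hj (by lia) (by lia)

/-- The projective resolution of a complex of flat modules of bounded projective dimension. -/
lemma exists_projective_resolution_of_dim (𝒳 : ObjectProperty (ModuleCat.{u} R))
    (h𝒳 : ∀ S : ShortComplex (ModuleCat.{u} R), S.ShortExact → Projective S.X₂ → 𝒳 S.X₃ → 𝒳 S.X₁)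
    (hP : ∀ S : ShortComplex (CochainComplex (ModuleCat.{u} R) ℤ), S.ShortExact →
      (∀ i, 𝒳 (S.X₃.X i)) → P ((toHot R).obj (totalComplex S))) (k : ℕ)
    (X : CochainComplex (ModuleCat.{u} R) ℤ) (hX : ∀ i, HasProjectiveDimensionLT (X.X i) (k + 1))
    (hX' : ∀ i, 𝒳 (X.X i)) (U : Set ℤ) (hU : ∀ i ∉ U, IsZero (X.X i)) :
    ∃ (J : CochainComplex (ModuleCat.{u} R) ℤ) (s : J ⟶ X), (∀ i, Projective (J.X i)) ∧
      P.trW ((toHot R).map s) ∧ ∀ i ∉ thicken U (2 * k), IsZero (J.X i) := by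
  induction k generalizing X U with
  | zero =>
    refine ⟨X, 𝟙 X, fun i => projective_iff_hasProjectiveDimensionLT_one.2 (hX i), ?_,
      fun i hi => hU i fun h => hi (mem_thicken_of_mem h (by lia) (by lia))⟩
    rw [(toHot R).map_id]
    exact P.trW.id_mem _
  | succ k ih =>
    -- Dually, with Y the kernel of I → X. All sequences used end in a complex with terms in `𝒳`, so
    -- the hypothesis on total complexes may be restricted to such sequences.
    obtain ⟨I, g, hI, hg, -, hI0⟩ := exists_epi_contractible X
    obtain ⟨Y, f, w, hS, hY⟩ := exists_shortExact_of_epi g hg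
    let U' : Set ℤ := {i | i ∈ U ∨ i - 1 ∈ U}
    have hIU (i : ℤ) (hi : i ∉ U') : IsZero (I.X i) :=
      hI0 i (hU i fun h => hi (Or.inl h)) (hU _ fun h => hi (Or.inr h))
    obtain ⟨J', t, hJ', ht, hJU⟩ := ih Y (fun i => by
      have := hI i
      exact (shortExact_X hS i).hasProjectiveDimensionLT_X₁ _
        (hasProjectiveDimensionLT_of_ge (I.X i) 1 (k + 1) (by lia)) (hX i))
      (fun i => h𝒳 _ (shortExact_X hS i) (hI i) (hX' i)) U' (fun i hi => hY i (hIU i hi))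
    have hd : P.trW ((toHot R).map (mappingCone.desc f 0 g (by simp [w]) : mappingCone f ⟶ X)) :=
      trW_desc_of_total P (ShortComplex.mk f g w) (hP _ hS hX')
    obtain ⟨b, hT⟩ : ∃ b, Triangle.mk ((toHot R).map (t ≫ f))
        ((toHot R).map (mappingCone.inr (t ≫ f))) b ∈ distTriang (Hot R) :=
      ⟨_, HomotopyCategory.mappingCone_triangleh_distinguished (t ≫ f)⟩
    rw [Functor.map_comp] at hT
    obtain ⟨s, hs⟩ : ∃ s : (toHot R).obj (mappingCone (t ≫ f)) ⟶ (toHot R).obj (mappingCone f),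
        P.trW s := exists_trW_cone P
      (HomotopyCategory.mappingCone_triangleh_distinguished f) ht hT
    obtain ⟨s, rfl⟩ := (toHot R).map_surjective s
    refine ⟨mappingCone (t ≫ f), s ≫ (mappingCone.desc f 0 g (by simp [w]) : mappingCone f ⟶ X),
      fun i => projective_mappingCone_X _ hJ' hI _, ?_, fun i hi => ?_⟩
    · rw [Functor.map_comp]
      exact P.trW.comp_mem _ _ hs hd
    refine (mappingCone.isZero_X_iff _ _).2 ⟨hJU _ fun h => hi ?_, hIU _ fun h => hi ?_⟩
    · obtain ⟨j, hj | hj, h₁, h₂⟩ := h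
      · exact mem_thicken_of_mem hj (by lia) (by lia)
      · exact mem_thicken_of_mem hj (by lia) (by lia)
    · rcases h with h | h
      · exact mem_thicken_of_mem h (by lia) (by lia)
      · exact mem_thicken_of_mem h (by lia) (by lia)

end FiniteResolutions

end CoContra

end

noncomputable section

namespace CoContra

/-! ### Telescopes -/

section Telescope

variable {R : Type u} [Ring R] {M : ℕ → Type u} [∀ k, AddCommGroup (M k)] [∀ k, Module R (M k)]
  (i : ∀ k, M k →ₗ[R] M (k + 1))

/-- The map `id - shift` on the direct sum of a sequence. -/
def telescope : (Π₀ k, M k) →ₗ[R] (Π₀ k, M k) :=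
  DFinsupp.lsum ℕ fun k => DFinsupp.lsingle k - (DFinsupp.lsingle (k + 1)).comp (i k)

lemma telescope_single (k : ℕ) (x : M k) :
    telescope i (DFinsupp.single k x) =
      DFinsupp.single k x - DFinsupp.single (k + 1) (i k x) := by
  rw [telescope, DFinsupp.lsum_single]
  rfl

lemma telescope_apply_zero (y : Π₀ k, M k) : telescope i y 0 = y 0 := by
  have : (DFinsupp.lapply (R := R) (M := M) 0).comp (telescope i) = DFinsupp.lapply 0 := by
    refine DFinsupp.lhom_ext fun k x => ?_
    simp only [LinearMap.comp_apply, telescope_single, DFinsupp.lapply_apply, DFinsupp.sub_apply]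
    rw [DFinsupp.single_eq_of_ne (i := k + 1) (i' := 0) (by lia), sub_zero]
  exact congr_arg (fun f => f y) this

lemma telescope_apply_succ (y : Π₀ k, M k) (n : ℕ) :
    telescope i y (n + 1) = y (n + 1) - i n (y n) := by
  have : (DFinsupp.lapply (R := R) (M := M) (n + 1)).comp (telescope i) =
      DFinsupp.lapply (n + 1) - (i n).comp (DFinsupp.lapply n) := by
    refine DFinsupp.lhom_ext fun k x => ?_
    simp only [LinearMap.comp_apply, telescope_single, DFinsupp.lapply_apply, DFinsupp.sub_apply,
      LinearMap.sub_apply]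
    by_cases h : n = k
    · subst h
      simp
    · rw [DFinsupp.single_eq_of_ne (i := k + 1) (i' := n + 1) (by lia),
        DFinsupp.single_eq_of_ne (i := k) (i' := n) h, map_zero]
  exact congr_arg (fun f => f y) this

lemma telescope_injective : Function.Injective (telescope i) := by
  rw [injective_iff_map_eq_zero]
  intro y hy
  refine DFinsupp.ext fun n => ?_
  induction n with
  | zero => rw [← telescope_apply_zero i, hy]
  | succ n ih =>
    have h := telescope_apply_succ i y n
    rw [hy, ih] at h
    simpa using h.symm

/-- Modulo the image, an element of the k-th summand equals its image in any later summand, so a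
finite sum can be pushed into a single summand arbitrarily far out. -/
lemma exists_sub_single_mem_range_telescope (y : Π₀ k, M k) :
    ∃ N, ∀ n ≥ N, ∃ s : M n, y - DFinsupp.single n s ∈ LinearMap.range (telescope i) := by
  induction y using DFinsupp.induction with
  | h0 => exact ⟨0, fun n _ => ⟨0, by simp⟩⟩
  | ha k x y _ _ ih =>
    obtain ⟨N, hN⟩ := ih
    have h (m : ℕ) : ∃ s : M (k + m),
        DFinsupp.single k x - DFinsupp.single (k + m) s ∈ LinearMap.range (telescope i) := by
      induction m with
      | zero => exact ⟨x, by simp⟩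
      | succ m ih =>
        obtain ⟨s, hs⟩ := ih
        refine ⟨i _ s, ?_⟩
        have := add_mem hs (LinearMap.mem_range_self (telescope i) (DFinsupp.single (k + m) s))
        rwa [telescope_single, sub_add_sub_cancel] at this
    refine ⟨max N k, fun n hn => ?_⟩
    obtain ⟨s, hs⟩ := hN n (by lia)
    obtain ⟨m, rfl⟩ : ∃ m, n = k + m := ⟨n - k, by lia⟩
    obtain ⟨t, ht⟩ := h m
    refine ⟨t + s, ?_⟩
    rw [DFinsupp.single_add, add_sub_add_comm]
    exact add_mem ht hs

/-- A preimage y vanishes in degrees below k by recursion and far above k by finite support. Beyond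
k the recursion reads y_{n+1} = i_n(y_n), so injectivity carries the vanishing back down to k. Hence
the terms of the sequence embed in the colimit. -/
lemma eq_zero_of_single_mem_range_telescope (hi : ∀ k, Function.Injective (i k)) (k : ℕ) (x : M k)
    (hx : DFinsupp.single k x ∈ LinearMap.range (telescope i)) : x = 0 := by
  classical
  obtain ⟨y, hy⟩ := hx
  have h₁ (n : ℕ) (hn : k ≤ n) (h : y n = 0) : y k = 0 := by
    induction n, hn using Nat.le_induction with
    | base => exact h
    | succ n hn ih =>
      have h' := telescope_apply_succ i y n
      rw [hy, h, DFinsupp.single_eq_of_ne (by lia), zero_sub, eq_comm, neg_eq_zero] at h'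
      exact ih ((hi n).eq_iff.1 (h'.trans (map_zero _).symm))
  have h₂ (n : ℕ) (hn : n < k) : y n = 0 := by
    induction n with
    | zero => rw [← telescope_apply_zero i, hy, DFinsupp.single_eq_of_ne (by lia)]
    | succ n ih =>
      have h' := telescope_apply_succ i y n
      rw [hy, ih (by lia), DFinsupp.single_eq_of_ne (by lia), map_zero, sub_zero] at h'
      exact h'.symm
  have h₃ : y k = 0 := by
    obtain ⟨n, hn⟩ := Infinite.exists_notMem_finset (y.support ∪ Finset.range k)
    simp only [Finset.mem_union, Finset.mem_range, not_or, not_lt, DFinsupp.mem_support_toFun,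
      not_not] at hn
    exact h₁ n hn.2 hn.1
  obtain _ | k := k
  · have h := telescope_apply_zero i y
    rw [hy, DFinsupp.single_eq_same, h₃] at h
    exact h
  · have h := telescope_apply_succ i y k
    rw [hy, DFinsupp.single_eq_same, h₃, h₂ k (by lia), map_zero, sub_zero] at h
    exact h

end Telescope

/-! ### Direct sums of sequences and unions of coacyclic subcomplexes -/

section DirectSum

variable {R : Type u} [Ring R]

/-- The direct sum of a sequence of complexes. -/
def dsum (X : ℕ → CochainComplex (ModuleCat.{u} R) ℤ) : CochainComplex (ModuleCat.{u} R) ℤ where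
  X n := ModuleCat.of R (Π₀ k, (X k).X n)
  d n m := ModuleCat.ofHom (DFinsupp.mapRange.linearMap fun k => ((X k).d n m).hom)
  shape n m h := by
    refine ModuleCat.hom_ext (LinearMap.ext fun y =>
      DFinsupp.ext (β := fun k => (X k).X m) fun k => ?_)
    change (X k).d n m _ = 0
    rw [(X k).shape n m h]
    rfl
  d_comp_d' n m p _ _ := by
    refine ModuleCat.hom_ext (LinearMap.ext fun y =>
      DFinsupp.ext (β := fun k => (X k).X p) fun k => ?_)
    change ((X k).d n m ≫ (X k).d m p) _ = 0
    rw [(X k).d_comp_d]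
    rfl

variable {X : ℕ → CochainComplex (ModuleCat.{u} R) ℤ}

lemma dsum_d_single (n m : ℤ) (k : ℕ) (x : (X k).X n) :
    DFinsupp.mapRange.linearMap (fun k => ((X k).d n m).hom) (DFinsupp.single k x) =
      DFinsupp.single k ((X k).d n m x) :=
  DFinsupp.mapRange_single (f := fun k => ((X k).d n m).hom) (hf := fun _ => map_zero _)

/-- The inclusion of a summand. -/
def dsumι (k : ℕ) : X k ⟶ dsum X where
  f n := ModuleCat.ofHom (DFinsupp.lsingle (R := R) (M := fun k => (X k).X n) k)
  comm' n m _ := by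
    refine ModuleCat.hom_ext (LinearMap.ext fun x => ?_)
    exact dsum_d_single n m k x

/-- The map from a direct sum given by its components. -/
def dsumDesc {K : CochainComplex (ModuleCat.{u} R) ℤ} (f : ∀ k, X k ⟶ K) : dsum X ⟶ K where
  f n := ModuleCat.ofHom (DFinsupp.lsum ℕ fun k => ((f k).f n).hom)
  comm' n m _ := by
    refine ModuleCat.hom_ext (DFinsupp.lhom_ext fun k x => ?_)
    have h₁ : (DFinsupp.lsum ℕ fun k => ((f k).f n).hom) (DFinsupp.single k x) = (f k).f n x :=
      DFinsupp.lsum_single _ _ _ _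
    have h₂ : (DFinsupp.lsum ℕ fun k => ((f k).f m).hom) (DFinsupp.single k ((X k).d n m x)) =
      (f k).f m ((X k).d n m x) := DFinsupp.lsum_single _ _ _ _
    refine (congr_arg (K.d n m).hom h₁).trans ?_
    refine (congr_arg (fun g => g.hom x) ((f k).comm n m)).trans (h₂.symm.trans ?_)
    exact congr_arg (DFinsupp.lsum ℕ fun k => ((f k).f m).hom) (dsum_d_single n m k x).symm

lemma dsumDesc_f_single {K : CochainComplex (ModuleCat.{u} R) ℤ} (f : ∀ k, X k ⟶ K) (n : ℤ) (k : ℕ)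
    (x : (X k).X n) : (dsumDesc f).f n (DFinsupp.single k x) = (f k).f n x :=
  DFinsupp.lsum_single _ _ _ _

lemma dsumι_desc {K : CochainComplex (ModuleCat.{u} R) ℤ} (f : ∀ k, X k ⟶ K) (k : ℕ) :
    dsumι k ≫ dsumDesc f = f k := by
  ext n x
  exact dsumDesc_f_single f n k x

lemma dsum_hom_ext {K : CochainComplex (ModuleCat.{u} R) ℤ} {f g : dsum X ⟶ K}
    (h : ∀ k, dsumι k ≫ f = dsumι k ≫ g) : f = g := by
  ext n : 1
  refine ModuleCat.hom_ext (DFinsupp.lhom_ext fun k x => ?_)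
  exact congr_arg (fun φ : X k ⟶ K => (φ.f n).hom x) (h k)

lemma coacyclic_dsum (hX : ∀ k, coacyclic R ((toHot R).obj (X k))) :
    coacyclic R ((toHot R).obj (dsum X)) := by
  have h := coacyclic.directSum (ULift.{u} ℕ) (fun k => X k.down) (fun k => hX k.down)
  refine (coacyclic R).prop_of_iso ((toHot R).mapIso ?_) h
  exact
    { hom := Sigma.desc fun k => dsumι k.down
      inv := dsumDesc fun k => Sigma.ι (fun k : ULift.{u} ℕ => X k.down) (ULift.up k)
      hom_inv_id := by
        refine Sigma.hom_ext _ _ fun k => ?_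
        rw [Sigma.ι_desc_assoc, Category.comp_id, dsumι_desc]
      inv_hom_id := by
        refine dsum_hom_ext fun k => ?_
        rw [← Category.assoc, dsumι_desc, Sigma.ι_desc, Category.comp_id] }

/-- The telescope map on the direct sum of a sequence of complexes. -/
def dsumTelescope (i : ∀ k, X k ⟶ X (k + 1)) : dsum X ⟶ dsum X :=
  dsumDesc fun k => dsumι k - i k ≫ dsumι (k + 1)

lemma dsumTelescope_f_apply (i : ∀ k, X k ⟶ X (k + 1)) (n : ℤ) (y : Π₀ k, (X k).X n) :
    (dsumTelescope i).f n y = telescope (fun k => ((i k).f n).hom) y := by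
  refine congr_arg (fun f : (Π₀ k, (X k).X n) →ₗ[R] (Π₀ k, (X k).X n) => f y)
    (DFinsupp.lhom_ext (φ := ((dsumTelescope i).f n).hom) fun k x => ?_)
  exact (dsumDesc_f_single _ _ _ _).trans (telescope_single (fun k => ((i k).f n).hom) k x).symm

/-- A complex which is the union of coacyclic subcomplexes is coacyclic. -/
lemma coacyclic_of_union (K : CochainComplex (ModuleCat.{u} R) ℤ)
    (S : ℕ → ∀ i, Submodule R (K.X i)) (hS : ∀ k i j, ∀ x ∈ S k i, K.d i j x ∈ S k j)
    (hmono : ∀ k i, S k i ≤ S (k + 1) i) (hunion : ∀ i x, ∃ k, x ∈ S k i)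
    (h : ∀ k, coacyclic R ((toHot R).obj (subcomplex K (S k) (hS k)))) :
    coacyclic R ((toHot R).obj K) := by
  let X (k : ℕ) := subcomplex K (S k) (hS k)
  let i (k : ℕ) : X k ⟶ X (k + 1) :=
    { f := fun n => ModuleCat.ofHom (Submodule.inclusion (hmono k n))
      comm' := fun _ _ _ => rfl }
  let σ : dsum X ⟶ K := dsumDesc fun k => subcomplexι K (S k) (hS k)
  have hσ (n : ℤ) (k : ℕ) (x : S k n) : σ.f n (DFinsupp.single k x) = x.1 := dsumDesc_f_single _ _ _ _
  have hσt (n : ℤ) (y : Π₀ k, (X k).X n) : σ.f n (telescope (fun k => ((i k).f n).hom) y) = 0 := by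
    refine congr_arg (fun f : (Π₀ k, (X k).X n) →ₗ[R] K.X n => f y) (DFinsupp.lhom_ext
      (φ := (σ.f n).hom.comp (telescope fun k => ((i k).f n).hom)) (ψ := 0) fun k x => ?_)
    refine (congr_arg (σ.f n).hom (telescope_single _ _ _)).trans ?_
    refine (map_sub (σ.f n).hom _ _).trans ?_
    exact (congr_arg₂ (· - ·) (hσ n k x) (hσ n (k + 1) _)).trans (sub_self _)
  -- The telescope sequence: two copies of the direct sum of the subcomplexes, with quotient K.
  obtain ⟨w, hw⟩ := shortExact_of_elements (dsumTelescope i) σ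
    (fun n x y hxy => telescope_injective (fun k => ((i k).f n).hom)
      ((dsumTelescope_f_apply i n x).symm.trans (hxy.trans (dsumTelescope_f_apply i n y))))
    (fun n x => by
      obtain ⟨k, hk⟩ := hunion n x
      exact ⟨DFinsupp.single k ⟨x, hk⟩, hσ n k _⟩)
    (fun n y => (congr_arg (σ.f n).hom (dsumTelescope_f_apply i n y)).trans (hσt n y))
    (fun n y hy => by
      obtain ⟨N, hN⟩ := exists_sub_single_mem_range_telescope (fun k => ((i k).f n).hom) y
      obtain ⟨s, z, hz⟩ := hN N le_rfl
      have h := hσt n z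
      rw [hz] at h
      have h' : s = 0 := Subtype.ext <| by
        refine (hσ n N s).symm.trans ?_
        have := (map_sub (σ.f n).hom (show Π₀ k, (X k).X n from y) (DFinsupp.single N s)).symm.trans h
        exact (sub_eq_zero.1 this).symm.trans hy
      refine ⟨z, (dsumTelescope_f_apply i n z).trans (hz.trans ?_)⟩
      rw [h', DFinsupp.single_zero]
      exact sub_zero (show Π₀ k, (X k).X n from y))
  exact prop_X₃_of_total (coacyclic R) _ (.total _ hw) (coacyclic_dsum h) (coacyclic_dsum h)

end DirectSum

end CoContra

end

noncomputable section

namespace CoContra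

/-! ### Injective resolutions of complexes -/

section InjectiveResolutions

variable {R : Type u} [Ring R]

/-- The map of complexes `X ⟶ cone(g)[-1]` given by `f : X ⟶ I` with `f ≫ g = 0`. -/
def fibreLift {X I Y : CochainComplex (ModuleCat.{u} R) ℤ} (f : X ⟶ I) (g : I ⟶ Y) (w : f ≫ g = 0) :
    X ⟶ (mappingCone g)⟦(-1 : ℤ)⟧ where
  f n := f.f n ≫ (mappingCone.inl g).v n (n + -1) rfl
  comm' n m hnm := by
    have hnm : n + 1 = m := hnm
    have hd : ((mappingCone g)⟦(-1 : ℤ)⟧).d n m = - (mappingCone g).d (n + -1) (m + -1) := by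
      rw [CochainComplex.shiftFunctor_obj_d']
      simp
    have hw : f.f n ≫ g.f n = 0 := by
      rw [← HomologicalComplex.comp_f, w, HomologicalComplex.zero_f]
    obtain rfl : n = m + -1 := by lia
    have key : f.f (m + -1) ≫ (mappingCone.inl g).v (m + -1) (m + -1 + -1) rfl ≫
        (-(mappingCone g).d (m + -1 + -1) (m + -1)) =
          X.d (m + -1) m ≫ f.f m ≫ (mappingCone.inl g).v m (m + -1) rfl := by
      rw [Preadditive.comp_neg, mappingCone.inl_v_d g (m + -1) (m + -1 + -1) m rfl rfl, neg_sub,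
        Preadditive.comp_sub, reassoc_of% hw, zero_comp, sub_zero]
      exact f.comm_assoc _ _ _
    refine (congr_arg (fun φ : (mappingCone g).X (m + -1 + -1) ⟶ (mappingCone g).X (m + -1) =>
      (f.f (m + -1) ≫ (mappingCone.inl g).v (m + -1) (m + -1 + -1) rfl) ≫ φ) hd).trans ?_
    exact (Category.assoc _ _ _).trans key

/-- Embed X in a contractible complex I of injectives, put Q = I/X, and let Y be the fibre of I → Q,
with terms I^n ⊕ Q^{n-1}. The quotient Y/X is a shift of the cone of the identity of Q, hence
coacyclic, while each X^n → Y^n visibly passes through I^n. The terms of Y need not be better than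
those of X; the gain appears in the colimit. -/
lemma exists_mono_trW_factor (X : CochainComplex (ModuleCat.{u} R) ℤ) :
    ∃ (Y : CochainComplex (ModuleCat.{u} R) ℤ) (s : X ⟶ Y), (∀ n, Function.Injective (s.f n)) ∧
      (coacyclic R).trW ((toHot R).map s) ∧ ∀ n, ∃ (E : ModuleCat.{u} R) (a : X.X n ⟶ E)
        (b : E ⟶ Y.X n), Injective E ∧ a ≫ b = s.f n := by
  obtain ⟨I, f, hI, hf, -, -⟩ := exists_mono_contractible X
  obtain ⟨Q, g, w, hS, -⟩ := exists_shortExact_of_mono f hf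
  let c : mappingCone g ⟶ mappingCone (𝟙 Q) := mappingCone.map g (𝟙 Q) g (𝟙 Q) (by simp)
  have hex (n : ℤ) := shortExact_X hS n
  have hfst (p q : ℤ) (h : p + 1 = q) : c.f p ≫ (mappingCone.fst (𝟙 Q)).1.v p q h =
      (mappingCone.fst g).1.v p q h ≫ g.f q := by
    rw [mappingCone.ext_from_iff _ q p h]
    simp [c, mappingCone.map]
  have hsnd (p : ℤ) : c.f p ≫ (mappingCone.snd (𝟙 Q)).v p p (add_zero p) =
      (mappingCone.snd g).v p p (add_zero p) := by
    rw [mappingCone.ext_from_iff _ (p + 1) p rfl]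
    simp [c, mappingCone.map]
  have hinl (p q : ℤ) (h : p + 1 = q) : (mappingCone.inl g).v q p (by lia) ≫ c.f p =
      g.f q ≫ (mappingCone.inl (𝟙 Q)).v q p (by lia) := by
    simp [c, mappingCone.map]
  have hinr (p : ℤ) : (mappingCone.inr g).f p ≫ c.f p = (mappingCone.inr (𝟙 Q)).f p := by
    simp [c, mappingCone.map]
  have hinj (n : ℤ) : Function.Injective ((fibreLift f g w).f n) := by
    rw [← ModuleCat.mono_iff_injective]
    have h : (f.f n ≫ (mappingCone.inl g).v n (n + -1) rfl) ≫
        (mappingCone.fst g).1.v (n + -1) n (by lia) = f.f n := by simp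
    have := hf n
    exact mono_of_mono_fac h
  have hsurj (n : ℤ) : Function.Surjective (c.f n) := by
    intro y
    obtain ⟨a, ha⟩ := (ModuleCat.epi_iff_surjective _).1 (hex (n + 1)).epi_g
      ((mappingCone.fst (𝟙 Q)).1.v n (n + 1) rfl y)
    refine ⟨(mappingCone.inl g).v (n + 1) n (by lia) a +
      (mappingCone.inr g).f n ((mappingCone.snd (𝟙 Q)).v n n (add_zero n) y), ?_⟩
    refine (map_add (c.f n).hom _ _).trans ?_
    have h₁ := congr_arg (fun φ => φ.hom a) (hinl n (n + 1) rfl)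
    have h₂ := congr_arg (fun φ => φ.hom ((mappingCone.snd (𝟙 Q)).v n n (add_zero n) y)) (hinr n)
    have h₃ := congr_arg (fun φ => φ.hom y) (mappingCone.id_X (𝟙 Q) n (n + 1) rfl)
    refine (congr_arg₂ (· + ·) (h₁.trans ?_) h₂).trans h₃
    exact congr_arg ((mappingCone.inl (𝟙 Q)).v (n + 1) n (by lia)).hom ha
  -- The map c from the cone of I → Q to the cone of the identity of Q is surjective with kernel
  -- X[1].
  obtain ⟨w', hS'⟩ := shortExact_of_elements (fibreLift f g w) (c⟦(-1 : ℤ)⟧') hinj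
    (fun n => hsurj (n + -1)) (fun n x => by
      have h : (f.f n ≫ (mappingCone.inl g).v n (n + -1) rfl) ≫ c.f (n + -1) = 0 := by
        rw [Category.assoc, hinl _ n (by lia), ← Category.assoc, ← HomologicalComplex.comp_f, w]
        simp
      exact congr_arg (fun φ => φ.hom x) h) (fun n y hy => by
      have hy : c.f (n + -1) y = 0 := hy
      have h₁ := congr_arg (fun φ => φ.hom y) (hfst (n + -1) n (by lia))
      have h₂ := congr_arg (fun φ => φ.hom y) (hsnd (n + -1))
      have h₃ := congr_arg (fun φ => φ.hom y) (mappingCone.id_X g (n + -1) n (by lia))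
      have h₁' : g.f n ((mappingCone.fst g).1.v (n + -1) n (by lia) y) = 0 :=
        h₁.symm.trans ((congr_arg
          ((mappingCone.fst (𝟙 Q)).1.v (n + -1) n (by lia)).hom hy).trans (map_zero _))
      have h₂' : (mappingCone.snd g).v (n + -1) (n + -1) (by lia) y = 0 :=
        h₂.symm.trans ((congr_arg
          ((mappingCone.snd (𝟙 Q)).v (n + -1) (n + -1) (by lia)).hom hy).trans (map_zero _))
      obtain ⟨x, hx⟩ := (ShortComplex.moduleCat_exact_iff _).1 (hex n).exact _ h₁'
      refine ⟨x, Eq.trans ?_ h₃⟩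
      refine Eq.trans ?_ (congr_arg₂ (· + ·)
        (congr_arg ((mappingCone.inl g).v n (n + -1) (by lia)).hom hx)
        ((congr_arg ((mappingCone.inr g).f (n + -1)).hom h₂').trans (map_zero _)).symm)
      exact (add_zero _).symm)
  refine ⟨_, fibreLift f g w, hinj, trW_f_of_total (coacyclic R) _ (.total _ hS') ?_,
    fun n => ⟨I.X n, f.f n, _, hI n, rfl⟩⟩
  have hQ : coacyclic R ((toHot R).obj (mappingCone (𝟙 Q))) := by
    rw [← trW_map_iff (coacyclic R), (toHot R).map_id]
    exact (coacyclic R).trW.id_mem _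
  exact (coacyclic R).prop_of_iso (((toHot R).commShiftIso (-1 : ℤ)).app _).symm (.shift _ (-1) hQ)

/-- The colimit of a sequence of monomorphisms of complexes. -/
lemma exists_sequential_colimit {X : ℕ → CochainComplex (ModuleCat.{u} R) ℤ}
    (i : ∀ k, X k ⟶ X (k + 1)) (hi : ∀ k n, Function.Injective ((i k).f n)) :
    ∃ (T : CochainComplex (ModuleCat.{u} R) ℤ) (j : ∀ k, X k ⟶ T), (∀ k, i k ≫ j (k + 1) = j k) ∧
      (∀ k n, Function.Injective ((j k).f n)) ∧ ∀ n x, ∃ k y, (j k).f n y = x := by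
  have hd (n m : ℤ) (x) (hx : x ∈ LinearMap.range ((dsumTelescope i).f n).hom) :
      (dsum X).d n m x ∈ LinearMap.range ((dsumTelescope i).f m).hom := by
    obtain ⟨x, rfl⟩ := hx
    exact ⟨(dsum X).d n m x, (congr_arg (fun g => g.hom x) ((dsumTelescope i).comm n m)).symm⟩
  have hr (n : ℤ) (x : Π₀ k, (X k).X n) : x ∈ LinearMap.range ((dsumTelescope i).f n).hom ↔
      x ∈ LinearMap.range (telescope fun k => ((i k).f n).hom) :=
    ⟨fun ⟨y, hy⟩ => ⟨y, (dsumTelescope_f_apply i n y).symm.trans hy⟩,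
      fun ⟨y, hy⟩ => ⟨y, (dsumTelescope_f_apply i n y).trans hy⟩⟩
  refine ⟨_, fun k => dsumι k ≫ quotientComplexπ _ _ hd, fun k => ?_, fun k n => ?_, fun n x => ?_⟩
  · ext n x
    refine (Submodule.Quotient.eq _).2 ((hr n _).2 ⟨-DFinsupp.single k x, ?_⟩)
    rw [map_neg, telescope_single, neg_sub]
    rfl
  · refine (injective_iff_map_eq_zero ((dsumι k ≫ quotientComplexπ _ _ hd).f n).hom).2
      fun x hx => ?_
    exact eq_zero_of_single_mem_range_telescope _ (fun k => hi k n) k x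
      ((hr n _).1 ((Submodule.Quotient.mk_eq_zero _).1 hx))
  · obtain ⟨y, rfl⟩ := Submodule.Quotient.mk_surjective _ x
    obtain ⟨N, hN⟩ := exists_sub_single_mem_range_telescope (fun k => ((i k).f n).hom) y
    obtain ⟨s, hs⟩ := hN N le_rfl
    exact ⟨N, s, ((Submodule.Quotient.eq _).2 ((hr n _).2 hs)).symm⟩

section

variable {X : ℕ → CochainComplex (ModuleCat.{u} R) ℤ} (i : ∀ k, X k ⟶ X (k + 1))
  {T : CochainComplex (ModuleCat.{u} R) ℤ} (j : ∀ k, X k ⟶ T) (hij : ∀ k, i k ≫ j (k + 1) = j k)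
  (hj : ∀ k n, Function.Injective ((j k).f n)) (hT : ∀ n x, ∃ k y, (j k).f n y = x)

include hij in
lemma range_mono (n : ℤ) : Monotone fun k => LinearMap.range ((j k).f n).hom := by
  refine monotone_nat_of_le_succ fun k => ?_
  rintro _ ⟨x, rfl⟩
  exact ⟨(i k).f n x, congr_arg (fun f : X k ⟶ T => f.f n x) (hij k)⟩

include hij hj hT in
-- The quotient of T by the image of X₀ is the union of the complexes X_k/X₀, which are coacyclic
-- because X₀ → X_k is a finite composite of maps with coacyclic cone.
lemma trW_sequential_colimit (hi : ∀ k, (coacyclic R).trW ((toHot R).map (i k))) :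
    (coacyclic R).trW ((toHot R).map (j 0)) := by
  have h0 (k : ℕ) : ∃ a : X 0 ⟶ X k, a ≫ j k = j 0 ∧ (coacyclic R).trW ((toHot R).map a) := by
    induction k with
    | zero =>
      refine ⟨𝟙 _, Category.id_comp _, ?_⟩
      rw [(toHot R).map_id]
      exact (coacyclic R).trW.id_mem _
    | succ k ih =>
      obtain ⟨a, ha, ha'⟩ := ih
      refine ⟨a ≫ i k, by rw [Category.assoc, hij, ha], ?_⟩
      rw [Functor.map_comp]
      exact (coacyclic R).trW.comp_mem _ _ ha' (hi k)
  choose a ha ha' using h0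
  obtain ⟨Q, g, w, hS, -⟩ := exists_shortExact_of_mono (j 0)
    (fun n => (ModuleCat.mono_iff_injective _).2 (hj 0 n))
  refine (prop_X₃_iff_of_total (coacyclic R) _ (.total _ hS)).1 ?_
  have hg (n : ℤ) : Function.Surjective (g.f n) :=
    (ModuleCat.epi_iff_surjective _).1 (shortExact_X hS n).epi_g
  have hw (n : ℤ) (x : (X 0).X n) : g.f n ((j 0).f n x) = 0 :=
    congr_arg (fun f : X 0 ⟶ Q => f.f n x) w
  have hex (n : ℤ) (y : T.X n) (hy : g.f n y = 0) : ∃ x, (j 0).f n x = y :=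
    (ShortComplex.moduleCat_exact_iff _).1 (shortExact_X hS n).exact y hy
  have hd (k : ℕ) (n m : ℤ) (x) (hx : x ∈ LinearMap.range ((j k ≫ g).f n).hom) :
      Q.d n m x ∈ LinearMap.range ((j k ≫ g).f m).hom := by
    obtain ⟨x, rfl⟩ := hx
    exact ⟨(X k).d n m x, (congr_arg (fun g => g.hom x) ((j k ≫ g).comm n m)).symm⟩
  refine coacyclic_of_union Q (fun k n => LinearMap.range ((j k ≫ g).f n).hom) hd ?_ ?_ fun k => ?_
  · rintro k n _ ⟨x, rfl⟩
    exact ⟨(i k).f n x, congr_arg (fun f : X k ⟶ T => g.f n (f.f n x)) (hij k)⟩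
  · intro n x
    obtain ⟨y, rfl⟩ := hg n x
    obtain ⟨k, z, rfl⟩ := hT n y
    exact ⟨k, z, rfl⟩
  · let p : X k ⟶ subcomplex Q _ (hd k) :=
      { f := fun n => ModuleCat.ofHom ((j k ≫ g).f n).hom.rangeRestrict
        comm' := fun n m _ => by
          ext x
          exact Subtype.ext (congr_arg (fun g => g.hom x) ((j k ≫ g).comm n m)) }
    have hak (n : ℤ) (x : (X 0).X n) : (j k).f n ((a k).f n x) = (j 0).f n x :=
      congr_arg (fun f : X 0 ⟶ T => f.f n x) (ha k)
    obtain ⟨w', hS'⟩ := shortExact_of_elements (a k) p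
      (fun n x y hxy => hj 0 n ((hak n x).symm.trans ((congr_arg ((j k).f n) hxy).trans (hak n y))))
      (fun n => LinearMap.surjective_rangeRestrict _)
      (fun n x => Subtype.ext ((congr_arg (g.f n) (hak n x)).trans (hw n x)))
      (fun n y hy => by
        obtain ⟨x, hx⟩ := hex n ((j k).f n y) (congr_arg Subtype.val hy)
        exact ⟨x, hj k n ((hak n x).trans hx)⟩)
    exact (prop_X₃_iff_of_total (coacyclic R) _ (.total _ hS')).2 (ha' k)

include hij hj hT in
-- A map from a finitely generated K lands in some X_N; since X_N → X_{N+1} passes through an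
-- injective, it extends after one more step. Arbitrary injectives need not be stable under such
-- colimits, which is why fp-injectives intervene.
lemma fpExt_sequential_colimit (n : ℤ) (hE : ∀ k, ∃ (E : ModuleCat.{u} R) (a : (X k).X n ⟶ E)
    (b : E ⟶ (X (k + 1)).X n), Injective E ∧ a ≫ b = (i k).f n) : FPExt R (T.X n) := by
  intro m K hK g
  have hN : ∃ N, LinearMap.range g ≤ LinearMap.range ((j N).f n).hom := by
    have : Module.Finite R K := Module.Finite.iff_fg.2 hK
    obtain ⟨s, hs⟩ := Module.Finite.fg_top (R := R) (M := K)
    choose k y hy using fun x : K => hT n (g x)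
    refine ⟨s.sup k, ?_⟩
    rw [LinearMap.range_eq_map, ← hs, Submodule.map_span_le]
    exact fun x hx => range_mono i j hij n (Finset.le_sup hx) ⟨y x, hy x⟩
  obtain ⟨N, hN⟩ := hN
  obtain ⟨E, a, b, hE, hab⟩ := hE N
  let e := LinearEquiv.ofInjective ((j N).f n).hom (hj N n)
  let g' : K →ₗ[R] (X N).X n := e.symm.toLinearMap.comp
    (g.codRestrict _ fun x => hN (LinearMap.mem_range_self g x))
  have hg' (x : K) : (j N).f n (g' x) = g x := congr_arg Subtype.val (e.apply_symm_apply _)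
  have : Mono (ModuleCat.ofHom K.subtype) :=
    (ModuleCat.mono_iff_injective _).2 K.injective_subtype
  refine ⟨(Injective.factorThru (ModuleCat.ofHom g' ≫ a) (ModuleCat.ofHom K.subtype) ≫
    b ≫ (j (N + 1)).f n).hom, fun x => ?_⟩
  refine Eq.trans ?_ (hg' x)
  have h := Injective.comp_factorThru (ModuleCat.ofHom g' ≫ a) (ModuleCat.ofHom K.subtype)
  have h' : ModuleCat.ofHom K.subtype ≫ (Injective.factorThru (ModuleCat.ofHom g' ≫ a)
      (ModuleCat.ofHom K.subtype) ≫ b ≫ (j (N + 1)).f n) = ModuleCat.ofHom g' ≫ (j N).f n := by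
    rw [reassoc_of% h, reassoc_of% hab, ← hij N, HomologicalComplex.comp_f]
  exact congr_arg (fun f => f.hom x) h'

end

/-- Countably many iterations of the embedding step suffice. -/
lemma exists_trW_fpExt (X : CochainComplex (ModuleCat.{u} R) ℤ) :
    ∃ (T : CochainComplex (ModuleCat.{u} R) ℤ) (s : X ⟶ T), (∀ n, FPExt R (T.X n)) ∧
      (coacyclic R).trW ((toHot R).map s) := by
  choose Y s hs hs' hE using exists_mono_trW_factor (R := R)
  let Z (k : ℕ) : CochainComplex (ModuleCat.{u} R) ℤ := Nat.rec X (fun _ => Y) k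
  obtain ⟨T, j, hij, hj, hT⟩ := exists_sequential_colimit (X := Z) (fun k => s (Z k))
    (fun k => hs (Z k))
  exact ⟨T, j 0, fun n => fpExt_sequential_colimit _ j hij hj hT n fun k => hE (Z k) n,
    trW_sequential_colimit _ j hij hj hT fun k => hs' (Z k)⟩

/-- Otherwise, choose for every k an fp-injective module of injective dimension greater than k.
Their product is fp-injective, hence of some finite dimension n, yet its n-th factor is a retract of
it. -/
lemma exists_injectiveDimension_bound (hfin : ∀ J : ModuleCat.{u} R, IsFPInjective J →
    ∃ n : ℕ, HasInjectiveDimensionLE J n) :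
    ∃ k : ℕ, ∀ J : ModuleCat.{u} R, FPExt R J → HasInjectiveDimensionLT J (k + 1) := by
  by_contra! h
  choose J hJ hJ' using h
  obtain ⟨n, hn⟩ := hfin (ModuleCat.of R (∀ k, J k))
    ((isFPInjective_iff (ModuleCat.of R (∀ k, J k))).2 (FPExt.pi hJ))
  refine hJ' n (Retract.hasInjectiveDimensionLT (Y := ModuleCat.of R (∀ k, J k)) ?_ (n + 1))
  exact
    { i := ModuleCat.ofHom (LinearMap.single R (fun k => J k) n)
      r := ModuleCat.ofHom (LinearMap.proj n)
      retract := by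
        ext x
        exact Pi.single_eq_same (M := fun k => J k) n x }

section

variable (hfin : ∀ J : ModuleCat.{u} R, IsFPInjective J → ∃ n : ℕ, HasInjectiveDimensionLE J n)

include hfin

/-- Bounded injective resolutions of complexes of fp-injective modules. -/
lemma exists_injective_resolution_of_fpExt : ∃ c : ℕ,
    ∀ (X : CochainComplex (ModuleCat.{u} R) ℤ), (∀ n, FPExt R (X.X n)) → ∀ U : Set ℤ,
      (∀ i ∉ U, IsZero (X.X i)) → ∃ (J : CochainComplex (ModuleCat.{u} R) ℤ) (s : X ⟶ J),
        (∀ i, Injective (J.X i)) ∧ (coacyclic R).trW ((toHot R).map s) ∧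
        ∀ i ∉ thicken U c, IsZero (J.X i) := by
  obtain ⟨k, hk⟩ := exists_injectiveDimension_bound hfin
  exact ⟨2 * k, fun X hX U hU => exists_injective_resolution_of_dim (coacyclic R)
    (fun S hS => .total S hS) k X (fun n => hk _ (hX n)) U hU⟩

lemma exists_injective_resolution (X : CochainComplex (ModuleCat.{u} R) ℤ) :
    ∃ (J : CochainComplex (ModuleCat.{u} R) ℤ) (s : X ⟶ J),
      (∀ i, Injective (J.X i)) ∧ (coacyclic R).trW ((toHot R).map s) := by
  obtain ⟨c, hc⟩ := exists_injective_resolution_of_fpExt hfin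
  obtain ⟨T, s, hT, hs⟩ := exists_trW_fpExt X
  obtain ⟨J, t, hJ, ht, -⟩ := hc T hT Set.univ (fun i hi => (hi trivial).elim)
  refine ⟨J, s ≫ t, hJ, ?_⟩
  rw [Functor.map_comp]
  exact (coacyclic R).trW.comp_mem _ _ hs ht

end

end InjectiveResolutions

end CoContra

end

noncomputable section

namespace CoContra

/-! ### Flat resolutions of complexes -/

section Towers

variable {R : Type u} [Ring R]

/-- The limit of a tower of surjective maps which factor through projective modules is flat. -/
lemma baer_charMod_of_tower (hR : IsRightCoherent R) {X P : ℕ → Type u}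
    [∀ k, AddCommGroup (X k)] [∀ k, Module R (X k)] [∀ k, AddCommGroup (P k)] [∀ k, Module R (P k)]
    (s : ∀ k, X (k + 1) →ₗ[R] P k) (p : ∀ k, P k →ₗ[R] X k)
    (hq : ∀ k, Function.Surjective ((p k).comp (s k))) (hP : ∀ k, Module.Projective R (P k))
    (T : Submodule R (∀ k, X k)) (hT : ∀ x, x ∈ T ↔ ∀ k, p k (s k (x (k + 1))) = x k) :
    Module.Baer Rᵐᵒᵖ (CharMod T) := by
  have hb : Module.Baer Rᵐᵒᵖ (CharMod (∀ k, P k)) :=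
    (RelSolvable.pi fun k => RelSolvable.of_projective (P k)).baer hR
  -- The towers X and P interleave, so the limit of X is the kernel of 1 - shift on the product of
  -- the P_k. That map is surjective, by recursive lifting through the surjections p s, and the
  -- product is flat by coherence; so the kernel is flat.
  refine baer_charMod_of_exact (LinearMap.pi fun k => (s k).comp ((LinearMap.proj (k + 1)).comp
    T.subtype)) (LinearMap.pi fun k => LinearMap.proj k - ((s k).comp ((p (k + 1)).comp
      (LinearMap.proj (k + 1))))) ?_ ?_ ?_ hb hb
  · rw [injective_iff_map_eq_zero]
    intro x hx
    refine Subtype.ext (funext fun k => ?_)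
    have h : s k (x.1 (k + 1)) = 0 := congr_fun hx k
    rw [← (hT x.1).1 x.2 k, h, map_zero]
    rfl
  · intro d
    choose q hq' using hq
    let x (k : ℕ) : X k := Nat.rec 0 (fun k y => q k (y - p k (d k))) k
    have hx (k : ℕ) : p k (s k (x (k + 1))) = x k - p k (d k) := hq' k _
    refine ⟨fun k => d k + s k (x (k + 1)), funext fun k => ?_⟩
    change d k + s k (x (k + 1)) - s k (p (k + 1) (d (k + 1) + s (k + 1) (x (k + 1 + 1)))) = d k
    rw [map_add (p (k + 1)), hx, add_sub_cancel, add_sub_cancel_right]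
  · intro c
    constructor
    · intro hc
      have hc' (k : ℕ) : s k (p (k + 1) (c (k + 1))) = c k :=
        (sub_eq_zero.1 (congr_fun hc k : c k - s k (p (k + 1) (c (k + 1))) = 0)).symm
      exact ⟨⟨fun k => p k (c k), (hT _).2 fun k => by rw [hc']⟩, funext hc'⟩
    · rintro ⟨x, rfl⟩
      refine funext fun k => ?_
      change s k (x.1 (k + 1)) - s k (p (k + 1) (s (k + 1) (x.1 (k + 1 + 1)))) = 0
      rw [(hT x.1).1 x.2 (k + 1), sub_self]

/-- The product of a sequence of complexes. -/
def dprod (X : ℕ → CochainComplex (ModuleCat.{u} R) ℤ) : CochainComplex (ModuleCat.{u} R) ℤ where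
  X n := ModuleCat.of R (∀ k, (X k).X n)
  d n m := ModuleCat.ofHom (LinearMap.pi fun k => ((X k).d n m).hom.comp (LinearMap.proj k))
  shape n m h := by
    refine ModuleCat.hom_ext (LinearMap.ext fun y => funext fun k => ?_)
    change (X k).d n m _ = 0
    rw [(X k).shape n m h]
    rfl
  d_comp_d' n m p _ _ := by
    refine ModuleCat.hom_ext (LinearMap.ext fun y => funext fun k => ?_)
    change ((X k).d n m ≫ (X k).d m p) _ = 0
    rw [(X k).d_comp_d]
    rfl

variable {X : ℕ → CochainComplex (ModuleCat.{u} R) ℤ}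

/-- The projection from a product. -/
def dprodπ (k : ℕ) : dprod X ⟶ X k where
  f n := ModuleCat.ofHom (LinearMap.proj (R := R) (φ := fun k => (X k).X n) k)
  comm' _ _ _ := rfl

/-- The map to a product given by its components. -/
def dprodLift {K : CochainComplex (ModuleCat.{u} R) ℤ} (f : ∀ k, K ⟶ X k) : K ⟶ dprod X where
  f n := ModuleCat.ofHom (LinearMap.pi fun k => ((f k).f n).hom)
  comm' n m _ := ModuleCat.hom_ext (LinearMap.ext fun x => funext fun k =>
    congr_arg (fun g => g.hom x) ((f k).comm n m))

lemma dprodLift_π {K : CochainComplex (ModuleCat.{u} R) ℤ} (f : ∀ k, K ⟶ X k) (k : ℕ) :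
    dprodLift f ≫ dprodπ k = f k := rfl

lemma dprod_hom_ext {K : CochainComplex (ModuleCat.{u} R) ℤ} {f g : K ⟶ dprod X}
    (h : ∀ k, f ≫ dprodπ k = g ≫ dprodπ k) : f = g := by
  ext n : 1
  refine ModuleCat.hom_ext (LinearMap.ext fun x => funext fun k => ?_)
  exact congr_arg (fun φ : K ⟶ X k => (φ.f n).hom x) (h k)

lemma contraacyclic_dprod (hX : ∀ k, contraacyclic R ((toHot R).obj (X k))) :
    contraacyclic R ((toHot R).obj (dprod X)) := by
  have h := contraacyclic.product (ULift.{u} ℕ) (fun k => X k.down) (fun k => hX k.down)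
  refine (contraacyclic R).prop_of_iso ((toHot R).mapIso ?_) h
  exact
    { hom := dprodLift fun k => Pi.π (fun k : ULift.{u} ℕ => X k.down) (ULift.up k)
      inv := Pi.lift fun k => dprodπ k.down
      hom_inv_id := by
        refine Pi.hom_ext _ _ fun k => ?_
        rw [Category.assoc, Pi.lift_π, Category.id_comp, dprodLift_π]
      inv_hom_id := by
        refine dprod_hom_ext fun k => ?_
        rw [Category.assoc, dprodLift_π, Pi.lift_π, Category.id_comp] }

/-- The limit of a tower of contraacyclic complexes with surjective maps is contraacyclic. -/
lemma contraacyclic_of_tower (q : ∀ k, X (k + 1) ⟶ X k)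
    (hq : ∀ k n, Function.Surjective ((q k).f n)) (hX : ∀ k, contraacyclic R ((toHot R).obj (X k)))
    (N : CochainComplex (ModuleCat.{u} R) ℤ) (π : ∀ k, N ⟶ X k)
    (hπq : ∀ k, π (k + 1) ≫ q k = π k)
    (hinj : ∀ n (x : N.X n), (∀ k, (π k).f n x = 0) → x = 0)
    (hex : ∀ n (y : ∀ k, (X k).X n), (∀ k, (q k).f n (y (k + 1)) = y k) →
      ∃ x, ∀ k, (π k).f n x = y k) : contraacyclic R ((toHot R).obj N) := by
  -- The Milnor sequence 0 → N → ∏ X_k → ∏ X_k → 0; it is exact on the right because the transition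
  -- maps are surjective.
  obtain ⟨w, hS⟩ := shortExact_of_elements (dprodLift π)
    (dprodLift fun k => dprodπ k - dprodπ (k + 1) ≫ q k)
    (fun n => (injective_iff_map_eq_zero ((dprodLift π).f n).hom).2 fun x hx =>
      hinj n x fun k => congr_fun hx k)
    (fun n z => by
      choose p hp using fun k => hq k n
      let y (k : ℕ) : (X k).X n := Nat.rec 0 (fun k y => p k (y - z k)) k
      refine ⟨y, funext fun k => ?_⟩
      change y k - (q k).f n (p k (y k - z k)) = z k
      rw [hp, sub_sub_cancel])
    (fun n x => funext fun k => by
      change (π k).f n x - (π (k + 1) ≫ q k).f n x = 0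
      rw [hπq, sub_self])
    (fun n y hy => by
      obtain ⟨x, hx⟩ := hex n y fun k => (sub_eq_zero.1 (congr_fun hy k)).symm
      exact ⟨x, funext hx⟩)
  exact (prop_iff_of_trW (contraacyclic R) (trW_f_of_total (contraacyclic R) _ (.total _ hS)
    (contraacyclic_dprod hX))).2 (contraacyclic_dprod hX)

lemma trW_of_postcomp (P : ObjectProperty (Hot R)) [P.IsTriangulated]
    [P.IsClosedUnderIsomorphisms] {K L M : Hot R} (f : K ⟶ L) (g : L ⟶ M) (hg : P.trW g)
    (hfg : P.trW (f ≫ g)) : P.trW f := by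
  obtain ⟨Z, a, b, hZ⟩ := distinguished_cocone_triangle f
  obtain ⟨_, _, _, hT, h⟩ := hg
  obtain ⟨_, _, _, hT', h'⟩ := hfg
  exact ⟨Z, a, b, hZ, P.ext_of_isTriangulatedClosed₁ _
    (Triangulated.someOctahedron rfl hZ hT hT').mem h' h⟩

/-- Conversely to `trW_g_of_total`: if g is a `P`-equivalence, so is the inclusion of X₂ in the cone
of f, whose cone is X₁[1]. -/
lemma prop_X₁_iff_of_total (P : ObjectProperty (Hot R)) [P.IsTriangulated]
    [P.IsClosedUnderIsomorphisms] (S : ShortComplex (CochainComplex (ModuleCat.{u} R) ℤ))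
    (hS : P ((toHot R).obj (totalComplex S))) :
    P ((toHot R).obj S.X₁) ↔ P.trW ((toHot R).map S.g) := by
  refine ⟨trW_g_of_total P S hS, fun h => ?_⟩
  have h1 : P.trW ((toHot R).map (mappingCone.inr S.f)) := by
    refine trW_of_postcomp P _
      ((toHot R).map (mappingCone.desc S.f 0 S.g (by simp) : mappingCone S.f ⟶ S.X₃))
      (trW_desc_of_total P S hS) ?_
    rwa [← Functor.map_comp, mappingCone.inr_desc]
  have h2 : P (((toHot R).obj S.X₁)⟦(1 : ℤ)⟧) := (P.trW_iff_of_distinguished _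
    (rot_of_distTriang _ (HomotopyCategory.mappingCone_triangleh_distinguished S.f))).1 h1
  exact P.prop_of_iso ((shiftShiftNeg ((toHot R).obj S.X₁) (1 : ℤ)))
    (ObjectProperty.IsStableUnderShift.isStableUnderShiftBy (-1 : ℤ) |>.le_shift _ h2)

/-- The limit of a tower of surjective maps of complexes. -/
lemma exists_sequential_limit (q : ∀ k, X (k + 1) ⟶ X k)
    (hq : ∀ k n, Function.Surjective ((q k).f n))
    (hq' : ∀ k, (contraacyclic R).trW ((toHot R).map (q k))) :
    ∃ (S : ∀ n, Submodule R (∀ k, (X k).X n))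
      (hS : ∀ n m, ∀ x ∈ S n, (dprod X).d n m x ∈ S m) (π : subcomplex (dprod X) S hS ⟶ X 0),
      (∀ n x, x ∈ S n ↔ ∀ k, (q k).f n (x (k + 1)) = x k) ∧
      (contraacyclic R).trW ((toHot R).map π) := by
  let S (n : ℤ) : Submodule R (∀ k, (X k).X n) :=
    ⨅ k, LinearMap.ker (((q k).f n).hom.comp
      (LinearMap.proj (R := R) (φ := fun k => (X k).X n) (k + 1)) - LinearMap.proj k)
  have hmem (n : ℤ) (x : ∀ k, (X k).X n) : x ∈ S n ↔ ∀ k, (q k).f n (x (k + 1)) = x k := by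
    rw [Submodule.mem_iInf]
    exact forall_congr' fun k => LinearMap.mem_ker.trans sub_eq_zero
  have hS (n m : ℤ) (x : ∀ k, (X k).X n) (hx : x ∈ S n) : (dprod X).d n m x ∈ S m := by
    refine (hmem m _).2 fun k => ?_
    refine (congr_arg (fun g => g.hom (x (k + 1))) ((q k).comm n m)).symm.trans ?_
    exact congr_arg ((X k).d n m).hom ((hmem n x).1 hx k)
  let T := subcomplex (dprod X) S hS
  let π (k : ℕ) : T ⟶ X k := subcomplexι (dprod X) S hS ≫ dprodπ k
  have hπq (k : ℕ) : π (k + 1) ≫ q k = π k := by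
    ext n x
    exact (hmem n x.1).1 x.2 k
  refine ⟨S, hS, π 0, hmem, ?_⟩
  let r (k : ℕ) : X k ⟶ X 0 := Nat.rec (motive := fun k => (X k ⟶ X 0)) (𝟙 _) (fun k r => q k ≫ r) k
  have hr (k : ℕ) : r (k + 1) = q k ≫ r k := rfl
  have hrW (k : ℕ) : (contraacyclic R).trW ((toHot R).map (r k)) := by
    induction k with
    | zero =>
      change (contraacyclic R).trW ((toHot R).map (𝟙 _))
      rw [(toHot R).map_id]
      exact (contraacyclic R).trW.id_mem _
    | succ k ih =>
      rw [hr, Functor.map_comp]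
      exact (contraacyclic R).trW.comp_mem _ _ (hq' k) ih
  have hrs (k : ℕ) (n : ℤ) : Function.Surjective ((r k).f n) := by
    induction k with
    | zero => exact fun x => ⟨x, rfl⟩
    | succ k ih => exact ih.comp (hq k n)
  have hπr (k : ℕ) : π k ≫ r k = π 0 := by
    induction k with
    | zero => exact Category.comp_id _
    | succ k ih => rw [hr, reassoc_of% hπq, ih]
  have hπs (n : ℤ) : Function.Surjective ((π 0).f n) := by
    intro y
    choose p hp using fun k => hq k n
    let x (k : ℕ) : (X k).X n := Nat.rec y (fun k y => p k y) k
    exact ⟨⟨x, (hmem n x).2 fun k => hp k _⟩, rfl⟩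
  have hd {K L : CochainComplex (ModuleCat.{u} R) ℤ} (f : K ⟶ L) (n m : ℤ) (x)
      (hx : x ∈ LinearMap.ker (f.f n).hom) : K.d n m x ∈ LinearMap.ker (f.f m).hom :=
    LinearMap.mem_ker.2 ((congr_arg (fun g => g.hom x) (f.comm n m)).symm.trans
      ((congr_arg (L.d n m).hom hx).trans (map_zero _)))
  have hses {K L : CochainComplex (ModuleCat.{u} R) ℤ} (f : K ⟶ L)
      (hf : ∀ n, Function.Surjective (f.f n)) :
      contraacyclic R ((toHot R).obj (subcomplex K (fun n => LinearMap.ker (f.f n).hom) (hd f))) ↔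
        (contraacyclic R).trW ((toHot R).map f) := by
    obtain ⟨w, hw⟩ := shortExact_of_elements (subcomplexι K _ (hd f)) f
      (fun n => Submodule.injective_subtype _) hf (fun n x => x.2) (fun n y hy => ⟨⟨y, hy⟩, rfl⟩)
    exact prop_X₁_iff_of_total (contraacyclic R) _ (.total _ hw)
  -- It suffices that the kernel of the projection to X₀ is contraacyclic; it is the limit of the
  -- kernels of X_k → X₀, a tower of contraacyclic complexes with surjective maps.
  rw [← hses (π 0) hπs]
  have hkq (k : ℕ) (n : ℤ) (x : (X (k + 1)).X n) (hx : x ∈ LinearMap.ker ((r (k + 1)).f n).hom) :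
      (q k).f n x ∈ LinearMap.ker ((r k).f n).hom := hx
  have hkπ (k : ℕ) (n : ℤ) (x : T.X n) (hx : x ∈ LinearMap.ker ((π 0).f n).hom) :
      (π k).f n x ∈ LinearMap.ker ((r k).f n).hom :=
    LinearMap.mem_ker.2 ((congr_arg (fun g : T ⟶ X 0 => g.f n x) (hπr k)).trans hx)
  refine contraacyclic_of_tower
    (X := fun k => subcomplex (X k) (fun n => LinearMap.ker ((r k).f n).hom) (hd (r k)))
    (fun k => { f := fun n => ModuleCat.ofHom (((q k).f n).hom.restrict (hkq k n))
                comm' := fun n m _ => ?_ }) (fun k n y => ?_)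
    (fun k => (hses (r k) (hrs k)).2 (hrW k)) _
    (fun k => { f := fun n => ModuleCat.ofHom (((π k).f n).hom.restrict (hkπ k n))
                comm' := fun n m _ => rfl }) (fun k => ?_) (fun n x hx => ?_) (fun n y hy => ?_)
  · ext x
    exact Subtype.ext (congr_arg (fun g => g.hom x.1) ((q k).comm n m))
  · obtain ⟨x, hx⟩ := hq k n y.1
    exact ⟨⟨x, (congr_arg ((r k).f n).hom hx).trans y.2⟩, Subtype.ext hx⟩
  · ext n x
    exact Subtype.ext (congr_arg (fun g : T ⟶ X k => g.f n x.1) (hπq k))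
  · exact Subtype.ext (Subtype.ext (funext fun k => congr_arg Subtype.val (hx k)))
  · exact ⟨⟨⟨fun k => (y k).1, (hmem n _).2 fun k => congr_arg Subtype.val (hy k)⟩, (y 0).2⟩,
      fun k => rfl⟩

/-- The dual step: cover X by a contractible complex I of projectives with kernel K, and let Y be
the cone of K → I, with terms K^{n+1} ⊕ I^n. In each degree the map to X passes through the
projective I^n. -/
lemma exists_epi_trW_factor (X : CochainComplex (ModuleCat.{u} R) ℤ) :
    ∃ (Y : CochainComplex (ModuleCat.{u} R) ℤ) (s : Y ⟶ X), (∀ n, Function.Surjective (s.f n)) ∧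
      (contraacyclic R).trW ((toHot R).map s) ∧ ∀ n, ∃ (E : ModuleCat.{u} R) (a : Y.X n ⟶ E)
        (b : E ⟶ X.X n), Projective E ∧ a ≫ b = s.f n := by
  obtain ⟨I, g, hI, hg, -, -⟩ := exists_epi_contractible X
  obtain ⟨K, f, w, hS, -⟩ := exists_shortExact_of_epi g hg
  let c : mappingCone f ⟶ X := mappingCone.desc f 0 g (by simp [w])
  refine ⟨mappingCone f, c, fun n => ?_,
    trW_desc_of_total (contraacyclic R) (ShortComplex.mk f g w) (.total _ hS),
    fun n => ⟨I.X n, (mappingCone.snd f).v n n (add_zero n), g.f n, hI n, ?_⟩⟩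
  · rw [← ModuleCat.epi_iff_surjective]
    have h : (mappingCone.inr f).f n ≫ c.f n = g.f n := mappingCone.inr_f_desc_f _ _ _ _ _
    have := hg n
    exact epi_of_epi_fac h
  · rw [mappingCone.ext_from_iff _ (n + 1) n rfl]
    simp [c]

/-- Flat resolutions of complexes. -/
lemma exists_trW_flat (hR : IsRightCoherent R) (X : CochainComplex (ModuleCat.{u} R) ℤ) :
    ∃ (T : CochainComplex (ModuleCat.{u} R) ℤ) (s : T ⟶ X), (∀ n, IsFlat (T.X n)) ∧
      (contraacyclic R).trW ((toHot R).map s) := by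
  choose Y s hs hs' E a b hE hab using exists_epi_trW_factor (R := R)
  let Z (k : ℕ) : CochainComplex (ModuleCat.{u} R) ℤ := Nat.rec X (fun _ => Y) k
  obtain ⟨S, hS, π, hmem, hπ⟩ := exists_sequential_limit (X := Z) (fun k => s (Z k))
    (fun k => hs (Z k)) (fun k => hs' (Z k))
  refine ⟨_, π, fun n => (isFlat_iff_baer _).2 ?_, hπ⟩
  have h (k : ℕ) (x : (Z (k + 1)).X n) : b (Z k) n (a (Z k) n x) = (s (Z k)).f n x :=
    congr_arg (fun g => g.hom x) (hab (Z k) n)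
  refine baer_charMod_of_tower hR (X := fun k => (Z k).X n) (P := fun k => E (Z k) n)
    (fun k => (a (Z k) n).hom) (fun k => (b (Z k) n).hom) (fun k y => ?_)
    (fun k => (IsProjective.iff_projective (E (Z k) n)).2 (hE (Z k) n)) (S n) (fun x => ?_)
  · obtain ⟨x, hx⟩ := hs (Z k) n y
    exact ⟨x, (h k x).trans hx⟩
  · exact (hmem n x).trans (forall_congr' fun k => by rw [← h k])

end Towers

end CoContra

end

open MulOpposite

noncomputable section

namespace CoContra

/-! ### Complexes of flat modules and the tensor product -/

section FlatComplexes

/-- Let s : X → J be an injective resolution. Since s = 0, the identity of J factors through the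
cone of s, which is coacyclic and so has no nonzero maps to J. Hence J = 0 and X is coacyclic. -/
lemma coacyclic_of_forall_hom_eq_zero {R : Type u} [Ring R]
    (hfin : ∀ J : ModuleCat.{u} R, IsFPInjective J → ∃ n : ℕ, HasInjectiveDimensionLE J n)
    (X : Hot R) (hX : ∀ (J : CochainComplex (ModuleCat.{u} R) ℤ), (∀ i, Injective (J.X i)) →
      ∀ f : X ⟶ (toHot R).obj J, f = 0) : coacyclic R X := by
  obtain ⟨X, rfl⟩ := HomotopyCategory.quotient_obj_surjective X
  obtain ⟨J, s, hJ, hs⟩ := exists_injective_resolution hfin X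
  have h0 := hX J hJ ((toHot R).map s)
  have hC := (trW_map_iff (coacyclic R) s).1 hs
  obtain ⟨g, hg⟩ := Triangle.yoneda_exact₂ _
    (HomotopyCategory.mappingCone_triangleh_distinguished s) (𝟙 _)
    ((congr_arg (· ≫ 𝟙 _) h0).trans zero_comp)
  have hg0 : g = 0 := rightOrthogonal_coacyclic J hJ g hC
  have hJ0 : IsZero ((toHot R).obj J) := by
    rw [IsZero.iff_id_eq_zero]
    exact hg.trans ((congr_arg (_ ≫ ·) hg0).trans comp_zero)
  exact (prop_iff_of_trW (coacyclic R) hs).2 (.zero _ hJ0)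

variable {A B : Type u} [Ring A] [Ring B] (D : CochainComplex (BimodCat A B) ℤ)

/-- The complex of `D` with values in a complex of injective modules has the extension property
for submodules with flat quotient. -/
lemma exists_extension_homFunctor {S : ShortComplex (ModuleCat.{u} B)} (hS : S.ShortExact)
    (hS₃ : IsFlat S.X₃) (J : CochainComplex (ModuleCat.{u} A) ℤ) (hJ : ∀ i, Injective (J.X i)) (q : ℤ)
    (f : S.X₁ ⟶ ((homFunctor D).obj J).X q) :
    ∃ g : S.X₂ ⟶ ((homFunctor D).obj J).X q, S.f ≫ g = f := by
  have hex : Function.Exact S.f.hom S.g.hom := fun y =>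
    ⟨(ShortComplex.moduleCat_exact_iff _).1 hS.exact y, by
      rintro ⟨x, rfl⟩
      exact congr_arg (fun f => f.hom x) S.zero⟩
  have key (p k : ℤ) (h : p + q = k) := exists_extension_balanced (E := D.X p) (A := A) S.f.hom
    S.g.hom ((ModuleCat.mono_iff_injective _).1 hS.mono_f)
    ((ModuleCat.epi_iff_surjective _).1 hS.epi_g) hex ((isFlat_iff_baer _).1 hS₃)
    (baer_of_injective (hJ k)) (AddMonoidHom.mk' (fun x => cochainApply (f.hom x) p k h)
      (fun x y => by rw [map_add]; rfl)) (fun b x e => by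
        change cochainApply (f.hom (b • x)) p k h e = _
        rw [map_smul]
        exact cochainApply_smul D b _ p k h e)
  choose ψ hψ hψ' using key
  refine ⟨ModuleCat.ofHom (Y := Cochain (leftComplex D) J q)
    { toFun := fun x => cochainMk fun p k h => ψ p k h x
      map_add' := fun x y => cochain_ext fun p k h e => by
        rw [cochainApply_add, cochainApply_mk, cochainApply_mk, cochainApply_mk, map_add]
        rfl
      map_smul' := fun b x => cochain_ext fun p k h e => by
        rw [RingHom.id_apply, cochainApply_smul, cochainApply_mk, cochainApply_mk]
        exact hψ p k h b x e }, ?_⟩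
  ext x : 2
  refine cochain_ext fun p k h e => ?_
  exact congr_arg (fun f : D.X p →ₗ[A] J.X k => f e) (hψ' p k h x)

lemma hom_totalComplex_eq_zero {S : ShortComplex (CochainComplex (ModuleCat.{u} B) ℤ)}
    (hS : S.ShortExact) (hS₃ : ∀ i, IsFlat (S.X₃.X i)) (J : CochainComplex (ModuleCat.{u} A) ℤ)
    (hJ : ∀ i, Injective (J.X i))
    (f : (toHot B).obj (totalComplex S) ⟶ (homHot D).obj ((toHot A).obj J)) : f = 0 := by
  obtain ⟨f, rfl⟩ : ∃ f' : totalComplex S ⟶ (homFunctor D).obj J, (toHot B).map f' = f :=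
    (toHot B).map_surjective f
  exact (HomotopyCategory.quotient_map_eq_zero_iff _).2 (homotopy_zero_of_totalComplex_to hS
    ((homFunctor D).obj J) (fun p q w =>
      exists_extension_homFunctor D (shortExact_X hS p) (hS₃ p) J hJ q w) f)

/-- The contraacyclic complexes which `D ⊗ -` takes to coacyclic complexes. -/
def tensorContraacyclic : ObjectProperty (Hot B) :=
  contraacyclic B ⊓ (coacyclic A).inverseImage (tensorHot D)

instance : (tensorContraacyclic D).IsTriangulated :=
  inferInstanceAs (contraacyclic B ⊓ (coacyclic A).inverseImage (tensorHot D)).IsTriangulated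

instance : (tensorContraacyclic D).IsClosedUnderIsomorphisms :=
  inferInstanceAs
    (contraacyclic B ⊓ (coacyclic A).inverseImage (tensorHot D)).IsClosedUnderIsomorphisms

lemma trW_of_trW_tensorContraacyclic {X Y : Hot B} {f : X ⟶ Y}
    (hf : (tensorContraacyclic D).trW f) :
    (contraacyclic B).trW f ∧ (coacyclic A).trW ((tensorHot D).map f) := by
  obtain ⟨Z, a, b, hT, h₁, h₂⟩ := hf
  exact ⟨⟨Z, a, b, hT, h₁⟩,
    ((coacyclic A).inverseImage_trW_iff (tensorHot D) f).1 ⟨Z, a, b, hT, h₂⟩⟩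

/-- By adjunction, maps from D ⊗ Tot to J are maps from Tot to Hom_A(D, J). These vanish in the
homotopy category since maps into the terms of Hom_A(D, J) extend along monomorphisms with flat
cokernel. Flatness of the last term alone is enough. -/
lemma tensorContraacyclic_total
    (hfin : ∀ J : ModuleCat.{u} A, IsFPInjective J → ∃ n : ℕ, HasInjectiveDimensionLE J n)
    {S : ShortComplex (CochainComplex (ModuleCat.{u} B) ℤ)}
    (hS : S.ShortExact) (hS₃ : ∀ i, IsFlat (S.X₃.X i)) :
    tensorContraacyclic D ((toHot B).obj (totalComplex S)) := by
  refine ⟨.total S hS, coacyclic_of_forall_hom_eq_zero hfin _ fun J hJ f => ?_⟩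
  refine ((tensorHomAdjunctionHot D).homEquiv _ _).injective ?_
  exact (hom_totalComplex_eq_zero D hS hS₃ J hJ _).trans
    (hom_totalComplex_eq_zero D hS hS₃ J hJ _).symm

lemma isFlat_of_projective (hB : IsRightCoherent B) (P : ModuleCat.{u} B) (hP : Projective P) :
    IsFlat P := by
  rw [isFlat_iff_baer]
  have : Module.Projective B P := (IsProjective.iff_projective P).2 hP
  exact (RelSolvable.of_projective P).baer hB

lemma isFlat_X₁_of_shortExact {S : ShortComplex (ModuleCat.{u} B)} (hS : S.ShortExact)
    (h₂ : IsFlat S.X₂) (h₃ : IsFlat S.X₃) : IsFlat S.X₁ := by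
  rw [isFlat_iff_baer] at *
  refine baer_charMod_of_exact S.f.hom S.g.hom ((ModuleCat.mono_iff_injective _).1 hS.mono_f)
    ((ModuleCat.epi_iff_surjective _).1 hS.epi_g) (fun y => ⟨?_, ?_⟩) h₂ h₃
  · exact (ShortComplex.moduleCat_exact_iff _).1 hS.exact y
  · rintro ⟨x, rfl⟩
    exact congr_arg (fun f => f.hom x) S.zero

/-- Bounded projective resolutions of complexes of flat modules. -/
lemma exists_projective_resolution_of_flat (hB : IsRightCoherent B)
    (hfin : ∀ J : ModuleCat.{u} A, IsFPInjective J → ∃ n : ℕ, HasInjectiveDimensionLE J n)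
    (k : ℕ) (hk : ∀ F : ModuleCat.{u} B, IsFlat F → HasProjectiveDimensionLT F (k + 1))
    (X : CochainComplex (ModuleCat.{u} B) ℤ) (hX : ∀ i, IsFlat (X.X i)) (U : Set ℤ)
    (hU : ∀ i ∉ U, IsZero (X.X i)) :
    ∃ (P : CochainComplex (ModuleCat.{u} B) ℤ) (s : P ⟶ X), (∀ i, Projective (P.X i)) ∧
      (tensorContraacyclic D).trW ((toHot B).map s) ∧ ∀ i ∉ thicken U (2 * k), IsZero (P.X i) :=
  exists_projective_resolution_of_dim (tensorContraacyclic D) (fun M => IsFlat M)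
    (fun S hS h₂ h₃ => isFlat_X₁_of_shortExact hS (isFlat_of_projective hB _ h₂) h₃)
    (fun _ hS hS₃ => tensorContraacyclic_total D hfin hS hS₃) k X (fun i => hk _ (hX i)) hX U hU

end FlatComplexes

end CoContra

end

noncomputable section

namespace CoContra

/-! ### Dévissage for the evaluation pairing -/

section Pairing

lemma CharMod.sub_apply {F : Type*} [AddCommGroup F] (φ ψ : CharMod F) (x : F) :
    (φ - ψ) x = φ x - ψ x := rfl

variable {𝒯 : Type*} [Category 𝒯] [Preadditive 𝒯]
  {S : Type*} [Ring S] {X Y : 𝒯} (ρ : S →+* End X) {V : Type*} [AddCommGroup V]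
  [Module S (CharMod V)] (t : V →+ (X ⟶ Y))

/-- The map `CharMod (M ⟶ Y) → Hom_S((M ⟶ X), CharMod V)` given by `t` is injective. -/
def PairInj (M : 𝒯) : Prop :=
  ∀ φ : CharMod (M ⟶ Y), (∀ (f : M ⟶ X) v, φ (f ≫ t v) = 0) → φ = 0

/-- The map `CharMod (M ⟶ Y) → Hom_S((M ⟶ X), CharMod V)` given by `t` is surjective. -/
def PairSurj (M : 𝒯) : Prop :=
  ∀ l : (M ⟶ X) →+ CharMod V, (∀ s f, l (f ≫ ρ s) = s • l f) →
    ∃ φ : CharMod (M ⟶ Y), ∀ (f : M ⟶ X) v, φ (f ≫ t v) = l f v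

/-- The map `CharMod (M ⟶ Y) → Hom((M ⟶ X), CharMod V)` given by `t`. -/
def pairMap {M : 𝒯} (φ : CharMod (M ⟶ Y)) : (M ⟶ X) →+ CharMod V := AddMonoidHom.mk'
  (fun f => (AddMonoidHom.mk' (fun v => φ (f ≫ t v)) (fun v v' => by
    rw [map_add, Preadditive.comp_add, map_add]) : V →+ AddCircle (1 : ℚ)))
  (fun f f' => CharMod.ext fun v => by
    change φ ((f + f') ≫ t v) = φ (f ≫ t v) + φ (f' ≫ t v)
    rw [Preadditive.add_comp, map_add])

variable {t} in
lemma PairInj.of_iso {M N : 𝒯} (h : PairInj t M) (e : M ≅ N) : PairInj t N := by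
  intro φ hφ
  have h0 := h (φ.comp (Preadditive.leftComp Y e.inv))
    (fun f v => by
      change φ (e.inv ≫ f ≫ t v) = 0
      rw [← Category.assoc]
      exact hφ _ v)
  refine CharMod.ext fun g => ?_
  have := DFunLike.congr_fun h0 (e.hom ≫ g)
  change φ (e.inv ≫ e.hom ≫ g) = 0 at this
  rwa [Iso.inv_hom_id_assoc] at this

variable {ρ t} in
lemma PairSurj.of_iso {M N : 𝒯} (h : PairSurj ρ t M) (e : M ≅ N) : PairSurj ρ t N := by
  intro l hl
  obtain ⟨φ, hφ⟩ := h (l.comp (Preadditive.leftComp X e.inv)) (fun s f => by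
    change l (e.inv ≫ f ≫ ρ s) = s • l (e.inv ≫ f)
    rw [← hl, Category.assoc])
  refine ⟨φ.comp (Preadditive.leftComp Y e.hom),
    fun f v => ?_⟩
  change φ (e.hom ≫ f ≫ t v) = _
  rw [← Category.assoc, hφ]
  change l (e.inv ≫ e.hom ≫ f) v = _
  rw [Iso.inv_hom_id_assoc]

lemma pairInj_of_subsingleton {M : 𝒯} (h : ∀ f : M ⟶ Y, f = 0) : PairInj t M := by
  intro φ _
  refine CharMod.ext fun g => ?_
  rw [h g, map_zero, map_zero]

lemma pairSurj_of_subsingleton {M : 𝒯} (h : ∀ f : M ⟶ X, f = 0) : PairSurj ρ t M := by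
  intro l _
  refine ⟨0, fun f v => ?_⟩
  rw [h f, map_zero]
  rfl

/-- Injectivity of the characters of V over S, stated for additive maps compatible with the action
of S through `ρ`. -/
lemma exists_factor_equivariant (hW : Module.Baer S (CharMod V)) {M N : 𝒯} (h : M ⟶ N)
    (l : (N ⟶ X) →+ CharMod V) (hl : ∀ s f, l (f ≫ ρ s) = s • l f)
    (hker : ∀ f, h ≫ f = 0 → l f = 0) :
    ∃ m : (M ⟶ X) →+ CharMod V, (∀ s f, m (f ≫ ρ s) = s • m f) ∧ ∀ f, m (h ≫ f) = l f := by
  let _ (M : 𝒯) : Module S (M ⟶ X) := Module.compHom _ ρ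
  have hs (M : 𝒯) (s : S) (f : M ⟶ X) : s • f = f ≫ ρ s := rfl
  let p : (N ⟶ X) →ₗ[S] (M ⟶ X) :=
    { toFun := fun f => h ≫ f
      map_add' := fun _ _ => Preadditive.comp_add _ _ _ _ _ _
      map_smul' := fun s f => by rw [hs, RingHom.id_apply, hs, Category.assoc] }
  let q : (N ⟶ X) →ₗ[S] CharMod V :=
    { toFun := l
      map_add' := map_add l
      map_smul' := hl }
  obtain ⟨g, hg⟩ := baer_exists_factor hW p q hker
  exact ⟨g.toAddMonoidHom, fun s f => map_smul g s f, hg⟩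

variable [HasZeroObject 𝒯] [HasShift 𝒯 ℤ] [∀ n : ℤ, (CategoryTheory.shiftFunctor 𝒯 n).Additive]
  [Pretriangulated 𝒯] {M₁ M₂ M₃ : 𝒯} {a : M₁ ⟶ M₂} {b : M₂ ⟶ M₃} {d : M₃ ⟶ M₁⟦(1 : ℤ)⟧}

lemma exists_shift_comp (hT : Triangle.mk a b d ∈ distTriang 𝒯) (g : M₁⟦(1 : ℤ)⟧ ⟶ Y)
    (hg : d ≫ g = 0) : ∃ g' : M₂⟦(1 : ℤ)⟧ ⟶ Y, g = a⟦(1 : ℤ)⟧' ≫ g' := by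
  obtain ⟨g', hg'⟩ : ∃ g' : M₂⟦(1 : ℤ)⟧ ⟶ Y, g = (-(a⟦(1 : ℤ)⟧')) ≫ g' :=
    Triangle.yoneda_exact₂ _ (rot_of_distTriang _ (rot_of_distTriang _ hT)) g hg
  refine ⟨-g', hg'.trans ?_⟩
  rw [Preadditive.neg_comp, Preadditive.comp_neg]

include ρ in
-- One half of the five lemma for the map from characters of Hom(M, Y) to equivariant maps from
-- Hom(M, X) to characters of V; injectivity of the latter group makes the second functor exact. The
-- condition `ht` says that the action of S on characters is dual to operations on V compatible with
-- t, without requiring a module structure on V.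
lemma PairInj.of_triangle (hW : Module.Baer S (CharMod V))
    (ht : ∀ s, ∃ c : V → V, (∀ v, t (c v) = ρ s ≫ t v) ∧ ∀ (w : CharMod V) v, (s • w) v = w (c v))
    (hT : Triangle.mk a b d ∈ distTriang 𝒯)
    (h₁ : PairSurj ρ t M₁) (h₂ : PairInj t M₂) (h₁' : PairInj t (M₁⟦(1 : ℤ)⟧)) :
    PairInj t M₃ := by
  intro φ hφ
  have h0 := h₁' (φ.comp (Preadditive.leftComp Y d))
    (fun f v => by
      change φ (d ≫ f ≫ t v) = 0
      rw [← Category.assoc]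
      exact hφ _ v)
  obtain ⟨φ₂, hφ₂⟩ := CharMod.exists_factor (Preadditive.leftComp Y b) φ (fun g hg => by
    obtain ⟨g', hg'⟩ := Triangle.yoneda_exact₃ _ hT g hg
    rw [hg']
    exact DFunLike.congr_fun h0 g')
  have hφ₂' (g : M₃ ⟶ Y) : φ₂ (b ≫ g) = φ g := hφ₂ g
  let l₂ : (M₂ ⟶ X) →+ CharMod V := pairMap t φ₂
  have hl₂ (f : M₂ ⟶ X) (v : V) : l₂ f v = φ₂ (f ≫ t v) := rfl
  -- The pairing of φ₂ vanishes on maps coming from M₃, so it is induced from M₁, where surjectivity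
  -- realises it by some φ₁. Injectivity at M₂ identifies φ₂ with the pullback of φ₁ along a, which
  -- vanishes on maps through b.
  obtain ⟨l₁, hl₁, hl₁'⟩ := exists_factor_equivariant ρ hW a l₂ (fun s f => by
    obtain ⟨c, hc, hc'⟩ := ht s
    refine CharMod.ext fun v => ?_
    rw [hc', hl₂, hl₂, hc, Category.assoc]) (fun f hf => by
    obtain ⟨g, rfl⟩ : ∃ g : M₃ ⟶ X, f = b ≫ g := Triangle.yoneda_exact₂ _ hT f hf
    refine CharMod.ext fun v => ?_
    rw [hl₂]
    exact (congr_arg φ₂ (Category.assoc _ _ _)).trans ((hφ₂' _).trans (hφ _ _)))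
  obtain ⟨φ₁, hφ₁⟩ := h₁ l₁ hl₁
  have h3 := h₂ (φ₂ - φ₁.comp (Preadditive.leftComp Y a))
    (fun f v => by
      change φ₂ (f ≫ t v) - φ₁ (a ≫ f ≫ t v) = 0
      rw [← Category.assoc, hφ₁, hl₁', hl₂, sub_self])
  refine CharMod.ext fun g => ?_
  have h4 := DFunLike.congr_fun h3 (b ≫ g)
  change φ₂ (b ≫ g) - φ₁ (a ≫ b ≫ g) = 0 at h4
  have h5 : a ≫ b = 0 := comp_distTriang_mor_zero₁₂ _ hT
  rw [reassoc_of% h5, zero_comp, map_zero, sub_zero, hφ₂'] at h4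
  exact h4

/-- The other half: l is first realised on maps factoring through d, using M₁[1] and injectivity at
M₂[1]; the difference vanishes on those maps, hence comes from M₂. -/
lemma PairSurj.of_triangle (hW : Module.Baer S (CharMod V))
    (ht : ∀ s, ∃ c : V → V, (∀ v, t (c v) = ρ s ≫ t v) ∧ ∀ (w : CharMod V) v, (s • w) v = w (c v))
    (hT : Triangle.mk a b d ∈ distTriang 𝒯)
    (h₂ : PairSurj ρ t M₂) (h₁' : PairSurj ρ t (M₁⟦(1 : ℤ)⟧)) (h₂' : PairInj t (M₂⟦(1 : ℤ)⟧)) :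
    PairSurj ρ t M₃ := by
  intro l hl
  obtain ⟨φ', hφ'⟩ := h₁' (l.comp (Preadditive.leftComp X d)) (fun s f => by
    change l (d ≫ f ≫ ρ s) = s • l (d ≫ f)
    rw [← hl, Category.assoc])
  have hφ'' (f : M₁⟦(1 : ℤ)⟧ ⟶ X) (v : V) : φ' (f ≫ t v) = l (d ≫ f) v := hφ' f v
  have hda : d ≫ a⟦(1 : ℤ)⟧' = 0 := comp_distTriang_mor_zero₃₁ _ hT
  have h0 := h₂' (φ'.comp
    (Preadditive.leftComp Y (a⟦(1 : ℤ)⟧'))) (fun f v => by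
      change φ' (a⟦(1 : ℤ)⟧' ≫ f ≫ t v) = 0
      rw [← Category.assoc, hφ'', reassoc_of% hda, zero_comp, map_zero]
      rfl)
  obtain ⟨φ₃, hφ₃⟩ := CharMod.exists_factor (Preadditive.leftComp Y d) φ' (fun g hg => by
    obtain ⟨g', rfl⟩ := exists_shift_comp hT g hg
    exact DFunLike.congr_fun h0 g')
  have hφ₃' (g : M₁⟦(1 : ℤ)⟧ ⟶ Y) : φ₃ (d ≫ g) = φ' g := hφ₃ g
  let m : (M₃ ⟶ X) →+ CharMod V := l - pairMap t φ₃
  have hm (f : M₃ ⟶ X) (v : V) : m f v = l f v - φ₃ (f ≫ t v) := rfl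
  obtain ⟨l₂, hl₂, hl₂'⟩ := exists_factor_equivariant ρ hW b m (fun s f => by
    obtain ⟨c, hc, hc'⟩ := ht s
    refine CharMod.ext fun v => ?_
    rw [hc', hm, hm, hl, hc', hc, Category.assoc]) (fun f hf => by
    obtain ⟨g, rfl⟩ : ∃ g : M₁⟦(1 : ℤ)⟧ ⟶ X, f = d ≫ g := Triangle.yoneda_exact₃ _ hT f hf
    refine CharMod.ext fun v => ?_
    rw [hm]
    refine (congr_arg (l _ v - ·) ((congr_arg φ₃ (Category.assoc _ _ _)).trans
      ((hφ₃' _).trans (hφ'' g v)))).trans (sub_self _))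
  obtain ⟨φ₂, hφ₂⟩ := h₂ l₂ hl₂
  refine ⟨φ₃ + φ₂.comp (Preadditive.leftComp Y b),
    fun f v => ?_⟩
  change φ₃ (f ≫ t v) + φ₂ (b ≫ f ≫ t v) = l f v
  rw [← Category.assoc, hφ₂, hl₂', hm, add_sub_cancel]

end Pairing

end CoContra

end

noncomputable section

namespace CoContra

/-! ### Dévissage in the derived category of a coherent ring -/

section Pairing

variable {𝒯 : Type*} [Category 𝒯] [Preadditive 𝒯]
  {S : Type*} [Ring S] {X Y : 𝒯} {ρ : S →+* End X} {V : Type*} [AddCommGroup V]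
  [Module S (CharMod V)] {t : V →+ (X ⟶ Y)}

/-- With End X = S, a character w of V gives the equivariant map f ↦ f • w on End X. Realising it by
a character of Hom(X, Y) makes w recoverable from t, so t is injective. A character that kills the
image of t kills all f ≫ t v, hence is zero, and t is surjective. -/
lemma bijective_of_pairing
    (ht : ∀ s, ∃ c : V → V, (∀ v, t (c v) = ρ s ≫ t v) ∧ ∀ (w : CharMod V) v, (s • w) v = w (c v))
    (hρ : Function.Bijective ρ) (hi : PairInj t X) (hs : PairSurj ρ t X) :
    Function.Bijective t := by
  constructor
  · rw [injective_iff_map_eq_zero]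
    intro v hv
    refine CharMod.eq_zero fun w => ?_
    let e : S ≃+* End X := RingEquiv.ofBijective ρ hρ
    have he (s : S) : e s = ρ s := rfl
    let l : (X ⟶ X) →+ CharMod V := AddMonoidHom.mk' (fun f => e.symm f • w) (fun f g => by
      rw [← add_smul]
      congr 1
      exact map_add e.symm f g)
    obtain ⟨φ, hφ⟩ := hs l (fun s f => by
      change e.symm (f ≫ ρ s) • w = s • e.symm f • w
      rw [smul_smul]
      congr 1
      apply e.injective
      rw [map_mul, RingEquiv.apply_symm_apply, he, RingEquiv.apply_symm_apply]
      rfl)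
    have h1 := hφ (𝟙 X) v
    have h2 : e.symm (𝟙 X) = 1 := map_one e.symm
    rw [Category.id_comp, hv, map_zero] at h1
    change 0 = (e.symm (𝟙 X) • w) v at h1
    rw [h2, one_smul] at h1
    exact h1.symm
  · intro y
    refine CharMod.mem_of_forall t.range y (fun φ hφ => ?_)
    have : φ = 0 := hi φ (fun f v => by
      obtain ⟨s, rfl⟩ := hρ.2 f
      obtain ⟨c, hc, -⟩ := ht s
      rw [← hc]
      exact hφ _ ⟨_, rfl⟩)
    rw [this]
    rfl

lemma eq_zero_of_pairInj {M : 𝒯} (hi : PairInj t M) (h : ∀ f : M ⟶ X, f = 0) (g : M ⟶ Y) :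
    g = 0 := by
  refine CharMod.eq_zero fun w => ?_
  rw [hi w (fun f v => by rw [h f, zero_comp, map_zero])]
  rfl

variable [HasZeroObject 𝒯] [HasShift 𝒯 ℤ] [∀ n : ℤ, (CategoryTheory.shiftFunctor 𝒯 n).Additive]
  [Pretriangulated 𝒯]

variable (ρ t) in
/-- The pairing given by `t` is perfect on all the shifts of `M`. -/
def PairGood (M : 𝒯) : Prop :=
  ∀ j : ℤ, PairInj t (M⟦j⟧) ∧ PairSurj ρ t (M⟦j⟧)

lemma PairGood.of_iso {M N : 𝒯} (h : PairGood ρ t M) (e : M ≅ N) : PairGood ρ t N := fun j =>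
  ⟨(h j).1.of_iso ((CategoryTheory.shiftFunctor 𝒯 j).mapIso e),
    (h j).2.of_iso ((CategoryTheory.shiftFunctor 𝒯 j).mapIso e)⟩

lemma PairGood.shift {M : 𝒯} (h : PairGood ρ t M) (n : ℤ) : PairGood ρ t (M⟦n⟧) := fun j =>
  ⟨(h (n + j)).1.of_iso ((shiftFunctorAdd 𝒯 n j).app M),
    (h (n + j)).2.of_iso ((shiftFunctorAdd 𝒯 n j).app M)⟩

lemma PairGood.of_isZero {M : 𝒯} (h : IsZero M) : PairGood ρ t M := fun j =>
  ⟨pairInj_of_subsingleton _ fun f =>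
    ((CategoryTheory.shiftFunctor 𝒯 j).map_isZero h).eq_of_src _ _,
   pairSurj_of_subsingleton _ _ fun f =>
    ((CategoryTheory.shiftFunctor 𝒯 j).map_isZero h).eq_of_src _ _⟩

/-- The two halves consume information about M₁[1] and M₂[1], so the property only propagates when
required for all shifts simultaneously. -/
lemma PairGood.of_triangle₃ (hW : Module.Baer S (CharMod V))
    (ht : ∀ s, ∃ c : V → V, (∀ v, t (c v) = ρ s ≫ t v) ∧ ∀ (w : CharMod V) v, (s • w) v = w (c v))
    (T : Triangle 𝒯) (hT : T ∈ distTriang 𝒯) (h₁ : PairGood ρ t T.obj₁)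
    (h₂ : PairGood ρ t T.obj₂) : PairGood ρ t T.obj₃ := fun j => by
  have hT' := Triangle.shift_distinguished T hT j
  let e (M : 𝒯) : M⟦j + 1⟧ ≅ M⟦j⟧⟦(1 : ℤ)⟧ := (shiftFunctorAdd 𝒯 j 1).app M
  exact ⟨PairInj.of_triangle ρ t hW ht hT' (h₁ j).2 (h₂ j).1 ((h₁ (j + 1)).1.of_iso (e _)),
    PairSurj.of_triangle ρ t hW ht hT' (h₂ j).2 ((h₁ (j + 1)).2.of_iso (e _))
      ((h₂ (j + 1)).1.of_iso (e _))⟩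

lemma PairGood.of_triangle₂ (hW : Module.Baer S (CharMod V))
    (ht : ∀ s, ∃ c : V → V, (∀ v, t (c v) = ρ s ≫ t v) ∧ ∀ (w : CharMod V) v, (s • w) v = w (c v))
    (T : Triangle 𝒯) (hT : T ∈ distTriang 𝒯) (h₁ : PairGood ρ t T.obj₁)
    (h₃ : PairGood ρ t T.obj₃) : PairGood ρ t T.obj₂ :=
  PairGood.of_triangle₃ hW ht _ (inv_rot_of_distTriang _ hT) (h₃.shift (-1)) h₁

end Pairing

section Derived

attribute [local instance] HasDerivedCategory.standard

open DerivedCategory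

variable {R : Type u} [Ring R] {S : Type*} [Ring S] {X Y : DerivedCategory (ModuleCat.{u} R)}
  {ρ : S →+* End X} {V : Type*} [AddCommGroup V]
  [Module S (CharMod V)] {t : V →+ (X ⟶ Y)}

lemma exists_fp_resolution (hR : IsLeftCoherent R) (E : ModuleCat.{u} R)
    (hE : Module.FinitePresentation R E) :
    ∃ (n : ℕ) (K : ModuleCat.{u} R) (f : K ⟶ ModuleCat.of R (Fin n → R))
      (g : ModuleCat.of R (Fin n → R) ⟶ E) (w : f ≫ g = 0), (ShortComplex.mk f g w).ShortExact ∧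
      Module.FinitePresentation R K := by
  obtain ⟨n, g, hg⟩ := Module.Finite.exists_fin' R E
  refine ⟨n, ModuleCat.of R g.ker, ModuleCat.ofHom g.ker.subtype, ModuleCat.ofHom g, ?_, ?_, ?_⟩
  · ext x
    exact x.2
  · exact shortExact_of_ker g.ker.subtype g g.ker.subtype_injective hg
      (LinearMap.exact_subtype_ker_map g)
  · exact hR.isCoherentModule n _ (Module.FinitePresentation.fg_ker g hg)

lemma PairGood.free (hW : Module.Baer S (CharMod V))
    (ht : ∀ s, ∃ c : V → V, (∀ v, t (c v) = ρ s ≫ t v) ∧ ∀ (w : CharMod V) v, (s • w) v = w (c v))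
    (h : PairGood ρ t ((DerivedCategory.singleFunctor (ModuleCat.{u} R) 0).obj (ModuleCat.of R R))) (n : ℕ) :
    PairGood ρ t ((DerivedCategory.singleFunctor (ModuleCat.{u} R) 0).obj (ModuleCat.of R (Fin n → R))) := by
  induction n with
  | zero =>
    refine PairGood.of_isZero ((DerivedCategory.singleFunctor (ModuleCat.{u} R) 0).map_isZero ?_)
    exact ModuleCat.isZero_of_subsingleton _
  | succ n ih =>
    have hS : (ShortComplex.mk (X₁ := ModuleCat.of R R) (X₂ := ModuleCat.of R (R × (Fin n → R)))
        (X₃ := ModuleCat.of R (Fin n → R)) (ModuleCat.ofHom (LinearMap.inl R R (Fin n → R)))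
        (ModuleCat.ofHom (LinearMap.snd R R (Fin n → R))) (by ext; rfl)).ShortExact :=
      ShortComplex.ShortExact.mk' (by
        rw [ShortComplex.moduleCat_exact_iff]
        rintro ⟨x, y⟩ h
        exact ⟨x, Prod.ext rfl (Eq.symm h)⟩)
        ((ModuleCat.mono_iff_injective _).2 LinearMap.inl_injective)
        ((ModuleCat.epi_iff_surjective _).2 LinearMap.snd_surjective)
    have h2 := PairGood.of_triangle₂ hW ht _ hS.singleTriangle_distinguished h ih
    exact h2.of_iso ((DerivedCategory.singleFunctor (ModuleCat.{u} R) 0).mapIso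
      (Fin.consLinearEquiv R (fun _ => R)).toModuleIso)

lemma single_shift_hom_eq_zero {Z : DerivedCategory (ModuleCat.{u} R)} {a : ℤ} [Z.IsGE a]
    (E : ModuleCat.{u} R) (j : ℤ) (hj : -a < j)
    (f : ((DerivedCategory.singleFunctor (ModuleCat.{u} R) 0).obj E)⟦j⟧ ⟶ Z) : f = 0 := by
  have := TStructure.t.isLE_shift ((DerivedCategory.singleFunctor (ModuleCat.{u} R) 0).obj E) 0 j (-j) (by lia)
  exact TStructure.t.zero f (-j) a (by lia)

/-- Descending induction on the shift j. For j > -a there are no maps from E[j] to X or Y. Otherwise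
write E = R^n/K with K finitely presented by coherence: the triangle reduces E[j] to R^n and to K[j
+ 1]. -/
lemma PairGood.single (hR : IsLeftCoherent R) (hW : Module.Baer S (CharMod V))
    (ht : ∀ s, ∃ c : V → V, (∀ v, t (c v) = ρ s ≫ t v) ∧ ∀ (w : CharMod V) v, (s • w) v = w (c v))
    (h : PairGood ρ t ((DerivedCategory.singleFunctor (ModuleCat.{u} R) 0).obj (ModuleCat.of R R)))
    (a : ℤ) (hX : X.IsGE a) (hY : Y.IsGE a)
    (E : ModuleCat.{u} R) (hE : Module.FinitePresentation R E) :
    PairGood ρ t ((DerivedCategory.singleFunctor (ModuleCat.{u} R) 0).obj E) := by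
  suffices H : ∀ (k : ℕ) (j : ℤ), -a - k < j →
      ∀ (E : ModuleCat.{u} R), Module.FinitePresentation R E →
      PairInj t (((DerivedCategory.singleFunctor (ModuleCat.{u} R) 0).obj E)⟦j⟧) ∧
        PairSurj ρ t (((DerivedCategory.singleFunctor (ModuleCat.{u} R) 0).obj E)⟦j⟧) from
    fun j => H (-a - j + 1).toNat j (by lia) E hE
  intro k
  induction k with
  | zero =>
    intro j hj E _
    exact ⟨pairInj_of_subsingleton _ (single_shift_hom_eq_zero (a := a) E j (by lia)),
      pairSurj_of_subsingleton _ _ (single_shift_hom_eq_zero (a := a) E j (by lia))⟩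
  | succ k ih =>
    intro j hj
    let e (M : DerivedCategory (ModuleCat.{u} R)) : M⟦j + 1⟧ ≅ M⟦j⟧⟦(1 : ℤ)⟧ :=
      (shiftFunctorAdd _ j 1).app M
    -- Surjectivity comes first and for all modules, because injectivity for E[j] uses surjectivity
    -- for K in the same shift j.
    have hs (E : ModuleCat.{u} R) (hE : Module.FinitePresentation R E) :
        PairSurj ρ t (((DerivedCategory.singleFunctor (ModuleCat.{u} R) 0).obj E)⟦j⟧) := by
      obtain ⟨n, K, f, g, w, hS, hK⟩ := exists_fp_resolution hR E hE
      have hn := PairGood.free hW ht h n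
      exact PairSurj.of_triangle ρ t hW ht
        (Triangle.shift_distinguished _ hS.singleTriangle_distinguished j) (hn j).2
        ((ih (j + 1) (by lia) K hK).2.of_iso (e _)) ((hn (j + 1)).1.of_iso (e _))
    intro E hE
    refine ⟨?_, hs E hE⟩
    obtain ⟨n, K, f, g, w, hS, hK⟩ := exists_fp_resolution hR E hE
    have hn := PairGood.free hW ht h n
    exact PairInj.of_triangle ρ t hW ht
        (Triangle.shift_distinguished _ hS.singleTriangle_distinguished j) (hs K hK) (hn j).1
        ((ih (j + 1) (by lia) K hK).1.of_iso (e _))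

/-- Induction on the number k of possibly nonzero cohomology degrees, starting at c: the truncation
triangle splits off the lowest cohomology module. -/
lemma PairGood.of_bounded (hR : IsLeftCoherent R) (hW : Module.Baer S (CharMod V))
    (ht : ∀ s, ∃ c : V → V, (∀ v, t (c v) = ρ s ≫ t v) ∧ ∀ (w : CharMod V) v, (s • w) v = w (c v))
    (h : PairGood ρ t ((DerivedCategory.singleFunctor (ModuleCat.{u} R) 0).obj (ModuleCat.of R R)))
    (a : ℤ) (hX : X.IsGE a) (hY : Y.IsGE a) (k : ℕ) :
    ∀ (c : ℤ) (M : DerivedCategory (ModuleCat.{u} R)), M.IsGE c → M.IsLE (c - 1 + k) →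
    (∀ i, Module.FinitePresentation R ((DerivedCategory.homologyFunctor (ModuleCat.{u} R) i).obj M)) → PairGood ρ t M := by
  induction k with
  | zero =>
    intro c M _ h2 _
    have : M.IsLE (c - 1) := by simpa using h2
    exact PairGood.of_isZero (TStructure.t.isZero M (c - 1) c (by lia))
  | succ k ih =>
    intro c M hc hk hM
    obtain ⟨P, N, hP, hN, f, g, δ, hT⟩ := TStructure.t.exists_triangle M c (c + 1) rfl
    have hP : P.IsLE c := ⟨hP⟩
    have hN : N.IsGE (c + 1) := ⟨hN⟩
    have hz (i : ℤ) (hi : c < i) : IsIso ((DerivedCategory.homologyFunctor (ModuleCat.{u} R) i).map g) := by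
      have h1 := (HomologySequence.epi_homologyMap_mor₂_iff _ hT i (i + 1)).2
        ((P.isZero_of_isLE c (i + 1) (by lia)).eq_of_tgt _ _)
      have h2 := (HomologySequence.mono_homologyMap_mor₂_iff _ hT i).2
        ((P.isZero_of_isLE c i (by lia)).eq_of_src _ _)
      exact @isIso_of_mono_of_epi _ _ _ _ _ _ h2 h1
    have hz' (i : ℤ) (hi : i ≤ c) : IsIso ((DerivedCategory.homologyFunctor (ModuleCat.{u} R) i).map f) := by
      have h1 := (HomologySequence.epi_homologyMap_mor₁_iff _ hT i).2
        ((N.isZero_of_isGE (c + 1) i (by lia)).eq_of_tgt _ _)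
      have h2 := (HomologySequence.mono_homologyMap_mor₁_iff _ hT (i - 1) i).2
        ((N.isZero_of_isGE (c + 1) (i - 1) (by lia)).eq_of_src _ _)
      exact @isIso_of_mono_of_epi _ _ _ _ _ _ h2 h1
    have fpiso {E E' : ModuleCat.{u} R} (e : E ≅ E') (hE : Module.FinitePresentation R E) :
        Module.FinitePresentation R E' :=
      Module.FinitePresentation.of_equiv e.toLinearEquiv
    have fpz {E : ModuleCat.{u} R} (e : IsZero E) : Module.FinitePresentation R E := by
      have := ModuleCat.subsingleton_of_isZero e
      infer_instance
    have hPge : P.IsGE c := by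
      rw [DerivedCategory.isGE_iff]
      intro i hi
      have := hz' i hi.le
      exact (M.isZero_of_isGE c i hi).of_iso (asIso ((DerivedCategory.homologyFunctor (ModuleCat.{u} R) i).map f))
    have hNle : N.IsLE (c + 1 - 1 + k) := by
      rw [DerivedCategory.isLE_iff]
      intro i hi
      have := hz i (by lia)
      exact (M.isZero_of_isLE (c - 1 + (k + 1 : ℕ)) i (by lia)).of_iso
        (asIso ((DerivedCategory.homologyFunctor (ModuleCat.{u} R) i).map g)).symm
    refine PairGood.of_triangle₂ hW ht _ hT ?_ (ih (c + 1) N hN hNle fun i => ?_)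
    · obtain ⟨E, ⟨e⟩⟩ := exists_iso_singleFunctor_obj_of_isGE_of_isLE P c
      have hE : Module.FinitePresentation R E := by
        have := hz' c le_rfl
        exact fpiso ((asIso ((DerivedCategory.homologyFunctor (ModuleCat.{u} R) c).map f)).symm ≪≫
          (DerivedCategory.homologyFunctor (ModuleCat.{u} R) c).mapIso e ≪≫
          (singleFunctorCompHomologyFunctorIso (ModuleCat.{u} R) c).app E) (hM c)
      have h1 := (PairGood.single hR hW ht h a hX hY E hE).shift (-c)
      exact h1.of_iso (((DerivedCategory.singleFunctors (ModuleCat.{u} R)).shiftIso (-c) c 0 (by lia)).app E ≪≫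
        e.symm)
    · by_cases hi : c < i
      · have := hz i hi
        exact fpiso (asIso ((DerivedCategory.homologyFunctor (ModuleCat.{u} R) i).map g)) (hM i)
      · exact fpz (N.isZero_of_isGE (c + 1) i (by lia))

end Derived

end CoContra

end

noncomputable section

namespace CoContra

/-! ### Morphisms in the derived category of a ring -/

section Derived

attribute [local instance] HasDerivedCategory.standard

section

variable {C : Type*} [Category C] [Abelian C] {K L : CochainComplex C ℤ}

lemma exists_Q_map_of_isKProjective [K.IsKProjective]
    (f : DerivedCategory.Q.obj K ⟶ DerivedCategory.Q.obj L) :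
    ∃ g : K ⟶ L, DerivedCategory.Q.map g = f := by
  obtain ⟨g, hg⟩ := (IsKProjective.Qh_map_bijective K _).2
    ((DerivedCategory.quotientCompQhIso C).hom.app K ≫ f ≫
      (DerivedCategory.quotientCompQhIso C).inv.app L)
  obtain ⟨g, rfl⟩ := (HomotopyCategory.quotient _ _).map_surjective g
  refine ⟨g, ?_⟩
  rw [← cancel_epi ((DerivedCategory.quotientCompQhIso C).hom.app K),
    ← DerivedCategory.quotientCompQhIso_hom_naturality, hg]
  simp

lemma Q_map_eq_zero_of_homotopy (f : K ⟶ L) (h : Homotopy f 0) :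
    DerivedCategory.Q.map f = 0 := by
  rw [← cancel_epi ((DerivedCategory.quotientCompQhIso C).hom.app K),
    ← DerivedCategory.quotientCompQhIso_hom_naturality, HomotopyCategory.eq_of_homotopy _ _ h,
    Functor.map_zero, Functor.map_zero, zero_comp, comp_zero]

lemma Qh_map_eq_zero_of_Q_map_eq_zero (f : K ⟶ L) (h : DerivedCategory.Q.map f = 0) :
    DerivedCategory.Qh.map ((HomotopyCategory.quotient _ _).map f) = 0 := by
  rw [← cancel_mono ((DerivedCategory.quotientCompQhIso C).hom.app L),
    DerivedCategory.quotientCompQhIso_hom_naturality, h, comp_zero, zero_comp]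

lemma homotopy_zero_of_isKProjective [K.IsKProjective] (f : K ⟶ L)
    (h : DerivedCategory.Q.map f = 0) : Nonempty (Homotopy f 0) :=
  ⟨HomotopyCategory.homotopyOfEq _ _ ((IsKProjective.Qh_map_bijective K _).1
    (by rw [Qh_map_eq_zero_of_Q_map_eq_zero f h, Functor.map_zero, Functor.map_zero]))⟩

lemma homotopy_zero_of_isKInjective [L.IsKInjective] (f : K ⟶ L)
    (h : DerivedCategory.Q.map f = 0) : Nonempty (Homotopy f 0) :=
  ⟨HomotopyCategory.homotopyOfEq _ _ ((IsKInjective.Qh_map_bijective _ L).1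
    (by rw [Qh_map_eq_zero_of_Q_map_eq_zero f h, Functor.map_zero, Functor.map_zero]))⟩

/-- As L is K-injective, the class of a cocycle of degree n is faithfully a morphism K → L[n] in the
derived category; if all of these vanish, the cocycle is a coboundary. -/
lemma exists_δ_of_isKInjective [L.IsKInjective] (n : ℤ)
    (h : ∀ f : DerivedCategory.Q.obj K ⟶ (DerivedCategory.Q.obj L)⟦n⟧, f = 0)
    (z : Cochain K L n) (hz : δ n (n + 1) z = 0) : ∃ w : Cochain K L (n - 1), δ (n - 1) n w = z := by
  let c : Cocycle K L n := Cocycle.mk z (n + 1) rfl hz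
  have h0 : CohomologyClass.mk c = 0 := by
    apply (CohomologyClass.toHom_bijective K L n).1
    rw [map_zero, CohomologyClass.toHom_mk]
    apply (IsKInjective.Qh_map_bijective _ (L⟦n⟧)).1
    rw [Functor.map_zero]
    apply Qh_map_eq_zero_of_Q_map_eq_zero
    rw [← cancel_mono ((DerivedCategory.Q.commShiftIso n).hom.app L), zero_comp]
    exact h _
  rw [CohomologyClass.mk_eq_zero_iff, mem_coboundaries_iff c (n - 1) (by lia)] at h0
  exact h0

lemma exists_δ_of_homotopy_zero (f : K ⟶ L) (h : Homotopy f 0) :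
    ∃ w : Cochain K L (-1), δ (-1) 0 w = Cochain.ofHom f :=
  ⟨Cochain.ofHomotopy h, by rw [δ_ofHomotopy, Cochain.ofHom_zero, sub_zero]⟩

end

section

variable {R : Type u} [Ring R]

/-- The complex `R` placed in degree `i`. -/
abbrev freeComplex (R : Type u) [Ring R] (i : ℤ) : CochainComplex (ModuleCat.{u} R) ℤ :=
  (HomologicalComplex.single (ModuleCat.{u} R) (ComplexShape.up ℤ) i).obj (ModuleCat.of R R)

instance (i : ℤ) : (freeComplex R i).IsKProjective :=
  have (n : ℤ) : Projective ((freeComplex R i).X n) := by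
    by_cases h : n = i
    · subst h
      exact Projective.of_iso
        (HomologicalComplex.singleObjXSelf (ComplexShape.up ℤ) n (ModuleCat.of R R)).symm
        ((IsProjective.iff_projective (R := R) R).1 inferInstance)
    · exact (HomologicalComplex.isZero_single_obj_X _ _ _ _ h).projective
  isKProjective_of_projective (freeComplex R i) i

variable (K L : CochainComplex (ModuleCat.{u} R) ℤ)

/-- The map from `R` placed in degree `i` given by a cocycle of degree `i`. -/
def cocycleMap (i : ℤ) (x : (K.d i (i + 1)).hom.ker) : freeComplex R i ⟶ K :=
  HomologicalComplex.mkHomFromSingle (ModuleCat.ofHom (LinearMap.toSpanSingleton R (K.X i) x.1))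
    (fun k hk => by
      obtain rfl : i + 1 = k := hk
      ext
      change (K.d i (i + 1)).hom ((1 : R) • x.1) = 0
      rw [one_smul]
      exact x.2)

/-- The generator of the complex `R` placed in degree `i`. -/
def freeGen (R : Type u) [Ring R] (i : ℤ) : (freeComplex R i).X i :=
  (HomologicalComplex.singleObjXSelf (ComplexShape.up ℤ) i (ModuleCat.of R R)).inv (1 : R)

lemma singleObjXSelf_freeGen (i : ℤ) :
    (HomologicalComplex.singleObjXSelf (ComplexShape.up ℤ) i (ModuleCat.of R R)).hom
      (freeGen R i) = (1 : R) := by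
  rw [freeGen, ← ModuleCat.comp_apply, Iso.inv_hom_id]
  rfl

lemma freeGen_hom_ext {i : ℤ} {M : ModuleCat.{u} R} {f g : (freeComplex R i).X i ⟶ M}
    (h : f (freeGen R i) = g (freeGen R i)) : f = g := by
  rw [← cancel_epi
    (HomologicalComplex.singleObjXSelf (ComplexShape.up ℤ) i (ModuleCat.of R R)).inv]
  refine ModuleCat.hom_ext (LinearMap.ext_ring ?_)
  exact h

variable {K L}

lemma freeComplex_hom_ext {i : ℤ} {f g : freeComplex R i ⟶ K}
    (h : f.f i (freeGen R i) = g.f i (freeGen R i)) : f = g :=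
  HomologicalComplex.from_single_hom_ext (freeGen_hom_ext h)

lemma cocycleMap_freeGen (i : ℤ) (x : (K.d i (i + 1)).hom.ker) :
    (cocycleMap K i x).f i (freeGen R i) = x.1 := by
  rw [cocycleMap, HomologicalComplex.mkHomFromSingle_f, ModuleCat.comp_apply,
    singleObjXSelf_freeGen]
  exact one_smul R x.1

lemma exists_cocycleMap (i : ℤ) (f : freeComplex R i ⟶ K) : ∃ x, cocycleMap K i x = f := by
  refine ⟨⟨f.f i (freeGen R i), ?_⟩, freeComplex_hom_ext (cocycleMap_freeGen i _)⟩
  change (K.d i (i + 1)).hom _ = 0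
  have := congr_arg (fun (g : (freeComplex R i).X i ⟶ K.X (i + 1)) => g (freeGen R i))
    (f.comm i (i + 1))
  rw [HomologicalComplex.single_obj_d, zero_comp] at this
  exact this

variable (K) in
/-- The morphism in the derived category given by a cocycle. -/
def cocycleClass (i : ℤ) : (K.d i (i + 1)).hom.ker →+
    (DerivedCategory.Q.obj (freeComplex R i) ⟶ DerivedCategory.Q.obj K) :=
  AddMonoidHom.mk' (fun x => DerivedCategory.Q.map (cocycleMap K i x)) (fun x y => by
    rw [← Functor.map_add]
    congr 1
    refine freeComplex_hom_ext ?_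
    rw [cocycleMap_freeGen, HomologicalComplex.add_f_apply]
    change _ = (cocycleMap K i x).f i (freeGen R i) + (cocycleMap K i y).f i (freeGen R i)
    rw [cocycleMap_freeGen, cocycleMap_freeGen]
    rfl)

lemma cocycleClass_surjective (i : ℤ) : Function.Surjective (cocycleClass K i) := by
  intro f
  obtain ⟨g, rfl⟩ := exists_Q_map_of_isKProjective f
  obtain ⟨x, rfl⟩ := exists_cocycleMap i g
  exact ⟨x, rfl⟩

lemma cocycleClass_comp (i : ℤ) (f : K ⟶ L) (x : (K.d i (i + 1)).hom.ker)
    (y : (L.d i (i + 1)).hom.ker) (h : f.f i x.1 = y.1) :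
    cocycleClass K i x ≫ DerivedCategory.Q.map f = cocycleClass L i y := by
  change DerivedCategory.Q.map (cocycleMap K i x) ≫ _ = DerivedCategory.Q.map (cocycleMap L i y)
  rw [← Functor.map_comp]
  congr 1
  refine freeComplex_hom_ext ?_
  rw [cocycleMap_freeGen, HomologicalComplex.comp_f, ModuleCat.comp_apply, cocycleMap_freeGen, h]

/-- The free module in one degree is K-projective, so vanishing in the derived category is
null-homotopy, and a null-homotopy amounts to an element with the given boundary. -/
lemma cocycleClass_eq_zero_iff (i : ℤ) (x : (K.d i (i + 1)).hom.ker) :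
    cocycleClass K i x = 0 ↔ ∃ y : K.X (i - 1), x.1 = K.d (i - 1) i y := by
  constructor
  · intro h
    obtain ⟨h⟩ := homotopy_zero_of_isKProjective (cocycleMap K i x) h
    have h1 := h.comm i
    rw [dNext_eq _ (show (ComplexShape.up ℤ).Rel i (i + 1) from rfl),
      prevD_eq _ (show (ComplexShape.up ℤ).Rel (i - 1) i from by simp),
      HomologicalComplex.single_obj_d, zero_comp, zero_add, HomologicalComplex.zero_f,
      add_zero] at h1
    refine ⟨h.hom i (i - 1) (freeGen R i), ?_⟩
    rw [← cocycleMap_freeGen, h1]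
    rfl
  · rintro ⟨y, hy⟩
    let w : Cochain (freeComplex R i) K (-1) := Cochain.single
      ((HomologicalComplex.singleObjXSelf (ComplexShape.up ℤ) i (ModuleCat.of R R)).hom ≫
        ModuleCat.ofHom (LinearMap.toSpanSingleton R (K.X (i - 1)) y)) (-1)
    refine Q_map_eq_zero_of_homotopy _ ((Cochain.equivHomotopy _ _).symm ⟨w, ?_⟩)
    rw [Cochain.ofHom_zero, add_zero]
    ext p e : 2
    by_cases hp : p = i
    · subst hp
      rw [Cochain.ofHom_v, δ_v (-1) 0 (by lia) _ p p (by lia) (p - 1) (p + 1) (by lia) (by lia),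
        HomologicalComplex.single_obj_d, zero_comp, smul_zero, add_zero, Cochain.single_v]
      congr 1
      refine freeGen_hom_ext ?_
      rw [cocycleMap_freeGen, ModuleCat.comp_apply, ModuleCat.comp_apply, singleObjXSelf_freeGen,
        hy]
      change _ = K.d (p - 1) p ((1 : R) • y)
      rw [one_smul]
    · congr 1
      exact (HomologicalComplex.isZero_single_obj_X _ _ _ _ hp).eq_of_src _ _

end

end Derived

end CoContra

end

noncomputable section

namespace CoContra

/-! ### The evaluation pairing for complexes -/

section Derived

attribute [local instance] HasDerivedCategory.standard

lemma shift_hom_eq_zero_iff {𝒯 : Type*} [Category 𝒯] [HasShift 𝒯 ℤ] [Preadditive 𝒯]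
    [∀ n : ℤ, (CategoryTheory.shiftFunctor 𝒯 n).Additive] (X Y : 𝒯) (i j : ℤ) (h : i + j = 0) :
    (∀ f : X⟦i⟧ ⟶ Y, f = 0) ↔ ∀ f : X ⟶ Y⟦j⟧, f = 0 := by
  let e (Z : 𝒯) : Z⟦i⟧⟦j⟧ ≅ Z := (shiftFunctorCompIsoId 𝒯 i j h).app Z
  constructor
  · intro H f
    apply (CategoryTheory.shiftFunctor 𝒯 i).map_injective
    rw [Functor.map_zero, ← cancel_mono ((shiftFunctorCompIsoId 𝒯 j i (by lia)).hom.app Y),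
      zero_comp]
    exact H _
  · intro H f
    apply (CategoryTheory.shiftFunctor 𝒯 j).map_injective
    rw [Functor.map_zero, ← cancel_epi (e X).inv, comp_zero]
    exact H _

variable {R : Type u} [Ring R] {S : Type*} [Ring S] {F G₀ G : CochainComplex (ModuleCat.{u} R) ℤ}
  (r : S →+* End F) {V : Type*} [AddCommGroup V] [Module S (CharMod V)]
  (τ : V →+ (F ⟶ G₀)) (σ : G₀ ⟶ G)

/-- The action of an element of `S` as a map of complexes. -/
def actHom (s : S) : F ⟶ F := r s

/-- The condition that the pairing given by `τ` is perfect on cohomology. -/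
structure PairCohomology : Prop where
  /-- characters of the cohomology of the target are determined by their values -/
  inj (i : ℤ) (χ : CharMod (G₀.X i)) (hχ : ∀ y, χ (G₀.d (i - 1) i y) = 0)
    (h : ∀ z, F.d i (i + 1) z = 0 → ∀ v, χ ((τ v).f i z) = 0) (y : G₀.X i)
    (hy : G₀.d i (i + 1) y = 0) : χ y = 0
  /-- every equivariant map is given by a character of the cohomology of the target -/
  surj (i : ℤ) (l : (F.d i (i + 1)).hom.ker →+ CharMod V)
    (hl : ∀ z, (∃ y, z.1 = F.d (i - 1) i y) → l z = 0)
    (hl' : ∀ (s : S) z z', z'.1 = (actHom r s).f i z.1 → l z' = s • l z) :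
    ∃ χ : CharMod (G₀.X i), (∀ y, χ (G₀.d (i - 1) i y) = 0) ∧
      ∀ z v, χ ((τ v).f i z.1) = l z v

variable {r τ}

lemma finitePresentation_of_iso {E E' : ModuleCat.{u} R} (e : E ≅ E')
    (hE : Module.FinitePresentation R E) : Module.FinitePresentation R E' :=
  Module.FinitePresentation.of_equiv e.toLinearEquiv

/-- The action of `S` in the derived category. -/
def derivedAction (r : S →+* End F) : S →+* End (DerivedCategory.Q.obj F) where
  toFun s := DerivedCategory.Q.map (r s)
  map_one' := by
    rw [map_one]
    exact DerivedCategory.Q.map_id F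
  map_mul' s s' := by
    rw [map_mul]
    exact DerivedCategory.Q.map_comp (actHom r s') (r s)
  map_zero' := by
    rw [map_zero]
    exact DerivedCategory.Q.map_zero F F
  map_add' s s' := by
    rw [map_add]
    exact DerivedCategory.Q.map_add

/-- The pairing in the derived category. -/
def derivedPairing (τ : V →+ (F ⟶ G₀)) :
    V →+ (DerivedCategory.Q.obj F ⟶ DerivedCategory.Q.obj G₀) :=
  DerivedCategory.Q.mapAddHom.comp τ

lemma map_mem_ker {F G : CochainComplex (ModuleCat.{u} R) ℤ} (f : F ⟶ G) (i : ℤ)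
    (z : (F.d i (i + 1)).hom.ker) : f.f i z.1 ∈ (G.d i (i + 1)).hom.ker := by
  change (G.d i (i + 1)).hom _ = 0
  have h := congr_arg (fun (g : F.X i ⟶ G.X (i + 1)) => g z.1) (f.comm i (i + 1))
  refine h.trans ?_
  rw [ModuleCat.comp_apply, show F.d i (i + 1) z.1 = 0 from z.2, map_zero]

lemma d_mem_ker (F : CochainComplex (ModuleCat.{u} R) ℤ) (i : ℤ) (y : F.X (i - 1)) :
    F.d (i - 1) i y ∈ (F.d i (i + 1)).hom.ker := by
  change (F.d i (i + 1)).hom _ = 0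
  rw [← LinearMap.comp_apply, ← ModuleCat.hom_comp, HomologicalComplex.d_comp_d]
  rfl

/-- The base of the dévissage: maps from R[j] compute cohomology in degree -j. Characters of
cohomology are handled as characters of the terms that vanish on boundaries, which is the form of
`PairCohomology`. -/
lemma PairCohomology.pairGood (h : PairCohomology r τ) : PairGood (derivedAction r)
    (derivedPairing τ)
    ((DerivedCategory.singleFunctor (ModuleCat.{u} R) 0).obj (ModuleCat.of R R)) := by
  intro j
  let e : DerivedCategory.Q.obj (freeComplex R (-j)) ≅
      ((DerivedCategory.singleFunctor (ModuleCat.{u} R) 0).obj (ModuleCat.of R R))⟦j⟧ :=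
    (((DerivedCategory.singleFunctors (ModuleCat.{u} R)).shiftIso j (-j) 0
      (by lia)).app (ModuleCat.of R R)).symm
  clear_value e
  generalize -j = i at e
  refine ⟨PairInj.of_iso ?_ e, PairSurj.of_iso ?_ e⟩
  · intro φ hφ
    obtain ⟨χ, hχ⟩ := CharMod.exists_extension (G₀.d i (i + 1)).hom.ker.subtype.toAddMonoidHom
      Subtype.val_injective (φ.comp (cocycleClass G₀ i))
    have hχ' (y : (G₀.d i (i + 1)).hom.ker) : χ y.1 = φ (cocycleClass G₀ i y) := hχ y
    refine CharMod.ext fun f => ?_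
    obtain ⟨y, rfl⟩ := cocycleClass_surjective i f
    rw [← hχ']
    refine h.inj i χ (fun x => ?_) (fun z hz v => ?_) y.1 y.2
    · rw [hχ' ⟨_, d_mem_ker G₀ i x⟩, (cocycleClass_eq_zero_iff i _).2 ⟨x, rfl⟩, map_zero]
    · rw [hχ' ⟨_, map_mem_ker (τ v) i ⟨z, hz⟩⟩, ← cocycleClass_comp i (τ v) ⟨z, hz⟩ _ rfl]
      exact hφ _ v
  · intro l hl
    obtain ⟨χ, hχ, hχ'⟩ := h.surj i (l.comp (cocycleClass F i)) (fun z hz => by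
      change l (cocycleClass F i z) = 0
      rw [(cocycleClass_eq_zero_iff i z).2 hz, map_zero]) (fun s z z' hz => by
      change l (cocycleClass F i z') = s • l (cocycleClass F i z)
      rw [← cocycleClass_comp i (actHom r s) z z' hz.symm]
      exact hl s _)
    obtain ⟨φ, hφ⟩ := CharMod.exists_factor (cocycleClass G₀ i)
      (χ.comp (G₀.d i (i + 1)).hom.ker.subtype.toAddMonoidHom) (fun x hx => by
        obtain ⟨y, hy⟩ := (cocycleClass_eq_zero_iff i x).1 hx
        change χ x.1 = 0
        rw [hy, hχ])
    have hφ' (y : (G₀.d i (i + 1)).hom.ker) : φ (cocycleClass G₀ i y) = χ y.1 := hφ y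
    refine ⟨φ, fun f v => ?_⟩
    obtain ⟨z, rfl⟩ := cocycleClass_surjective i f
    change φ (cocycleClass F i z ≫ DerivedCategory.Q.map (τ v)) = _
    rw [cocycleClass_comp i (τ v) z ⟨_, map_mem_ker (τ v) i z⟩ rfl, hφ', hχ']
    rfl

section

variable (hR : IsLeftCoherent R) (hW : Module.Baer S (CharMod V))
  (hτ : ∀ s, ∃ c : V → V, (∀ v, τ (c v) = actHom r s ≫ τ v) ∧
    ∀ (w : CharMod V) v, (s • w) v = w (c v))
  (h : PairCohomology r τ) (a b : ℤ) [F.IsStrictlyGE a] [F.IsStrictlyLE b] [G₀.IsStrictlyGE a]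
  (hfp : ∀ i, Module.FinitePresentation R (F.homology i))
  (hr : Function.Bijective fun s : S => DerivedCategory.Q.map (r s))
  (hv : ∀ n : ℤ, n ≠ 0 → ∀ f : DerivedCategory.Q.obj F ⟶ (DerivedCategory.Q.obj F)⟦n⟧, f = 0)

include hτ in
lemma derivedPairing_equivariant (s : S) :
    ∃ c : V → V, (∀ v, derivedPairing τ (c v) = derivedAction r s ≫ derivedPairing τ v) ∧
      ∀ (w : CharMod V) v, (s • w) v = w (c v) := by
  obtain ⟨c, hc, hc'⟩ := hτ s
  refine ⟨c, fun v => ?_, hc'⟩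
  change DerivedCategory.Q.map (τ (c v)) = _
  rw [hc]
  exact DerivedCategory.Q.map_comp (actHom r s) (τ v)

include hR hW hτ h a b hfp

lemma PairCohomology.pairGood_self :
    PairGood (derivedAction r) (derivedPairing τ) (DerivedCategory.Q.obj F) := by
  refine PairGood.of_bounded hR hW (derivedPairing_equivariant hτ) h.pairGood a inferInstance
    inferInstance (b - a + 1).toNat a _ inferInstance ?_ (fun i => ?_)
  · have : F.IsStrictlyLE (a - 1 + (b - a + 1).toNat) :=
      F.isStrictlyLE_of_le b _ (by lia)
    infer_instance
  · exact finitePresentation_of_iso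
      ((DerivedCategory.homologyFunctorFactors (ModuleCat.{u} R) i).app F).symm (hfp i)

include hr

variable [QuasiIso σ] [G.IsKInjective]

/-- With G a K-injective replacement of G₀, morphisms in the derived category become cochains F → G.
This and the next two results say that the cohomology of the complex of such cochains is V in degree
0 and zero elsewhere. -/
theorem PairCohomology.exists_eq (z : Cochain F G 0) (hz : δ 0 1 z = 0) :
    ∃ (v : V) (w : Cochain F G (-1)), z = Cochain.ofHom (τ v ≫ σ) + δ (-1) 0 w := by
  have hg := h.pairGood_self hR hW hτ a b hfp 0
  let e := (shiftFunctorZero (DerivedCategory (ModuleCat.{u} R)) ℤ).app (DerivedCategory.Q.obj F)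
  obtain ⟨-, hb⟩ := bijective_of_pairing (derivedPairing_equivariant hτ) hr (hg.1.of_iso e)
    (hg.2.of_iso e)
  let f : F ⟶ G := Cocycle.homOf (Cocycle.mk z 1 rfl hz)
  have hf : Cochain.ofHom f = z := Cocycle.cochain_ofHom_homOf_eq_coe _
  obtain ⟨v, hv⟩ := hb (DerivedCategory.Q.map f ≫ inv (DerivedCategory.Q.map σ))
  have hv' : DerivedCategory.Q.map (τ v) = DerivedCategory.Q.map f ≫
    inv (DerivedCategory.Q.map σ) := hv
  obtain ⟨hh⟩ := homotopy_zero_of_isKInjective (f - τ v ≫ σ) (by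
    rw [Functor.map_sub, Functor.map_comp, hv']
    simp)
  obtain ⟨w, hw⟩ := exists_δ_of_homotopy_zero _ hh
  refine ⟨v, w, ?_⟩
  rw [hw, Cochain.ofHom_sub, hf]
  abel

theorem PairCohomology.eq_zero (v : V) (w : Cochain F G (-1))
    (hw : Cochain.ofHom (τ v ≫ σ) = δ (-1) 0 w) : v = 0 := by
  have hg := h.pairGood_self hR hW hτ a b hfp 0
  let e := (shiftFunctorZero (DerivedCategory (ModuleCat.{u} R)) ℤ).app (DerivedCategory.Q.obj F)
  obtain ⟨hb, -⟩ := bijective_of_pairing (derivedPairing_equivariant hτ) hr (hg.1.of_iso e)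
    (hg.2.of_iso e)
  rw [injective_iff_map_eq_zero] at hb
  refine hb v ?_
  have h0 : DerivedCategory.Q.map (τ v ≫ σ) = 0 :=
    Q_map_eq_zero_of_homotopy _ ((Cochain.equivHomotopy _ _).symm ⟨w, by
      rw [Cochain.ofHom_zero, add_zero, hw]⟩)
  rw [Functor.map_comp] at h0
  rw [← cancel_mono (DerivedCategory.Q.map σ), zero_comp]
  exact h0

omit hr
include hv σ

/-- Since F has no maps to its own nonzero shifts, injectivity of the pairing for M = F[-n] leaves
no nonzero map from F[-n] to G₀. -/
theorem PairCohomology.exists_δ (n : ℤ) (hn : n ≠ 0) (z : Cochain F G n)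
    (hz : δ n (n + 1) z = 0) : ∃ w : Cochain F G (n - 1), δ (n - 1) n w = z := by
  refine exists_δ_of_isKInjective n (fun f => ?_) z hz
  have hg := h.pairGood_self hR hW hτ a b hfp (-n)
  have h1 := eq_zero_of_pairInj hg.1
    ((shift_hom_eq_zero_iff _ _ (-n) n (by lia)).2 (hv n hn))
  rw [shift_hom_eq_zero_iff _ _ (-n) n (by lia)] at h1
  rw [← cancel_mono (inv ((DerivedCategory.Q.map σ)⟦n⟧')), zero_comp]
  exact h1 _

end

end Derived

end CoContra

end

open MulOpposite

noncomputable section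

namespace CoContra

/-! ### Quasi-isomorphisms -/

section

variable {R : Type u} [Ring R]

lemma comp_hom_apply {M N P : ModuleCat.{u} R} {f : M ⟶ N} {g : N ⟶ P} {h : M ⟶ P}
    (w : f ≫ g = h) (x : M) : g.hom (f.hom x) = h.hom x := by
  rw [← w]
  rfl

lemma acyclic_mappingCone_of_elements {F G : CochainComplex (ModuleCat.{u} R) ℤ} (f : F ⟶ G)
    (hinj : ∀ i j : ℤ, i + 1 = j → ∀ x : F.X j, (F.d j (j + 1)).hom x = 0 → ∀ y : G.X i,
      (f.f j).hom x = (G.d i j).hom y → ∃ x' : F.X i, (F.d i j).hom x' = x)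
    (hsurj : ∀ i j : ℤ, i + 1 = j → ∀ y : G.X j, (G.d j (j + 1)).hom y = 0 →
      ∃ x : F.X j, (F.d j (j + 1)).hom x = 0 ∧ ∃ y' : G.X i, y = (f.f j).hom x + (G.d i j).hom y') :
    (mappingCone f).Acyclic := by
  rw [acyclic_iff_elements]
  intro m n k hmn hnk x hx
  obtain rfl : k = n + 1 := hnk.symm
  have hx : ((mappingCone f).d n (n + 1)).hom x = 0 := hx
  let fst : F.X (n + 1) := ((mappingCone.fst f).1.v n (n + 1) rfl).hom x
  let snd : G.X n := ((mappingCone.snd f).v n n (add_zero n)).hom x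
  have h1 : (F.d (n + 1) (n + 1 + 1)).hom fst = 0 := by
    have := comp_hom_apply (mappingCone.d_fst_v f n (n + 1) (n + 1 + 1) rfl rfl) x
    rw [hx, map_zero] at this
    have h2 : (0 : F.X (n + 1 + 1)) = -((F.d (n + 1) (n + 1 + 1)).hom fst) := by
      simpa [Preadditive.neg_comp] using! this
    exact neg_eq_zero.1 h2.symm
  have h2 : (f.f (n + 1)).hom fst + (G.d n (n + 1)).hom snd = 0 := by
    have := comp_hom_apply (mappingCone.d_snd_v f n (n + 1) rfl) x
    rw [hx, map_zero] at this
    exact this.symm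
  obtain ⟨a', ha'⟩ := hinj n (n + 1) rfl fst h1 (-snd) (by
    rw [map_neg, eq_neg_iff_add_eq_zero, h2])
  obtain ⟨a'', ha'', b', hb'⟩ := hsurj m n hmn ((f.f n).hom a' + snd) (by
    rw [map_add, comp_hom_apply (f.comm n (n + 1)), ModuleCat.hom_comp, LinearMap.comp_apply, ha',
      h2])
  refine ⟨((mappingCone.inl f).v n m (by lia)).hom (a'' - a') + ((mappingCone.inr f).f m).hom b',
    ?_⟩
  change ((mappingCone f).d m n).hom _ = x
  have h3 : ((mappingCone.inl f).v (n + 1) n (by lia)).hom fst + ((mappingCone.inr f).f n).hom snd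
      = x := congr_arg (fun g => g.hom x) (mappingCone.id_X f n (n + 1) rfl)
  rw [map_add, comp_hom_apply (mappingCone.inl_v_d f n m (n + 1) (by lia) (by lia)),
    comp_hom_apply (mappingCone.inr_f_d f m n)]
  rw [← h3, ModuleCat.hom_sub, LinearMap.sub_apply]
  simp only [ModuleCat.hom_comp, LinearMap.comp_apply, map_sub, ha', ha'']
  have h4 : snd = (f.f n).hom a'' + (G.d m n).hom b' - (f.f n).hom a' := by
    rw [← hb']
    abel
  rw [h4, map_sub, map_add, map_zero]
  abel

/-- Map X to the complex with one injective term E in degree j, where E contains X^j modulo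
boundaries. Orthogonality makes this map null-homotopic, so it vanishes on cocycles of degree j,
which are therefore boundaries. -/
lemma acyclic_of_coacyclic {X : CochainComplex (ModuleCat.{u} R) ℤ}
    (hX : coacyclic R ((toHot R).obj X)) : X.Acyclic := by
  rw [acyclic_iff_elements]
  intro i j k hij hjk x hx
  let q : X.X j →ₗ[R] (X.X j ⧸ (X.d i j).hom.range) := (X.d i j).hom.range.mkQ
  let E := Injective.under (ModuleCat.of R (X.X j ⧸ (X.d i j).hom.range))
  let ι : ModuleCat.of R (X.X j ⧸ (X.d i j).hom.range) ⟶ E := Injective.ι _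
  have hι : Function.Injective ι.hom := (ModuleCat.mono_iff_injective ι).1 inferInstance
  let φ : X ⟶ (HomologicalComplex.single _ (ComplexShape.up ℤ) j).obj E :=
    HomologicalComplex.mkHomToSingle (ModuleCat.ofHom q ≫ ι) (fun i' hi' => by
      obtain rfl : i' = i := by
        have : i' + 1 = j := hi'
        lia
      ext y
      change ι.hom (q ((X.d i' j).hom y)) = 0
      rw [show q ((X.d i' j).hom y) = 0 from (Submodule.Quotient.mk_eq_zero _).2 ⟨y, rfl⟩, map_zero])
  have h0 := rightOrthogonal_coacyclic ((HomologicalComplex.single _ (ComplexShape.up ℤ) j).obj E)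
    (fun n => by
      by_cases h : n = j
      · subst h
        exact Injective.of_iso (HomologicalComplex.singleObjXSelf (ComplexShape.up ℤ) n E).symm
          inferInstance
      · exact (HomologicalComplex.isZero_single_obj_X _ _ _ _ h).injective) ((toHot R).map φ) hX
  obtain ⟨h⟩ := (HomotopyCategory.quotient_map_eq_zero_iff φ).1 h0
  have h1 := h.comm j
  rw [dNext_eq _ (show (ComplexShape.up ℤ).Rel j k from hjk),
      prevD_eq _ (show (ComplexShape.up ℤ).Rel i j from hij),
      HomologicalComplex.single_obj_d, comp_zero, add_zero, HomologicalComplex.zero_f,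
      add_zero, HomologicalComplex.mkHomToSingle_f, Iso.comp_inv_eq] at h1
  have h2 : ι.hom (q x) = 0 := by
    have h3 := congr_arg (fun g : X.X j ⟶ E => g.hom x) h1
    refine h3.trans ?_
    rw [ModuleCat.hom_comp, ModuleCat.hom_comp, LinearMap.comp_apply, LinearMap.comp_apply,
      show (X.d j k).hom x = 0 from hx, map_zero, map_zero]
  have h3 : q x = 0 := hι (by rw [h2, map_zero])
  exact (Submodule.Quotient.mk_eq_zero _).1 h3

lemma quasiIso_of_trW_coacyclic {X Y : CochainComplex (ModuleCat.{u} R) ℤ} (s : X ⟶ Y)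
    (hs : (coacyclic R).trW ((toHot R).map s)) : QuasiIso s := by
  have h1 : coacyclic R ≤ HomotopyCategory.subcategoryAcyclic _ := by
    rintro ⟨X⟩ hX
    exact (HomotopyCategory.quotient_obj_mem_subcategoryAcyclic_iff_acyclic X).2
      (acyclic_of_coacyclic hX)
  have h2 := ObjectProperty.trW_monotone h1 _ hs
  rw [← HomotopyCategory.quasiIso_eq_trW_subcategoryAcyclic,
    HomotopyCategory.quotient_map_mem_quasiIso_iff] at h2
  exact h2

end

end CoContra

end

open MulOpposite

noncomputable section

namespace CoContra

/-! ### The unit of the tensor-Hom adjunction on a flat module -/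

section

variable {A B : Type u} [Ring A] [Ring B] (D : CochainComplex (BimodCat A B) ℤ)

/-- The action of `Bᵐᵒᵖ` on the complex of left modules. -/
def rightAction : Bᵐᵒᵖ →+* End (leftComplex D) where
  toFun b := rightMul D b.unop
  map_one' := rightMul_one D
  map_mul' b b' := rightMul_mul D b'.unop b.unop
  map_zero' := rightMul_zero D
  map_add' b b' := rightMul_add D b.unop b'.unop

/-- A bimodule map, as a map of right `B`-modules. -/
def rightLinear {E E' : BimodCat A B} (f : E ⟶ E') : E →ₗ[Bᵐᵒᵖ] E' where
  toFun := f
  map_add' := map_add f.hom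
  map_smul' b e := f.hom.map_smul ((1 : A) ⊗ₜ[ℤ] b) e

variable {K : CochainComplex (ModuleCat.{u} B) ℤ} (hK : ∀ q, q ≠ 0 → IsZero (K.X q))

include hK

lemma tensorElt_eq_zero_of_ne {p q n : ℤ} (h : p + q = n) (hq : q ≠ 0) (x : K.X q) (e : D.X p) :
    tensorElt D K n h x e = 0 := by
  have := ModuleCat.subsingleton_of_isZero (hK q hq)
  rw [Subsingleton.elim x 0]
  have h1 := tensorElt_add D h (0 : K.X q) 0 e
  rw [add_zero] at h1
  exact left_eq_add.1 h1

lemma tensorElt_zero_d {p n n' : ℤ} (h : p + 0 = n) (h' : n + 1 = n') (e : D.X p) (x : K.X 0) :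
    (((tensorFunctor D).obj K).d n n').hom (tensorElt D K n h x e) =
      tensorElt D K n' (by lia) x ((D.d p (p + 1)).hom e) := by
  rw [tensorElt_d D h h', tensorElt_eq_zero_of_ne D hK (q := 0 + 1) _ (by norm_num), smul_zero,
    add_zero]

lemma char_tensor_ext {n : ℤ} {χ χ' : CharMod (((tensorFunctor D).obj K).X n)}
    (h : ∀ (e : D.X n) (x : K.X 0), χ (tensorElt D K n (add_zero n) x e) =
      χ' (tensorElt D K n (add_zero n) x e)) : χ = χ' := by
  have h1 : tensorπ D K n 0 n ≫ tensorι D K n 0 n (add_zero n) = 𝟙 _ := by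
    refine tensor_hom_ext D fun p q hpq e x => ?_
    by_cases hq : q = 0
    · subst hq
      obtain rfl : p = n := by lia
      change (tensorι D K p 0 p _).hom ((tensorπ D K p 0 p).hom ((tensorι D K p 0 p hpq).hom _)) = _
      rw [tensorπ_tensorι_self]
      rfl
    · have h2 : (tensorι D K p q n hpq).hom (BalancedTensor.tmul A B e x) = 0 :=
        tensorElt_eq_zero_of_ne D hK hpq hq x e
      rw [h2, map_zero, map_zero]
  have h2 : χ.comp (tensorι D K n 0 n (add_zero n)).hom.toAddMonoidHom =
      χ'.comp (tensorι D K n 0 n (add_zero n)).hom.toAddMonoidHom :=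
    BalancedTensor.addHom_ext (A := A) fun e x => h e x
  refine CharMod.ext fun y => ?_
  have h3 : (tensorι D K n 0 n (add_zero n)).hom ((tensorπ D K n 0 n).hom y) = y :=
    congr_arg (fun g => g.hom y) h1
  rw [← h3]
  exact DFunLike.congr_fun h2 _

omit hK

lemma exists_char_tensor {n : ℤ} (l : D.X n →ₗ[Bᵐᵒᵖ] CharMod (K.X 0)) :
    ∃ χ : CharMod (((tensorFunctor D).obj K).X n), ∀ e x,
      χ (tensorElt D K n (add_zero n) x e) = l e x := by
  obtain ⟨χ, hχ⟩ := BalancedTensor.exists_char A l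
  refine ⟨χ.comp (tensorπ D K n 0 n).hom.toAddMonoidHom, fun e x => ?_⟩
  rw [CharMod.comp_apply, ← hχ]
  exact congr_arg χ (tensorπ_tensorι_self D K n 0 n (add_zero n) _)

/-- The linear map given by a character. -/
def charTensor {p q n : ℤ} (h : p + q = n) (χ : CharMod (((tensorFunctor D).obj K).X n)) :
    D.X p →ₗ[Bᵐᵒᵖ] CharMod (K.X q) where
  toFun e := (AddMonoidHom.mk' (fun x => χ (tensorElt D K n h x e)) (fun x y => by
    rw [tensorElt_add, map_add]) : K.X q →+ AddCircle (1 : ℚ))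
  map_add' e e' := CharMod.ext fun x => by
    change χ (tensorElt D K n h x (e + e')) = χ (tensorElt D K n h x e) +
      χ (tensorElt D K n h x e')
    rw [map_add, map_add]
  map_smul' b e := CharMod.ext fun x => by
    change χ (tensorElt D K n h x (b • e)) =
      χ (tensorElt D K n h (b.unop • x) e)
    rw [tensorElt_smul, op_unop]

include hK

/-- The maps `e ↦ e ⊗ v` of complexes. -/
def tensorPairing : K.X 0 →+ (leftComplex D ⟶ (tensorFunctor D).obj K) := AddMonoidHom.mk'
  (fun v =>
    { f := fun n => ModuleCat.ofHom (X := D.X n) (tensorElt D K n (add_zero n) v)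
      comm' := fun n n' hn => by
        obtain rfl : n + 1 = n' := hn
        ext e
        exact tensorElt_zero_d D hK (add_zero n) rfl e v })
  (fun v v' => by
    ext n e
    exact tensorElt_add D (add_zero n) v v' e)

/-- Characters of D^i ⊗ F are maps from D^i to F^*. As F^* is injective, Hom(-, F^*) is exact, so
the characters of the cohomology of D ⊗ F are the maps from the cohomology of D to F^*. -/
lemma pairCohomology_tensor (hK' : IsFlat (K.X 0)) :
    PairCohomology (rightAction D) (tensorPairing D hK) where
  inj i χ hχ h y hy := by
    obtain ⟨μ, hμ⟩ := baer_exists_factor ((isFlat_iff_baer _).1 hK') (rightLinear (D.d i (i + 1)))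
      (charTensor D (add_zero i) χ) (fun e he => CharMod.ext fun v => h e he v)
    obtain ⟨χ', hχ'⟩ := exists_char_tensor D μ
    have h1 : χ = χ'.comp (((tensorFunctor D).obj K).d i (i + 1)).hom.toAddMonoidHom :=
      char_tensor_ext D hK fun e x => by
        rw [CharMod.comp_apply]
        refine (DFunLike.congr_fun (hμ e) x).symm.trans ((hχ' _ _).symm.trans ?_)
        exact congr_arg χ' (tensorElt_zero_d D hK (add_zero i) rfl e x).symm
    rw [h1, CharMod.comp_apply]
    exact (congr_arg χ' hy).trans (map_zero _)
  surj i l hl hl' := by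
    let N : Submodule Bᵐᵒᵖ (D.X i) := (rightLinear (D.d i (i + 1))).ker
    obtain ⟨μ, hμ⟩ := baer_exists_factor ((isFlat_iff_baer _).1 hK') N.subtype
      { toFun := fun z => l ⟨z.1, z.2⟩
        map_add' := fun z z' => map_add l ⟨z.1, z.2⟩ ⟨z'.1, z'.2⟩
        map_smul' := fun b z => hl' b ⟨z.1, z.2⟩ ⟨(b • z).1, (b • z).2⟩ rfl } (fun z hz => by
          obtain rfl : z = 0 := Subtype.ext hz
          exact map_zero l)
    obtain ⟨χ, hχ⟩ := exists_char_tensor D μ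
    refine ⟨χ, fun y => ?_, fun z v => ?_⟩
    · have h1 : χ.comp (((tensorFunctor D).obj K).d (i - 1) i).hom.toAddMonoidHom = 0 :=
        char_tensor_ext D hK fun e x => by
          rw [CharMod.comp_apply]
          refine (congr_arg χ (tensorElt_zero_d D hK (add_zero (i - 1)) (by lia) e x)).trans ?_
          have key (j : ℤ) (hj : j = i) (h : j + 0 = i) :
              χ (tensorElt D K i h x ((D.d (i - 1) j).hom e)) = 0 := by
            subst hj
            refine (hχ _ _).trans ?_
            have h3 := d_mem_ker (leftComplex D) j e
            refine (DFunLike.congr_fun (hμ ⟨_, h3⟩) x).trans ?_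
            exact DFunLike.congr_fun (hl ⟨_, h3⟩ ⟨e, rfl⟩) x
          exact key _ (by lia) _
      exact DFunLike.congr_fun h1 y
    · refine (hχ _ _).trans ?_
      exact DFunLike.congr_fun (hμ ⟨z.1, z.2⟩) v

lemma tensorPairing_smul (b : B) (v : K.X 0) :
    tensorPairing D hK (b • v) = rightMul D b ≫ tensorPairing D hK v := by
  ext n e
  exact tensorElt_smul D (add_zero n) b v e

omit hK

lemma preservesHomology_restrictScalars {R R' : Type u} [Ring R] [Ring R'] (f : R →+* R') :
    (ModuleCat.restrictScalars.{u} f).PreservesHomology :=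
  Functor.preservesHomology_of_map_exact _ fun S hS => by
    rw [ShortComplex.ShortExact.moduleCat_exact_iff_function_exact] at hS ⊢
    exact hS

lemma finitePresentation_homology_rightComplex (hD : IsDualizingComplex D) (i : ℤ) :
    Module.FinitePresentation Bᵐᵒᵖ ((rightComplex D).homology i) :=
  have : (rightModule A B).PreservesHomology := preservesHomology_restrictScalars _
  finitePresentation_of_iso ((D.sc i).mapHomologyIso (rightModule A B)).symm (hD.fp_right i)

lemma finitePresentation_homology_leftComplex (hD : IsDualizingComplex D) (i : ℤ) :
    Module.FinitePresentation A ((leftComplex D).homology i) :=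
  have : (leftModule A B).PreservesHomology := preservesHomology_restrictScalars _
  finitePresentation_of_iso ((D.sc i).mapHomologyIso (leftModule A B)).symm (hD.fp_left i)

lemma isZero_leftComplex_X {i : ℤ} (h : IsZero (D.X i)) : IsZero ((leftComplex D).X i) :=
  (leftModule A B).map_isZero h

lemma isZero_rightComplex_X {i : ℤ} (h : IsZero (D.X i)) : IsZero ((rightComplex D).X i) :=
  (rightModule A B).map_isZero h

include hK

/-- The unit of the adjunction, for a flat module `K` placed in degree zero. -/
theorem acyclic_mappingCone_curry (hA : IsLeftCoherent A) (hD : IsDualizingComplex D)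
    (hK' : IsFlat (K.X 0)) {J : CochainComplex (ModuleCat.{u} A) ℤ} (hJ : ∀ i, Injective (J.X i))
    (c : ℤ) (hc : ∀ i, i < c → IsZero (J.X i)) (σ : (tensorFunctor D).obj K ⟶ J)
    (hσ : QuasiIso σ) : (mappingCone (tensorHomCurry D σ)).Acyclic := by
  obtain ⟨a, b, hab⟩ := hD.finite
  have : (leftComplex D).IsStrictlyGE a := by
    rw [isStrictlyGE_iff]
    exact fun i hi => isZero_leftComplex_X D (hab i (Or.inl hi))
  have : (leftComplex D).IsStrictlyLE b := by
    rw [isStrictlyLE_iff]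
    exact fun i hi => isZero_leftComplex_X D (hab i (Or.inr hi))
  have : ((tensorFunctor D).obj K).IsStrictlyGE a := by
    rw [isStrictlyGE_iff]
    refine fun i hi => isZero_tensorFunctor_X D K i fun p q hpq => ?_
    by_cases hq : q = 0
    · exact Or.inl (hab p (Or.inl (by lia)))
    · exact Or.inr (hK q hq)
  have : J.IsStrictlyGE c := by
    rw [isStrictlyGE_iff]
    exact hc
  -- The lower bound on J is used here: complexes of injectives are K-injective when bounded below.
  have : J.IsKInjective := isKInjective_of_injective J c
  have hW := (isFlat_iff_baer _).1 hK'
  have h := pairCohomology_tensor D hK hK'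
  have hτ (s : Bᵐᵒᵖ) : ∃ c : K.X 0 → K.X 0, (∀ v, tensorPairing D hK (c v) =
      actHom (rightAction D) s ≫ tensorPairing D hK v) ∧
      ∀ (w : CharMod (K.X 0)) v, (s • w) v = w (c v) :=
    ⟨fun v => s.unop • v, fun v => tensorPairing_smul D hK s.unop v, fun w v => rfl⟩
  have hfp := finitePresentation_homology_leftComplex D hD
  have hr : Function.Bijective fun s : Bᵐᵒᵖ =>
      @DerivedCategory.Q _ _ _ (HasDerivedCategory.standard _) |>.map (actHom (rightAction D) s) :=
    hD.homothety_right.comp unop_bijective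
  have hcurry (v : K.X 0) : (((tensorHomCurry D σ).f 0).hom v : Cochain (leftComplex D) J 0) =
      Cochain.ofHom (tensorPairing D hK v ≫ σ) := by
    refine cochain_ext fun p n hpn e => ?_
    obtain rfl : p = n := by lia
    rw [tensorHomCurry_apply, mul_zero, Int.negOnePow_zero, one_smul]
    exact congr_arg (fun f => f.hom e)
      (Cochain.ofHom_v (tensorPairing D hK v ≫ σ) p).symm
  -- As K has only the term K^0, acyclicity means that Hom_A(D, J) has cohomology K^0 in degree 0,
  -- embedded through the pairing, and none elsewhere.
  refine acyclic_mappingCone_of_elements _ (fun i j hij x hx y hxy => ?_) (fun i j hij y hy => ?_)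
  · by_cases hj : j = 0
    · subst hj
      obtain rfl : i = -1 := by lia
      refine ⟨0, ?_⟩
      rw [map_zero]
      refine (h.eq_zero σ hA hW hτ a b hfp hr x y ?_).symm
      exact (hcurry x).symm.trans hxy
    · have := ModuleCat.subsingleton_of_isZero (hK j hj)
      exact ⟨0, Subsingleton.elim _ _⟩
  · by_cases hj : j = 0
    · subst hj
      obtain rfl : i = -1 := by lia
      obtain ⟨v, w, hvw⟩ := h.exists_eq σ hA hW hτ a b hfp hr y hy
      refine ⟨v, ?_, w, ?_⟩
      · have := ModuleCat.subsingleton_of_isZero (hK (0 + 1) (by norm_num))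
        exact Subsingleton.elim _ _
      · refine hvw.trans ?_
        rw [← hcurry]
        rfl
    · obtain rfl : i = j - 1 := by lia
      obtain ⟨w, hw⟩ := h.exists_δ σ hA hW hτ a b hfp hD.hom_left_eq_zero j hj y hy
      refine ⟨0, map_zero _, w, ?_⟩
      rw [map_zero, zero_add]
      exact hw.symm

end

end CoContra

end

open MulOpposite

noncomputable section

namespace CoContra

/-! ### Double character modules of injective modules -/

section

variable {A : Type u} [Ring A]

/-- Transport of the Baer property along the identification of a ring with its double opposite. -/
lemma baer_of_baer_op_op {V : Type*} [AddCommGroup V] [Module Aᵐᵒᵖ V]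
    (h : Module.Baer Aᵐᵒᵖᵐᵒᵖ (CharMod V)) : Module.Baer A (CharMod V) := by
  intro I g
  let I' : Ideal Aᵐᵒᵖᵐᵒᵖ :=
    { carrier := {x | x.unop.unop ∈ I}
      add_mem' := fun hx hy => I.add_mem hx hy
      zero_mem' := I.zero_mem
      smul_mem' := fun c x hx => I.mul_mem_left c.unop.unop hx }
  obtain ⟨g', hg'⟩ := h I'
    { toFun := fun x => g ⟨x.1.unop.unop, x.2⟩
      map_add' := fun x y => map_add g ⟨x.1.unop.unop, x.2⟩ ⟨y.1.unop.unop, y.2⟩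
      map_smul' := fun c x => map_smul g c.unop.unop ⟨x.1.unop.unop, x.2⟩ }
  refine ⟨{ toFun := fun a => g' (op (op a))
            map_add' := fun x y => map_add g' (op (op x)) (op (op y))
            map_smul' := fun c x => map_smul g' (op (op c)) (op (op x)) }, fun x hx => ?_⟩
  exact hg' (op (op x)) hx

/-- The dual of an injective module satisfies the equational criterion. Solving for y means
factoring the character (x_k) ↦ Σ f_k(x_k) through the matrix r. If r kills x, the x_k satisfy all
relations between the i_k, so by injectivity x_k = i_k g(1) for one map g, and the hypothesis on f
gives zero. -/
lemma relSolvable_charMod (J : ModuleCat.{u} A) (hJ : Injective J) :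
    RelSolvable Aᵐᵒᵖ (CharMod J) := by
  intro n m i r hr f hf
  let μ : (Fin n → J) →+ (Fin m → J) := AddMonoidHom.mk'
    (fun x l => ∑ k, (r k l).unop • x k) (fun x y => by
      ext l
      simp [Finset.sum_add_distrib])
  let φ : CharMod (Fin n → J) := (AddMonoidHom.mk' (fun x => ∑ k, f k (x k)) (fun x y => by
    simp [Finset.sum_add_distrib]) : (Fin n → J) →+ AddCircle (1 : ℚ))
  obtain ⟨y, hy⟩ := CharMod.exists_factor μ φ (fun x hx => by
    obtain ⟨g, hg⟩ := baer_exists_factor (baer_of_injective hJ)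
      (Fintype.linearCombination A (fun k => (i k).unop)) (Fintype.linearCombination A x)
      (fun c hc => by
        rw [Fintype.linearCombination_apply] at hc ⊢
        obtain ⟨s, hs⟩ := hr.2 (fun k => op (c k)) (by
          apply unop_injective
          simpa using hc)
        have hc' (k : Fin n) : c k = ∑ l, (s l).unop * (r k l).unop := by
          have := congr_arg unop (hs k)
          simpa using this
        simp_rw [hc', Finset.sum_smul, mul_smul]
        rw [Finset.sum_comm]
        refine Finset.sum_eq_zero fun l _ => ?_
        rw [← Finset.smul_sum, show ∑ k, (r k l).unop • x k = 0 from congr_fun hx l, smul_zero])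
    have hx' (k : Fin n) : x k = (i k).unop • g 1 := by
      have := hg (Pi.single k 1)
      rw [Fintype.linearCombination_apply_single, Fintype.linearCombination_apply_single,
        one_smul, one_smul, ← mul_one (i k).unop, ← smul_eq_mul, map_smul] at this
      exact this.symm
    have h0 := DFunLike.congr_fun hf (g 1)
    rw [CharMod.sum_apply] at h0
    refine Eq.trans ?_ h0
    change ∑ k, f k (x k) = _
    refine Finset.sum_congr rfl fun k _ => ?_
    rw [hx' k]
    rfl)
  refine ⟨fun l => y.comp (AddMonoidHom.single (fun _ => J) l), fun k => CharMod.ext fun x => ?_⟩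
  have h1 := hy (Pi.single k x)
  have h2 : φ (Pi.single k x) = f k x := by
    change ∑ k', f k' ((Pi.single k x : Fin n → J) k') = f k x
    rw [Finset.sum_eq_single k]
    · simp
    · intro k' _ hk
      simp [Pi.single_eq_of_ne hk]
    · simp
  have h3 : μ (Pi.single k x) = ∑ l, Pi.single l ((r k l).unop • x) := by
    ext l
    change ∑ k', (r k' l).unop • (Pi.single k x : Fin n → J) k' = _
    rw [Finset.sum_apply, Finset.sum_eq_single k, Finset.sum_eq_single l]
    · simp
    · intro l' _ hl
      simp [Pi.single_eq_of_ne hl.symm]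
    · simp
    · intro k' _ hk
      simp [Pi.single_eq_of_ne hk]
    · simp
  rw [h2, h3, map_sum] at h1
  rw [← h1, CharMod.sum_apply]
  rfl

/-- Over a left coherent ring the double dual of an injective module is injective. This is the
hypothesis on V^* in the dévissage for V = J^*. -/
lemma baer_charMod_charMod (hA : IsLeftCoherent A) (J : ModuleCat.{u} A) (hJ : Injective J) :
    Module.Baer A (CharMod (CharMod J)) := by
  refine baer_of_baer_op_op ((relSolvable_charMod J hJ).baer_of_relGen fun n i => ?_)
  obtain ⟨m, s, hs, hs'⟩ := IsCoherentModule.exists_relations (M := A) hA (fun k => (i k).unop)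
  refine ⟨m, fun k l => op (s l k), fun l => ?_, fun c hc => ?_⟩
  · apply unop_injective
    simpa using hs l
  · obtain ⟨t, ht⟩ := hs' (fun k => (c k).unop) (by
      have := congr_arg unop hc
      simpa using this)
    refine ⟨fun l => op (t l), fun k => ?_⟩
    apply unop_injective
    simpa using ht k

/-- A finite presentation of the cohomology, in terms of cocycles. -/
lemma exists_presentation_of_homology (F : CochainComplex (ModuleCat.{u} A) ℤ) (i : ℤ)
    (hF : Module.FinitePresentation A (F.homology i)) :
    ∃ (n m : ℕ) (z : Fin n → F.X i) (r : Fin m → Fin n → A),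
      (∀ k, (F.d i (i + 1)).hom (z k) = 0) ∧
      (∀ x, (F.d i (i + 1)).hom x = 0 → ∃ (a : Fin n → A) (y : F.X (i - 1)),
        x = ∑ k, a k • z k + (F.d (i - 1) i).hom y) ∧
      (∀ j, ∃ y : F.X (i - 1), ∑ k, r j k • z k = (F.d (i - 1) i).hom y) ∧
      ∀ a : Fin n → A, (∃ y : F.X (i - 1), ∑ k, a k • z k = (F.d (i - 1) i).hom y) →
        ∃ t : Fin m → A, ∀ k, a k = ∑ j, t j * r j k := by
  let S := F.sc' (i - 1) i (i + 1)
  let e : F.homology i ≅ S.moduleCatLeftHomologyData.H :=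
    ShortComplex.homologyMapIso (F.isoSc' (i - 1) i (i + 1) (by simp) (by simp)) ≪≫
      S.moduleCatHomologyIso
  let Z : Submodule A (F.X i) := (F.d i (i + 1)).hom.ker
  let Bd : Submodule A Z := LinearMap.range S.moduleCatToCycles
  have hfp : Module.FinitePresentation A (Z ⧸ Bd) := finitePresentation_of_iso e hF
  have hBd (x : Z) : x ∈ Bd ↔ ∃ y : F.X (i - 1), x.1 = (F.d (i - 1) i).hom y :=
    ⟨fun ⟨y, hy⟩ => ⟨y, (congr_arg Subtype.val hy).symm⟩, fun ⟨y, hy⟩ => ⟨y, Subtype.ext hy.symm⟩⟩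
  obtain ⟨n, g, hg⟩ := Module.Finite.exists_fin' A (Z ⧸ Bd)
  choose z hz using fun k => Submodule.Quotient.mk_surjective Bd (g (Pi.single k 1))
  have hgz (a : Fin n → A) : g a = Submodule.Quotient.mk (∑ k, a k • z k) := by
    have h1 : g a = ∑ k, a k • g (Pi.single k 1) := by
      conv_lhs => rw [pi_eq_sum_univ' a]
      rw [map_sum]
      refine Finset.sum_congr rfl fun k _ => ?_
      rw [map_smul]
    rw [h1]
    simp only [← hz]
    exact (map_sum Bd.mkQ _ _).symm ▸ rfl
  have hsum (a : Fin n → A) : (∑ k, a k • z k).1 = ∑ k, a k • (z k).1 := by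
    rw [← Submodule.subtype_apply, map_sum]
    rfl
  obtain ⟨m, r, hr⟩ := Submodule.fg_iff_exists_fin_generating_family.1
    (Module.FinitePresentation.fg_ker g hg)
  have hmem (a : Fin n → A) : a ∈ g.ker ↔
      ∃ y : F.X (i - 1), ∑ k, a k • (z k).1 = (F.d (i - 1) i).hom y := by
    rw [LinearMap.mem_ker, hgz, Submodule.Quotient.mk_eq_zero, hBd, hsum]
  refine ⟨n, m, fun k => (z k).1, r, fun k => (z k).2, fun x hx => ?_, fun j => ?_, fun a ha => ?_⟩
  · obtain ⟨a, ha⟩ := hg (Submodule.Quotient.mk ⟨x, hx⟩)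
    rw [hgz, eq_comm, Submodule.Quotient.eq, hBd] at ha
    obtain ⟨y, hy⟩ := ha
    refine ⟨a, y, ?_⟩
    rw [← hsum, ← hy]
    exact (add_sub_cancel _ _).symm
  · rw [← hmem, ← hr]
    exact Submodule.subset_span ⟨j, rfl⟩
  · rw [← hmem, ← hr, Submodule.mem_span_range_iff_exists_fun] at ha
    obtain ⟨t, ht⟩ := ha
    refine ⟨t, fun k => ?_⟩
    rw [← ht]
    simp

end

end CoContra

end

open MulOpposite

noncomputable section

namespace CoContra

/-! ### The character complex of `Hom_A(D, J)` -/

section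

variable {A B : Type u} [Ring A] [Ring B]

lemma CharMod.units_smul_apply {F : Type*} [AddCommGroup F] (n : ℤˣ) (c : CharMod F) (x : F) :
    (n • c) x = n • c x := by
  rw [Units.smul_def, Units.smul_def]
  exact map_zsmul (CharMod.eval x) _ c

/-- The complex of right modules `Hom_ℤ(K, ℚ/ℤ)`. -/
def charComplex (K : CochainComplex (ModuleCat.{u} B) ℤ) :
    CochainComplex (ModuleCat.{u} Bᵐᵒᵖ) ℤ where
  X m := ModuleCat.of Bᵐᵒᵖ (CharMod (K.X (-m)))
  -- With this sign, evaluation of Hom_A(D, J) on D is a chain map without any further sign when J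
  -- sits in degree zero.
  d m m' := m.negOnePow • ModuleCat.ofHom (CharMod.dual (K.d (-m') (-m)).hom)
  shape m m' h := by
    have : K.d (-m') (-m) = 0 := K.shape _ _ (fun h' => h (by
      have : -m' + 1 = -m := h'
      change m + 1 = m'
      lia))
    rw [this]
    ext y
    refine CharMod.ext fun x => ?_
    change (m.negOnePow • CharMod.dual _ y) x = 0
    rw [CharMod.units_smul_apply, CharMod.dual_apply]
    change m.negOnePow • y 0 = 0
    rw [map_zero, smul_zero]
  d_comp_d' i j k _ _ := by
    rw [Linear.units_smul_comp, Linear.comp_units_smul]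
    convert! smul_zero _
    convert! smul_zero _
    ext y
    refine CharMod.ext fun x => ?_
    change y ((K.d (-j) (-i)).hom ((K.d (-k) (-j)).hom x)) = 0
    rw [comp_hom_apply (K.d_comp_d _ _ _)]
    exact map_zero y

lemma charComplex_d_apply (K : CochainComplex (ModuleCat.{u} B) ℤ) (m m' : ℤ)
    (y : CharMod (K.X (-m))) (x : K.X (-m')) :
    (show CharMod (K.X (-m')) from ((charComplex K).d m m').hom y) x =
      m.negOnePow • y ((K.d (-m') (-m)).hom x) :=
  CharMod.units_smul_apply _ _ _

variable (D : CochainComplex (BimodCat A B) ℤ) {J : CochainComplex (ModuleCat.{u} A) ℤ}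

lemma cochainApply_δ' {q q' : ℤ} (hq : q + 1 = q') (z : Cochain (leftComplex D) J q) (p n n' : ℤ)
    (h : p + q = n) (h' : n + 1 = n') (h'' : p + q' = n') (e : D.X p) :
    cochainApply (δ q q' z) p n' h'' e =
      (J.d n n').hom (cochainApply z p n h e) + q'.negOnePow •
        cochainApply z (p + 1) n' (by lia) ((D.d p (p + 1)).hom e) := by
  subst hq
  exact cochainApply_δ D z p n n' h h' e

variable (hJ : ∀ n, n ≠ 0 → IsZero (J.X n))

include hJ in
lemma homComplex_d_apply {q q' : ℤ} (hq : q + 1 = q') (z : Cochain (leftComplex D) J q) (p : ℤ)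
    (h : p + q' = 0) (e : D.X p) :
    cochainApply (δ q q' z) p 0 h e =
      q'.negOnePow • cochainApply z (p + 1) 0 (by lia) ((D.d p (p + 1)).hom e) := by
  have := ModuleCat.subsingleton_of_isZero (hJ (-1) (by lia))
  rw [cochainApply_δ' D hq z p (-1) 0 (by lia) (by lia) h,
    Subsingleton.elim (cochainApply z p (-1) _ e) 0, map_zero, zero_add]

include hJ in
lemma homComplex_ext {p q : ℤ} (h : p + q = 0) {z z' : Cochain (leftComplex D) J q}
    (hz : ∀ e, cochainApply z p 0 h e = cochainApply z' p 0 h e) : z = z' := by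
  refine cochain_ext fun p' n hpn e => ?_
  by_cases hn : n = 0
  · subst hn
    obtain rfl : p' = p := by lia
    exact hz e
  · have := ModuleCat.subsingleton_of_isZero (hJ n hn)
    exact Subsingleton.elim _ _

lemma exists_cochainApply_eq {p q : ℤ} (h : p + q = 0) (g : D.X p →ₗ[A] J.X 0) :
    ∃ z : Cochain (leftComplex D) J q, cochainApply z p 0 h = g := by
  refine ⟨Cochain.single (K := leftComplex D) (ModuleCat.ofHom (X := D.X p) g) q, ?_⟩
  exact congr_arg ModuleCat.Hom.hom (Cochain.single_v (K := leftComplex D) _ q h)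

/-- Evaluation of the elements of `Hom_A(D, J)`, followed by a character. -/
def evalChar {p q : ℤ} (h : p + q = 0) (v : CharMod (J.X 0)) :
    D.X p →ₗ[Bᵐᵒᵖ] CharMod (((homFunctor D).obj J).X q) where
  toFun e := (AddMonoidHom.mk' (fun z : Cochain (leftComplex D) J q => v (cochainApply z p 0 h e))
    (fun z z' => by rw [cochainApply_add, map_add]) :
      (Cochain (leftComplex D) J q) →+ AddCircle (1 : ℚ))
  map_add' e e' := CharMod.ext fun z => by
    change v (cochainApply z p 0 h (e + e')) = v (cochainApply z p 0 h e) +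
      v (cochainApply z p 0 h e')
    rw [map_add, map_add]
  map_smul' b e := CharMod.ext fun z => by
    change v (cochainApply z p 0 h (b • e)) =
      v (cochainApply (b.unop • (show Cochain (leftComplex D) J q from z)) p 0 h e)
    rw [cochainApply_smul, op_unop]

/-- The maps `e ↦ (z ↦ v (z e))` of complexes. -/
def homPairing : CharMod (J.X 0) →+ (rightComplex D ⟶ charComplex ((homFunctor D).obj J)) :=
  AddMonoidHom.mk' (fun v =>
    { f := fun p => ModuleCat.ofHom (X := D.X p) (evalChar D (add_neg_cancel p) v)
      comm' := fun p p' hp => by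
        obtain rfl : p + 1 = p' := hp
        ext e
        refine CharMod.ext fun z => ?_
        refine (charComplex_d_apply _ _ _ _ z).trans ?_
        refine (congr_arg (fun x => p.negOnePow • v x) (homComplex_d_apply D hJ (by lia)
          (show Cochain (leftComplex D) J (-(p + 1)) from z) p (add_neg_cancel p) e)).trans ?_
        have h1 (x : J.X 0) : v ((-p).negOnePow • x) = (-p).negOnePow • v x := by
          rw [Units.smul_def, Units.smul_def, map_zsmul]
        dsimp only
        rw [h1, Int.negOnePow_neg, smul_smul, Int.units_mul_self, one_smul]
        rfl })
    (fun v v' => by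
      ext p e
      rfl)

/-- The action of `A` on the complex of right modules. -/
def leftAction : A →+* End (rightComplex D) where
  toFun a := leftMul D a
  map_one' := by
    refine HomologicalComplex.hom_ext _ _ fun i => ModuleCat.hom_ext (LinearMap.ext fun e => ?_)
    exact one_smul A (show D.X i from e)
  map_mul' a a' := by
    refine HomologicalComplex.hom_ext _ _ fun i => ModuleCat.hom_ext (LinearMap.ext fun e => ?_)
    exact mul_smul a a' (show D.X i from e)
  map_zero' := by
    refine HomologicalComplex.hom_ext _ _ fun i => ModuleCat.hom_ext (LinearMap.ext fun e => ?_)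
    exact zero_smul A (show D.X i from e)
  map_add' a a' := by
    refine HomologicalComplex.hom_ext _ _ fun i => ModuleCat.hom_ext (LinearMap.ext fun e => ?_)
    exact add_smul a a' (show D.X i from e)

lemma homPairing_smul (a : A) (v : CharMod (J.X 0)) :
    homPairing D hJ (op a • v) = leftMul D a ≫ homPairing D hJ v := by
  ext p e
  refine CharMod.ext fun z => ?_
  exact congr_arg v ((cochainApply z p 0 (add_neg_cancel p)).map_smul a e).symm

end

end CoContra

end

open MulOpposite

noncomputable section

namespace CoContra

/-! ### Characters of the cohomology of Hom_A(D, J) -/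

section

variable {A B : Type u} [Ring A] [Ring B] (D : CochainComplex (BimodCat A B) ℤ)
  {J : CochainComplex (ModuleCat.{u} A) ℤ} (hJ : ∀ n, n ≠ 0 → IsZero (J.X n))
  (hJ' : Injective (J.X 0))

include hJ

lemma homComplex_d_eq_zero_iff (i : ℤ) (z : Cochain (leftComplex D) J (-i)) :
    δ (-i) (-(i - 1)) z = 0 ↔
      ∀ e, cochainApply z i 0 (add_neg_cancel i) ((D.d (i - 1) i).hom e) = 0 := by
  have h1 (e : D.X (i - 1)) : cochainApply (δ (-i) (-(i - 1)) z) (i - 1) 0 (by lia) e =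
      (-(i - 1)).negOnePow • cochainApply z i 0 (add_neg_cancel i) ((D.d (i - 1) i).hom e) := by
    rw [homComplex_d_apply D hJ (by lia) z (i - 1) (by lia) e]
    have key (j : ℤ) (hj : j = i) (h : j + -i = 0) :
        cochainApply z j 0 h ((D.d (i - 1) j).hom e) =
          cochainApply z i 0 (add_neg_cancel i) ((D.d (i - 1) i).hom e) := by
      subst hj
      rfl
    rw [key _ (by lia)]
  constructor
  · intro h e
    have h2 := h1 e
    rw [h] at h2
    exact (smul_eq_zero_iff_eq _).1 h2.symm
  · intro h
    refine homComplex_ext D hJ (p := i - 1) (by lia) fun e => ?_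
    rw [h1, h, smul_zero]
    rfl

include hJ'

/-- Maps vanishing on the cocycles are boundaries. -/
lemma exists_homComplex_d_eq (i : ℤ) (z : Cochain (leftComplex D) J (-i))
    (hz : ∀ e, (D.d i (i + 1)).hom e = 0 → cochainApply z i 0 (add_neg_cancel i) e = 0) :
    ∃ z' : Cochain (leftComplex D) J (-(i + 1)), δ (-(i + 1)) (-i) z' = z := by
  obtain ⟨g, hg⟩ := baer_exists_factor (baer_of_injective hJ') (leftLinear (D.d i (i + 1)))
    (cochainApply z i 0 (add_neg_cancel i)) hz
  obtain ⟨z', hz'⟩ := exists_cochainApply_eq D (add_neg_cancel (i + 1)) ((-i).negOnePow • g)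
  refine ⟨z', homComplex_ext D hJ (add_neg_cancel i) fun e => ?_⟩
  rw [homComplex_d_apply D hJ (by lia) z' i (add_neg_cancel i) e, hz', LinearMap.smul_apply,
    smul_smul, Int.units_mul_self, one_smul]
  exact hg e

/-- Characters of the cohomology of `Hom_A(D, J)`, in terms of generators of the cohomology
of `D`. -/
lemma exists_char_eq_sum (i : ℤ) {n : ℕ} (z : Fin n → D.X i)
    (hz' : ∀ x : D.X i, (D.d i (i + 1)).hom x = 0 → ∃ (a : Fin n → A) (y : D.X (i - 1)),
        x = ∑ k, a k • z k + (D.d (i - 1) i).hom y)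
    (y : CharMod (((homFunctor D).obj J).X (-i)))
    (hy : ∀ x : Cochain (leftComplex D) J (-(i + 1)), y (δ (-(i + 1)) (-i) x) = 0) :
    ∃ (v : Fin n → CharMod (J.X 0)) (x : CharMod (((homFunctor D).obj J).X (-(i - 1)))),
      y = ∑ k, evalChar D (add_neg_cancel i) (v k) (z k) +
        (show CharMod (((homFunctor D).obj J).X (-i)) from
          ((charComplex ((homFunctor D).obj J)).d (i - 1) i).hom x) := by
  let Z : AddSubgroup (Cochain (leftComplex D) J (-i)) :=
    ((((homFunctor D).obj J).d (-i) (-(i - 1))).hom.toAddMonoidHom).ker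
  have hZ (h : Z) : δ (-i) (-(i - 1)) h.1 = 0 := h.2
  let ev : Z →+ (Fin n → J.X 0) := AddMonoidHom.mk'
    (fun h k => cochainApply h.1 i 0 (add_neg_cancel i) (z k)) (fun h h' => rfl)
  -- A cocycle that vanishes at the generators z_k vanishes on all cocycles of D, hence is a
  -- boundary, where y is zero. So on cocycles y depends only on the values at the z_k; the rest of
  -- y factors through the differential.
  obtain ⟨v, hv⟩ := CharMod.exists_factor ev (y.comp Z.subtype) (fun h hh => by
    obtain ⟨x, hx⟩ := exists_homComplex_d_eq D hJ hJ' i h.1 (fun e he => by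
      obtain ⟨a, x, rfl⟩ := hz' e he
      rw [map_add, map_sum, (homComplex_d_eq_zero_iff D hJ i h.1).1 (hZ h), add_zero]
      refine Finset.sum_eq_zero fun k _ => ?_
      have h3 : cochainApply h.1 i 0 (add_neg_cancel i) (z k) = 0 := congr_fun hh k
      rw [map_smul, h3, smul_zero])
    change y h.1 = 0
    rw [← hx]
    exact hy x)
  let w (k : Fin n) : CharMod (J.X 0) := v.comp (AddMonoidHom.single (fun _ => J.X 0) k)
  have hw (x : Fin n → J.X 0) : v x = ∑ k, w k (x k) := by
    change v x = ∑ k, v (Pi.single k (x k))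
    rw [← map_sum]
    congr 1
    exact (Finset.univ_sum_single x).symm
  obtain ⟨x₀, hx₀⟩ := CharMod.exists_factor
    (((homFunctor D).obj J).d (-i) (-(i - 1))).hom.toAddMonoidHom
    (y - ∑ k, evalChar D (add_neg_cancel i) (w k) (z k)) (fun h hh => by
      rw [CharMod.sub_apply, CharMod.sum_apply, sub_eq_zero]
      exact (hv ⟨h, hh⟩).symm.trans (hw _))
  refine ⟨w, (i - 1).negOnePow • x₀, CharMod.ext fun h => ?_⟩
  rw [CharMod.add_apply, charComplex_d_apply, CharMod.units_smul_apply, smul_smul,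
    Int.units_mul_self, one_smul]
  refine Eq.trans ?_ (congr_arg (_ + ·) (hx₀ h).symm)
  rw [CharMod.sub_apply, add_sub_cancel]

/-- The relations between characters of the cohomology of `Hom_A(D, J)`. -/
lemma exists_relation_of_sum_char (i : ℤ) {n m : ℕ} (z : Fin n → D.X i)
    (r : Fin m → Fin n → A) (hz : ∀ k, (D.d i (i + 1)).hom (z k) = 0)
    (hr : ∀ a : Fin n → A, (∃ y : D.X (i - 1), ∑ k, a k • z k = (D.d (i - 1) i).hom y) →
        ∃ t : Fin m → A, ∀ k, a k = ∑ j, t j * r j k)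
    (v : Fin n → CharMod (J.X 0))
    (hv : ∀ h : Cochain (leftComplex D) J (-i), δ (-i) (-(i - 1)) h = 0 →
      ∑ k, v k (cochainApply h i 0 (add_neg_cancel i) (z k)) = 0) :
    ∃ u : Fin m → CharMod (J.X 0), ∀ k, v k = ∑ j, op (r j k) • u j := by
  let μ : (Fin n → J.X 0) →+ (Fin m → J.X 0) := AddMonoidHom.mk'
    (fun x j => ∑ k, r j k • x k) (fun x y => by
      ext j
      simp [Finset.sum_add_distrib])
  let φ : CharMod (Fin n → J.X 0) := (AddMonoidHom.mk' (fun x => ∑ k, v k (x k)) (fun x y => by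
    simp [Finset.sum_add_distrib]) : (Fin n → J.X 0) →+ AddCircle (1 : ℚ))
  -- If x satisfies the relations r, sending z_k to x_k and boundaries to zero is well defined and
  -- extends to D^i by injectivity of J. This is a cocycle h with h(z_k) = x_k, so Σ v_k(x_k) = 0.
  obtain ⟨y, hy⟩ := CharMod.exists_factor μ φ (fun x hx => by
    let p : ((Fin n → A) × D.X (i - 1)) →ₗ[A] D.X i :=
      (Fintype.linearCombination A z).coprod (leftLinear (D.d (i - 1) i))
    have hp (a : Fin n → A) (e : D.X (i - 1)) :
      p (a, e) = ∑ k, a k • z k + (D.d (i - 1) i).hom e := rfl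
    obtain ⟨g, hg⟩ := baer_exists_factor (baer_of_injective hJ') p
      ((Fintype.linearCombination A x).comp (LinearMap.fst _ _ _)) (fun ae hae => by
        obtain ⟨a, e⟩ := ae
        rw [hp] at hae
        obtain ⟨t, ht⟩ := hr a ⟨-e, by rw [map_neg, eq_neg_iff_add_eq_zero, hae]⟩
        change ∑ k, a k • x k = 0
        simp_rw [ht, Finset.sum_smul, mul_smul]
        rw [Finset.sum_comm]
        refine Finset.sum_eq_zero fun j _ => ?_
        rw [← Finset.smul_sum, show ∑ k, r j k • x k = 0 from congr_fun hx j, smul_zero])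
    obtain ⟨h, hh⟩ := exists_cochainApply_eq D (add_neg_cancel i) g
    have h1 := hv h ((homComplex_d_eq_zero_iff D hJ i h).2 fun e => by
      rw [hh]
      have := hg (0, e)
      rw [hp] at this
      simpa using this)
    refine Eq.trans ?_ h1
    change ∑ k, v k (x k) = _
    refine Finset.sum_congr rfl fun k _ => ?_
    congr 1
    rw [hh]
    have := hg (Pi.single k 1, 0)
    rw [hp, map_zero, add_zero] at this
    change g (∑ k', (Pi.single k 1 : Fin n → A) k' • z k') =
      ∑ k', (Pi.single k 1 : Fin n → A) k' • x k' at this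
    rw [Finset.sum_eq_single k (fun k' _ hk => by rw [Pi.single_eq_of_ne hk, zero_smul])
        (by simp), Finset.sum_eq_single k (fun k' _ hk => by
        rw [Pi.single_eq_of_ne hk, zero_smul]) (by simp), Pi.single_eq_same, one_smul,
      one_smul] at this
    exact this.symm)
  refine ⟨fun j => y.comp (AddMonoidHom.single (fun _ => J.X 0) j), fun k => CharMod.ext fun x => ?_⟩
  have h1 := hy (Pi.single k x)
  have h2 : φ (Pi.single k x) = v k x := by
    change ∑ k', v k' ((Pi.single k x : Fin n → J.X 0) k') = v k x
    rw [Finset.sum_eq_single k (fun k' _ hk => by rw [Pi.single_eq_of_ne hk, map_zero])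
      (by simp), Pi.single_eq_same]
  have h3 : μ (Pi.single k x) = ∑ j, Pi.single j (r j k • x) := by
    rw [Finset.univ_sum_single (fun j => r j k • x)]
    ext j
    change ∑ k', r j k' • (Pi.single k x : Fin n → J.X 0) k' = _
    rw [Finset.sum_eq_single k (fun k' _ hk => by rw [Pi.single_eq_of_ne hk, smul_zero])
      (by simp), Pi.single_eq_same]
  rw [h2, h3, map_sum] at h1
  rw [← h1, CharMod.sum_apply]
  rfl

omit hJ hJ' in
lemma exists_presentation_leftComplex (i : ℤ)
    (hfp : Module.FinitePresentation A ((leftComplex D).homology i)) :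
    ∃ (n m : ℕ) (z : Fin n → D.X i) (r : Fin m → Fin n → A),
      (∀ k, (D.d i (i + 1)).hom (z k) = 0) ∧
      (∀ x : D.X i, (D.d i (i + 1)).hom x = 0 → ∃ (a : Fin n → A) (y : D.X (i - 1)),
        x = ∑ k, a k • z k + (D.d (i - 1) i).hom y) ∧
      (∀ j, ∃ y : D.X (i - 1), ∑ k, r j k • z k = (D.d (i - 1) i).hom y) ∧
      ∀ a : Fin n → A, (∃ y : D.X (i - 1), ∑ k, a k • z k = (D.d (i - 1) i).hom y) →
        ∃ t : Fin m → A, ∀ k, a k = ∑ j, t j * r j k :=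
  exists_presentation_of_homology (leftComplex D) i hfp

/-- As H^i(D) is finitely presented and J is injective, the dual of Hom_A(H^i(D), J) is J^* ⊗_A
H^i(D), so its characters are the maps from H^i(D) to J^{**}. The argument is this identification
written in generators z and relations r. -/
lemma pairCohomology_hom (hfp : ∀ i, Module.FinitePresentation A ((leftComplex D).homology i)) :
    PairCohomology (leftAction D) (homPairing D hJ) where
  inj i χ hχ h y hy := by
    obtain ⟨n, m, z, r, hz, hz', -, -⟩ := exists_presentation_leftComplex D i (hfp i)
    obtain ⟨v, x, hvx⟩ := exists_char_eq_sum D hJ hJ' i z hz' y (fun x => by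
      have h1 := (charComplex_d_apply ((homFunctor D).obj J) i (i + 1) y x).symm.trans
        (DFunLike.congr_fun (show (show CharMod (((homFunctor D).obj J).X (-(i + 1))) from
          ((charComplex ((homFunctor D).obj J)).d i (i + 1)).hom y) = 0 from hy) x)
      exact (smul_eq_zero_iff_eq _).1 h1)
    rw [hvx]
    refine (map_add χ _ _).trans ?_
    rw [show χ (((charComplex ((homFunctor D).obj J)).d (i - 1) i).hom x) = 0 from hχ x, add_zero]
    refine (map_sum χ _ _).trans (Finset.sum_eq_zero fun k _ => ?_)
    exact h (z k) (hz k) (v k)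
  surj i l hl hl' := by
    obtain ⟨n, m, z, r, hz, hz', hr, hr'⟩ := exists_presentation_leftComplex D i (hfp i)
    let K := (homFunctor D).obj J
    let dK : CharMod (K.X (-(i - 1))) →+ CharMod (K.X (-i)) :=
      ((charComplex K).d (i - 1) i).hom.toAddMonoidHom
    -- Sums of evaluations at the generators plus boundaries; the required character χ is prescribed
    -- on such sums.
    let Φ : ((Fin n → CharMod (J.X 0)) × CharMod (K.X (-(i - 1)))) →+ CharMod (K.X (-i)) :=
      AddMonoidHom.mk' (fun vx => ∑ k, evalChar D (add_neg_cancel i) (vx.1 k) (z k) +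
        dK vx.2) (fun vx vx' => by
        refine (congr_arg₂ (· + ·) (?_ : _ = ∑ k, evalChar D (add_neg_cancel i) (vx.1 k) (z k) +
          ∑ k, evalChar D (add_neg_cancel i) (vx'.1 k) (z k))
          (map_add dK vx.2 vx'.2)).trans (add_add_add_comm _ _ _ _)
        rw [← Finset.sum_add_distrib]
        rfl)
    have hΦ (v : Fin n → CharMod (J.X 0)) (x : CharMod (K.X (-(i - 1)))) :
      Φ (v, x) = ∑ k, evalChar D (add_neg_cancel i) (v k) (z k) + dK x := rfl
    have hΦe (v : Fin n → CharMod (J.X 0)) (x : CharMod (K.X (-(i - 1)))) (h : K.X (-i)) :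
        Φ (v, x) h = ∑ k, v k (cochainApply h i 0 (add_neg_cancel i) (z k)) + dK x h := by
      rw [hΦ, CharMod.add_apply, CharMod.sum_apply]
      rfl
    let ζ (k : Fin n) : ((rightComplex D).d i (i + 1)).hom.ker := ⟨z k, hz k⟩
    let c : CharMod ((Fin n → CharMod (J.X 0)) × CharMod (K.X (-(i - 1)))) :=
      (AddMonoidHom.mk' (fun vx => ∑ k, l (ζ k) (vx.1 k)) (fun vx vx' => by
        simp [Finset.sum_add_distrib]) :
        ((Fin n → CharMod (J.X 0)) × CharMod (K.X (-(i - 1)))) →+ AddCircle (1 : ℚ))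
    have hc (v : Fin n → CharMod (J.X 0)) (x : CharMod (K.X (-(i - 1)))) :
      c (v, x) = ∑ k, l (ζ k) (v k) := rfl
    have hlsum (a : Fin n → A) (x : ((rightComplex D).d i (i + 1)).hom.ker)
        (y : D.X (i - 1)) (hx : (show D.X i from x.1) = ∑ k, a k • z k + (D.d (i - 1) i).hom y) :
        l x = ∑ k, a k • l (ζ k) := by
      let ξ (k : Fin n) : ((rightComplex D).d i (i + 1)).hom.ker :=
        ⟨((leftMul D (a k)).f i).hom (z k), map_mem_ker (leftMul D (a k)) i (ζ k)⟩
      let β : ((rightComplex D).d i (i + 1)).hom.ker :=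
        ⟨((rightComplex D).d (i - 1) i).hom y, d_mem_ker (rightComplex D) i y⟩
      have h1 : x = ∑ k, ξ k + β := Subtype.ext (by
        refine hx.trans ?_
        refine congr_arg (· + (D.d (i - 1) i).hom y) ?_
        exact (map_sum ((rightComplex D).d i (i + 1)).hom.ker.subtype ξ Finset.univ).symm)
      rw [h1, map_add, hl β ⟨y, rfl⟩, add_zero, map_sum]
      exact Finset.sum_congr rfl fun k _ => hl' (a k) (ζ k) (ξ k) rfl
    -- The prescription is consistent: if a sum of evaluations is a boundary, its coefficients v_k
    -- are combinations of the relations r, and l vanishes on those relations.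
    obtain ⟨χ, hχ⟩ := CharMod.exists_factor Φ c (fun vx hvx => by
      obtain ⟨v, x⟩ := vx
      obtain ⟨u, hu⟩ := exists_relation_of_sum_char D hJ hJ' i z r hz hr' v (fun h hh => by
        have h1 := (hΦe v x h).symm.trans (DFunLike.congr_fun hvx h)
        have h2 := charComplex_d_apply K (i - 1) i x h
        have h3 : (K.d (-i) (-(i - 1))).hom h = 0 := hh
        rw [h3, map_zero, smul_zero] at h2
        have h4 : dK x h = 0 := h2
        rw [h4, add_zero] at h1
        exact h1)
      rw [hc]
      calc ∑ k, l (ζ k) (v k) = ∑ k, ∑ j, (r j k • l (ζ k)) (u j) := by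
            refine Finset.sum_congr rfl fun k _ => ?_
            rw [hu k, map_sum]
            rfl
        _ = ∑ j, (∑ k, r j k • l (ζ k)) (u j) := by
            rw [Finset.sum_comm]
            refine Finset.sum_congr rfl fun j _ => ?_
            rw [CharMod.sum_apply]
        _ = 0 := by
            refine Finset.sum_eq_zero fun j _ => ?_
            obtain ⟨y, hy⟩ := hr j
            rw [← hlsum (r j) 0 (-y) (by
              rw [hy, map_neg, add_neg_cancel]
              rfl), map_zero]
            rfl)
    refine ⟨χ, fun y => ?_, fun x v => ?_⟩
    · have h0 : ∑ k, evalChar D (add_neg_cancel i) ((0 : Fin n → CharMod (J.X 0)) k) (z k) = 0 :=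
        Finset.sum_eq_zero fun _ _ => rfl
      have h1 : χ (∑ k, evalChar D (add_neg_cancel i) ((0 : Fin n → CharMod (J.X 0)) k) (z k) +
          dK y) = ∑ k, l (ζ k) 0 := hχ (0, y)
      rw [h0, zero_add, Finset.sum_eq_zero (fun k _ => map_zero (l (ζ k)))] at h1
      exact h1
    · obtain ⟨a, y, hay⟩ := hz' x.1 x.2
      rw [hlsum a x y hay, CharMod.sum_apply]
      have h1 := hχ (fun k => op (a k) • v,
        (show CharMod (K.X (-(i - 1))) from ((homPairing D hJ v).f (i - 1)).hom y))
      refine Eq.trans (congr_arg χ ?_) h1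
      have h2 : ((homPairing D hJ v).f i).hom x.1 = evalChar D (add_neg_cancel i) v
          (∑ k, a k • z k + (D.d (i - 1) i).hom y) :=
        congr_arg (evalChar D (add_neg_cancel i) v) hay
      refine h2.trans ?_
      refine (map_add (evalChar D (add_neg_cancel i) v) _ _).trans (congr_arg₂ (· + ·) ?_ ?_)
      · refine (map_sum (evalChar D (add_neg_cancel i) v) _ _).trans
          (Finset.sum_congr rfl fun k _ => ?_)
        exact (congr_arg (fun f : rightComplex D ⟶ _ => (f.f i).hom (z k))
          (homPairing_smul D hJ (a k) v)).symm
      · exact congr_arg (fun f => f.hom y) ((homPairing D hJ v).comm (i - 1) i).symm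

end

end CoContra

end

open MulOpposite

noncomputable section

namespace CoContra

/-! ### The counit of the tensor-Hom adjunction on an injective module -/

section

variable {A B : Type u} [Ring A] [Ring B] (D : CochainComplex (BimodCat A B) ℤ)
  (K : CochainComplex (ModuleCat.{u} B) ℤ)

lemma char_tensor_ext' {n : ℤ} {χ χ' : CharMod (((tensorFunctor D).obj K).X n)}
    (h : ∀ (p q : ℤ) (hpq : p + q = n) (e : D.X p) (x : K.X q), χ (tensorElt D K n hpq x e) =
      χ' (tensorElt D K n hpq x e)) : χ = χ' := by
  let T : Set (((tensorFunctor D).obj K).X n) :=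
    {y | ∃ (p q : ℤ) (hpq : p + q = n) (e : D.X p) (x : K.X q), tensorElt D K n hpq x e = y}
  let N : Submodule A (((tensorFunctor D).obj K).X n) :=
    { AddSubgroup.closure T with
      smul_mem' := fun a y hy => by
        induction hy using AddSubgroup.closure_induction with
        | mem y hy =>
          obtain ⟨p, q, hpq, e, x, rfl⟩ := hy
          exact AddSubgroup.subset_closure ⟨p, q, hpq, a • e, x, map_smul _ _ _⟩
        | zero => rw [smul_zero]; exact (AddSubgroup.closure T).zero_mem
        | add x y _ _ hx hy => rw [smul_add]; exact (AddSubgroup.closure T).add_mem hx hy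
        | neg x _ hx => rw [smul_neg]; exact (AddSubgroup.closure T).neg_mem hx }
  have h1 : ModuleCat.ofHom N.mkQ = 0 := tensor_hom_ext D fun p q hpq e x =>
    (Submodule.Quotient.mk_eq_zero N).2 (AddSubgroup.subset_closure ⟨p, q, hpq, e, x, rfl⟩)
  refine CharMod.ext fun y => ?_
  have h2 : y ∈ AddSubgroup.closure T :=
    (Submodule.Quotient.mk_eq_zero N).1 (congr_arg (fun f => f.hom y) h1)
  induction h2 using AddSubgroup.closure_induction with
  | mem y hy =>
    obtain ⟨p, q, hpq, e, x, rfl⟩ := hy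
    exact h p q hpq e x
  | zero => rw [map_zero, map_zero]
  | add x y _ _ hx hy => rw [map_add, map_add, hx, hy]
  | neg x _ hx => rw [map_neg, map_neg, hx]

variable {K}

lemma tensorElt_d' {p q q' n n' : ℤ} (hq : q + 1 = q') (h : p + q = n) (h' : n + 1 = n')
    (e : D.X p) (x : K.X q) :
    (((tensorFunctor D).obj K).d n n').hom (tensorElt D K n h x e) =
      tensorElt D K n' (by lia) x ((D.d p (p + 1)).hom e) +
      p.negOnePow • tensorElt D K n' (by lia) ((K.d q q').hom x) e := by
  subst hq
  exact tensorElt_d D h h' e x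

/-- The cochain given by a character of the tensor product. -/
def charCochain {n i : ℤ} (h : i + n = 0) (χ : CharMod (((tensorFunctor D).obj K).X n)) :
    Cochain (rightComplex D) (charComplex K) i :=
  -- The sign (-1)^p absorbs the signs depending on p, so that the compatibility with differentials
  -- involves only a sign depending on i.
  Cochain.mk fun p m hpm => p.negOnePow • ModuleCat.ofHom (X := D.X p) (Y := CharMod (K.X (-m)))
    (charTensor D (show p + -m = n by lia) χ)

/-- The value of a cochain. -/
def charCochainApply {i : ℤ} (w : Cochain (rightComplex D) (charComplex K) i) (p m : ℤ)
    (h : p + i = m) : D.X p →ₗ[Bᵐᵒᵖ] CharMod (K.X (-m)) := (w.v p m h).hom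

variable {D} in
lemma charCochain_ext {i : ℤ} {w w' : Cochain (rightComplex D) (charComplex K) i}
    (h : ∀ (p m : ℤ) (hpm : p + i = m) (e : D.X p) (k : K.X (-m)),
      charCochainApply D w p m hpm e k = charCochainApply D w' p m hpm e k) : w = w' := by
  ext p m hpm : 1
  exact ModuleCat.hom_ext (LinearMap.ext fun e => CharMod.ext (h p m hpm e))

lemma charCochain_apply {n i : ℤ} (h : i + n = 0) (χ : CharMod (((tensorFunctor D).obj K).X n))
    (p m : ℤ) (hpm : p + i = m) (e : D.X p) (k : K.X (-m)) :
    charCochainApply D (charCochain D h χ) p m hpm e k =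
      p.negOnePow • χ (tensorElt D K n (by lia) k e) :=
  CharMod.units_smul_apply _ _ _

lemma charCochain_injective {n i : ℤ} (h : i + n = 0)
    {χ χ' : CharMod (((tensorFunctor D).obj K).X n)}
    (hχ : charCochain D h χ = charCochain D h χ') : χ = χ' := by
  refine char_tensor_ext' D K fun p q hpq e x => ?_
  obtain rfl : q = -(p + i) := by lia
  have h1 := charCochain_apply D h χ p (p + i) rfl e x
  rw [hχ, charCochain_apply D h χ' p (p + i) rfl e x] at h1
  exact (smul_left_cancel _ h1).symm

lemma charCochain_add {n i : ℤ} (h : i + n = 0) (χ χ' : CharMod (((tensorFunctor D).obj K).X n)) :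
    charCochain D h (χ + χ') = charCochain D h χ + charCochain D h χ' := by
  refine charCochain_ext fun p m hpm e k => ?_
  rw [charCochain_apply, CharMod.add_apply, smul_add, ← charCochain_apply D h χ p m hpm,
    ← charCochain_apply D h χ' p m hpm]
  rfl

lemma charCochain_zero {n i : ℤ} (h : i + n = 0) :
    charCochain D h (0 : CharMod (((tensorFunctor D).obj K).X n)) = 0 := by
  have := charCochain_add D h (0 : CharMod (((tensorFunctor D).obj K).X n)) 0
  rw [add_zero] at this
  exact left_eq_add.1 this

/-- A cochain has one component for each p, while a character of the total complex must be assembled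
from them by a sum; finiteness of D makes the sum finite. -/
lemma charCochain_surjective {n i : ℤ} (h : i + n = 0) (a b : ℤ)
    (hab : ∀ p, p < a ∨ b < p → IsZero (D.X p)) (w : Cochain (rightComplex D) (charComplex K) i) :
    ∃ χ : CharMod (((tensorFunctor D).obj K).X n), charCochain D h χ = w := by
  choose c hc using fun p : ℤ => BalancedTensor.exists_char A
    (charCochainApply D w p (p + i) rfl)
  refine ⟨∑ p ∈ Finset.Icc a b,
    p.negOnePow • (c p).comp (tensorπ D K p (-(p + i)) n).hom.toAddMonoidHom,
    charCochain_ext fun p m hpm e k => ?_⟩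
  subst hpm
  rw [charCochain_apply]
  by_cases hp : p ∈ Finset.Icc a b
  · rw [CharMod.sum_apply, Finset.sum_eq_single p]
    · rw [CharMod.units_smul_apply, smul_smul, Int.units_mul_self, one_smul, ← hc]
      exact congr_arg (c p) (tensorπ_tensorι_self D K p (-(p + i)) n _ _)
    · intro p' _ hp'
      rw [CharMod.units_smul_apply]
      refine (congr_arg (fun x => p'.negOnePow • c p' x) (tensorπ_tensorι_of_ne D K p (-(p + i))
        p' (-(p' + i)) n _ hp'.symm _)).trans ?_
      rw [map_zero, smul_zero]
    · exact fun h => absurd hp h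
  · have := ModuleCat.subsingleton_of_isZero (hab p (by
        rw [Finset.mem_Icc] at hp
        lia))
    rw [Subsingleton.elim e 0, map_zero, map_zero, map_zero, smul_zero]
    rfl

/-- Up to sign, the dual of D ⊗ K is the complex of cochains from D to the dual of K. Thus
statements on the cohomology of D ⊗ Hom_A(D, J) translate into statements on Hom in the derived
category of right B-modules. -/
lemma charCochain_δ {n n' i i' : ℤ} (h : i + n = 0) (h' : i' + n' = 0) (hi : i + 1 = i')
    (χ : CharMod (((tensorFunctor D).obj K).X n)) :
    δ i i' (charCochain D h χ) = i.negOnePow • charCochain D h'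
      (χ.comp (((tensorFunctor D).obj K).d n' n).hom.toAddMonoidHom) := by
  refine charCochain_ext fun p m hpm e k => ?_
  have h1 := δ_v i i' hi (charCochain D h χ) p m hpm (m - 1) (p + 1) (by lia) rfl
  have h2 : charCochainApply D (δ i i' (charCochain D h χ)) p m hpm e k =
      (m - 1).negOnePow • charCochainApply D (charCochain D h χ) p (m - 1) (by lia) e
        ((K.d (-m) (-(m - 1))).hom k) +
      i'.negOnePow • charCochainApply D (charCochain D h χ) (p + 1) m (by lia)
        ((D.d p (p + 1)).hom e) k := by
    refine (congr_arg (fun f : (rightComplex D).X p ⟶ (charComplex K).X m =>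
      (show CharMod (K.X (-m)) from f.hom e) k) h1).trans ?_
    refine (CharMod.add_apply _ _ _).trans (congr_arg₂ (· + ·) ?_ ?_)
    · exact charComplex_d_apply K (m - 1) m _ k
    · exact CharMod.units_smul_apply _ _ _
  have h3 : charCochainApply D (i.negOnePow • charCochain D h'
      (χ.comp (((tensorFunctor D).obj K).d n' n).hom.toAddMonoidHom)) p m hpm e k =
      i.negOnePow • charCochainApply D (charCochain D h'
      (χ.comp (((tensorFunctor D).obj K).d n' n).hom.toAddMonoidHom)) p m hpm e k :=
    CharMod.units_smul_apply _ _ _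
  rw [h2, h3, charCochain_apply, charCochain_apply, charCochain_apply, CharMod.comp_apply]
  have h4 := congr_arg χ (tensorElt_d' D (show -m + 1 = -(m - 1) by lia)
    (show p + -m = n' by lia) (show n' + 1 = n by lia) e k)
  have h5 (x : ((tensorFunctor D).obj K).X n) :
      χ (p.negOnePow • x) = p.negOnePow • χ x := by
    rw [Units.smul_def, Units.smul_def, map_zsmul]
  rw [map_add, h5] at h4
  refine Eq.trans ?_ (congr_arg (fun x => i.negOnePow • p.negOnePow • x) h4.symm)
  obtain rfl : m = p + i + 1 := by lia
  subst hi
  rw [smul_add, smul_add, smul_smul, smul_smul, smul_smul, smul_smul, smul_smul, add_comm]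
  congr 2
  · rw [Int.negOnePow_succ, Int.negOnePow_succ, neg_mul_neg]
  · rw [show p + i + 1 - 1 = p + i by lia, Int.negOnePow_add, mul_assoc, mul_comm p.negOnePow,
      mul_assoc]

lemma charCochain_units_smul {n i : ℤ} (h : i + n = 0) (ε : ℤˣ)
    (χ : CharMod (((tensorFunctor D).obj K).X n)) :
    charCochain D h (ε • χ) = ε • charCochain D h χ := by
  refine charCochain_ext fun p m hpm e k => ?_
  refine Eq.trans ?_ (CharMod.units_smul_apply _ _ _).symm
  rw [charCochain_apply, CharMod.units_smul_apply]
  refine (smul_comm _ _ _).trans ?_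
  rw [← charCochain_apply D h χ p m hpm]
  rfl

end

section

variable {A B : Type u} [Ring A] [Ring B] (D : CochainComplex (BimodCat A B) ℤ)
  {J : CochainComplex (ModuleCat.{u} A) ℤ} (hJ : ∀ n, n ≠ 0 → IsZero (J.X n))

lemma ofHom_homPairing (v : CharMod (J.X 0)) :
    Cochain.ofHom (homPairing D hJ v) = charCochain D (add_zero 0)
      (v.comp ((tensorHomUncurry D (𝟙 ((homFunctor D).obj J))).f 0).hom.toAddMonoidHom) := by
  refine charCochain_ext fun p m hpm e k => ?_
  obtain rfl : m = p := by lia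
  rw [charCochain_apply, CharMod.comp_apply]
  have h1 : charCochainApply D (Cochain.ofHom (homPairing D hJ v)) m m hpm e k =
      v (cochainApply k m 0 (add_neg_cancel m) e) := by
    refine (congr_arg (fun f : (rightComplex D).X m ⟶
      (charComplex ((homFunctor D).obj J)).X m => (show CharMod _ from f.hom e) k)
      (Cochain.ofHom_v (homPairing D hJ v) m)).trans ?_
    rfl
  have h2 := congr_arg v (tensorHomUncurryX_apply D (𝟙 ((homFunctor D).obj J))
    (add_neg_cancel m) k e)
  have h3 (ε : ℤˣ) (x : J.X 0) : v (ε • x) = ε • v x := by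
    rw [Units.smul_def, Units.smul_def, map_zsmul]
  rw [h3] at h2
  refine h1.trans (Eq.trans ?_ (congr_arg (fun x => m.negOnePow • x) h2.symm))
  rw [smul_smul, show m.negOnePow * (m * -m).negOnePow = 1 from ?_, one_smul]
  · rfl
  · rw [← Int.negOnePow_add, Int.negOnePow_eq_one_iff, mul_neg, ← sub_eq_add_neg, ← mul_one_sub]
    rcases Int.even_or_odd m with h | h
    · exact h.mul_right _
    · exact (odd_one.sub_odd h).mul_left _

include hJ in
/-- The counit of the adjunction, for an injective module `J` placed in degree zero. -/
theorem acyclic_mappingCone_uncurry (hA : IsLeftCoherent A) (hB : IsRightCoherent B)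
    (hD : IsDualizingComplex D) (hJ' : Injective (J.X 0)) :
    (mappingCone (tensorHomUncurry D (𝟙 ((homFunctor D).obj J)))).Acyclic := by
  obtain ⟨a, b, hab⟩ := hD.finite
  have : (rightComplex D).IsStrictlyGE a := by
    rw [isStrictlyGE_iff]
    exact fun i hi => isZero_rightComplex_X D (hab i (Or.inl hi))
  have : (rightComplex D).IsStrictlyLE b := by
    rw [isStrictlyLE_iff]
    exact fun i hi => isZero_rightComplex_X D (hab i (Or.inr hi))
  have hJ'' (n : ℤ) : Injective (J.X n) := by
    by_cases hn : n = 0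
    · subst hn
      exact hJ'
    · exact (hJ n hn).injective
  set G := charComplex ((homFunctor D).obj J) with hG
  have hGa : G.IsStrictlyGE a := by
    rw [isStrictlyGE_iff]
    intro i hi
    have : Subsingleton (((homFunctor D).obj J).X (-i)) :=
      ModuleCat.subsingleton_of_isZero (isZero_homFunctor_X D J (-i) fun p n hpn => by
        by_cases hn : n = 0
        · exact Or.inl (hab p (Or.inl (by lia)))
        · exact Or.inr (hJ n hn))
    have : Subsingleton (CharMod (((homFunctor D).obj J).X (-i))) :=
      ⟨fun c c' => CharMod.ext fun x => by rw [Subsingleton.elim x 0, map_zero, map_zero]⟩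
    exact @ModuleCat.isZero_of_subsingleton _ _ _ this
  -- The terms of Hom_A(D, J) are flat, so their duals are injective; G is its own K-injective
  -- replacement and σ can be the identity.
  have hGi (i : ℤ) : Injective (G.X i) := by
    refine injective_of_baer ?_
    exact (isFlat_iff_baer _).1 (isFlat_homFunctor_X D hB
      (fun i => (isFPInjective_iff _).1 (hD.fpInjective_right i)) J hJ'' (-i))
  have : G.IsKInjective := isKInjective_of_injective G a
  have hW := baer_charMod_charMod hA _ hJ'
  have hfpl := finitePresentation_homology_leftComplex D hD
  have h := pairCohomology_hom D hJ hJ' hfpl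
  have hτ (s : A) : ∃ c : CharMod (J.X 0) → CharMod (J.X 0), (∀ v, homPairing D hJ (c v) =
      actHom (leftAction D) s ≫ homPairing D hJ v) ∧
      ∀ (w : CharMod (CharMod (J.X 0))) v, (s • w) v = w (c v) :=
    ⟨fun v => op s • v, fun v => homPairing_smul D hJ s v, fun w v => rfl⟩
  have hfp := finitePresentation_homology_rightComplex D hD
  have hr : Function.Bijective fun s : A =>
      @DerivedCategory.Q _ _ _ (HasDerivedCategory.standard _) |>.map (actHom (leftAction D) s) :=
    hD.homothety_left
  set f := tensorHomUncurry D (𝟙 ((homFunctor D).obj J)) with hf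
  refine acyclic_mappingCone_of_elements _ (fun i j hij x hx y hxy => ?_) (fun i j hij y hy => ?_)
  -- Boundaries are detected by characters. One that vanishes on them is a cocycle of cochains from
  -- D to G; up to coboundaries, which kill the cocycle x, it is v composed with the counit in
  -- degree 0 and zero otherwise. In degree 0 the counit sends x to a boundary of J, which is zero.
  · refine CharMod.mem_of_forall
      (((tensorFunctor D).obj ((homFunctor D).obj J)).d i j).hom.toAddMonoidHom.range x
      fun χ hχ => ?_
    have h1 : δ (-j) (-j + 1) (charCochain D (neg_add_cancel j) χ) = 0 := by
      rw [charCochain_δ D (neg_add_cancel j) (show -j + 1 + i = 0 by lia) rfl]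
      have : χ.comp (((tensorFunctor D).obj ((homFunctor D).obj J)).d i
          j).hom.toAddMonoidHom = 0 := CharMod.ext fun z => hχ _ ⟨z, rfl⟩
      rw [this, charCochain_zero, smul_zero]
    have h2 (k : ℤ) (hk : k + 1 = -j) (w : Cochain (rightComplex D) G k) :
        ∃ χ' : CharMod (((tensorFunctor D).obj ((homFunctor D).obj J)).X j),
          charCochain D (neg_add_cancel j) χ' = δ k (-j) w ∧ χ' x = 0 := by
      obtain ⟨ψ, rfl⟩ := charCochain_surjective D (show k + (j + 1) = 0 by lia) a b hab w
      rw [charCochain_δ D _ (neg_add_cancel j) hk, ← charCochain_units_smul]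
      refine ⟨_, rfl, ?_⟩
      rw [CharMod.units_smul_apply, CharMod.comp_apply]
      refine (congr_arg (fun x => k.negOnePow • ψ x) hx).trans ?_
      rw [map_zero, smul_zero]
    by_cases hj : j = 0
    · subst hj
      obtain ⟨v, w, hvw⟩ := h.exists_eq (𝟙 G) hB hW hτ a b hfp hr
        (charCochain D (add_zero 0) χ) h1
      obtain ⟨χ', h3, h4⟩ := h2 (-1) (by lia) w
      rw [Category.comp_id, ofHom_homPairing] at hvw
      have h5 : χ = v.comp (f.f 0).hom.toAddMonoidHom + χ' := by
        refine charCochain_injective D (add_zero 0) (hvw.trans ?_)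
        rw [charCochain_add]
        exact congr_arg₂ (· + ·) rfl h3.symm
      rw [h5, CharMod.add_apply, h4, add_zero, CharMod.comp_apply]
      refine (congr_arg v hxy).trans ?_
      have := ModuleCat.subsingleton_of_isZero (hJ i (by lia))
      rw [Subsingleton.elim y 0, map_zero, map_zero]
    · obtain ⟨w, hw⟩ := h.exists_δ (𝟙 G) hB hW hτ a b hfp hD.hom_right_eq_zero (-j)
        (by lia) (charCochain D (neg_add_cancel j) χ) h1
      obtain ⟨χ', h3, h4⟩ := h2 (-j - 1) (by lia) w
      rw [← charCochain_injective D (neg_add_cancel j) (h3.trans hw), h4]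
  · by_cases hj : j = 0
    · subst hj
      -- A character v of J that kills the image of the cocycles becomes, after the counit, one that
      -- factors through the differential. So the pairing with v is a coboundary, and v = 0.
      let N : AddSubgroup (J.X 0) := (AddSubgroup.map (f.f 0).hom.toAddMonoidHom
        (((tensorFunctor D).obj ((homFunctor D).obj J)).d 0 (0 + 1)).hom.toAddMonoidHom.ker)
      have h1 : y ∈ N := by
        refine CharMod.mem_of_forall N y fun v hv => ?_
        obtain ⟨ψ, hψ⟩ := CharMod.exists_factor
          (((tensorFunctor D).obj ((homFunctor D).obj J)).d 0 (0 + 1)).hom.toAddMonoidHom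
          (v.comp (f.f 0).hom.toAddMonoidHom) (fun x hx => hv _ ⟨x, hx, rfl⟩)
        have h2 := charCochain_δ D (show (-1 : ℤ) + (0 + 1) = 0 by lia) (add_zero 0)
          (show (-1 : ℤ) + 1 = 0 by lia) ψ
        have h3 : ψ.comp (((tensorFunctor D).obj ((homFunctor D).obj J)).d 0
            (0 + 1)).hom.toAddMonoidHom = v.comp (f.f 0).hom.toAddMonoidHom := CharMod.ext hψ
        rw [h3, ← ofHom_homPairing D hJ v] at h2
        have h4 : v = 0 := by
          refine h.eq_zero (𝟙 G) hB hW hτ a b hfp hr v ((-1 : ℤ).negOnePow •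
            charCochain D (show (-1 : ℤ) + (0 + 1) = 0 by lia) ψ) ?_
          rw [Category.comp_id, δ_units_smul, h2, smul_smul, Int.units_mul_self, one_smul]
        rw [h4]
        rfl
      obtain ⟨x, hx, rfl⟩ := h1
      refine ⟨x, hx, 0, ?_⟩
      rw [map_zero, add_zero]
      rfl
    · have := ModuleCat.subsingleton_of_isZero (hJ j hj)
      exact ⟨0, map_zero _, 0, Subsingleton.elim _ _⟩

end

end CoContra

end

noncomputable section

namespace CoContra

/-! ### The projective dimension of flat modules -/

section

variable {B : Type u} [Ring B]

/-- The groups `Ext` from flat modules vanish above the degree `k`. -/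
def FlatExtVanish (k : ℕ) (M : ModuleCat.{u} B) : Prop :=
  ∀ V : ModuleCat.{u} B, IsFlat V → ∀ i, k < i → ∀ e : Abelian.Ext V M i, e = 0

variable (hB : IsRightCoherent B)
include hB

lemma exists_flat_syzygy (V : ModuleCat.{u} B) (hV : IsFlat V) :
    ∃ (K P : ModuleCat.{u} B) (f : K ⟶ P) (g : P ⟶ V) (w : f ≫ g = 0), Projective P ∧ IsFlat K ∧
      (ShortComplex.mk f g w).ShortExact := by
  obtain ⟨⟨P, g⟩⟩ := EnoughProjectives.presentation V
  have hS : (ShortComplex.mk (kernel.ι g) g (by simp)).ShortExact :=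
    { exact := ShortComplex.exact_of_f_is_kernel _ (kernelIsKernel g) }
  exact ⟨_, P, kernel.ι g, g, by simp, inferInstance,
    isFlat_X₁_of_shortExact hS (isFlat_of_projective hB P inferInstance) hV, hS⟩

/-- Obtained from the exact sequence V' → V → 0 and closure of flat modules under kernels of
surjections. -/
lemma isFlat_of_iso {V V' : ModuleCat.{u} B} (e : V ≅ V') (hV : IsFlat V) : IsFlat V' := by
  have h0 : IsZero (ModuleCat.of B PUnit.{u + 1}) := ModuleCat.isZero_of_subsingleton _
  have hS : (ShortComplex.mk e.inv (0 : V ⟶ ModuleCat.of B PUnit.{u + 1}) (by simp)).ShortExact :=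
    { exact := (ShortComplex.exact_iff_epi _ rfl).2 inferInstance
      epi_g := ⟨fun _ _ _ => h0.eq_of_src _ _⟩ }
  exact isFlat_X₁_of_shortExact hS hV (isFlat_of_projective hB _ h0.projective)

/-- The extension property kills Ext¹ through a projective presentation; higher groups reduce to it
since the syzygies of flat modules are flat. -/
lemma flatExtVanish_of_extension (M : ModuleCat.{u} B)
    (h : ∀ S : ShortComplex (ModuleCat.{u} B), S.ShortExact → IsFlat S.X₃ → ∀ f : S.X₁ ⟶ M,
      ∃ g : S.X₂ ⟶ M, S.f ≫ g = f) : FlatExtVanish 0 M := by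
  intro V hV i hi
  obtain ⟨i, rfl⟩ : ∃ j, i = 1 + j := ⟨i - 1, by lia⟩
  clear hi
  induction i generalizing V with
  | zero =>
    intro e
    obtain ⟨K, P, f, g, w, hP, hK, hS⟩ := exists_flat_syzygy hB V hV
    obtain ⟨e', rfl⟩ := Abelian.Ext.contravariant_sequence_exact₃ hS M e
      (Abelian.Ext.eq_zero_of_projective _) (n₀ := 0) rfl
    obtain ⟨e', rfl⟩ := (Abelian.Ext.mk₀_bijective K M).2 e'
    obtain ⟨t, rfl⟩ := h _ hS hV e'
    have h1 := congr_arg (fun x => Abelian.Ext.comp x (Abelian.Ext.mk₀ t) (add_zero 1))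
      hS.extClass_comp
    dsimp only at h1
    rwa [Abelian.Ext.zero_comp, Abelian.Ext.comp_assoc_of_second_deg_zero,
      Abelian.Ext.mk₀_comp_mk₀] at h1
  | succ i ih =>
    intro e
    obtain ⟨K, P, f, g, w, hP, hK, hS⟩ := exists_flat_syzygy hB V hV
    obtain ⟨e', rfl⟩ := Abelian.Ext.contravariant_sequence_exact₃ hS M e
      (Abelian.Ext.eq_zero_of_projective _) (n₀ := 1 + i) (by lia)
    rw [ih K hK e', Abelian.Ext.comp_zero]

/-- For a flat module it is enough to test against flat modules. After k syzygies, all of them flat,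
the class of the next presentation lies in Ext¹ with values in a flat module, so that presentation
splits. -/
lemma hasProjectiveDimensionLT_of_flat (k : ℕ) (V : ModuleCat.{u} B) (hV : IsFlat V)
    (h : ∀ M : ModuleCat.{u} B, IsFlat M → ∀ e : Abelian.Ext V M (k + 1), e = 0) :
    HasProjectiveDimensionLT V (k + 1) := by
  induction k generalizing V with
  | zero =>
    obtain ⟨K, P, f, g, w, hP, hK, hS⟩ := exists_flat_syzygy hB V hV
    have h1 : hS.extClass = 0 := h K hK _
    obtain ⟨e, he⟩ := Abelian.Ext.contravariant_sequence_exact₁ hS K (Abelian.Ext.mk₀ (𝟙 K))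
      (n₁ := 1) rfl (by rw [h1, Abelian.Ext.zero_comp])
    obtain ⟨r, rfl⟩ := (Abelian.Ext.mk₀_bijective P K).2 e
    rw [Abelian.Ext.mk₀_comp_mk₀] at he
    have h2 := (Abelian.Ext.mk₀_bijective K K).1 he
    have := hS.epi_g
    let s := ShortComplex.Splitting.ofExactOfRetraction _ hS.exact r h2 hS.epi_g
    rw [zero_add, ← projective_iff_hasProjectiveDimensionLT_one]
    exact Retract.projective ⟨s.s, g, s.s_g⟩
  | succ k ih =>
    obtain ⟨K, P, f, g, w, hP, hK, hS⟩ := exists_flat_syzygy hB V hV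
    refine (hS.hasProjectiveDimensionLT_X₃_iff k hP).2 (ih K hK fun M hM e => ?_)
    obtain ⟨e', rfl⟩ := Abelian.Ext.contravariant_sequence_exact₁ hS M e
      (n₁ := k + 1 + 1) (by lia) (h M hM _)
    rw [Abelian.Ext.eq_zero_of_projective e', Abelian.Ext.comp_zero]

omit hB

section

variable {S : ShortComplex (ModuleCat.{u} B)} (hS : S.ShortExact) (k : ℕ)
include hS

lemma FlatExtVanish.X₁ (h₂ : FlatExtVanish (k + 1) S.X₂) (h₃ : FlatExtVanish k S.X₃) :
    FlatExtVanish (k + 1) S.X₁ := by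
  intro V hV i hi e
  obtain ⟨i, rfl⟩ : ∃ j, i = j + 1 := ⟨i - 1, by lia⟩
  obtain ⟨e', rfl⟩ := Abelian.Ext.covariant_sequence_exact₁ V hS e (h₂ V hV _ hi _)
    (n₀ := i) rfl
  rw [h₃ V hV i (by lia) e', Abelian.Ext.zero_comp]

lemma FlatExtVanish.X₂ (h₁ : FlatExtVanish k S.X₁) (h₃ : FlatExtVanish k S.X₃) :
    FlatExtVanish k S.X₂ := by
  intro V hV i hi e
  obtain ⟨e', rfl⟩ := Abelian.Ext.covariant_sequence_exact₂ V hS e (h₃ V hV _ hi _)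
  rw [h₁ V hV i hi e', Abelian.Ext.zero_comp]

lemma FlatExtVanish.X₃ (h₁ : FlatExtVanish k S.X₁) (h₂ : FlatExtVanish k S.X₂) :
    FlatExtVanish k S.X₃ := by
  intro V hV i hi e
  obtain ⟨e', rfl⟩ := Abelian.Ext.covariant_sequence_exact₃ V hS e (n₁ := i + 1) rfl
    (h₁ V hV _ (by lia) _)
  rw [h₂ V hV i hi e', Abelian.Ext.zero_comp]

end

lemma FlatExtVanish.of_retract {k : ℕ} {M N : ModuleCat.{u} B} (h : FlatExtVanish k N)
    (r : Retract M N) : FlatExtVanish k M := by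
  intro V hV i hi e
  have := congr_arg (fun x => x.comp (Abelian.Ext.mk₀ r.r) (add_zero i))
    (h V hV i hi (e.comp (Abelian.Ext.mk₀ r.i) (add_zero i)))
  simpa using this

lemma FlatExtVanish.mono {k k' : ℕ} {M : ModuleCat.{u} B} (h : FlatExtVanish k M) (hk : k ≤ k') :
    FlatExtVanish k' M := fun V hV i hi e => h V hV i (by lia) e

lemma FlatExtVanish.of_isZero {M : ModuleCat.{u} B} (h : IsZero M) : FlatExtVanish 0 M :=
  have := h.injective
  fun _ _ i hi e => by
    obtain ⟨i, rfl⟩ : ∃ j, i = j + 1 := ⟨i - 1, by lia⟩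
    exact Abelian.Ext.eq_zero_of_injective e

/-- Vanishing for one term of a bounded acyclic complex. -/
lemma FlatExtVanish.of_acyclic (K : CochainComplex (ModuleCat.{u} B) ℤ) (hK : K.Acyclic) (t : ℤ)
    (h : ∀ i, i ≠ t → FlatExtVanish 0 (K.X i)) (a : ℤ) (ha : ∀ i, i < a → IsZero (K.X i)) (k : ℕ)
    (hk : ∀ i, t + k < i → IsZero (K.X i)) : FlatExtVanish k (K.X t) := by
  let Z (i : ℤ) : ModuleCat.{u} B := ModuleCat.of B (K.d i (i + 1)).hom.ker
  have hZ (i j : ℤ) (hij : i + 1 = j) : ∃ (f : Z i ⟶ K.X i) (g : K.X i ⟶ Z j) (w : f ≫ g = 0),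
      (ShortComplex.mk f g w).ShortExact := by
    refine ⟨_, _, _, shortExact_of_ker (K.d i (i + 1)).hom.ker.subtype
      ((K.d i j).hom.codRestrict (K.d j (j + 1)).hom.ker fun x =>
        comp_hom_apply (K.d_comp_d i j (j + 1)) x) Subtype.val_injective (fun y => ?_)
        (fun x => ?_)⟩
    · obtain ⟨x, hx⟩ := (acyclic_iff_elements K).1 hK i j (j + 1) hij rfl y.1 y.2
      exact ⟨x, Subtype.ext hx⟩
    · subst hij
      rw [Set.mem_range]
      constructor
      · exact fun hx => ⟨⟨x, congr_arg Subtype.val hx⟩, rfl⟩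
      · rintro ⟨y, rfl⟩
        exact Subtype.ext y.2
  have hZ0 (i : ℤ) (hi : IsZero (K.X i)) : IsZero (Z i) := by
    have := ModuleCat.subsingleton_of_isZero hi
    have : Subsingleton (K.d i (i + 1)).hom.ker := inferInstance
    exact @ModuleCat.isZero_of_subsingleton _ _ _ this
  -- From the left end up to degree t, cocycles are successive cokernels, which costs nothing.
  have h1 (n : ℕ) : ∀ i, i ≤ t → i < a + n → FlatExtVanish 0 (Z i) := by
    induction n with
    | zero => exact fun i _ hi => .of_isZero (hZ0 i (ha i (by lia)))
    | succ n ih =>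
      intro i hit hin
      obtain ⟨f, g, w, hS⟩ := hZ (i - 1) i (by lia)
      exact FlatExtVanish.X₃ hS 0 (ih (i - 1) (by lia) (by lia)) (h (i - 1) (by lia))
  -- From the right end down to t + 1, cocycles are successive kernels, and each kernel costs one
  -- degree of Ext.
  have h2 (n : ℕ) : ∀ i, t < i → t + k - n < i → FlatExtVanish n (Z i) := by
    induction n with
    | zero => exact fun i _ hi => .of_isZero (hZ0 i (hk i (by lia)))
    | succ n ih =>
      intro i hit hin
      obtain ⟨f, g, w, hS⟩ := hZ i (i + 1) rfl
      exact FlatExtVanish.X₁ hS n ((h i (by lia)).mono (by lia)) (ih (i + 1) (by lia) (by lia))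
  obtain ⟨f, g, w, hS⟩ := hZ t (t + 1) rfl
  exact FlatExtVanish.X₂ hS k ((h1 (t - a + 1).toNat t le_rfl (by lia)).mono (by lia))
    (h2 k (t + 1) (by lia) (by lia))

end

section

variable {A B : Type u} [Ring A] [Ring B] (hA : IsLeftCoherent A) (hB : IsRightCoherent B)
  (D : CochainComplex (BimodCat A B) ℤ) (hD : IsDualizingComplex D)
  (hfin : ∀ J : ModuleCat.{u} A, IsFPInjective J → ∃ n : ℕ, HasInjectiveDimensionLE J n)
include hA hB hD hfin

/-- The projective dimensions of flat modules are bounded. -/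
theorem exists_hasProjectiveDimensionLT_of_flat : ∃ k : ℕ, ∀ F : ModuleCat.{u} B, IsFlat F →
    HasProjectiveDimensionLT F (k + 1) := by
  obtain ⟨a, b, hab⟩ := hD.finite
  obtain ⟨c, hc⟩ := exists_injective_resolution_of_fpExt hfin
  -- With D in degrees [a, b] and J in [a - c, b + c], the complex Hom_A(D, J) ends in degree b - a
  -- + c. In the cone of M → Hom_A(D, J) the module M sits in degree -1, which is b - a + c + 1
  -- steps before the end.
  refine ⟨(b - a + c + 1).toNat, fun V hV => hasProjectiveDimensionLT_of_flat hB _ V hV ?_⟩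
  intro M hM e
  let K := (HomologicalComplex.single (ModuleCat.{u} B) (ComplexShape.up ℤ) 0).obj M
  have hK (q : ℤ) (hq : q ≠ 0) : IsZero (K.X q) :=
    HomologicalComplex.isZero_single_obj_X _ _ _ _ hq
  have hK0 : IsFlat (K.X 0) :=
    isFlat_of_iso hB (HomologicalComplex.singleObjXSelf (ComplexShape.up ℤ) 0 M).symm hM
  have hKf (q : ℤ) : IsFlat (K.X q) := by
    by_cases hq : q = 0
    · subst hq
      exact hK0
    · exact isFlat_of_projective hB _ (hK q hq).projective
  obtain ⟨J, σ, hJ, hσ, hJ0⟩ := hc ((tensorFunctor D).obj K)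
    (fpExt_tensorFunctor_X D K hA (fun i => (isFPInjective_iff _).1 (hD.fpInjective_left i))
      hD.finite hKf) (Set.Icc a b) (fun i hi => isZero_tensorFunctor_X D K i fun p q hpq => by
        by_cases hq : q = 0
        · refine Or.inl (hab p ?_)
          rw [Set.mem_Icc] at hi
          lia
        · exact Or.inr (hK q hq))
  have hJ1 (i : ℤ) (hi : i < a - c ∨ b + c < i) : IsZero (J.X i) := by
    refine hJ0 i ?_
    rintro ⟨j, hj, h⟩
    rw [Set.mem_Icc] at hj
    lia
  have hac := acyclic_mappingCone_curry D hK hA hD hK0 hJ (a - c) (fun i hi => hJ1 i (Or.inl hi))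
    σ (quasiIso_of_trW_coacyclic σ hσ)
  have hH (q : ℤ) (hq : q < a - c - b ∨ b + c - a < q) :
      IsZero (((homFunctor D).obj J).X q) := by
    refine isZero_homFunctor_X D J q fun p n hpn => ?_
    by_cases hp : p < a ∨ b < p
    · exact Or.inl (hab p hp)
    · exact Or.inr (hJ1 n (by lia))
  have hcone (i : ℤ) (h : IsZero (K.X (i + 1))) (h' : IsZero (((homFunctor D).obj J).X i)) :
      IsZero ((mappingCone (tensorHomCurry D σ)).X i) := by
    obtain ⟨e⟩ := mappingCone_X_iso_biprod (tensorHomCurry D σ) i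
    exact (IsZero.of_iso ((biprod_isZero_iff _ _).2 ⟨h, h'⟩) e)
  -- Apart from the summand M in degree -1, the terms of the acyclic cone are those of Hom_A(D, J),
  -- which have no positive Ext from flat modules.
  have h1 : FlatExtVanish (b - a + c + 1).toNat
      ((mappingCone (tensorHomCurry D σ)).X (-1)) := by
    refine FlatExtVanish.of_acyclic _ hac (-1) (fun i hi => ?_) (min (-1) (a - c - b))
      (fun i hi => ?_) _ (fun i hi => ?_)
    · have h2 : FlatExtVanish 0 (((homFunctor D).obj J).X i) :=
        flatExtVanish_of_extension hB _ fun S hS hS₃ f =>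
          exists_extension_homFunctor D hS hS₃ J hJ i f
      obtain ⟨ε⟩ := mappingCone_X_iso_biprod (tensorHomCurry D σ) i
      refine h2.of_retract ((Retract.ofIso ε).trans ⟨biprod.snd, biprod.inr, ?_⟩)
      have h3 := (hK (i + 1) (by lia)).eq_of_tgt
        (biprod.fst : K.X (i + 1) ⊞ ((homFunctor D).obj J).X i ⟶ _) 0
      rw [← biprod.total, h3, zero_comp, zero_add]
    · exact hcone i (hK _ (by lia)) (hH i (by lia))
    · exact hcone i (hK _ (by lia)) (hH i (by lia))
  obtain ⟨ε⟩ := mappingCone_X_iso_biprod (tensorHomCurry D σ) (-1)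
  have h2 : FlatExtVanish (b - a + c + 1).toNat (K.X 0) :=
    h1.of_retract ((Retract.mk biprod.inl biprod.fst).trans (Retract.ofIso ε.symm))
  exact (h2.of_retract (Retract.ofIso
    (HomologicalComplex.singleObjXSelf (ComplexShape.up ℤ) 0 M).symm)) V hV _ (by lia) e

end

end CoContra

end

noncomputable section

namespace CoContra

/-! ### The equivalence of the coderived and contraderived categories -/

section

variable {C C' E E' : Type*} [Category* C] [Category* C'] [Category* E] [Category* E']
  {Q : C ⥤ E} {r : E ⥤ C} (adjQ : Q ⊣ r) {Q' : C' ⥤ E'} {l : E' ⥤ C'} (adjQ' : l ⊣ Q')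
  {T : C' ⥤ C} {H : C ⥤ C'} (adj : T ⊣ H)

/-- The adjunction between the derived functors. -/
def derivedAdjunction : l ⋙ (T ⋙ Q) ⊣ r ⋙ (H ⋙ Q') := adjQ'.comp (adj.comp adjQ)

lemma isIso_derivedAdjunction_unit (Y : E') (h : IsIso (adjQ'.unit.app Y))
    (h' : IsIso (Q'.map ((adj.comp adjQ).unit.app (l.obj Y)))) :
    IsIso ((derivedAdjunction adjQ adjQ' adj).unit.app Y) := by
  have : (derivedAdjunction adjQ adjQ' adj).unit.app Y =
    adjQ'.unit.app Y ≫ Q'.map ((adj.comp adjQ).unit.app (l.obj Y)) := by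
      simp [derivedAdjunction]
  rw [this]
  exact IsIso.comp_isIso

lemma isIso_derivedAdjunction_counit (X : E) (h : IsIso (adjQ.counit.app X))
    (h' : IsIso (Q.map (adj.counit.app (r.obj X))))
    (h'' : IsIso (Q.map (T.map (adjQ'.counit.app (H.obj (r.obj X)))))) :
    IsIso ((derivedAdjunction adjQ adjQ' adj).counit.app X) := by
  have : (derivedAdjunction adjQ adjQ' adj).counit.app X =
    Q.map (T.map (adjQ'.counit.app (H.obj (r.obj X)))) ≫ Q.map (adj.counit.app (r.obj X)) ≫
      adjQ.counit.app X := by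
    simp [derivedAdjunction]
  rw [this]
  exact IsIso.comp_isIso

/-- The derived unit may be computed with any convenient resolution s of T X in place of the
canonical one. -/
lemma isIso_map_comp_unit {X : C'} {J : C} (s : T.obj X ⟶ J) [IsIso (Q.map s)]
    [IsIso (adjQ.unit.app J)] (h : IsIso (Q'.map (adj.unit.app X ≫ H.map s))) :
    IsIso (Q'.map ((adj.comp adjQ).unit.app X)) := by
  have h1 : Q'.map ((adj.comp adjQ).unit.app X) ≫ Q'.map (H.map (r.map (Q.map s))) =
      Q'.map (adj.unit.app X ≫ H.map s) ≫ Q'.map (H.map (adjQ.unit.app J)) := by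
    have h2 : s ≫ adjQ.unit.app J = adjQ.unit.app (T.obj X) ≫ r.map (Q.map s) :=
      adjQ.unit.naturality s
    have h3 : (adj.comp adjQ).unit.app X = adj.unit.app X ≫ H.map (adjQ.unit.app (T.obj X)) :=
      Adjunction.comp_unit_app _ _ _
    rw [h3]
    refine (Q'.map_comp _ _).symm.trans (Eq.trans (congr_arg Q'.map ?_) (Q'.map_comp _ _))
    rw [Category.assoc, Category.assoc]
    refine congr_arg (adj.unit.app X ≫ ·) ?_
    exact (H.map_comp _ _).symm.trans ((congr_arg H.map h2.symm).trans (H.map_comp _ _))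
  have h4 : IsIso (Q'.map (adj.unit.app X ≫ H.map s) ≫ Q'.map (H.map (adjQ.unit.app J))) :=
    IsIso.comp_isIso
  rw [← h1] at h4
  exact IsIso.of_isIso_comp_right _ (Q'.map (H.map (r.map (Q.map s))))

lemma isIso_map_counit_of_iso {P X : C'} (s : P ⟶ X) (F : C' ⥤ E) [IsIso (Q'.map s)]
    [IsIso (F.map s)] [IsIso (adjQ'.counit.app P)] : IsIso (F.map (adjQ'.counit.app X)) := by
  have h1 : F.map (l.map (Q'.map s)) ≫ F.map (adjQ'.counit.app X) =
      F.map (adjQ'.counit.app P) ≫ F.map s :=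
    (F.map_comp _ _).symm.trans ((congr_arg F.map (adjQ'.counit.naturality s)).trans
      (F.map_comp _ _))
  have h2 : IsIso (F.map (adjQ'.counit.app P) ≫ F.map s) := IsIso.comp_isIso
  rw [← h1] at h2
  exact IsIso.of_isIso_comp_left (F.map (l.map (Q'.map s))) _

end

section

variable {R : Type u} [Ring R]

lemma nonempty_iso_of_trW_coacyclic {r : Coderived R ⥤ Hot R} (adjQ : toCoderived R ⊣ r)
    {X J : Hot R} (s : X ⟶ J) (hs : (coacyclic R).trW s) (hJ : IsIso (adjQ.unit.app J)) :
    Nonempty (r.obj ((toCoderived R).obj X) ≅ J) := by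
  have : IsIso ((toCoderived R).map s) := Localization.inverts _ (coacyclic R).trW s hs
  exact ⟨asIso (r.map ((toCoderived R).map s)) ≪≫
    (asIso (X := J) (Y := r.obj ((toCoderived R).obj J)) (adjQ.unit.app J)).symm⟩

lemma nonempty_iso_of_trW_contraacyclic {l : Contraderived R ⥤ Hot R}
    (adjQ' : l ⊣ toContraderived R) {X P : Hot R} (s : P ⟶ X) (hs : (contraacyclic R).trW s)
    (hP : IsIso (adjQ'.counit.app P)) : Nonempty (l.obj ((toContraderived R).obj X) ≅ P) := by
  have : IsIso ((toContraderived R).map s) := Localization.inverts _ (contraacyclic R).trW s hs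
  exact ⟨(asIso (l.map ((toContraderived R).map s))).symm ≪≫
    asIso (X := l.obj ((toContraderived R).obj P)) (Y := P) (adjQ'.counit.app P)⟩

/-- Reduction of a complex concentrated in one degree to the degree zero. -/
lemma isIso_app_of_shift_single {𝒯 : Type*} [Category* 𝒯] [HasShift 𝒯 ℤ] {F G : Hot R ⥤ 𝒯}
    [F.CommShift ℤ] [G.CommShift ℤ] (θ : F ⟶ G) [NatTrans.CommShift θ ℤ]
    (K : CochainComplex (ModuleCat.{u} R) ℤ) (n : ℤ)
    (h : IsIso (θ.app ((toHot R).obj (K⟦n⟧)))) : IsIso (θ.app ((toHot R).obj K)) := by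
  have e : (((toHot R).obj (K⟦n⟧))⟦-n⟧ : Hot R) ≅ (toHot R).obj K :=
    (CategoryTheory.shiftFunctor (Hot R) (-n)).mapIso (((toHot R).commShiftIso n).app K) ≪≫
      shiftShiftNeg ((toHot R).obj K) n
  have h1 := isIso_app_shift θ _ h (-n)
  exact (NatTrans.isIso_app_iff_of_iso θ e).1 h1

lemma thicken_thicken (U : Set ℤ) (a b : ℕ) : thicken (thicken U a) b ⊆ thicken U (a + b) := by
  rintro i ⟨j, ⟨k, hk, h1, h2⟩, h3, h4⟩
  exact ⟨k, hk, by push_cast; lia, by push_cast; lia⟩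

lemma hotSupported_mono {U V : Set ℤ} (h : U ⊆ V) {X : Hot R} (hX : hotSupported R U X) :
    hotSupported R V X :=
  let ⟨K, hK, e⟩ := hX
  ⟨K, fun i hi => hK i fun h' => hi (h h'), e⟩

/-- A variant of `isIso_app_of_single`. -/
lemma isIso_app_of_single_zero {S : Type u} [Ring S] {F G : Hot R ⥤ Hot S} [F.CommShift ℤ]
    [G.CommShift ℤ] [F.IsTriangulated] [G.IsTriangulated] (θ : F ⟶ G) [NatTrans.CommShift θ ℤ]
    (𝒳 : ObjectProperty (ModuleCat.{u} R)) [𝒳.IsClosedUnderIsomorphisms]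
    (h0 : ∀ M, IsZero M → 𝒳 M)
    (h : ∀ (K : CochainComplex (ModuleCat.{u} R) ℤ), (∀ i, i ≠ 0 → IsZero (K.X i)) →
      (∀ i, 𝒳 (K.X i)) → IsIso (θ.app ((toHot R).obj K))) (c : ℕ)
    (hc : ∀ (U : Set ℤ) (K : CochainComplex (ModuleCat.{u} R) ℤ), (∀ i ∉ U, IsZero (K.X i)) →
      (∀ i, 𝒳 (K.X i)) → hotSupported S (thicken U c) (F.obj ((toHot R).obj K)) ∧
        hotSupported S (thicken U c) (G.obj ((toHot R).obj K)))
    (K : CochainComplex (ModuleCat.{u} R) ℤ) (hK : ∀ i, 𝒳 (K.X i)) :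
    IsIso (θ.app ((toHot R).obj K)) := by
  refine isIso_app_of_single F G θ 𝒳 h0 (fun n K hK hK' => ?_) c (fun n K hK hK' => ?_)
    (fun n K hK hK' => ?_) K hK
  · exact isIso_app_of_shift_single θ K n (h _ (fun i hi => hK (i + n) (by lia))
      fun i => hK' (i + n))
  · have h1 : thicken (Set.Ici n) c ⊆ Set.Ici (n - c) := by
      rintro i ⟨j, hj, h2, h3⟩
      rw [Set.mem_Ici] at *
      lia
    obtain ⟨h2, h3⟩ := hc (Set.Ici n) K (fun i hi => hK i (by simpa using hi)) hK'
    exact ⟨hotSupported_mono h1 h2, hotSupported_mono h1 h3⟩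
  · have h1 : thicken (Set.Iic n) c ⊆ Set.Iic (n + c) := by
      rintro i ⟨j, hj, h2, h3⟩
      rw [Set.mem_Iic] at *
      lia
    obtain ⟨h2, h3⟩ := hc (Set.Iic n) K (fun i hi => hK i (by simpa using hi)) hK'
    exact ⟨hotSupported_mono h1 h2, hotSupported_mono h1 h3⟩

end

section

variable {A B : Type u} [Ring A] [Ring B] (D : CochainComplex (BimodCat A B) ℤ) (N : ℕ)
  (hN : ∀ i, i < -(N : ℤ) ∨ (N : ℤ) < i → IsZero (D.X i))
include hN

lemma isZero_homFunctor_X_of_thicken {U : Set ℤ} (K : CochainComplex (ModuleCat.{u} A) ℤ)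
    (hK : ∀ i ∉ U, IsZero (K.X i)) (i : ℤ) (hi : i ∉ thicken U N) :
    IsZero (((homFunctor D).obj K).X i) := by
  refine isZero_homFunctor_X D K i fun p n hpn => ?_
  by_cases hp : p < -(N : ℤ) ∨ (N : ℤ) < p
  · exact Or.inl (hN p hp)
  · exact Or.inr (hK n fun h => hi ⟨n, h, by lia, by lia⟩)

lemma isZero_tensorFunctor_X_of_thicken {U : Set ℤ} (K : CochainComplex (ModuleCat.{u} B) ℤ)
    (hK : ∀ i ∉ U, IsZero (K.X i)) (i : ℤ) (hi : i ∉ thicken U N) :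
    IsZero (((tensorFunctor D).obj K).X i) := by
  refine isZero_tensorFunctor_X D K i fun p q hpn => ?_
  by_cases hp : p < -(N : ℤ) ∨ (N : ℤ) < p
  · exact Or.inl (hN p hp)
  · exact Or.inr (hK q fun h => hi ⟨q, h, by lia, by lia⟩)

end

section

variable {A B : Type u} [Ring A] [Ring B] (hA : IsLeftCoherent A) (hB : IsRightCoherent B)
  (D : CochainComplex (BimodCat A B) ℤ) (hD : IsDualizingComplex D)
  (hfin : ∀ J : ModuleCat.{u} A, IsFPInjective J → ∃ n : ℕ, HasInjectiveDimensionLE J n)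

include hB hD in
lemma isFlat_homFunctor_X_of_injective (J : CochainComplex (ModuleCat.{u} A) ℤ)
    (hJ : ∀ i, Injective (J.X i)) (i : ℤ) : IsFlat (((homFunctor D).obj J).X i) :=
  isFlat_homFunctor_X D hB (fun i => (isFPInjective_iff _).1 (hD.fpInjective_right i)) J hJ i

include hD in
lemma exists_bound : ∃ N : ℕ, ∀ i, i < -(N : ℤ) ∨ (N : ℤ) < i → IsZero (D.X i) := by
  obtain ⟨a, b, hab⟩ := hD.finite
  exact ⟨(max (-a) b).toNat, fun i hi => hab i (by lia)⟩

section

variable {r : Coderived A ⥤ Hot A} (adjQ : toCoderived A ⊣ r) [r.CommShift ℤ] [adjQ.CommShift ℤ]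
  (hr : ∀ J : CochainComplex (ModuleCat.{u} A) ℤ, (∀ i, Injective (J.X i)) →
    IsIso (adjQ.unit.app ((toHot A).obj J)))

include hA hD hfin hr in
omit [r.CommShift ℤ] [adjQ.CommShift ℤ] in
lemma exists_support_tensor : ∃ c : ℕ, ∀ (U : Set ℤ) (K : CochainComplex (ModuleCat.{u} B) ℤ),
    (∀ i ∉ U, IsZero (K.X i)) → (∀ i, IsFlat (K.X i)) →
    ∃ (J : CochainComplex (ModuleCat.{u} A) ℤ) (σ : (tensorFunctor D).obj K ⟶ J),
      (∀ i, Injective (J.X i)) ∧ (coacyclic A).trW ((toHot A).map σ) ∧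
      (∀ i ∉ thicken U c, IsZero (J.X i)) ∧
      Nonempty (r.obj ((toCoderived A).obj ((toHot A).obj ((tensorFunctor D).obj K))) ≅
        (toHot A).obj J) := by
  obtain ⟨N, hN⟩ := exists_bound D hD
  obtain ⟨c, hc⟩ := exists_injective_resolution_of_fpExt hfin
  refine ⟨N + c, fun U K hK hK' => ?_⟩
  obtain ⟨J, σ, hJ, hσ, hJ0⟩ := hc ((tensorFunctor D).obj K)
    (fpExt_tensorFunctor_X D K hA (fun i => (isFPInjective_iff _).1 (hD.fpInjective_left i))
      hD.finite hK') (thicken U N) (isZero_tensorFunctor_X_of_thicken D N hN K hK)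
  exact ⟨J, σ, hJ, hσ, fun i hi => hJ0 i fun h => hi (thicken_thicken U N c h),
    nonempty_iso_of_trW_coacyclic adjQ _ hσ (hr J hJ)⟩

include hA hB hD hfin hr in
/-- The counit of the adjunction on complexes of injective modules. -/
lemma isIso_map_counit (hr' : ∀ X, IsIso (adjQ.counit.app X))
    (J : CochainComplex (ModuleCat.{u} A) ℤ) (hJ : ∀ i, Injective (J.X i)) :
    IsIso ((toCoderived A).map ((tensorHomAdjunctionHot D).counit.app ((toHot A).obj J))) := by
  have := adjQ.isTriangulated_rightAdjoint
  have : IsIso adjQ.counit := NatIso.isIso_of_isIso_app _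
  have := adjQ.fullyFaithfulROfIsIsoCounit.full
  have := adjQ.fullyFaithfulROfIsIsoCounit.faithful
  obtain ⟨N, hN⟩ := exists_bound D hD
  obtain ⟨c, hc⟩ := exists_support_tensor hA D hD hfin adjQ hr
  -- The fully faithful r brings the question back to the homotopy category, where supports make
  -- sense and the reduction to one-term complexes applies.
  let θ := Functor.whiskerRight (tensorHomAdjunctionHot D).counit (toCoderived A ⋙ r)
  have : ObjectProperty.IsClosedUnderIsomorphisms (fun M : ModuleCat.{u} A => Injective M) :=
    ⟨fun e h => Injective.of_iso e h⟩
  have h : IsIso (r.map ((toCoderived A).map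
      ((tensorHomAdjunctionHot D).counit.app ((toHot A).obj J)))) := by
    change IsIso (θ.app ((toHot A).obj J))
    refine isIso_app_of_single_zero θ (fun M => Injective M) (fun M hM => hM.injective)
      (fun K hK hK' => ?_) (N + c) (fun U K hK hK' => ⟨?_, ?_⟩) J hJ
    · have h1 := acyclic_mappingCone_uncurry D hK hA hB hD (hK' 0)
      -- All complexes involved are finite, and a bounded acyclic complex is coacyclic.
      have h2 : coacyclic A ((toHot A).obj
          (mappingCone (tensorHomUncurry D (𝟙 ((homFunctor D).obj K))))) := by
        refine prop_of_bounded_acyclic (coacyclic A) (coacyclic.total) _ h1 (-(2 * N + 1 : ℤ))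
          (2 * N + 1) fun i hi => ?_
        rw [mappingCone.isZero_X_iff]
        have hK0 (i : ℤ) (hi : i ∉ ({0} : Set ℤ)) : IsZero (K.X i) := hK i (by simpa using hi)
        constructor
        · refine isZero_tensorFunctor_X_of_thicken D N hN _
            (isZero_homFunctor_X_of_thicken D N hN K hK0) _ fun h => ?_
          obtain ⟨j, hj, h3, h4⟩ := thicken_thicken _ _ _ h
          rw [Set.mem_singleton_iff] at hj
          push_cast at h3 h4
          lia
        · exact hK _ (by lia)
      have h3 := Localization.inverts (toCoderived A) (coacyclic A).trW _
        ((trW_map_iff (coacyclic A) _).2 h2)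
      exact inferInstanceAs (IsIso (r.map ((toCoderived A).map
        ((toHot A).map (tensorHomUncurry D (𝟙 ((homFunctor D).obj K)))))))
    · obtain ⟨J', σ, -, -, hJ', e⟩ := hc (thicken U N) ((homFunctor D).obj K)
        (isZero_homFunctor_X_of_thicken D N hN K hK)
        (isFlat_homFunctor_X_of_injective hB D hD K hK')
      exact ⟨J', fun i hi => hJ' i fun h => hi (thicken_thicken U N c h), e⟩
    · refine ⟨K, fun i hi => hK i fun h => hi ⟨i, h, by lia, by lia⟩, ?_⟩
      exact nonempty_iso_of_trW_coacyclic adjQ (𝟙 _) (MorphismProperty.id_mem _ _) (hr K hK')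
  exact isIso_of_fully_faithful r ((toCoderived A).map
    ((tensorHomAdjunctionHot D).counit.app ((toHot A).obj J)))

section

variable {l : Contraderived B ⥤ Hot B} (adjQ' : l ⊣ toContraderived B) [l.CommShift ℤ]
  [adjQ'.CommShift ℤ]
  (hl : ∀ P : CochainComplex (ModuleCat.{u} B) ℤ, (∀ i, Projective (P.X i)) →
    IsIso (adjQ'.counit.app ((toHot B).obj P)))

include hA hB hD hfin hr hl in
/-- The unit of the adjunction on complexes of projective modules. -/
lemma isIso_map_unit (hl' : ∀ X, IsIso (adjQ'.unit.app X))
    (P : CochainComplex (ModuleCat.{u} B) ℤ) (hP : ∀ i, Projective (P.X i)) :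
    IsIso ((toContraderived B).map (((tensorHomAdjunctionHot D).comp adjQ).unit.app
      ((toHot B).obj P))) := by
  have := adjQ.isTriangulated_rightAdjoint
  have := adjQ'.isTriangulated_leftAdjoint
  have : IsIso adjQ'.unit := NatIso.isIso_of_isIso_app _
  have := adjQ'.fullyFaithfulLOfIsIsoUnit.full
  have := adjQ'.fullyFaithfulLOfIsIsoUnit.faithful
  obtain ⟨N, hN⟩ := exists_bound D hD
  obtain ⟨c, hc⟩ := exists_support_tensor hA D hD hfin adjQ hr
  obtain ⟨k, hk⟩ := exists_hasProjectiveDimensionLT_of_flat hA hB D hD hfin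
  let θ := Functor.whiskerRight ((tensorHomAdjunctionHot D).comp adjQ).unit
    (toContraderived B ⋙ l)
  have : ObjectProperty.IsClosedUnderIsomorphisms (fun M : ModuleCat.{u} B => Projective M) :=
    ⟨fun e h => Projective.of_iso e h⟩
  have h : IsIso (l.map ((toContraderived B).map (((tensorHomAdjunctionHot D).comp adjQ).unit.app
      ((toHot B).obj P)))) := by
    change IsIso (θ.app ((toHot B).obj P))
    refine isIso_app_of_single_zero θ (fun M => Projective M) (fun M hM => hM.projective)
      (fun K hK hK' => ?_) (c + N + 2 * k) (fun U K hK hK' => ⟨?_, ?_⟩) P hP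
    · have hK0 (i : ℤ) (hi : i ∉ ({0} : Set ℤ)) : IsZero (K.X i) := hK i (by simpa using hi)
      have hKf (i : ℤ) : IsFlat (K.X i) := isFlat_of_projective hB _ (hK' i)
      obtain ⟨J, σ, hJ, hσ, hJ0, -⟩ := hc {0} K hK0 hKf
      have h1 := acyclic_mappingCone_curry D hK hA hD (hKf 0) hJ (-c) (fun i hi => hJ0 i (by
        rintro ⟨j, hj, h3, h4⟩
        rw [Set.mem_singleton_iff] at hj
        lia)) σ (quasiIso_of_trW_coacyclic σ hσ)
      have h2 : contraacyclic B ((toHot B).obj (mappingCone (tensorHomCurry D σ))) := by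
        refine prop_of_bounded_acyclic (contraacyclic B) (contraacyclic.total) _ h1
          (-(c + N + 1 : ℤ)) (c + N + 1) fun i hi => ?_
        rw [mappingCone.isZero_X_iff]
        constructor
        · exact hK _ (by lia)
        · refine isZero_homFunctor_X_of_thicken D N hN _ hJ0 _ fun h => ?_
          obtain ⟨j, hj, h3, h4⟩ := thicken_thicken _ _ _ h
          rw [Set.mem_singleton_iff] at hj
          push_cast at h3 h4
          lia
      have h3 := Localization.inverts (toContraderived B) (contraacyclic B).trW _
        ((trW_map_iff (contraacyclic B) _).2 h2)
      have h4 : tensorHomCurry D σ =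
          (tensorHomAdjunction D).unit.app K ≫ (homFunctor D).map σ := by
        refine Eq.trans ?_ ((tensorHomAdjunction D).homEquiv_unit K J σ)
        rw [tensorHomAdjunction, Adjunction.mkOfHomEquiv_homEquiv]
        rfl
      rw [h4] at h3
      let s : (tensorHot D).obj ((toHot B).obj K) ⟶ (toHot A).obj J := (toHot A).map σ
      have : IsIso ((toCoderived A).map s) :=
        Localization.inverts (toCoderived A) (coacyclic A).trW _ hσ
      have := hr J hJ
      have h5 := isIso_map_comp_unit (Q' := toContraderived B) adjQ (tensorHomAdjunctionHot D) s h3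
      exact inferInstanceAs (IsIso (l.map ((toContraderived B).map
        (((tensorHomAdjunctionHot D).comp adjQ).unit.app ((toHot B).obj K)))))
    · refine ⟨K, fun i hi => hK i fun h => hi ⟨i, h, by lia, by lia⟩, ?_⟩
      exact nonempty_iso_of_trW_contraacyclic adjQ' (𝟙 _) (MorphismProperty.id_mem _ _) (hl K hK')
    -- The amplitude adds up: c for resolving D ⊗ K by injectives, N for Hom_A(D, -), and 2k for the
    -- projective resolution of the resulting complex of flat modules.
    · obtain ⟨J, σ, hJ, -, hJ0, ⟨e⟩⟩ := hc U K hK fun i => isFlat_of_projective hB _ (hK' i)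
      obtain ⟨P', s, hP', hs, hP0⟩ := exists_projective_resolution_of_flat D hB hfin k hk
        ((homFunctor D).obj J) (isFlat_homFunctor_X_of_injective hB D hD J hJ)
        (thicken (thicken U c) N) (isZero_homFunctor_X_of_thicken D N hN J hJ0)
      obtain ⟨e'⟩ := nonempty_iso_of_trW_contraacyclic adjQ' ((toHot B).map s)
        (trW_of_trW_tensorContraacyclic D hs).1 (hl P' hP')
      refine ⟨P', fun i hi => hP0 i fun h => hi ?_,
        ⟨(homHot D ⋙ toContraderived B ⋙ l).mapIso e ≪≫ e'⟩⟩
      obtain ⟨j, hj, h⟩ := h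
      exact thicken_thicken U (c + N) (2 * k) ⟨j, thicken_thicken U c N hj, h⟩
  exact isIso_of_fully_faithful l _

end

end

end

end CoContra

end

noncomputable section

namespace CoContra

/-! ### Projective resolutions and the equivalence -/

section

variable {A B : Type u} [Ring A] [Ring B] (hA : IsLeftCoherent A) (hB : IsRightCoherent B)
  (D : CochainComplex (BimodCat A B) ℤ) (hD : IsDualizingComplex D)
  (hfin : ∀ J : ModuleCat.{u} A, IsFPInjective J → ∃ n : ℕ, HasInjectiveDimensionLE J n)

include hA hB hD hfin in
-- A flat resolution, followed by a resolution of finite length made possible by the bound on the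
-- projective dimensions of flat modules.
lemma exists_projective_resolution (X : CochainComplex (ModuleCat.{u} B) ℤ) :
    ∃ (P : CochainComplex (ModuleCat.{u} B) ℤ) (s : P ⟶ X), (∀ i, Projective (P.X i)) ∧
      (contraacyclic B).trW ((toHot B).map s) := by
  obtain ⟨k, hk⟩ := exists_hasProjectiveDimensionLT_of_flat hA hB D hD hfin
  obtain ⟨F, s, hF, hs⟩ := exists_trW_flat hB X
  obtain ⟨P, t, hP, ht, -⟩ := exists_projective_resolution_of_flat D hB hfin k hk F hF Set.univ
    (fun i hi => absurd (Set.mem_univ i) hi)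
  refine ⟨P, t ≫ s, hP, ?_⟩
  rw [Functor.map_comp]
  exact MorphismProperty.comp_mem _ _ _ (trW_of_trW_tensorContraacyclic D ht).1 hs

include hA hB hD hfin in
-- Complexes of flat modules are adapted to D ⊗_B -: the projective resolution P → F has a cone that
-- is contraacyclic and becomes coacyclic after tensoring.
lemma isIso_map_tensor_counit {l : Contraderived B ⥤ Hot B} (adjQ' : l ⊣ toContraderived B)
    (hl : ∀ P : CochainComplex (ModuleCat.{u} B) ℤ, (∀ i, Projective (P.X i)) →
      IsIso (adjQ'.counit.app ((toHot B).obj P)))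
    (F : CochainComplex (ModuleCat.{u} B) ℤ) (hF : ∀ i, IsFlat (F.X i)) :
    IsIso ((tensorHot D ⋙ toCoderived A).map (adjQ'.counit.app ((toHot B).obj F))) := by
  obtain ⟨k, hk⟩ := exists_hasProjectiveDimensionLT_of_flat hA hB D hD hfin
  obtain ⟨P, t, hP, ht, -⟩ := exists_projective_resolution_of_flat D hB hfin k hk F hF Set.univ
    (fun i hi => absurd (Set.mem_univ i) hi)
  obtain ⟨h1, h2⟩ := trW_of_trW_tensorContraacyclic D ht
  have := Localization.inverts (toContraderived B) (contraacyclic B).trW _ h1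
  have : IsIso ((tensorHot D ⋙ toCoderived A).map ((toHot B).map t)) :=
    Localization.inverts (toCoderived A) (coacyclic A).trW _ h2
  have := hl P hP
  exact isIso_map_counit_of_iso adjQ' ((toHot B).map t) (tensorHot D ⋙ toCoderived A)

end

end CoContra

theorem mainTheorem2 {A B : Type u} [Ring A] [Ring B]
    (hA : CoContra.IsLeftCoherent A) (hB : CoContra.IsRightCoherent B)
    (D : CochainComplex (CoContra.BimodCat A B) ℤ) (hD : CoContra.IsDualizingComplex D)
    (hfin : ∀ J : ModuleCat.{u} A, CoContra.IsFPInjective J →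
      ∃ n : ℕ, HasInjectiveDimensionLE J n) :
    ∃ (e : CoContra.Coderived A ≌ CoContra.Contraderived B)
      (α : CoContra.homHot D ⋙ CoContra.toContraderived B ⟶
        CoContra.toCoderived A ⋙ e.functor)
      (β : CoContra.toContraderived B ⋙ e.inverse ⟶
        CoContra.tensorHot D ⋙ CoContra.toCoderived A)
      (_ : e.functor.CommShift ℤ) (_ : e.inverse.CommShift ℤ),
      CoContra.IsRHom D e.functor α ∧ CoContra.IsLTensor D e.inverse β ∧ e.IsTriangulated := by
  open CoContra in
  have hresA (X : Hot A) : ∃ (J : CochainComplex (ModuleCat.{u} A) ℤ) (s : X ⟶ (toHot A).obj J),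
      (∀ i, Injective (J.X i)) ∧ (coacyclic A).trW s := by
    obtain ⟨K, rfl⟩ := HomotopyCategory.quotient_obj_surjective X
    obtain ⟨J, s, hJ, hs⟩ := exists_injective_resolution hfin K
    exact ⟨J, _, hJ, hs⟩
  have hresB (X : Hot B) : ∃ (P : CochainComplex (ModuleCat.{u} B) ℤ) (s : (toHot B).obj P ⟶ X),
      (∀ i, Projective (P.X i)) ∧ (contraacyclic B).trW s := by
    obtain ⟨K, rfl⟩ := HomotopyCategory.quotient_obj_surjective X
    obtain ⟨P, s, hP, hs⟩ := exists_projective_resolution hA hB D hD hfin K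
    exact ⟨P, _, hP, hs⟩
  obtain ⟨r, adjQ, hr', hr⟩ := exists_rightAdjoint (coacyclic A) (toCoderived A) (fun X => by
    obtain ⟨J, s, hJ, hs⟩ := hresA X
    exact ⟨_, s, rightOrthogonal_coacyclic J hJ, hs⟩)
  obtain ⟨l, adjQ', hl', hl⟩ := exists_leftAdjoint (contraacyclic B) (toContraderived B)
    (fun X => by
      obtain ⟨P, s, hP, hs⟩ := hresB X
      exact ⟨_, s, leftOrthogonal_contraacyclic P hP, hs⟩)
  replace hr (J : CochainComplex (ModuleCat.{u} A) ℤ) (hJ : ∀ i, Injective (J.X i)) :=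
    hr _ (rightOrthogonal_coacyclic J hJ)
  replace hl (P : CochainComplex (ModuleCat.{u} B) ℤ) (hP : ∀ i, Projective (P.X i)) :=
    hl _ (leftOrthogonal_contraacyclic P hP)
  let : r.CommShift ℤ := adjQ.rightAdjointCommShift ℤ
  have : adjQ.CommShift ℤ := adjQ.commShift_of_leftAdjoint ℤ
  let : l.CommShift ℤ := adjQ'.leftAdjointCommShift ℤ
  have : adjQ'.CommShift ℤ := adjQ'.commShift_of_rightAdjoint ℤ
  have := adjQ'.isTriangulated_leftAdjoint
  have hrX (X : Coderived A) : ∃ J : CochainComplex (ModuleCat.{u} A) ℤ,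
      (∀ i, Injective (J.X i)) ∧ Nonempty (r.obj X ≅ (toHot A).obj J) := by
    have := Localization.essSurj (toCoderived A) (coacyclic A).trW
    obtain ⟨J, s, hJ, hs⟩ := hresA ((toCoderived A).objPreimage X)
    obtain ⟨e⟩ := nonempty_iso_of_trW_coacyclic adjQ s hs (hr J hJ)
    exact ⟨J, hJ, ⟨r.mapIso ((toCoderived A).objObjPreimageIso X).symm ≪≫ e⟩⟩
  have hlY (Y : Contraderived B) : ∃ P : CochainComplex (ModuleCat.{u} B) ℤ,
      (∀ i, Projective (P.X i)) ∧ Nonempty (l.obj Y ≅ (toHot B).obj P) := by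
    have := Localization.essSurj (toContraderived B) (contraacyclic B).trW
    obtain ⟨P, s, hP, hs⟩ := hresB ((toContraderived B).objPreimage Y)
    obtain ⟨e⟩ := nonempty_iso_of_trW_contraacyclic adjQ' s hs (hl P hP)
    exact ⟨P, hP, ⟨l.mapIso ((toContraderived B).objObjPreimageIso Y).symm ≪≫ e⟩⟩
  let adj := derivedAdjunction adjQ adjQ' (tensorHomAdjunctionHot D)
  have hunit (Y) : IsIso (adj.unit.app Y) := by
    obtain ⟨P, hP, ⟨e⟩⟩ := hlY Y
    refine isIso_derivedAdjunction_unit _ _ _ Y (hl' Y) ?_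
    exact (NatTrans.isIso_app_iff_of_iso (Functor.whiskerRight
      ((tensorHomAdjunctionHot D).comp adjQ).unit (toContraderived B)) e).2
      (isIso_map_unit hA hB D hD hfin adjQ hr adjQ' hl hl' P hP)
  have hcounit (X) : IsIso (adj.counit.app X) := by
    obtain ⟨J, hJ, ⟨e⟩⟩ := hrX X
    refine isIso_derivedAdjunction_counit _ _ _ X (hr' X) ?_ ?_
    · exact (NatTrans.isIso_app_iff_of_iso (Functor.whiskerRight
        (tensorHomAdjunctionHot D).counit (toCoderived A)) e).2
        (isIso_map_counit hA hB D hD hfin adjQ hr hr' J hJ)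
    · exact (NatTrans.isIso_app_iff_of_iso (Functor.whiskerRight
        adjQ'.counit (tensorHot D ⋙ toCoderived A)) ((homHot D).mapIso e)).2
        (isIso_map_tensor_counit hA hB D hD hfin adjQ' hl ((homFunctor D).obj J)
          (isFlat_homFunctor_X_of_injective hB D hD J hJ))
  -- The functor of `e` is the left adjoint, from the contraderived to the coderived category, so
  -- the stated equivalence is its inverse. The shift structure on the other functor is transported
  -- from this one.
  let e := adj.toEquivalence
  let hΨ : (l ⋙ (tensorHot D ⋙ toCoderived A)).CommShift ℤ := inferInstance
  let : e.functor.CommShift ℤ := hΨ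
  let : e.inverse.CommShift ℤ := e.commShiftInverse ℤ
  have : e.CommShift ℤ := e.commShift_of_functor ℤ
  have : e.IsTriangulated := Equivalence.IsTriangulated.mk' e
    (show (l ⋙ (tensorHot D ⋙ toCoderived A)).IsTriangulated from inferInstance)
  let α : homHot D ⋙ toContraderived B ⟶
      toCoderived A ⋙ (r ⋙ (homHot D ⋙ toContraderived B)) :=
    (homHot D ⋙ toContraderived B).leftUnitor.inv ≫ Functor.whiskerRight adjQ.unit _ ≫
      (Functor.associator _ _ _).hom
  let β : toContraderived B ⋙ (l ⋙ (tensorHot D ⋙ toCoderived A)) ⟶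
      tensorHot D ⋙ toCoderived A :=
    (Functor.associator _ _ _).inv ≫ Functor.whiskerRight adjQ'.counit _ ≫
      (tensorHot D ⋙ toCoderived A).leftUnitor.hom
  refine ⟨e.symm, α, β, inferInstance, inferInstance, ⟨⟨?_⟩, fun J hJ => ?_⟩,
    ⟨⟨?_⟩, fun F hF => ?_⟩, inferInstance⟩
  · exact isLeftKanExtension_of_adjunction adjQ (homHot D ⋙ toContraderived B)
  · have h1 : α.app ((toHot A).obj J) =
        (homHot D ⋙ toContraderived B).map (adjQ.unit.app ((toHot A).obj J)) := by
      simp [α]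
    have h2 := hr J hJ
    rw [h1]
    exact Functor.map_isIso _ (adjQ.unit.app ((toHot A).obj J))
  · exact isRightKanExtension_of_adjunction adjQ' (tensorHot D ⋙ toCoderived A)
  · have h1 : β.app ((toHot B).obj F) =
        (tensorHot D ⋙ toCoderived A).map (adjQ'.counit.app ((toHot B).obj F)) := by
      simp [β]
    rw [h1]
    exact isIso_map_tensor_counit hA hB D hD hfin adjQ' hl F hF

end
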